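/- Let $M$ be a smooth $n$-dimensional manifold (Hausdorff, $\sigma$-compact, without boundary; no orientation is needed if top-degree forms are replaced by densities), and let $T^*M$ carry its canonical Poisson bracket $\{\cdot,\cdot\}$ and Liouville measure $dV$. Let $I\subseteq(-\tfrac12,\infty)$ be an interval with nonempty interior and $0\in I$. Let $C^\infty(T^*M)_+$ be the set of smooth $f>0$ on $T^*M$ such that, for every $s>0$, all derivatives of $f^s$ in canonical coordinates are rapidly decreasing along the fibres, locally uniformly on $M$. For functionals $F,G$ of $f$ put $$\{F,G\}_{KT}[f]=\int_{T^*M} f\,\Big\{\frac{\delta F}{\delta f},\frac{\delta G}{\delta f}\Big\}\,dV .$$ Let $\mathrm{Vect}(M)^*\times P\Omega^n(M)$ be the space of pairs $z=(m,\rho)$ of a smooth one-form density $m$ on $M$ and a smooth family $(\rho_\xi)_{\xi\in I}$ of densities on $M$. It is paired with triples $(u,g,(g_a))$, where $u$ is a smooth vector field on $M$, $(g_\xi)_{\xi\in I}$ is a smooth family of functions on $M$ with compact support in $\xi\in I$, and $(g_a)_{a\ge 0}$ are smooth functions on $M$, only finitely many of them nonzero (the triple represents $u$ and the generalized family $g_\xi+\sum_a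 g_a(-1)^a\delta^{(a)}(\xi)$), by $$\langle z,(u,g,(g_a))\rangle=\int_M m(u)+\int_I d\xi\int_M\rho_\xi\, g_\xi+\sum_a\int_M\partial_\xi^a\rho_\xi\big|_{\xi=0}\,g_a .$$ With the semidirect product Lie bracket $[(u,g),(v,h)]=([u,v],\mathcal L_uh-\mathcal L_vg)$, where $\mathcal L$ acts on each $g_\xi$ and each $g_a$, the bracket of functionals is $\{F,G\}(z)=-\langle z,[\delta F/\delta z,\delta G/\delta z]\rangle$. Likewise $\mathfrak s_A^*$ is the space of $(m,(s_0,\dots,s_A))$, with $m$ a smooth one-form density and $s_a$ smooth densities, paired with $(u,(g_0,\dots,g_A))$ by $\int_M\big(m(u)+\sum_{a=0}^A s_ag_a\big)$, with bracket $-\langle\cdot,[\delta F,\delta G]\rangle$ of the same form. Functional derivatives are taken along smooth compactly supported variations and are required to be smooth. In the last two spaces brackets are considered where at least one of the two functional derivatives has compact support in $M$ (no restriction if $M$ is compact). A map $\mathcal J$ is a *Poisson map* if it maps the first space into the second and, for all $F,G$ that have functional derivatives as above at the image point, $F\circ\mathcal J$ and $G\circ\mathcal J$ have functional derivatives, their bracket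 converges, and $\{F\circ\mathcal J,G\circ\mathcal J\}_1=\{F,G\}_2\circ\mathcal J$. For $f\in C^\infty(T^*M)_+$ set $\mathsf J[f]=(m[f],\,\xi\mapsto\rho_\xi[f])$ with $$m[f]=\int p\,f\,d^np,\qquad \rho_\xi[f]=\int f^{1+\xi}\,d^np .$$ Then: 1. The fibre integrals converge, and for $u$ and $g_\xi$ as above with compact support in $M$, $$\langle\mathsf J[f],(u,g)\rangle=\int_{T^*M}\Big(\langle u,p\rangle f+\int_I f^{1+\xi}g_\xi\,d\xi\Big)dV .$$ 2. $\mathsf J:C^\infty(T^*M)_+\to\mathrm{Vect}(M)^*\times P\Omega^n(M)$ is a Poisson map. 3. For every $A\ge 0$ the jet truncation $T_A:\mathrm{Vect}(M)^*\times P\Omega^n(M)\to\mathfrak s_A^*$, $(m,\rho)\mapsto\big(m,(\partial_\xi^a\rho_\xi|_{\xi=0})_{0\le a\le A}\big)$, is a Poisson map, and $T_A\circ\mathsf J=\mathcal J_A$, where $\mathcal J_A[f]=\big(m[f],(\int f(\log f)^a\,d^np)_{0\le a\le A}\big)$. -/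

import Mathlib

open Set MeasureTheory Bundle
open scoped Manifold ContDiff

noncomputable section

/-! ## The base manifold, its cotangent bundle and the Liouville measure

The base is a smooth `n`-manifold `M` without boundary, modelled on `ℝⁿ` with the Euclidean norm.
In Mathlib the tangent space `T_qM` is a copy of the model space, identified through the preferred
chart `chartAt q`; "preferred coordinates at `q`" always refers to this identification. -/

/-- The model space `ℝⁿ`. -/
abbrev ModelE (n : ℕ) : Type := EuclideanSpace ℝ (Fin n)

/-- The dual of the model space: covectors in coordinates. -/
abbrev ModelD (n : ℕ) : Type := ModelE n →L[ℝ] ℝ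

/-- Lebesgue measure `dp₁ ⋯ dpₙ` on covectors. -/
def covectorVolume (n : ℕ) : Measure (ModelD n) :=
  (volume : Measure (ModelE n)).map (InnerProductSpace.toDual ℝ (ModelE n))

/-- The model with corners of the cotangent bundle (product of base and fibre). -/
abbrev cotModel (n : ℕ) :
    ModelWithCorners ℝ (ModelE n × ModelD n) (ModelProd (ModelE n) (ModelD n)) :=
  (𝓘(ℝ, ModelE n)).prod 𝓘(ℝ, ModelD n)

section Geometry

variable (n : ℕ) (M : Type*) [TopologicalSpace M] [ChartedSpace (ModelE n) M]
  [IsManifold 𝓘(ℝ, ModelE n) ∞ M]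

/-- The cotangent bundle `T*M`. -/
abbrev CotBundle : Type _ :=
  TotalSpace (ModelD n) fun q : M ↦ TangentSpace 𝓘(ℝ, ModelE n) q →L[ℝ] Bundle.Trivial M ℝ q

instance : MeasurableSpace (CotBundle n M) := borel _

instance : BorelSpace (CotBundle n M) := ⟨rfl⟩

variable {n M}

/-- Canonical coordinates `(q¹, …, qⁿ, p₁, …, pₙ)` on `T*U`, where `U` is the domain of the preferred
chart at `x`. -/
def cotChart (x : M) : PartialEquiv (CotBundle n M) (ModelE n × ModelD n) :=
  extChartAt (cotModel n) (⟨x, 0⟩ : CotBundle n M)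

variable (n M) in
/-- The Liouville measure `dV = dq¹ ⋯ dqⁿ dp₁ ⋯ dpₙ` on `T*M`. Its restrictions to the canonical
coordinate domains are coordinate Lebesgue measures, which agree on overlaps, so that the glued
measure is their supremum. -/
def liouville : Measure (CotBundle n M) :=
  ⨆ x : M, (((volume : Measure (ModelE n)).prod (covectorVolume n)).restrict
    (cotChart (n := n) x).target).map (cotChart (n := n) x).symm

/-- The canonical Poisson bracket `{φ, ψ} = ∑ᵢ ∂φ/∂qⁱ ∂ψ/∂pᵢ - ∂ψ/∂qⁱ ∂φ/∂pᵢ`, computed at each point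
in the canonical coordinates of the preferred chart there. -/
def canonicalBracket (φ ψ : CotBundle n M → ℝ) (z : CotBundle n M) : ℝ :=
  let dφ : ModelE n × ModelD n →L[ℝ] ℝ := mfderiv (cotModel n) 𝓘(ℝ, ℝ) φ z
  let dψ : ModelE n × ModelD n →L[ℝ] ℝ := mfderiv (cotModel n) 𝓘(ℝ, ℝ) ψ z
  let eq (i : Fin n) : ModelE n × ModelD n := (EuclideanSpace.single i 1, 0)
  let ep (i : Fin n) : ModelE n × ModelD n := (0, EuclideanSpace.proj i)
  ∑ i : Fin n, (dφ (eq i) * dψ (ep i) - dψ (eq i) * dφ (ep i))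

/-- Evaluation `⟨v, p⟩` of a covector on a tangent vector at the same point. -/
def covectorApply {q : M} (p : TangentSpace 𝓘(ℝ, ModelE n) q →L[ℝ] Bundle.Trivial M ℝ q)
    (v : TangentSpace 𝓘(ℝ, ModelE n) q) : ℝ := p v

/-- The Lie derivative `L_u g` of a function along a vector field. -/
def lieDerivFun (u : (q : M) → TangentSpace 𝓘(ℝ, ModelE n) q) (g : M → ℝ) (q : M) : ℝ :=
  mfderiv 𝓘(ℝ, ModelE n) 𝓘(ℝ, ℝ) g q (u q)

/-- Smoothness of a vector field. -/
def SmoothVectorField (u : (q : M) → TangentSpace 𝓘(ℝ, ModelE n) q) : Prop :=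
  ContMDiff 𝓘(ℝ, ModelE n) (𝓘(ℝ, ModelE n)).tangent ∞
    fun q ↦ (⟨q, u q⟩ : TangentBundle 𝓘(ℝ, ModelE n) M)

/-! ## Densities and one-form densities on `M`

A density on `M` (a top-degree form, when `M` is oriented) is recorded by its coefficient
`c q` with respect to `d^n q` in preferred coordinates at `q`; a one-form density by its coefficient
`m q`, a covector in preferred coordinates at `q`. -/

/-- Jacobian at `q = (chartAt x)⁻¹ y` of the change from the preferred coordinates at `x` to the
preferred coordinates at `q`. -/
def toPreferred (x : M) (y : ModelE n) : ModelE n →L[ℝ] ModelE n :=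
  let q := (chartAt (ModelE n) x).symm y
  tangentCoordChange 𝓘(ℝ, ModelE n) x q q

/-- The coefficient, in the chart at `x`, of a density. -/
def densityRep (x : M) (c : M → ℝ) (y : ModelE n) : ℝ :=
  |(toPreferred x y).det| * c ((chartAt (ModelE n) x).symm y)

/-- The coefficients, in the chart at `x`, of a one-form density. -/
def covDensityRep (x : M) (m : M → ModelD n) (y : ModelE n) : ModelD n :=
  |(toPreferred x y).det| • (m ((chartAt (ModelE n) x).symm y)).comp (toPreferred x y)

variable (n) in
/-- Joint smoothness, on `S × M`, of a family of densities with parameters in `S`. -/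
def SmoothDensityOn {P : Type*} [NormedAddCommGroup P] [NormedSpace ℝ P] (S : Set P)
    (c : P → M → ℝ) : Prop :=
  ∀ x : M, ContDiffOn ℝ ∞ (fun w : P × ModelE n ↦ densityRep x (c w.1) w.2)
    (S ×ˢ (chartAt (ModelE n) x).target)

/-- Joint smoothness, on `S × M`, of a family of one-form densities with parameters in `S`. -/
def SmoothCovDensityOn {P : Type*} [NormedAddCommGroup P] [NormedSpace ℝ P] (S : Set P)
    (m : P → M → ModelD n) : Prop :=
  ∀ x : M, ContDiffOn ℝ ∞ (fun w : P × ModelE n ↦ covDensityRep x (m w.1) w.2)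
    (S ×ˢ (chartAt (ModelE n) x).target)

variable [T2Space M] [SigmaCompactSpace M]

variable (n M) in
/-- A smooth partition of unity subordinate to the preferred charts. -/
def chartPartition : SmoothPartitionOfUnity M 𝓘(ℝ, ModelE n) M univ :=
  Classical.choose
    (SmoothPartitionOfUnity.exists_isSubordinate_chartAt_source 𝓘(ℝ, ModelE n) M)

variable (n) in
/-- The integral over `M` of a compactly supported density. -/
def densityIntegral (c : M → ℝ) : ℝ :=
  ∑ᶠ x : M, ∫ y in (chartAt (ModelE n) x).target,
    chartPartition n M x ((chartAt (ModelE n) x).symm y) * densityRep x c y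

end Geometry

/-! ## Spaces with a bracket of functionals, and Poisson maps -/

/-- A set of points, the functionals of interest being real-valued functions of a point; a bracket of
functionals; and the condition on two functionals at a point (functional derivatives exist and decay
sufficiently) under which the bracket there is meaningful. -/
structure BracketSpace where
  /-- the ambient type -/
  Carrier : Type*
  /-- the points of the space -/
  points : Set Carrier
  /-- the functionals have functional derivatives at the point, and their bracket converges -/
  Admissible : (Carrier → ℝ) → (Carrier → ℝ) → Carrier → Prop
  /-- the bracket of two functionals at a point -/
  bracket : (Carrier → ℝ) → (Carrier → ℝ) → Carrier → ℝ

/-- `J` is a Poisson map: it maps points to points, and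
`{F ∘ J, G ∘ J}₁ = {F, G}₂ ∘ J`, wherever the right side is meaningful. -/
def IsPoissonMap (X Y : BracketSpace) (J : X.Carrier → Y.Carrier) : Prop :=
  ∀ z ∈ X.points, J z ∈ Y.points ∧
    ∀ F G : Y.Carrier → ℝ, Y.Admissible F G (J z) →
      X.Admissible (F ∘ J) (G ∘ J) z ∧ X.bracket (F ∘ J) (G ∘ J) z = Y.bracket F G (J z)

section Kinetic

variable (n : ℕ) (M : Type*) [TopologicalSpace M] [ChartedSpace (ModelE n) M]
  [IsManifold 𝓘(ℝ, ModelE n) ∞ M]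

/-! ## Kinetic theory: positive distribution functions on `T*M` -/

/-- The space `C^∞(T*M)₊` of smooth positive distribution functions, with the decay condition that all
positive powers of `f` are, with all their derivatives, rapidly decreasing along the fibres, locally
uniformly on `M`. -/
def PosDistributions : Set (CotBundle n M → ℝ) :=
  {f | ContMDiff (cotModel n) 𝓘(ℝ, ℝ) ∞ f ∧ (∀ z, 0 < f z) ∧
    ∀ (x : M) (K : Set (ModelE n)), IsCompact K → K ⊆ (chartAt (ModelE n) x).target →
      ∀ (s : ℝ), 0 < s → ∀ k N : ℕ, ∃ C : ℝ, ∀ y ∈ K, ∀ η : ModelD n,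
        (1 + ‖η‖) ^ N *
          ‖iteratedFDeriv ℝ k (fun w ↦ f ((cotChart (n := n) x).symm w) ^ s) (y, η)‖ ≤ C}

variable {n M}

/-- A smooth compactly supported variation of `f`: a smooth curve of distribution functions through `f`
at time `0`, constant outside a compact subset of `T*M`. -/
def IsKineticVariation (f : CotBundle n M → ℝ) (c : ℝ → CotBundle n M → ℝ) : Prop :=
  c 0 = f ∧ (∀ t, c t ∈ PosDistributions n M) ∧
    ContMDiff (𝓘(ℝ, ℝ).prod (cotModel n)) 𝓘(ℝ, ℝ) ∞ (fun w : ℝ × CotBundle n M ↦ c w.1 w.2) ∧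
    ∃ K : Set (CotBundle n M), IsCompact K ∧ ∀ t, ∀ z ∉ K, c t z = f z

/-- `φ` is the functional derivative `δF/δf` at `f`. -/
def HasKineticDeriv (F : (CotBundle n M → ℝ) → ℝ) (f φ : CotBundle n M → ℝ) : Prop :=
  ContMDiff (cotModel n) 𝓘(ℝ, ℝ) ∞ φ ∧
    ∀ c, IsKineticVariation f c →
      HasDerivAt (fun t ↦ F (c t)) (∫ z, deriv (fun t ↦ c t z) 0 * φ z ∂(liouville n M)) 0

/-- The functional derivative `δF/δf` at `f`. -/
def kineticDeriv (F : (CotBundle n M → ℝ) → ℝ) (f : CotBundle n M → ℝ) : CotBundle n M → ℝ :=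
  Classical.epsilon (HasKineticDeriv F f)

variable (n M) in
/-- Kinetic theory: `C^∞(T*M)₊` with the bracket
`{F, G}_KT[f] = ∫_{T*M} f {δF/δf, δG/δf} dV`. -/
def kineticSpace : BracketSpace where
  Carrier := CotBundle n M → ℝ
  points := PosDistributions n M
  Admissible F G f := (∃ φ, HasKineticDeriv F f φ) ∧ (∃ ψ, HasKineticDeriv G f ψ) ∧
    Integrable (fun z ↦ f z * canonicalBracket (kineticDeriv F f) (kineticDeriv G f) z)
      (liouville n M)
  bracket F G f :=
    ∫ z, f z * canonicalBracket (kineticDeriv F f) (kineticDeriv G f) z ∂(liouville n M)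

end Kinetic

section Path

variable (n : ℕ) (M : Type*) [TopologicalSpace M] [ChartedSpace (ModelE n) M]
  [IsManifold 𝓘(ℝ, ModelE n) ∞ M]

/-! ## The path space `Vect(M)* × PΩⁿ(M)`

It is paired with the semidirect product of `Vect(M)` with `PC^∞(M)`, the one-parameter families
`g_ξ`, `ξ ∈ I`, of functions on `M`, enlarged by the `C^∞(M)`-valued distributions
`∑ₐ gₐ (-1)ᵃ δ⁽ᵃ⁾(ξ)` supported at `ξ = 0`. -/

/-- A pair of a one-form density and a one-parameter family of densities. Only the members of the
family with parameter `ξ ∈ I` matter. -/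
structure PathDual where
  /-- the momentum density `m` -/
  mom : M → ModelD n
  /-- the densities `ρ_ξ` -/
  dens : ℝ → M → ℝ

/-- A vector field `u`, together with the generalized family `g_ξ + ∑ₐ gₐ (-1)ᵃ δ⁽ᵃ⁾(ξ)` of functions
on `M`. -/
structure PathAlg where
  /-- the vector field `u` -/
  vec : (q : M) → TangentSpace 𝓘(ℝ, ModelE n) q
  /-- the functions `g_ξ` -/
  fam : ℝ → M → ℝ
  /-- the coefficients `gₐ` of the distribution supported at `ξ = 0` -/
  jet : ℕ → M → ℝ

variable {n M}

/-- Smoothness of an element of `Vect(M)* × PΩⁿ(M)`. -/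
def PathDual.IsSmooth (I : Set ℝ) (z : PathDual n M) : Prop :=
  SmoothCovDensityOn univ (fun _ : ℝ ↦ z.mom) ∧ SmoothDensityOn n I z.dens

/-- The conditions for an element of the Lie algebra: everything is smooth, the family is compactly
supported in the parameter (no condition when `I` is compact), and the distribution at `ξ = 0` has
finite order. -/
def PathAlg.IsRegular (I : Set ℝ) (X : PathAlg n M) : Prop :=
  SmoothVectorField X.vec ∧
  ContMDiffOn (𝓘(ℝ, ℝ).prod 𝓘(ℝ, ModelE n)) 𝓘(ℝ, ℝ) ∞ (fun w : ℝ × M ↦ X.fam w.1 w.2)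
    (I ×ˢ univ) ∧
  (∃ K : Set ℝ, IsCompact K ∧ K ⊆ I ∧ ∀ ξ ∈ I \ K, ∀ q, X.fam ξ q = 0) ∧
  (∀ a, ContMDiff 𝓘(ℝ, ModelE n) 𝓘(ℝ, ℝ) ∞ (X.jet a)) ∧
  ∃ A : ℕ, ∀ a, A < a → ∀ q, X.jet a q = 0

/-- Compact support in `M` (no condition when `M` is compact). -/
def PathAlg.CompactlySupported (I : Set ℝ) (X : PathAlg n M) : Prop :=
  ∃ K : Set M, IsCompact K ∧ ∀ q ∉ K, X.vec q = 0 ∧ (∀ ξ ∈ I, X.fam ξ q = 0) ∧ ∀ a, X.jet a q = 0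

/-- The semidirect product Lie bracket
`[(u, g), (v, h)] = ([u, v], L_u h - L_v g)`. -/
def PathAlg.lie (X Y : PathAlg n M) : PathAlg n M where
  vec := VectorField.mlieBracket 𝓘(ℝ, ModelE n) X.vec Y.vec
  fam ξ q := lieDerivFun X.vec (Y.fam ξ) q - lieDerivFun Y.vec (X.fam ξ) q
  jet a q := lieDerivFun X.vec (Y.jet a) q - lieDerivFun Y.vec (X.jet a) q

/-- A smooth compactly supported variation of `z` in `Vect(M)* × PΩⁿ(M)`. -/
def IsPathVariation (I : Set ℝ) (z : PathDual n M) (c : ℝ → PathDual n M) : Prop :=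
  c 0 = z ∧ (∀ t, (c t).IsSmooth I) ∧
    SmoothCovDensityOn univ (fun t : ℝ ↦ (c t).mom) ∧
    SmoothDensityOn n (univ ×ˢ I) (fun w : ℝ × ℝ ↦ (c w.1).dens w.2) ∧
    ∃ K : Set M, IsCompact K ∧ ∀ t, ∀ q ∉ K,
      (c t).mom q = z.mom q ∧ ∀ ξ ∈ I, (c t).dens ξ q = z.dens ξ q

/-- The velocity of a curve at time `0`. -/
def pathVelocity (c : ℝ → PathDual n M) : PathDual n M where
  mom q := deriv (fun t ↦ (c t).mom q) 0
  dens ξ q := deriv (fun t ↦ (c t).dens ξ q) 0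

variable [T2Space M] [SigmaCompactSpace M]

/-- The dual pairing
`∫_M m(u) + ∫_I dξ ∫_M ρ_ξ g_ξ + ∑ₐ ∫_M (∂ᵃρ_ξ/∂ξᵃ)|_{ξ=0} gₐ`. -/
def pathPairing (I : Set ℝ) (z : PathDual n M) (X : PathAlg n M) : ℝ :=
  densityIntegral n (fun q : M ↦ z.mom q (X.vec q)) +
    (∫ ξ in I, densityIntegral n (fun q : M ↦ z.dens ξ q * X.fam ξ q)) +
    ∑ᶠ a : ℕ, densityIntegral n
      (fun q : M ↦ iteratedDerivWithin a (fun ξ ↦ z.dens ξ q) I 0 * X.jet a q)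

/-- `X` is the functional derivative `(δF/δm, δF/δρ)` at `z`. -/
def HasPathDeriv (I : Set ℝ) (F : PathDual n M → ℝ) (z : PathDual n M) (X : PathAlg n M) : Prop :=
  X.IsRegular I ∧ ∀ c, IsPathVariation I z c →
    HasDerivAt (fun t ↦ F (c t)) (pathPairing I (pathVelocity c) X) 0

/-- The functional derivative `(δF/δm, δF/δρ)` at `z`. -/
def pathDeriv (I : Set ℝ) (F : PathDual n M → ℝ) (z : PathDual n M) : PathAlg n M :=
  haveI : Nonempty (PathAlg n M) := ⟨⟨fun _ ↦ 0, fun _ _ ↦ 0, fun _ _ ↦ 0⟩⟩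
  Classical.epsilon (HasPathDeriv I F z)

variable (n M) in
/-- `Vect(M)* × PΩⁿ(M)` with the `(-)`-Lie–Poisson bracket; on a noncompact `M`, one of the two
functional derivatives is required to have compact support in `M`. -/
def pathSpace (I : Set ℝ) : BracketSpace where
  Carrier := PathDual n M
  points := {z | z.IsSmooth I}
  Admissible F G z := (∃ X, HasPathDeriv I F z X) ∧ (∃ Y, HasPathDeriv I G z Y) ∧
    ((pathDeriv I F z).CompactlySupported I ∨ (pathDeriv I G z).CompactlySupported I)
  bracket F G z := -pathPairing I z ((pathDeriv I F z).lie (pathDeriv I G z))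

end Path

section Fluid

variable (n : ℕ) (M : Type*) [TopologicalSpace M] [ChartedSpace (ModelE n) M]
  [IsManifold 𝓘(ℝ, ModelE n) ∞ M] (A : ℕ)

/-! ## The space `𝔰_A* = Vect(M)* × Ωⁿ(M, ℝ^{A+1})` of fluids with generalized entropies -/

/-- A one-form density and `A + 1` densities. -/
structure FluidDual where
  /-- the momentum density `m` -/
  mom : M → ModelD n
  /-- the densities `s₀, …, s_A` -/
  dens : Fin (A + 1) → M → ℝ

/-- A vector field and `A + 1` functions. -/
structure FluidAlg where
  /-- the vector field `u` -/
  vec : (q : M) → TangentSpace 𝓘(ℝ, ModelE n) q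
  /-- the functions `g₀, …, g_A` -/
  fn : Fin (A + 1) → M → ℝ

variable {n M A}

/-- Smoothness of an element of `𝔰_A*`. -/
def FluidDual.IsSmooth (z : FluidDual n M A) : Prop :=
  SmoothCovDensityOn univ (fun _ : ℝ ↦ z.mom) ∧
    ∀ a, SmoothDensityOn n univ (fun _ : ℝ ↦ z.dens a)

/-- Smoothness of an element of `𝔰_A`. -/
def FluidAlg.IsRegular (X : FluidAlg n M A) : Prop :=
  SmoothVectorField X.vec ∧ ∀ a, ContMDiff 𝓘(ℝ, ModelE n) 𝓘(ℝ, ℝ) ∞ (X.fn a)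

/-- Compact support in `M`. -/
def FluidAlg.CompactlySupported (X : FluidAlg n M A) : Prop :=
  ∃ K : Set M, IsCompact K ∧ ∀ q ∉ K, X.vec q = 0 ∧ ∀ a, X.fn a q = 0

/-- The semidirect product Lie bracket on `𝔰_A`. -/
def FluidAlg.lie (X Y : FluidAlg n M A) : FluidAlg n M A where
  vec := VectorField.mlieBracket 𝓘(ℝ, ModelE n) X.vec Y.vec
  fn a q := lieDerivFun X.vec (Y.fn a) q - lieDerivFun Y.vec (X.fn a) q

/-- A smooth compactly supported variation of `z` in `𝔰_A*`. -/
def IsFluidVariation (z : FluidDual n M A) (c : ℝ → FluidDual n M A) : Prop :=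
  c 0 = z ∧ (∀ t, (c t).IsSmooth) ∧
    SmoothCovDensityOn univ (fun t : ℝ ↦ (c t).mom) ∧
    (∀ a, SmoothDensityOn n univ (fun t : ℝ ↦ (c t).dens a)) ∧
    ∃ K : Set M, IsCompact K ∧ ∀ t, ∀ q ∉ K,
      (c t).mom q = z.mom q ∧ ∀ a, (c t).dens a q = z.dens a q

/-- The velocity of a curve at time `0`. -/
def fluidVelocity (c : ℝ → FluidDual n M A) : FluidDual n M A where
  mom q := deriv (fun t ↦ (c t).mom q) 0
  dens a q := deriv (fun t ↦ (c t).dens a q) 0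

variable [T2Space M] [SigmaCompactSpace M]

/-- The dual pairing `∫_M (m(u) + ∑ₐ sₐ gₐ)`. -/
def fluidPairing (z : FluidDual n M A) (X : FluidAlg n M A) : ℝ :=
  densityIntegral n (fun q : M ↦ z.mom q (X.vec q) + ∑ a, z.dens a q * X.fn a q)

/-- `X` is the functional derivative `(δF/δm, δF/δs)` at `z`. -/
def HasFluidDeriv (F : FluidDual n M A → ℝ) (z : FluidDual n M A) (X : FluidAlg n M A) : Prop :=
  X.IsRegular ∧ ∀ c, IsFluidVariation z c →
    HasDerivAt (fun t ↦ F (c t)) (fluidPairing (fluidVelocity c) X) 0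

/-- The functional derivative `(δF/δm, δF/δs)` at `z`. -/
def fluidDeriv (F : FluidDual n M A → ℝ) (z : FluidDual n M A) : FluidAlg n M A :=
  haveI : Nonempty (FluidAlg n M A) := ⟨⟨fun _ ↦ 0, fun _ _ ↦ 0⟩⟩
  Classical.epsilon (HasFluidDeriv F z)

variable (n M A) in
/-- `𝔰_A*` with the `(-)`-Lie–Poisson bracket. -/
def fluidSpace : BracketSpace where
  Carrier := FluidDual n M A
  points := {z | z.IsSmooth}
  Admissible F G z := (∃ X, HasFluidDeriv F z X) ∧ (∃ Y, HasFluidDeriv G z Y) ∧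
    ((fluidDeriv F z).CompactlySupported ∨ (fluidDeriv G z).CompactlySupported)
  bracket F G z := -fluidPairing z ((fluidDeriv F z).lie (fluidDeriv G z))

end Fluid

section Maps

variable {n : ℕ} {M : Type*} [TopologicalSpace M] [ChartedSpace (ModelE n) M]
  [IsManifold 𝓘(ℝ, ModelE n) ∞ M]

/-! ## The maps -/

/-- The momentum density `m[f] = ∫ p f dⁿp`. -/
def momentumDensity (f : CotBundle n M → ℝ) (q : M) : ModelD n :=
  ∫ p : ModelD n, f ⟨q, p⟩ • p ∂(covectorVolume n)

/-- The density `ρ_ξ[f] = ∫ f^{1+ξ} dⁿp`. -/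
def powerDensity (f : CotBundle n M → ℝ) (ξ : ℝ) (q : M) : ℝ :=
  ∫ p : ModelD n, f ⟨q, p⟩ ^ (1 + ξ) ∂(covectorVolume n)

/-- The generalized entropy density `s_a[f] = ∫ f (log f)^a dⁿp`. -/
def entropyDensity (f : CotBundle n M → ℝ) (a : ℕ) (q : M) : ℝ :=
  ∫ p : ModelD n, f ⟨q, p⟩ * Real.log (f ⟨q, p⟩) ^ a ∂(covectorVolume n)

/-- The combined map `J[f] = (m[f], ξ ↦ ρ_ξ[f])`. -/
def combinedJ (f : CotBundle n M → ℝ) : PathDual n M := ⟨momentumDensity f, powerDensity f⟩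

/-- The map `J_A[f] = (m[f], (s₀[f], …, s_A[f]))`. -/
def fluidJ (A : ℕ) (f : CotBundle n M → ℝ) : FluidDual n M A :=
  ⟨momentumDensity f, fun a ↦ entropyDensity f a⟩

/-- Truncation of the family `ρ_ξ` to its `A`-jet at `ξ = 0`, given by the derivatives
`∂ᵃρ_ξ/∂ξᵃ` at `ξ = 0` for `a = 0, …, A`. -/
def jetTruncation (I : Set ℝ) (A : ℕ) (z : PathDual n M) : FluidDual n M A :=
  ⟨z.mom, fun a q ↦ iteratedDerivWithin a (fun ξ ↦ z.dens ξ q) I 0⟩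

end Maps

end

noncomputable section

open scoped Topology ENNReal

set_option linter.unusedSectionVars false

/-! ### Shortcut instances for the model spaces -/

section ModelInstances

variable {n : ℕ}

/-! Write s = log f and P_u = ⟨u, p⟩. To X = (u, g, (g_a)) belongs the generating function Γ_X(q, s)
= ∫_I e^{ξs} g_ξ(q) dξ + ∑ s^a g_a(q) (`PathAlg.gen`). The distributions at ξ = 0 become polynomials
in s because ∂_ξ^a f^{1+ξ} = f (log f)^a at ξ = 0. Integration over the fibres then gives ⟨J[f], X⟩
= ∫ f (P_u + Γ_X(q, log f)) dV. This formula, and its analogue for velocities of curves, is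
`pathPairing_kernel`. By the chain rule the functional derivative of F ∘ J is P_u + B_X, where B_X =
Γ_X + ∂_sΓ_X is evaluated at s = log f (`HasPathDeriv.hasKineticDeriv`); ∂_sΓ_X is the generating
function of `PathAlg.shift`. The brackets use a derivative picked by choice, so
`HasKineticDeriv.unique` is needed to identify it with this one.

The kinetic bracket of P_u + B_X and P_v + B_Y splits into four terms. First, {P_u, P_v} =
-P_{[u,v]}. Next, f {P_u, B_Y} = {P_u, f ∂_sΓ_Y} - f (L_uΓ_Y)(q, log f), by the Leibniz rule and f
{P_u, log f} = {P_u, f}. The first summand integrates to zero, because the flow of P_u on T*M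
preserves the Liouville measure (`integral_canonicalBracket_momentum`). The term with u and v
exchanged is treated alike. Finally, f {B_X, B_Y} is the p-derivative of log f in a direction that
depends on q and log f only. It is therefore a total derivative along each fibre and integrates to
zero there (`integral_exp_mul_flatBracket_level`). What remains is -∫ f (P_{[u,v]} + L_uΓ_Y -
L_vΓ_X) dV, which is minus the pairing of J[f] with [X, Y]. The pointwise identity is
`canonicalBracket_pullback`; the integrated one is `integral_kineticBracket_pullback`.

The analysis rests on one consequence of the decay condition: if every positive power of f is
rapidly decreasing with all derivatives, then log f and all its derivatives grow more slowly than
any f^{-ε} (`LogDecayOn.temperate`). Hence f^a decays also when the exponent a varies, factors log f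
are harmless, and the fibre integrals are smooth jointly in q, ξ and time. The condition ξ > -1/2
enters through f {B_X, B_Y}, of the size f^{1+ξ+ξ'} up to small powers: the exponent must be
positive.

The truncation T_A is linear, and its transpose is the inclusion `FluidAlg.lift` of the Lie algebra
of finitely many functions as distributions supported at ξ = 0. This inclusion is a homomorphism, so
T_A is a Poisson map once the derivative of F ∘ T_A is known to be the lifted one. That needs ∂_t to
commute with ∂_ξ^a (`deriv_iteratedDerivWithin`) and uniqueness of derivatives on the path space
(`HasPathDeriv.eq_on`). The identity T_A ∘ J = J_A is differentiation under the fibre integral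
(`iteratedDerivWithin_fibreIntegral`). -/

instance : T2Space (ModelE n →L[ℝ] ModelE n) := inferInstance

instance : ContinuousAdd (ModelE n →L[ℝ] ModelE n) := inferInstance

instance : ContinuousSMul ℝ (ModelE n →L[ℝ] ModelE n) := inferInstance

instance : ContinuousSMul ℝ (ModelE n) := inferInstance

instance : ContinuousSMul ℝ (ModelD n) := inferInstance

instance : ContinuousSMul ℝ (ModelE n × ModelD n) := inferInstance

instance {M : Type*} [TopologicalSpace M] [ChartedSpace (ModelE n) M]
    [IsManifold 𝓘(ℝ, ModelE n) ∞ M] : TopologicalSpace (CotBundle n M) := inferInstance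

end ModelInstances

/-! ### Canonical coordinates on the cotangent bundle -/

section CotangentCoordinates

variable {n : ℕ} {M : Type*} [TopologicalSpace M] [ChartedSpace (ModelE n) M]
  [IsManifold 𝓘(ℝ, ModelE n) ∞ M]

/-- The point of `T*M` with base point `q` and covector `p` in preferred coordinates. -/
def mkCot (q : M) (p : ModelD n) : CotBundle n M := ⟨q, p⟩

/-- The covector, in preferred coordinates, of a point of `T*M`. -/
def cov (z : CotBundle n M) : ModelD n := z.snd

@[simp] lemma proj_mkCot (q : M) (p : ModelD n) : (mkCot q p).proj = q := rfl

/-- The change of tangent coordinates at `q` from the preferred chart at `x` to the one at `y`. -/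
def tcc (x y q : M) : ModelE n →L[ℝ] ModelE n := tangentCoordChange 𝓘(ℝ, ModelE n) x y q

lemma toPreferred_eq (x : M) (y : ModelE n) :
    toPreferred x y =
      tcc x ((chartAt (ModelE n) x).symm y) ((chartAt (ModelE n) x).symm y) := rfl

lemma tcc_self {x q : M} (h : q ∈ (chartAt (ModelE n) x).source) :
    tcc (n := n) x x q = ContinuousLinearMap.id ℝ (ModelE n) := by
  ext1 v
  exact tangentCoordChange_self (by simpa using h)

lemma tcc_comp {w x y q : M} (hw : q ∈ (chartAt (ModelE n) w).source)
    (hx : q ∈ (chartAt (ModelE n) x).source) (hy : q ∈ (chartAt (ModelE n) y).source) :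
    (tcc (n := n) x y q).comp (tcc w x q) = tcc w y q := by
  ext1 v
  exact tangentCoordChange_comp (by simp [hw, hx, hy])

lemma tcc_comp_symm {x y q : M} (hx : q ∈ (chartAt (ModelE n) x).source)
    (hy : q ∈ (chartAt (ModelE n) y).source) :
    (tcc (n := n) y x q).comp (tcc x y q) = ContinuousLinearMap.id ℝ (ModelE n) := by
  rw [tcc_comp hx hy hx, tcc_self hx]

/-- The change of coordinates on the base from the chart at `x` to the chart at `y`. -/
def baseTrans (x y : M) : ModelE n → ModelE n :=
  chartAt (ModelE n) y ∘ (chartAt (ModelE n) x).symm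

lemma hasFDerivAt_baseTrans {x y q : M} (hx : q ∈ (chartAt (ModelE n) x).source)
    (hy : q ∈ (chartAt (ModelE n) y).source) :
    HasFDerivAt (baseTrans x y) (tcc x y q) (chartAt (ModelE n) x q) := by
  have := hasFDerivWithinAt_tangentCoordChange (I := 𝓘(ℝ, ModelE n)) (x := x) (y := y) (z := q)
    (by simp [hx, hy])
  simp only [mfld_simps, hasFDerivWithinAt_univ] at this
  exact this

lemma contDiffOn_baseTrans (x y : M) :
    ContDiffOn ℝ ∞ (baseTrans (n := n) x y)
      ((chartAt (ModelE n) x).target ∩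
        (chartAt (ModelE n) x).symm ⁻¹' (chartAt (ModelE n) y).source) := by
  intro w hw
  have := contDiffWithinAt_ext_coord_change (I := 𝓘(ℝ, ModelE n)) (n := ∞) y x (y := w)
    (by simpa [mfld_simps] using hw)
  simp only [mfld_simps] at this
  exact this.mono (subset_univ _)

lemma isOpen_overlap (x y : M) : IsOpen
    ((chartAt (ModelE n) x).target ∩ (chartAt (ModelE n) x).symm ⁻¹' (chartAt (ModelE n) y).source) :=
  (chartAt (ModelE n) x).isOpen_inter_preimage_symm (chartAt (ModelE n) y).open_source

/-- Bundle charts depend on the base point only, so the zero covector in `cotChart` is immaterial.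
-/
lemma cotChart_eq_extChartAt (z : CotBundle n M) :
    extChartAt (cotModel n) z = cotChart (n := n) z.proj := by
  unfold cotChart
  simp only [cotModel, FiberBundle.extChartAt]

lemma cotChart_source (x : M) :
    (cotChart (n := n) x).source = TotalSpace.proj ⁻¹' (chartAt (ModelE n) x).source := by
  unfold cotChart
  rw [FiberBundle.extChartAt]
  ext z
  simp only [mfld_simps]
  simp
  intro h1
  rw [hom_trivializationAt_apply]
  exact h1

lemma cotChart_target (x : M) :
    (cotChart (n := n) x).target = (chartAt (ModelE n) x).target ×ˢ univ := by
  unfold cotChart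
  rw [FiberBundle.extChartAt_target]
  ext z
  simp
  intro h
  exact (chartAt (ModelE n) x).map_target h

/-- Covectors are pulled back by the Jacobian that leads from x-coordinates to preferred coordinates
at the point. The trivial line bundle in which covectors take values contributes the identity. -/
lemma cotChart_apply (x : M) (z : CotBundle n M) (hz : z.proj ∈ (chartAt (ModelE n) x).source) :
    cotChart x z = (chartAt (ModelE n) x z.proj, (cov z).comp (tcc x z.proj z.proj)) := by
  have h1 : cotChart x z = (chartAt (ModelE n) x z.proj,
      ContinuousLinearMap.inCoordinates (ModelE n) (TangentSpace 𝓘(ℝ, ModelE n)) ℝ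
        (Bundle.Trivial M ℝ) x z.proj x z.proj z.snd) := by
    unfold cotChart
    rw [FiberBundle.extChartAt]
    simp [hom_trivializationAt_apply]
  rw [h1, ContinuousLinearMap.inCoordinates]
  refine Prod.ext rfl (ContinuousLinearMap.ext fun v ↦ ?_)
  have h2 : (trivializationAt ℝ (Bundle.Trivial M ℝ) x).continuousLinearMapAt ℝ z.proj =
      ContinuousLinearMap.id ℝ ℝ :=
    Bundle.Trivial.continuousLinearMapAt_trivialization (𝕜 := ℝ) (B := M) (F := ℝ) z.proj
  have h3 := congrArg (fun A : ModelE n →L[ℝ] ModelE n ↦ cov z (A v))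
    (TangentBundle.symmL_trivializationAt_eq_core (I := 𝓘(ℝ, ModelE n)) hz)
  exact (DFunLike.congr_fun h2 _).trans h3

lemma cotChart_mkCot {x q : M} (hq : q ∈ (chartAt (ModelE n) x).source) (p : ModelD n) :
    cotChart x (mkCot q p) = (chartAt (ModelE n) x q, p.comp (tcc x q q)) :=
  cotChart_apply x (mkCot q p) hq

lemma cotChart_symm_apply (x : M) {y : ModelE n} (hy : y ∈ (chartAt (ModelE n) x).target)
    (η : ModelD n) :
    (cotChart x).symm (y, η) = mkCot ((chartAt (ModelE n) x).symm y)
      (η.comp (tcc (((chartAt (ModelE n) x).symm y)) x ((chartAt (ModelE n) x).symm y))) := by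
  have h : (chartAt (ModelE n) x).symm y ∈ (chartAt (ModelE n) x).source :=
    (chartAt (ModelE n) x).map_target hy
  have h1 : cotChart x (mkCot ((chartAt (ModelE n) x).symm y)
      (η.comp (tcc (((chartAt (ModelE n) x).symm y)) x ((chartAt (ModelE n) x).symm y)))) =
      (y, η) := by
    rw [cotChart_mkCot h, ContinuousLinearMap.comp_assoc, tcc_comp_symm h (mem_chart_source _ _),
      ContinuousLinearMap.comp_id, (chartAt (ModelE n) x).right_inv hy]
  rw [← h1, (cotChart (n := n) x).left_inv]
  rw [cotChart_source]; exact h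

lemma proj_cotChart_symm (x : M) {y : ModelE n} (hy : y ∈ (chartAt (ModelE n) x).target)
    (η : ModelD n) :
    ((cotChart x).symm (y, η)).proj = (chartAt (ModelE n) x).symm y := by
  rw [cotChart_symm_apply x hy, proj_mkCot]

/-- In the preferred chart, the fibre coordinate is the covector itself. -/
lemma cotChart_symm_preferred (q : M) (p : ModelD n) :
    (cotChart q).symm (chartAt (ModelE n) q q, p) = mkCot q p := by
  rw [cotChart_symm_apply q (mem_chart_target _ _),
    (chartAt (ModelE n) q).left_inv (mem_chart_source _ q), tcc_self (mem_chart_source _ q),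
    ContinuousLinearMap.comp_id]

lemma isOpen_cotChart_source (x : M) : IsOpen (cotChart (n := n) x).source :=
  isOpen_extChartAt_source _

lemma continuousOn_cotChart (x : M) : ContinuousOn (cotChart (n := n) x) (cotChart (n := n) x).source :=
  continuousOn_extChartAt _

lemma continuousOn_cotChart_symm (x : M) :
    ContinuousOn (cotChart (n := n) x).symm (cotChart (n := n) x).target :=
  continuousOn_extChartAt_symm _

lemma isOpen_cotChart_target (x : M) : IsOpen (cotChart (n := n) x).target := by
  rw [cotChart_target]; exact (chartAt (ModelE n) x).open_target.prod isOpen_univ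

lemma continuous_cotProj : Continuous (TotalSpace.proj : CotBundle n M → M) :=
  FiberBundle.continuous_proj _ _

instance : Measure.IsAddHaarMeasure (covectorVolume n) := by
  unfold covectorVolume
  exact ((InnerProductSpace.toDual ℝ (ModelE n)).toContinuousLinearEquiv).isAddHaarMeasure_map volume

/-- The linear map `p ↦ p ∘ A` on covectors. -/
def covComp (A : ModelE n →L[ℝ] ModelE n) : ModelD n →ₗ[ℝ] ModelD n where
  toFun p := p.comp A
  map_add' _ _ := by ext; simp
  map_smul' _ _ := by ext; simp

/-- Up to the identification of continuous and algebraic dual, p ↦ p ∘ A is the transpose of A, and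
transposition preserves the determinant. -/
lemma det_covComp (A : ModelE n →L[ℝ] ModelE n) : LinearMap.det (covComp A) = A.det := by
  have h : (LinearMap.toContinuousLinearMap.symm : (ModelD n) ≃ₗ[ℝ] Module.Dual ℝ (ModelE n)).toLinearMap
      ∘ₗ (covComp A) ∘ₗ (LinearMap.toContinuousLinearMap :
        Module.Dual ℝ (ModelE n) ≃ₗ[ℝ] ModelD n).toLinearMap
        = (A : ModelE n →ₗ[ℝ] ModelE n).dualMap := by
    ext p v
    rfl
  rw [ContinuousLinearMap.det, ← LinearMap.det_dualMap (A : ModelE n →ₗ[ℝ] ModelE n), ← h]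
  exact (LinearMap.det_conj (covComp A)
    (LinearMap.toContinuousLinearMap.symm : (ModelD n) ≃ₗ[ℝ] Module.Dual ℝ (ModelE n))).symm

end CotangentCoordinates

/-! ### The Liouville measure -/

section LiouvilleMeasure

variable {n : ℕ} {M : Type*} [TopologicalSpace M] [ChartedSpace (ModelE n) M]
  [IsManifold 𝓘(ℝ, ModelE n) ∞ M]



variable (n) in
/-- Lebesgue measure on canonical coordinates. -/
abbrev coordVolume : Measure (ModelE n × ModelD n) := volume.prod (covectorVolume n)

/-- Lebesgue measure of the canonical coordinates at `x`, transported to `T*M`. -/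
def chartMeasure (x : M) : Measure (CotBundle n M) :=
  ((coordVolume n).restrict (cotChart (n := n) x).target).map (cotChart (n := n) x).symm

lemma aemeasurable_cotChart_symm (x : M) :
    AEMeasurable (cotChart (n := n) x).symm
      ((coordVolume n).restrict (cotChart (n := n) x).target) :=
  (continuousOn_cotChart_symm x).aemeasurable (isOpen_cotChart_target x).measurableSet

lemma isOpen_target_inter_preimage (x : M) {A : Set (CotBundle n M)} (hA : IsOpen A) :
    IsOpen ((cotChart (n := n) x).target ∩ (cotChart (n := n) x).symm ⁻¹' A) :=
  (continuousOn_cotChart_symm x).isOpen_inter_preimage (isOpen_cotChart_target x) hA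

lemma measurableSet_target_inter_preimage (x : M) {A : Set (CotBundle n M)}
    (hA : MeasurableSet A) :
    MeasurableSet ((cotChart (n := n) x).target ∩ (cotChart (n := n) x).symm ⁻¹' A) := by
  have h : Measurable ((cotChart (n := n) x).target.domRestrict (cotChart (n := n) x).symm) :=
    (continuousOn_iff_continuous_domRestrict.1 (continuousOn_cotChart_symm x)).measurable
  have := MeasurableSet.subtype_image (isOpen_cotChart_target x).measurableSet (h hA)
  convert this using 1
  ext w; simp [and_comm]

lemma chartMeasure_apply (x : M) {A : Set (CotBundle n M)} (hA : MeasurableSet A) :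
    chartMeasure x A =
      coordVolume n ((cotChart (n := n) x).target ∩ (cotChart (n := n) x).symm ⁻¹' A) := by
  rw [chartMeasure, Measure.map_apply_of_aemeasurable (aemeasurable_cotChart_symm x) hA,
    Measure.restrict_apply' (isOpen_cotChart_target x).measurableSet, inter_comm]

lemma chartMeasure_inter_source (x : M) {A : Set (CotBundle n M)} (hA : MeasurableSet A) :
    chartMeasure x (A ∩ (cotChart (n := n) x).source) = chartMeasure x A := by
  rw [chartMeasure_apply _ hA,
    chartMeasure_apply _ (hA.inter (isOpen_cotChart_source x).measurableSet)]
  congr 1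
  ext w
  simp only [mem_inter_iff, mem_preimage]
  exact ⟨fun h ↦ ⟨h.1, h.2.1⟩, fun h ↦ ⟨h.1, h.2, (cotChart (n := n) x).map_target h.1⟩⟩

/-- The transition between two canonical coordinate systems. -/
lemma cotChart_cotChart_symm {x x' : M} {y : ModelE n} (hy : y ∈ (chartAt (ModelE n) x).target)
    (hy' : (chartAt (ModelE n) x).symm y ∈ (chartAt (ModelE n) x').source) (η : ModelD n) :
    cotChart x' ((cotChart x).symm (y, η)) =
      (baseTrans x x' y, η.comp (tcc x' x ((chartAt (ModelE n) x).symm y))) := by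
  rw [cotChart_symm_apply x hy, cotChart_mkCot hy', ContinuousLinearMap.comp_assoc,
    tcc_comp hy' (mem_chart_source _ _) ((chartAt (ModelE n) x).map_target hy)]
  rfl

lemma det_tcc_mul {x y q : M} (hx : q ∈ (chartAt (ModelE n) x).source)
    (hy : q ∈ (chartAt (ModelE n) y).source) :
    (tcc (n := n) y x q).det * (tcc (n := n) x y q).det = 1 := by
  have := congrArg ContinuousLinearMap.det (tcc_comp_symm (n := n) hx hy)
  simpa [ContinuousLinearMap.det] using this

lemma det_tcc_ne_zero {x y q : M} (hx : q ∈ (chartAt (ModelE n) x).source)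
    (hy : q ∈ (chartAt (ModelE n) y).source) : (tcc (n := n) x y q).det ≠ 0 := by
  intro h
  simpa [h] using det_tcc_mul (n := n) hx hy

/-- Only determinants matter for Haar measure, so B needs to be inverse to A at the level of
determinants only. -/
lemma covectorVolume_preimage_comp {A B : ModelE n →L[ℝ] ModelE n} (h : A.det * B.det = 1)
    (s : Set (ModelD n)) :
    covectorVolume n ((fun p : ModelD n ↦ p.comp A) ⁻¹' s) =
      ENNReal.ofReal |B.det| * covectorVolume n s := by
  have hA : LinearMap.det (covComp A) ≠ 0 := by
    rw [det_covComp]; exact left_ne_zero_of_mul_eq_one h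
  have := Measure.addHaar_preimage_linearMap (covectorVolume n) hA s
  rw [det_covComp, inv_eq_of_mul_eq_one_right h] at this
  exact this

lemma baseTrans_mapsTo (x x' : M) : baseTrans (n := n) x x' ''
      ((chartAt (ModelE n) x).target ∩
        (chartAt (ModelE n) x).symm ⁻¹' (chartAt (ModelE n) x').source) =
      (chartAt (ModelE n) x').target ∩
        (chartAt (ModelE n) x').symm ⁻¹' (chartAt (ModelE n) x).source := by
  ext w
  constructor
  · rintro ⟨y, ⟨hy, hy'⟩, rfl⟩
    refine ⟨(chartAt (ModelE n) x').map_source hy', ?_⟩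
    simp only [baseTrans, Function.comp, mem_preimage]
    rw [(chartAt (ModelE n) x').left_inv hy']
    exact (chartAt (ModelE n) x).map_target hy
  · rintro ⟨hw, hw'⟩
    refine ⟨chartAt (ModelE n) x ((chartAt (ModelE n) x').symm w),
      ⟨(chartAt (ModelE n) x).map_source hw', ?_⟩, ?_⟩
    · simp only [mem_preimage]
      rw [(chartAt (ModelE n) x).left_inv hw']
      exact (chartAt (ModelE n) x').map_target hw
    · simp only [baseTrans, Function.comp]
      rw [(chartAt (ModelE n) x).left_inv hw', (chartAt (ModelE n) x').right_inv hw]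

lemma injOn_baseTrans (x x' : M) : InjOn (baseTrans (n := n) x x')
      ((chartAt (ModelE n) x).target ∩
        (chartAt (ModelE n) x).symm ⁻¹' (chartAt (ModelE n) x').source) := by
  intro a ha b hb hab
  exact (chartAt (ModelE n) x).symm.injOn ha.1 hb.1
    ((chartAt (ModelE n) x').injOn ha.2 hb.2 hab)

/-- Invariance of dq dp: the change of base coordinates produces |det τ'|, and the fibres are
transformed by the inverse transpose of τ', which produces the reciprocal factor. Fubini separates
the two, so that the base change of variables and the linear change in each fibre cancel. -/
lemma chartMeasure_eq_of_subset {x x' : M} {A : Set (CotBundle n M)} (hA : MeasurableSet A)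
    (h : A ⊆ (cotChart (n := n) x).source) (h' : A ⊆ (cotChart (n := n) x').source) :
    chartMeasure x A = chartMeasure x' A := by
  rw [chartMeasure_apply _ hA, chartMeasure_apply _ hA]
  -- Base points outside the overlap have an empty slice, so the Fubini integral is an integral over
  -- the overlap, the only place where both charts are available.
  have key : ∀ (x x' : M), A ⊆ (cotChart (n := n) x').source →
      coordVolume n ((cotChart (n := n) x).target ∩ (cotChart (n := n) x).symm ⁻¹' A) =
      ∫⁻ y in ((chartAt (ModelE n) x).target ∩
        (chartAt (ModelE n) x).symm ⁻¹' (chartAt (ModelE n) x').source), covectorVolume n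
        (Prod.mk y ⁻¹' ((cotChart (n := n) x).target ∩ (cotChart (n := n) x).symm ⁻¹' A)) := by
    intro x x' h'
    rw [coordVolume, Measure.prod_apply (measurableSet_target_inter_preimage x hA)]
    symm
    apply setLIntegral_eq_of_support_subset
    intro y hy
    by_contra hcon
    apply hy
    beta_reduce
    rw [show Prod.mk y ⁻¹' ((cotChart (n := n) x).target ∩ (cotChart (n := n) x).symm ⁻¹' A) = ∅ from ?_]
    · simp
    · rw [eq_empty_iff_forall_notMem]
      rintro η ⟨h1, h2⟩
      rw [cotChart_target] at h1
      apply hcon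
      refine ⟨h1.1, ?_⟩
      have := h' h2
      rw [cotChart_source] at this
      simpa [proj_cotChart_symm x h1.1] using this
  rw [key x x' h', key x' x h, ← baseTrans_mapsTo x x',
    lintegral_image_eq_lintegral_abs_det_fderiv_mul volume (isOpen_overlap x x').measurableSet
      (f := baseTrans x x') (f' := fun y ↦ tcc x x' ((chartAt (ModelE n) x).symm y)) ?_
      (injOn_baseTrans x x')]
  · apply setLIntegral_congr_fun (isOpen_overlap x x').measurableSet
    intro y hy
    have hq := (chartAt (ModelE n) x).map_target hy.1
    beta_reduce
    rw [← covectorVolume_preimage_comp (det_tcc_mul hq hy.2)]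
    congr 1
    ext η
    have e1 := cotChart_cotChart_symm hy.1 hy.2 η
    have h3 : (cotChart (n := n) x).symm (y, η) ∈ (cotChart (n := n) x').source := by
      rw [cotChart_source, mem_preimage, proj_cotChart_symm x hy.1]; exact hy.2
    have h4 : (cotChart (n := n) x').symm
        (baseTrans x x' y, η.comp (tcc x' x ((chartAt (ModelE n) x).symm y))) =
        (cotChart (n := n) x).symm (y, η) := by
      rw [← e1, (cotChart (n := n) x').left_inv h3]
    have h5 : (y, η) ∈ (cotChart (n := n) x).target := by
      rw [cotChart_target]; exact ⟨hy.1, mem_univ _⟩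
    have h6 : (baseTrans x x' y, η.comp (tcc x' x ((chartAt (ModelE n) x).symm y))) ∈
        (cotChart (n := n) x').target := by
      rw [← e1]; exact (cotChart (n := n) x').map_source h3
    simp only [mem_preimage, mem_inter_iff, h4, h5, h6, true_and]
  · intro y hy
    have := hasFDerivAt_baseTrans ((chartAt (ModelE n) x).map_target hy.1) hy.2
    rw [(chartAt (ModelE n) x).right_inv hy.1] at this
    exact this.hasFDerivWithinAt

variable [SigmaCompactSpace M]

lemma exists_seq_iUnion_source_eq_univ (n : ℕ) {M : Type*} [TopologicalSpace M]
    [ChartedSpace (ModelE n) M] [SigmaCompactSpace M] [Nonempty M] :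
    ∃ c : ℕ → M, ⋃ i, (chartAt (ModelE n) (c i)).source = univ := by
  obtain ⟨s, hs, hs'⟩ := countable_cover_nhds_of_sigmaCompact
    (fun x : M ↦ chart_source_mem_nhds (ModelE n) x)
  have hne : s.Nonempty := by
    by_contra h
    rw [not_nonempty_iff_eq_empty] at h
    simp [h] at hs'
    exact (empty_ne_univ hs')
  obtain ⟨c, rfl⟩ := hs.exists_eq_range hne
  exact ⟨c, by simpa using hs'⟩

/-- A countable cover by chart domains, made disjoint, glues the chart measures to a measure ν. By
compatibility on overlaps, ν restricts to each chart measure; therefore it dominates all of them,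
and being a sum of pieces of them it is dominated by their supremum. -/
lemma exists_liouville_eq_sum [Nonempty M] : ∃ (c : ℕ → M) (D : ℕ → Set (CotBundle n M)),
    liouville n M = Measure.sum (fun i ↦ (chartMeasure (c i)).restrict (D i)) ∧
    ∀ (x : M) (A : Set (CotBundle n M)), MeasurableSet A → A ⊆ (cotChart (n := n) x).source →
      liouville n M A = chartMeasure x A := by
  obtain ⟨c, hc⟩ := exists_seq_iUnion_source_eq_univ n (M := M)
  set D := disjointed (fun i ↦ (cotChart (n := n) (c i)).source) with hD
  have hDm : ∀ i, MeasurableSet (D i) :=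
    MeasurableSet.disjointed fun i ↦ (isOpen_cotChart_source (c i)).measurableSet
  have hDu : ⋃ i, D i = univ := by
    rw [hD, iUnion_disjointed]
    simp only [cotChart_source, ← preimage_iUnion, hc, preimage_univ]
  have hDs : ∀ i, D i ⊆ (cotChart (n := n) (c i)).source := fun i ↦ disjointed_subset _ _
  have hdis : Pairwise (Function.onFun Disjoint D) := disjoint_disjointed _
  set ν := Measure.sum (fun i ↦ (chartMeasure (c i)).restrict (D i)) with hν
  have split : ∀ (μ : Measure (CotBundle n M)) (A : Set (CotBundle n M)), MeasurableSet A →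
      ∑' i, μ (A ∩ D i) = μ A := by
    intro μ A hA
    rw [← measure_iUnion (fun i j hij ↦ (hdis hij).mono inter_subset_right inter_subset_right)
      (fun i ↦ hA.inter (hDm i)), ← inter_iUnion, hDu, inter_univ]
  have hνA : ∀ A : Set (CotBundle n M), MeasurableSet A →
      ν A = ∑' i, chartMeasure (c i) (A ∩ D i) := by
    intro A hA
    rw [hν, Measure.sum_apply _ hA]
    congr 1; ext i
    rw [Measure.restrict_apply hA]
  have key : ∀ (x : M) (A : Set (CotBundle n M)), MeasurableSet A →
      A ⊆ (cotChart (n := n) x).source → ν A = chartMeasure x A := by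
    intro x A hA hx
    rw [hνA A hA, ← split (chartMeasure x) A hA]
    congr 1; ext i
    exact chartMeasure_eq_of_subset (hA.inter (hDm i)) (inter_subset_right.trans (hDs i))
      (inter_subset_left.trans hx)
  have hle : ∀ x : M, chartMeasure x ≤ liouville n M := fun x ↦ le_iSup (fun x : M ↦ chartMeasure (n := n) x) x
  have heq : liouville n M = ν := by
    apply le_antisymm
    · refine iSup_le fun x ↦ Measure.le_iff.2 fun A hA ↦ ?_
      change chartMeasure x A ≤ ν A
      rw [← chartMeasure_inter_source x hA, ← key x _
        (hA.inter (isOpen_cotChart_source x).measurableSet) inter_subset_right]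
      exact measure_mono inter_subset_left
    · refine Measure.le_iff.2 fun A hA ↦ ?_
      rw [hνA A hA, ← split (liouville n M) A hA]
      exact ENNReal.tsum_le_tsum fun i ↦ hle (c i) _
  exact ⟨c, D, heq, fun x A hA hx ↦ by rw [heq]; exact key x A hA hx⟩

lemma liouville_restrict_source (x : M) :
    (liouville n M).restrict (cotChart (n := n) x).source = chartMeasure x := by
  have : Nonempty M := ⟨x⟩
  obtain ⟨c, D, -, h⟩ := exists_liouville_eq_sum (n := n) (M := M)
  ext A hA
  rw [Measure.restrict_apply hA, h x _ (hA.inter (isOpen_cotChart_source x).measurableSet)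
    inter_subset_right, chartMeasure_inter_source x hA]

lemma liouville_apply_of_subset {x : M} {A : Set (CotBundle n M)} (hA : MeasurableSet A)
    (h : A ⊆ (cotChart (n := n) x).source) : liouville n M A =
      coordVolume n ((cotChart (n := n) x).target ∩ (cotChart (n := n) x).symm ⁻¹' A) := by
  rw [← chartMeasure_apply x hA, ← liouville_restrict_source, Measure.restrict_apply hA,
    inter_eq_left.2 h]

instance : SFinite (liouville n M) := by
  rcases isEmpty_or_nonempty M with h | h
  · have : liouville n M = 0 := by rw [liouville, iSup_of_empty]; rfl
    rw [this]; infer_instance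
  · obtain ⟨c, D, h, -⟩ := exists_liouville_eq_sum (n := n) (M := M)
    rw [h]
    have : ∀ i, SFinite ((chartMeasure (n := n) (c i)).restrict (D i)) := by
      intro i; unfold chartMeasure; infer_instance
    infer_instance

instance : IsLocallyFiniteMeasure (liouville n M) := by
  refine ⟨fun z ↦ ?_⟩
  have hz : z ∈ (cotChart (n := n) z.proj).source := by
    rw [cotChart_source]; exact mem_chart_source _ _
  have ho := (continuousOn_cotChart z.proj).isOpen_inter_preimage (isOpen_cotChart_source z.proj)
    (Metric.isOpen_ball (x := cotChart z.proj z) (ε := 1))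
  refine ⟨_, ho.mem_nhds ⟨hz, Metric.mem_ball_self one_pos⟩, ?_⟩
  rw [liouville_apply_of_subset ho.measurableSet inter_subset_left]
  refine lt_of_le_of_lt (measure_mono ?_)
    (measure_ball_lt_top (μ := coordVolume n) (x := cotChart z.proj z) (r := 1))
  rintro w ⟨hw, -, hw2⟩
  rw [mem_preimage, (cotChart (n := n) z.proj).right_inv hw] at hw2
  exact hw2

/-- Positivity on open sets is what makes functional derivatives with respect to f unique as smooth
functions, and not only almost everywhere. -/
instance : Measure.IsOpenPosMeasure (liouville n M) := by
  refine ⟨fun U hU ⟨z, hz⟩ h0 ↦ ?_⟩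
  have hz' : z ∈ (cotChart (n := n) z.proj).source := by
    rw [cotChart_source]; exact mem_chart_source _ _
  have h1 := measure_mono_null (μ := liouville n M)
    (inter_subset_left (s := U) (t := (cotChart (n := n) z.proj).source)) h0
  have ho := hU.inter (isOpen_cotChart_source z.proj)
  rw [liouville_apply_of_subset ho.measurableSet inter_subset_right] at h1
  have := (isOpen_target_inter_preimage z.proj ho).measure_eq_zero_iff (coordVolume n) |>.1 h1
  rw [eq_empty_iff_forall_notMem] at this
  refine this (cotChart z.proj z) ⟨(cotChart (n := n) z.proj).map_source hz', ?_⟩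
  rw [mem_preimage, (cotChart (n := n) z.proj).left_inv hz']
  exact ⟨hz, hz'⟩

end LiouvilleMeasure

/-! ### Fibre integration and integrability on phase space -/

section CotangentIntegration

variable {n : ℕ} {M : Type*} [TopologicalSpace M] [ChartedSpace (ModelE n) M]
  [IsManifold 𝓘(ℝ, ModelE n) ∞ M]

lemma mem_cotChart_source {x : M} {z : CotBundle n M} :
    z ∈ (cotChart (n := n) x).source ↔ z.proj ∈ (chartAt (ModelE n) x).source := by
  rw [cotChart_source]; rfl

lemma mem_cotChart_target {x : M} {w : ModelE n × ModelD n} :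
    w ∈ (cotChart (n := n) x).target ↔ w.1 ∈ (chartAt (ModelE n) x).target := by
  rw [cotChart_target]; simp

lemma proj_cotChart_symm' (x : M) {w : ModelE n × ModelD n}
    (hw : w ∈ (cotChart (n := n) x).target) :
    ((cotChart x).symm w).proj = (chartAt (ModelE n) x).symm w.1 :=
  proj_cotChart_symm x (mem_cotChart_target.1 hw) w.2

instance [T2Space M] : T2Space (CotBundle n M) := by
  refine ⟨fun z z' hne ↦ ?_⟩
  by_cases hp : z.proj = z'.proj
  · have hz : z ∈ (cotChart (n := n) z.proj).source :=
      mem_cotChart_source.2 (mem_chart_source _ _)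
    have hz' : z' ∈ (cotChart (n := n) z.proj).source :=
      mem_cotChart_source.2 (hp ▸ mem_chart_source _ _)
    obtain ⟨u, v, hu, hv, hzu, hzv, huv⟩ :=
      t2_separation ((cotChart (n := n) z.proj).injOn.ne hz hz' hne)
    refine ⟨_, _, (continuousOn_cotChart z.proj).isOpen_inter_preimage
      (isOpen_cotChart_source z.proj) hu, (continuousOn_cotChart z.proj).isOpen_inter_preimage
      (isOpen_cotChart_source z.proj) hv, ⟨hz, hzu⟩, ⟨hz', hzv⟩, ?_⟩
    exact Disjoint.mono inter_subset_right inter_subset_right (huv.preimage _)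
  · obtain ⟨u, v, hu, hv, hzu, hzv, huv⟩ := t2_separation hp
    exact ⟨_, _, hu.preimage continuous_cotProj, hv.preimage continuous_cotProj, hzu, hzv,
      huv.preimage _⟩

lemma integral_comp_covector {F : Type*} [NormedAddCommGroup F] [NormedSpace ℝ F]
    {A B : ModelE n →L[ℝ] ModelE n} (h : A.det * B.det = 1) (g : ModelD n → F) :
    ∫ η, g (η.comp A) ∂(covectorVolume n) = |B.det| • ∫ p, g p ∂(covectorVolume n) := by
  have hA : LinearMap.det (covComp A) ≠ 0 := by
    rw [det_covComp]; exact left_ne_zero_of_mul_eq_one h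
  have hm := Measure.map_linearMap_addHaar_eq_smul_addHaar (covectorVolume n) hA
  rw [det_covComp, inv_eq_of_mul_eq_one_right h] at hm
  have he : MeasurableEmbedding (covComp A) :=
    (LinearMap.equivOfDetNeZero (covComp A) hA).toContinuousLinearEquiv.toHomeomorph.measurableEmbedding
  have := he.integral_map (μ := covectorVolume n) g
  rw [hm, integral_smul_measure, ENNReal.toReal_ofReal (abs_nonneg _)] at this
  exact this.symm

/-- A fibre integral is a density: passing from preferred fibre coordinates to those of the chart at
x costs exactly the Jacobian factor by which densities transform. -/
lemma densityRep_fibreIntegral (x : M) (h : CotBundle n M → ℝ) {y : ModelE n}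
    (hy : y ∈ (chartAt (ModelE n) x).target) :
    densityRep x (fun q ↦ ∫ p, h (mkCot q p) ∂(covectorVolume n)) y =
      ∫ η, h ((cotChart x).symm (y, η)) ∂(covectorVolume n) := by
  have hq := (chartAt (ModelE n) x).map_target hy
  have hq' := mem_chart_source (ModelE n) ((chartAt (ModelE n) x).symm y)
  simp only [cotChart_symm_apply x hy]
  rw [integral_comp_covector (B := toPreferred x y) (det_tcc_mul hq hq')
    (fun p ↦ h (mkCot ((chartAt (ModelE n) x).symm y) p)), densityRep, smul_eq_mul]

/-- The fibre Jacobian accounts for the density factor, and the weight p, rewritten in the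
coordinates of the chart at x, for the pullback of the covector. -/
lemma covDensityRep_fibreIntegral (x : M) (k : CotBundle n M → ℝ) {y : ModelE n}
    (hy : y ∈ (chartAt (ModelE n) x).target) :
    covDensityRep x (fun q ↦ ∫ p, k (mkCot q p) • p ∂(covectorVolume n)) y =
      ∫ η, k ((cotChart x).symm (y, η)) • η ∂(covectorVolume n) := by
  have hq := (chartAt (ModelE n) x).map_target hy
  have hq' := mem_chart_source (ModelE n) ((chartAt (ModelE n) x).symm y)
  have hdet : LinearMap.det (covComp (toPreferred x y)) ≠ 0 := by
    rw [det_covComp, toPreferred_eq]; exact det_tcc_ne_zero hq hq'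
  have h2 := (LinearMap.equivOfDetNeZero (covComp (toPreferred x y))
    hdet).toContinuousLinearEquiv.integral_comp_comm (μ := covectorVolume n)
    (fun p ↦ k (mkCot ((chartAt (ModelE n) x).symm y) p) • p)
  have h3 := integral_comp_covector (B := toPreferred x y) (det_tcc_mul hq hq')
    (fun p ↦ k (mkCot ((chartAt (ModelE n) x).symm y) p) • p.comp (toPreferred x y))
  rw [covDensityRep]
  simp only [cotChart_symm_apply x hy]
  have h4 : ∀ η : ModelD n, (η.comp (tcc ((chartAt (ModelE n) x).symm y) x
      ((chartAt (ModelE n) x).symm y))).comp (toPreferred x y) = η := by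
    intro η
    rw [toPreferred_eq, ContinuousLinearMap.comp_assoc, tcc_comp_symm hq hq',
      ContinuousLinearMap.comp_id]
  simp only [h4] at h3
  rw [h3]
  congr 1
  refine Eq.trans h2.symm ?_
  refine integral_congr_ae (Filter.Eventually.of_forall fun p ↦ ?_)
  exact map_smul (covComp (toPreferred x y)) _ _

variable [SigmaCompactSpace M]

lemma integral_eq_chart (x : M) {h : CotBundle n M → ℝ}
    (hs : ∀ z, z.proj ∉ (chartAt (ModelE n) x).source → h z = 0)
    (hm : AEStronglyMeasurable h (liouville n M)) :
    ∫ z, h z ∂(liouville n M) =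
      ∫ w in (cotChart (n := n) x).target, h ((cotChart x).symm w) ∂(coordVolume n) := by
  rw [← setIntegral_eq_integral_of_forall_compl_eq_zero (s := (cotChart (n := n) x).source)
    (fun z hz ↦ hs z (fun h ↦ hz (mem_cotChart_source.2 h))), liouville_restrict_source,
    chartMeasure, integral_map (aemeasurable_cotChart_symm x)]
  have := hm.mono_measure (Measure.restrict_le_self (s := (cotChart (n := n) x).source))
  rwa [liouville_restrict_source] at this

lemma integrable_iff_chart (x : M) {h : CotBundle n M → ℝ}
    (hs : ∀ z, z.proj ∉ (chartAt (ModelE n) x).source → h z = 0)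
    (hm : AEStronglyMeasurable h (liouville n M)) :
    Integrable h (liouville n M) ↔
      IntegrableOn (fun w ↦ h ((cotChart x).symm w)) (cotChart (n := n) x).target
        (coordVolume n) := by
  rw [← integrableOn_iff_integrable_of_support_subset (s := (cotChart (n := n) x).source)
    (fun z hz ↦ by_contra fun h' ↦ hz (hs z (fun h ↦ h' (mem_cotChart_source.2 h)))),
    IntegrableOn, liouville_restrict_source,
    chartMeasure, integrable_map_measure _ (aemeasurable_cotChart_symm x)]
  · rfl
  · have := hm.mono_measure (Measure.restrict_le_self (s := (cotChart (n := n) x).source))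
    rwa [liouville_restrict_source] at this

variable [T2Space M]

lemma tsupport_chartPartition_subset (x : M) :
    tsupport (chartPartition n M x) ⊆ (chartAt (ModelE n) x).source :=
  Classical.choose_spec
    (SmoothPartitionOfUnity.exists_isSubordinate_chartAt_source 𝓘(ℝ, ModelE n) M) x

lemma continuous_chartPartition (x : M) : Continuous (chartPartition n M x) :=
  (chartPartition n M x).contMDiff.continuous

lemma chartPartition_eq_zero {x q : M} (h : q ∉ (chartAt (ModelE n) x).source) :
    chartPartition n M x q = 0 :=
  image_eq_zero_of_notMem_tsupport fun h' ↦ h (tsupport_chartPartition_subset x h')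

variable (n) in
/-- The finitely many indices of the chart partition that are active on a compact set. -/
def activeCharts {K : Set M} (hK : IsCompact K) : Finset M :=
  ((chartPartition n M).locallyFinite.finite_nonempty_inter_compact hK).toFinset

lemma chartPartition_eq_zero_of_notMem {K : Set M} (hK : IsCompact K) {x q : M}
    (hx : x ∉ activeCharts n hK) (hq : q ∈ K) : chartPartition n M x q = 0 := by
  by_contra h
  apply hx
  rw [activeCharts, Finite.mem_toFinset]
  exact ⟨q, h, hq⟩

lemma sum_chartPartition {K : Set M} (hK : IsCompact K) {q : M} (hq : q ∈ K) :
    ∑ x ∈ activeCharts n hK, chartPartition n M x q = 1 := by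
  rw [← (chartPartition n M).sum_eq_one (mem_univ q)]
  symm
  apply finsum_eq_sum_of_support_subset
  intro x hx
  by_contra h
  exact hx (chartPartition_eq_zero_of_notMem hK h hq)

lemma eq_sum_chartPartition_mul {K : Set M} (hK : IsCompact K) {h : CotBundle n M → ℝ}
    (hs : ∀ z, z.proj ∉ K → h z = 0) (z : CotBundle n M) :
    h z = ∑ x ∈ activeCharts n hK, chartPartition n M x z.proj * h z := by
  by_cases hz : z.proj ∈ K
  · rw [← Finset.sum_mul, sum_chartPartition hK hz, one_mul]
  · simp [hs z hz]

lemma continuous_chartPartition_proj (x : M) :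
    Continuous fun z : CotBundle n M ↦ chartPartition n M x z.proj :=
  (continuous_chartPartition x).comp continuous_cotProj

lemma integrable_chartPartition_mul {h : CotBundle n M → ℝ} (hi : Integrable h (liouville n M))
    (x : M) : Integrable (fun z ↦ chartPartition n M x z.proj * h z) (liouville n M) := by
  refine hi.bdd_mul (c := 1) (continuous_chartPartition_proj x).aestronglyMeasurable ?_
  refine Filter.Eventually.of_forall fun z ↦ ?_
  rw [Real.norm_eq_abs, abs_of_nonneg ((chartPartition n M).nonneg _ _)]
  exact (chartPartition n M).le_one _ _

/-- Integration over `T*M` as integration over `M` of the fibre integral. -/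
theorem densityIntegral_fibreIntegral {h : CotBundle n M → ℝ} (hi : Integrable h (liouville n M))
    {K : Set M} (hK : IsCompact K) (hs : ∀ z, z.proj ∉ K → h z = 0) :
    densityIntegral n (fun q : M ↦ ∫ p, h (mkCot q p) ∂(covectorVolume n)) =
      ∫ z, h z ∂(liouville n M) := by
  calc densityIntegral n (fun q : M ↦ ∫ p, h (mkCot q p) ∂(covectorVolume n))
      = ∑ x ∈ activeCharts n hK, ∫ z, chartPartition n M x z.proj * h z ∂(liouville n M) := ?_
    _ = ∫ z, ∑ x ∈ activeCharts n hK, chartPartition n M x z.proj * h z ∂(liouville n M) :=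
        (integral_finsetSum _ fun x _ ↦ integrable_chartPartition_mul hi x).symm
    _ = ∫ z, h z ∂(liouville n M) := by
        congr 1; ext z; exact (eq_sum_chartPartition_mul hK hs z).symm
  rw [densityIntegral, finsum_eq_sum_of_support_subset (s := activeCharts n hK)]
  · refine Finset.sum_congr rfl fun x _ ↦ ?_
    have hx : ∀ z : CotBundle n M, z.proj ∉ (chartAt (ModelE n) x).source →
        chartPartition n M x z.proj * h z = 0 := by
      intro z hz; rw [chartPartition_eq_zero hz, zero_mul]
    have hix := integrable_chartPartition_mul hi x
    rw [integral_eq_chart x hx hix.aestronglyMeasurable]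
    have h2 := (integrable_iff_chart x hx hix.aestronglyMeasurable).1 hix
    rw [cotChart_target] at h2 ⊢
    rw [coordVolume, setIntegral_prod _ h2]
    refine setIntegral_congr_fun (chartAt (ModelE n) x).open_target.measurableSet fun y hy ↦ ?_
    rw [densityRep_fibreIntegral x h hy, setIntegral_univ, ← integral_const_mul]
    refine integral_congr_ae (Filter.Eventually.of_forall fun η ↦ ?_)
    beta_reduce
    rw [proj_cotChart_symm x hy]
  · intro x hx
    by_contra hx'
    apply hx
    beta_reduce
    rw [setIntegral_eq_zero_of_forall_eq_zero]
    intro y hy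
    by_cases hq : (chartAt (ModelE n) x).symm y ∈ K
    · rw [chartPartition_eq_zero_of_notMem hK (by simpa using hx') hq, zero_mul]
    · have : ∀ p, h (mkCot ((chartAt (ModelE n) x).symm y) p) = 0 := fun p ↦ hs _ hq
      simp [densityRep, this]

/-- The exponent n + 1 is the first integer above the dimension of the fibre. All later decay rates
are this one plus the powers needed to absorb polynomial factors. -/
lemma integrable_one_add_norm_covector :
    Integrable (fun η : ModelD n ↦ ((1 + ‖η‖) ^ (n + 1))⁻¹) (covectorVolume n) := by
  have hf : Module.finrank ℝ (ModelD n) = n := by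
    rw [← (InnerProductSpace.toDual ℝ (ModelE n)).toLinearEquiv.finrank_eq]; simp
  have := integrable_one_add_norm (E := ModelD n) (μ := covectorVolume n) (r := n + 1)
    (by rw [hf]; linarith)
  refine this.congr (Filter.Eventually.of_forall fun η ↦ ?_)
  beta_reduce
  rw [Real.rpow_neg (by positivity)]
  norm_cast

/-- Domination by a product: the indicator of L on the base times (1 + |η|)^{-(n+1)} on the fibre.
-/
lemma integrableOn_of_fibre_decay {U L : Set (ModelE n)} (hU : IsOpen U) (hL : IsCompact L)
    {G : ModelE n × ModelD n → ℝ} (hG : ContinuousOn G (U ×ˢ univ))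
    (h0 : ∀ y ∈ U, y ∉ L → ∀ η, G (y, η) = 0)
    {C : ℝ} (hC : ∀ y ∈ U, y ∈ L → ∀ η, (1 + ‖η‖) ^ (n + 1) * |G (y, η)| ≤ C) :
    IntegrableOn G (U ×ˢ univ) (coordVolume n) := by
  have hm : MeasurableSet (U ×ˢ (univ : Set (ModelD n))) := (hU.prod isOpen_univ).measurableSet
  have hdom : Integrable (fun w : ModelE n × ModelD n ↦
      L.indicator (fun _ ↦ |C|) w.1 * ((1 + ‖w.2‖) ^ (n + 1))⁻¹) (coordVolume n) := by
    refine Integrable.mul_prod (f := L.indicator (fun _ ↦ |C|)) ?_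
      integrable_one_add_norm_covector
    exact (integrable_indicator_iff hL.measurableSet).2
      (integrableOn_const hL.measure_lt_top.ne)
  refine Integrable.mono' (hdom.mono_measure Measure.restrict_le_self)
    (hG.aestronglyMeasurable hm) ((ae_restrict_iff' hm).2 (Filter.Eventually.of_forall ?_))
  rintro ⟨y, η⟩ ⟨hy, -⟩
  have hpos : 0 < (1 + ‖η‖) ^ (n + 1) := by positivity
  by_cases hyL : y ∈ L
  · rw [indicator_of_mem hyL, ← div_eq_mul_inv, le_div_iff₀ hpos, mul_comm]
    exact (hC y hy hyL η).trans (le_abs_self _)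
  · rw [indicator_of_notMem hyL, zero_mul, h0 y hy hyL, norm_zero]

/-- A continuous function on `T*M` with base support in a compact set and sufficient decay along
the fibres is integrable. -/
theorem integrable_of_fibre_decay {h : CotBundle n M → ℝ} (hc : Continuous h)
    {K : Set M} (hK : IsCompact K) (hs : ∀ z, z.proj ∉ K → h z = 0)
    (hb : ∀ (x : M) (L : Set (ModelE n)), IsCompact L → L ⊆ (chartAt (ModelE n) x).target →
      ∃ C, ∀ y ∈ L, ∀ η, (1 + ‖η‖) ^ (n + 1) * |h ((cotChart x).symm (y, η))| ≤ C) :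
    Integrable h (liouville n M) := by
  have e : h = fun z ↦ ∑ x ∈ activeCharts n hK, chartPartition n M x z.proj * h z :=
    funext (eq_sum_chartPartition_mul hK hs)
  rw [e]
  refine integrable_finsetSum _ fun x _ ↦ ?_
  have hcx : Continuous fun z ↦ chartPartition n M x z.proj * h z :=
    (continuous_chartPartition_proj (n := n) x).mul hc
  rw [integrable_iff_chart x (fun z hz ↦ by rw [chartPartition_eq_zero hz, zero_mul])
    hcx.aestronglyMeasurable]
  set L := chartAt (ModelE n) x '' (tsupport (chartPartition n M x) ∩ K) with hL
  have hLc : IsCompact L := by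
    refine (hK.inter_left (isClosed_tsupport _)).image_of_continuousOn ?_
    exact (chartAt (ModelE n) x).continuousOn.mono
      (inter_subset_left.trans (tsupport_chartPartition_subset x))
  have hLt : L ⊆ (chartAt (ModelE n) x).target := by
    rintro _ ⟨q, hq, rfl⟩
    exact (chartAt (ModelE n) x).map_source (tsupport_chartPartition_subset x hq.1)
  obtain ⟨C, hC⟩ := hb x L hLc hLt
  have hco := hcx.comp_continuousOn (continuousOn_cotChart_symm (n := n) x)
  rw [cotChart_target] at hco ⊢
  refine integrableOn_of_fibre_decay (chartAt (ModelE n) x).open_target hLc hco ?_ (C := C) ?_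
  · intro y hy hyL η
    by_cases hq : (chartAt (ModelE n) x).symm y ∈ K
    · rw [proj_cotChart_symm x hy, image_eq_zero_of_notMem_tsupport (f := chartPartition n M x),
        zero_mul]
      intro hq'
      exact hyL ⟨_, ⟨hq', hq⟩, (chartAt (ModelE n) x).right_inv hy⟩
    · rw [hs _ (by rw [proj_cotChart_symm x hy]; exact hq), mul_zero]
  · intro y hy hyL η
    refine le_trans ?_ (hC y hyL η)
    rw [abs_mul, abs_of_nonneg ((chartPartition n M).nonneg _ _)]
    gcongr
    exact mul_le_of_le_one_left (abs_nonneg _) ((chartPartition n M).le_one _ _)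

end CotangentIntegration

/-! ### Coordinate invariance of the canonical bracket -/

section CanonicalBracket

variable {n : ℕ} {M : Type*} [TopologicalSpace M] [ChartedSpace (ModelE n) M]
  [IsManifold 𝓘(ℝ, ModelE n) ∞ M]

/-- The canonical Poisson bracket of two differentials in canonical coordinates. -/
def flatBracket (a b : ModelE n × ModelD n →L[ℝ] ℝ) : ℝ :=
  ∑ i : Fin n, (a (EuclideanSpace.single i 1, 0) * b (0, EuclideanSpace.proj i) -
    b (EuclideanSpace.single i 1, 0) * a (0, EuclideanSpace.proj i))

/-- The vector that represents a linear functional of covectors. -/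
def fibreGrad (a : ModelE n × ModelD n →L[ℝ] ℝ) : ModelE n :=
  ∑ i : Fin n, a (0, EuclideanSpace.proj i) • EuclideanSpace.single i (1 : ℝ)

lemma sum_coord_smul_single (v : ModelE n) :
    ∑ i : Fin n, v i • EuclideanSpace.single i (1 : ℝ) = v := by
  have := (EuclideanSpace.basisFun (Fin n) ℝ).sum_repr v
  simpa using this

lemma covector_eq_sum (p : ModelD n) :
    p = ∑ i : Fin n, p (EuclideanSpace.single i 1) •
      (EuclideanSpace.proj i : ModelE n →L[ℝ] ℝ) := by
  ext v
  conv_lhs => rw [← sum_coord_smul_single v]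
  simp [mul_comm]

lemma apply_fibreGrad (a : ModelE n × ModelD n →L[ℝ] ℝ) (p : ModelD n) :
    a (0, p) = p (fibreGrad a) := by
  have h : a (0, p) = (a.comp (ContinuousLinearMap.inr ℝ (ModelE n) (ModelD n))) p := by simp
  rw [h]
  conv_lhs => rw [covector_eq_sum p]
  simp [fibreGrad, mul_comm]

lemma eq_fibreGrad {a : ModelE n × ModelD n →L[ℝ] ℝ} {e : ModelE n}
    (h : ∀ p : ModelD n, a (0, p) = p e) : e = fibreGrad a := by
  ext i
  have := (h (EuclideanSpace.proj i)).symm.trans (apply_fibreGrad a _)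
  exact this

/-- The fibre derivative of a function is a vector on the base, and the bracket is the base
derivative along it, antisymmetrized. Invariance and all later bracket computations use this
basis-free form. -/
lemma flatBracket_eq (a b : ModelE n × ModelD n →L[ℝ] ℝ) :
    flatBracket a b = a (fibreGrad b, 0) - b (fibreGrad a, 0) := by
  have h : ∀ a b : ModelE n × ModelD n →L[ℝ] ℝ, a (fibreGrad b, 0) =
      ∑ i, a (EuclideanSpace.single i 1, 0) * b (0, EuclideanSpace.proj i) := by
    intro a b
    have h : a (fibreGrad b, 0) =
      (a.comp (ContinuousLinearMap.inl ℝ (ModelE n) (ModelD n))) (fibreGrad b) := by simp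
    rw [h, fibreGrad]
    simp [mul_comm]
  rw [h, h, flatBracket, Finset.sum_sub_distrib]

lemma canonicalBracket_eq (φ ψ : CotBundle n M → ℝ) (z : CotBundle n M) :
    canonicalBracket φ ψ z =
      flatBracket (mfderiv (cotModel n) 𝓘(ℝ, ℝ) φ z) (mfderiv (cotModel n) 𝓘(ℝ, ℝ) ψ z) := rfl

lemma mfderiv_cotBundle {φ : CotBundle n M → ℝ} {z : CotBundle n M}
    (h : MDifferentiableAt (cotModel n) 𝓘(ℝ, ℝ) φ z) :
    (mfderiv (cotModel n) 𝓘(ℝ, ℝ) φ z : ModelE n × ModelD n →L[ℝ] ℝ) =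
      fderiv ℝ (fun w ↦ φ ((cotChart (n := n) z.proj).symm w)) (cotChart z.proj z) := by
  rw [h.mfderiv, writtenInExtChartAt, cotChart_eq_extChartAt]
  simp only [mfld_simps, Prod.map_id, fderivWithin_univ]
  rfl

/-- A function on `T*M` is smooth if and only if its expressions in all canonical charts are. -/
lemma contMDiff_cotBundle_iff {F : Type*} [NormedAddCommGroup F] [NormedSpace ℝ F]
    {φ : CotBundle n M → F} :
    ContMDiff (cotModel n) 𝓘(ℝ, F) ∞ φ ↔
      ∀ x : M, ContDiffOn ℝ ∞ (fun w ↦ φ ((cotChart (n := n) x).symm w))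
        (cotChart (n := n) x).target := by
  constructor
  · intro h x
    rw [← contMDiffOn_iff_contDiffOn]
    have h2 : ContMDiffOn 𝓘(ℝ, ModelE n × ModelD n) (cotModel n) ∞ (cotChart (n := n) x).symm
        (cotChart (n := n) x).target := contMDiffOn_extChartAt_symm _
    exact h.comp_contMDiffOn h2
  · intro h z
    have hz : z ∈ (cotChart (n := n) z.proj).source := by
      rw [cotChart_source]; exact mem_chart_source _ _
    have h1 := (contMDiffOn_iff_contDiffOn.2 (h z.proj))
    have h2 : ContMDiffOn (cotModel n) 𝓘(ℝ, ModelE n × ModelD n) ∞ (cotChart (n := n) z.proj)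
        (cotChart (n := n) z.proj).source := by
      have := contMDiffOn_extChartAt (I := cotModel n) (n := ∞) (x := (⟨z.proj, 0⟩ : CotBundle n M))
      rwa [← extChartAt_source (cotModel n)] at this
    have h3 := h1.comp h2 (fun w hw ↦ (cotChart (n := n) z.proj).map_source hw)
    have h4 : ContMDiffOn (cotModel n) 𝓘(ℝ, F) ∞ φ (cotChart (n := n) z.proj).source :=
      h3.congr fun w hw ↦ by simp [(cotChart (n := n) z.proj).left_inv hw]
    exact h4.contMDiffAt ((isOpen_cotChart_source z.proj).mem_nhds hz)

/-- T stands for the derivative of a cotangent lift (y, η) ↦ (τ(y), η ∘ S(y)), with A = τ' and S its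
inverse. The fibre gradients transform by S, and S is undone by A. The only extra term comes from
S', the derivative of S; its symmetry after composition with A makes it cancel in the
antisymmetrization. -/
lemma flatBracket_comp {A S : ModelE n →L[ℝ] ModelE n}
    {S' : ModelE n →L[ℝ] ModelE n →L[ℝ] ModelE n} {η : ModelD n} (hAS : A.comp S = .id ℝ _)
    (hsym : ∀ v w, S' v (A w) = S' w (A v)) {T : ModelE n × ModelD n →L[ℝ] ModelE n × ModelD n}
    (hT : ∀ v p, T (v, p) = (A v, p.comp S + η.comp (S' v)))
    (a b : ModelE n × ModelD n →L[ℝ] ℝ) :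
    flatBracket (a.comp T) (b.comp T) = flatBracket a b := by
  have hg : ∀ a : ModelE n × ModelD n →L[ℝ] ℝ, fibreGrad (a.comp T) = S (fibreGrad a) := by
    intro a
    refine (eq_fibreGrad fun p ↦ ?_).symm
    rw [ContinuousLinearMap.comp_apply, hT, map_zero, map_zero, ContinuousLinearMap.comp_zero,
      add_zero, apply_fibreGrad]
    rfl
  have hAS' : ∀ v, A (S v) = v := fun v ↦ DFunLike.congr_fun hAS v
  have ht : ∀ a b : ModelE n × ModelD n →L[ℝ] ℝ, a.comp T (S (fibreGrad b), 0) =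
      a (fibreGrad b, 0) + η (S' (S (fibreGrad b)) (fibreGrad a)) := by
    intro a b
    have h1 : η (S' (S (fibreGrad b)) (fibreGrad a)) = a (0, η.comp (S' (S (fibreGrad b)))) := by
      rw [apply_fibreGrad]; rfl
    rw [ContinuousLinearMap.comp_apply, hT, hAS', ContinuousLinearMap.zero_comp, zero_add, h1,
      ← map_add]
    simp
  rw [flatBracket_eq, flatBracket_eq, hg, hg, ht, ht]
  have := hsym (S (fibreGrad b)) (S (fibreGrad a))
  rw [hAS', hAS'] at this
  rw [this]; ring

/-- The canonical bracket can be computed in every canonical chart. -/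
theorem canonicalBracket_cotChart_symm {φ ψ : CotBundle n M → ℝ}
    (hφ : ContMDiff (cotModel n) 𝓘(ℝ, ℝ) ∞ φ) (hψ : ContMDiff (cotModel n) 𝓘(ℝ, ℝ) ∞ ψ)
    (x : M) {w : ModelE n × ModelD n} (hw : w ∈ (cotChart (n := n) x).target) :
    canonicalBracket φ ψ ((cotChart x).symm w) =
      flatBracket (fderiv ℝ (fun w ↦ φ ((cotChart (n := n) x).symm w)) w)
        (fderiv ℝ (fun w ↦ ψ ((cotChart (n := n) x).symm w)) w) := by
  obtain ⟨y, η⟩ := w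
  have hy : y ∈ (chartAt (ModelE n) x).target := by rw [cotChart_target] at hw; exact hw.1
  set q := (chartAt (ModelE n) x).symm y with hq
  have hqx : q ∈ (chartAt (ModelE n) x).source := (chartAt (ModelE n) x).map_target hy
  have hqq := mem_chart_source (ModelE n) q
  have hxq : chartAt (ModelE n) x q = y := (chartAt (ModelE n) x).right_inv hy
  set z := (cotChart (n := n) x).symm (y, η) with hz
  have hzq : z.proj = q := proj_cotChart_symm x hy η
  -- the overlap of the two charts on the base
  set O := (chartAt (ModelE n) x).target ∩
    (chartAt (ModelE n) x).symm ⁻¹' (chartAt (ModelE n) q).source with hO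
  have hOo : IsOpen O := isOpen_overlap x q
  have hyO : y ∈ O := ⟨hy, hqq⟩
  have hτ : ∀ y' ∈ O, HasFDerivAt (baseTrans (n := n) x q)
      (tcc x q ((chartAt (ModelE n) x).symm y')) y' := by
    intro y' hy'
    have := hasFDerivAt_baseTrans (n := n) ((chartAt (ModelE n) x).map_target hy'.1) hy'.2
    rwa [(chartAt (ModelE n) x).right_inv hy'.1] at this
  have hτs : ContDiffOn ℝ ∞ (baseTrans (n := n) x q) O := contDiffOn_baseTrans x q
  -- derivative of the inverse Jacobian
  set S : ModelE n → ModelE n →L[ℝ] ModelE n :=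
    fun y' ↦ tcc q x ((chartAt (ModelE n) x).symm y') with hS
  -- S is the Jacobian of the inverse transition, evaluated along the transition.
  have hSd : DifferentiableAt ℝ S y := by
    have h1 : ContDiffOn ℝ ∞ (fderiv ℝ (baseTrans (n := n) q x)) ((chartAt (ModelE n) q).target ∩
      (chartAt (ModelE n) q).symm ⁻¹' (chartAt (ModelE n) x).source) :=
      (contDiffOn_baseTrans q x).fderiv_of_isOpen (isOpen_overlap q x) (by simp)
    have hm : baseTrans (n := n) x q y ∈ ((chartAt (ModelE n) q).target ∩
      (chartAt (ModelE n) q).symm ⁻¹' (chartAt (ModelE n) x).source) := by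
      rw [← baseTrans_mapsTo]; exact mem_image_of_mem _ hyO
    have h2 : DifferentiableAt ℝ (fun y' ↦ fderiv ℝ (baseTrans (n := n) q x) (baseTrans x q y')) y :=
      (((h1.contDiffAt ((isOpen_overlap q x).mem_nhds hm)).differentiableAt (by simp)).comp y
        (hτ y hyO).differentiableAt)
    refine h2.congr_of_eventuallyEq ?_
    filter_upwards [hOo.mem_nhds hyO] with y' hy'
    have := hasFDerivAt_baseTrans (n := n) hy'.2 ((chartAt (ModelE n) x).map_target hy'.1)
    exact this.fderiv.symm
  obtain ⟨S', hS'⟩ : ∃ S', HasFDerivAt S S' y := ⟨_, hSd.hasFDerivAt⟩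
  obtain ⟨D2, hD2⟩ : ∃ D2, HasFDerivAt (fderiv ℝ (baseTrans (n := n) x q)) D2 y :=
    ⟨_, ((hτs.fderiv_of_isOpen (m := ∞) hOo (by simp)).contDiffAt
      (hOo.mem_nhds hyO)).differentiableAt (by simp) |>.hasFDerivAt⟩
  have hsymm2 : ∀ v w, D2 v w = D2 w v := by
    intro v w
    have := (hτs.contDiffAt (hOo.mem_nhds hyO)).isSymmSndFDerivAt
      (by rw [minSmoothness_of_isRCLikeNormedField]; exact WithTop.coe_le_coe.2 (le_top : (2 : ℕ∞) ≤ ⊤))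
    have := this v w
    rwa [hD2.fderiv] at this
  have hAq : fderiv ℝ (baseTrans (n := n) x q) y = tcc x q q := (hτ y hyO).fderiv
  -- Differentiating S ∘ τ' = id expresses S' by the second derivative of the transition; the
  -- symmetry needed in `flatBracket_comp` is that of second derivatives.
  have hrel : ∀ v w, S' v (tcc x q q w) = - (tcc q x q) (D2 v w) := by
    intro v w
    have h1 : HasFDerivAt (fun y' ↦ (S y').comp (fderiv ℝ (baseTrans (n := n) x q) y'))
      _ y := hS'.clm_comp hD2
    have h2 : HasFDerivAt (fun y' ↦ (S y').comp (fderiv ℝ (baseTrans (n := n) x q) y'))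
      (0 : ModelE n →L[ℝ] ModelE n →L[ℝ] ModelE n) y := by
      refine (hasFDerivAt_const (ContinuousLinearMap.id ℝ (ModelE n)) y).congr_of_eventuallyEq ?_
      filter_upwards [hOo.mem_nhds hyO] with y' hy'
      rw [(hτ y' hy').fderiv]
      exact tcc_comp_symm ((chartAt (ModelE n) x).map_target hy'.1) hy'.2
    have h3 := DFunLike.congr_fun (DFunLike.congr_fun (h1.unique h2) v) w
    simp only [add_apply, ContinuousLinearMap.comp_apply,
      zero_apply, ContinuousLinearMap.compL_apply,
      ContinuousLinearMap.flip_apply, hAq] at h3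
    rw [eq_neg_iff_add_eq_zero, add_comm]
    exact h3
  -- the transition map and its derivative
  have hTd : HasFDerivAt (fun w : ModelE n × ModelD n ↦ (baseTrans (n := n) x q w.1, w.2.comp (S w.1)))
      (((tcc x q q).comp (.fst ℝ _ _)).prod
        (((ContinuousLinearMap.compL ℝ (ModelE n) (ModelE n) ℝ η).comp (S'.comp (.fst ℝ _ _))) +
          ((ContinuousLinearMap.compL ℝ (ModelE n) (ModelE n) ℝ).flip (S y)).comp (.snd ℝ _ _)))
      (y, η) := by
    have hf : HasFDerivAt (Prod.fst : ModelE n × ModelD n → ModelE n) (.fst ℝ _ _) (y, η) :=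
      hasFDerivAt_fst
    have hs : HasFDerivAt (Prod.snd : ModelE n × ModelD n → ModelD n) (.snd ℝ _ _) (y, η) :=
      hasFDerivAt_snd
    have hS1 : HasFDerivAt (fun w : ModelE n × ModelD n ↦ S w.1)
        (S'.comp (.fst ℝ (ModelE n) (ModelD n))) (y, η) :=
      HasFDerivAt.comp (g := S) (f := Prod.fst) (y, η) hS' hf
    refine HasFDerivAt.prodMk ?_ ?_
    · exact HasFDerivAt.comp (y, η) (hτ y hyO) hf
    · exact hs.clm_comp hS1
  set T := (((tcc (n := n) x q q).comp (.fst ℝ _ _)).prod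
        (((ContinuousLinearMap.compL ℝ (ModelE n) (ModelE n) ℝ η).comp (S'.comp (.fst ℝ _ _))) +
          ((ContinuousLinearMap.compL ℝ (ModelE n) (ModelE n) ℝ).flip (S y)).comp
            (.snd ℝ (ModelE n) (ModelD n)))) with hT
  have key : ∀ {φ : CotBundle n M → ℝ}, ContMDiff (cotModel n) 𝓘(ℝ, ℝ) ∞ φ →
      fderiv ℝ (fun w ↦ φ ((cotChart (n := n) x).symm w)) (y, η) =
        (mfderiv (cotModel n) 𝓘(ℝ, ℝ) φ z : ModelE n × ModelD n →L[ℝ] ℝ).comp T := by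
    intro φ hφ
    rw [mfderiv_cotBundle (hφ.mdifferentiableAt (by simp)), hzq]
    have hzs : z ∈ (cotChart (n := n) q).source := by
      rw [cotChart_source, mem_preimage, hzq]; exact hqq
    have h1 : DifferentiableAt ℝ (fun w ↦ φ ((cotChart (n := n) q).symm w)) (cotChart q z) :=
      ((contMDiff_cotBundle_iff.1 hφ q).contDiffAt ((isOpen_cotChart_target q).mem_nhds
        ((cotChart (n := n) q).map_source hzs))).differentiableAt (by simp)
    have hzT : cotChart q z = (baseTrans (n := n) x q y, η.comp (S y)) :=
      cotChart_cotChart_symm hy hqq η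
    have h2 := h1.hasFDerivAt
    rw [hzT] at h2
    have h3 := h2.comp (y, η) hTd
    rw [hzT]
    refine HasFDerivAt.fderiv (h3.congr_of_eventuallyEq ?_)
    filter_upwards [(hOo.preimage continuous_fst).mem_nhds (x := (y, η)) hyO] with w' hw'
    have e1 := cotChart_cotChart_symm (n := n) hw'.1 hw'.2 w'.2
    have h3 : (cotChart (n := n) x).symm w' ∈ (cotChart (n := n) q).source := by
      rw [cotChart_source, mem_preimage, proj_cotChart_symm x hw'.1]; exact hw'.2
    simp only [Function.comp]
    rw [← e1, (cotChart (n := n) q).left_inv h3]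
  rw [key hφ, key hψ, canonicalBracket_eq]
  refine (flatBracket_comp (A := tcc x q q) (S := S y) (S' := S') (η := η) ?_ ?_ ?_ _ _).symm
  · exact tcc_comp_symm hqq hqx
  · intro v w
    rw [hrel, hrel, hsymm2]
  · intro v p
    simp [hT, add_comm]

end CanonicalBracket

/-! ### Vector fields, momentum functions and bounds in charts -/

section HamiltonianVectorFields

variable {n : ℕ} {M : Type*} [TopologicalSpace M] [ChartedSpace (ModelE n) M]
  [IsManifold 𝓘(ℝ, ModelE n) ∞ M]

/-- The coordinates of a vector field in the chart at `x`. -/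
def vecRep (x : M) (u : (q : M) → TangentSpace 𝓘(ℝ, ModelE n) q) (y : ModelE n) : ModelE n :=
  tcc ((chartAt (ModelE n) x).symm y) x ((chartAt (ModelE n) x).symm y)
    (u ((chartAt (ModelE n) x).symm y))

lemma toPreferred_vecRep (x : M) (u : (q : M) → TangentSpace 𝓘(ℝ, ModelE n) q) {y : ModelE n}
    (hy : y ∈ (chartAt (ModelE n) x).target) :
    toPreferred x y (vecRep x u y) = u ((chartAt (ModelE n) x).symm y) :=
  DFunLike.congr_fun (tcc_comp_symm (n := n) (mem_chart_source _ _)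
    ((chartAt (ModelE n) x).map_target hy)) (u ((chartAt (ModelE n) x).symm y))

lemma vecRep_preferred (q : M) (u : (q : M) → TangentSpace 𝓘(ℝ, ModelE n) q) :
    vecRep q u (chartAt (ModelE n) q q) = u q := by
  rw [vecRep, (chartAt (ModelE n) q).left_inv (mem_chart_source _ q),
    tcc_self (mem_chart_source _ q)]
  rfl

lemma contMDiffOn_modelChart_symm (x : M) : ContMDiffOn 𝓘(ℝ, ModelE n) 𝓘(ℝ, ModelE n) ∞
    (chartAt (ModelE n) x).symm (chartAt (ModelE n) x).target := by
  have := contMDiffOn_extChartAt_symm (I := 𝓘(ℝ, ModelE n)) (n := ∞) x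
  simpa only [mfld_simps] using this

lemma SmoothVectorField.contDiffOn_vecRep {u : (q : M) → TangentSpace 𝓘(ℝ, ModelE n) q}
    (hu : SmoothVectorField u) (x : M) :
    ContDiffOn ℝ ∞ (vecRep x u) (chartAt (ModelE n) x).target := by
  rw [← contMDiffOn_iff_contDiffOn]
  have h1 := (Bundle.Trivialization.contMDiffOn_section_baseSet_iff (IB := 𝓘(ℝ, ModelE n)) (n := ∞)
    (s := u) (trivializationAt (ModelE n) (TangentSpace 𝓘(ℝ, ModelE n)) x)).1 hu.contMDiffOn
  exact h1.comp (contMDiffOn_modelChart_symm x) fun y hy ↦ (chartAt (ModelE n) x).map_target hy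

/-- The momentum function `⟨u, p⟩` of a vector field. -/
def momentumFn (u : (q : M) → TangentSpace 𝓘(ℝ, ModelE n) q) (z : CotBundle n M) : ℝ :=
  cov z (u z.proj)

lemma momentumFn_cotChart_symm (x : M) (u : (q : M) → TangentSpace 𝓘(ℝ, ModelE n) q)
    {w : ModelE n × ModelD n} (hw : w ∈ (cotChart (n := n) x).target) :
    momentumFn u ((cotChart x).symm w) = w.2 (vecRep x u w.1) := by
  obtain ⟨y, η⟩ := w
  rw [cotChart_symm_apply x (mem_cotChart_target.1 hw)]
  rfl

lemma contDiffOn_momentum {u : ModelE n → ModelE n} {U : Set (ModelE n)} (hu : ContDiffOn ℝ ∞ u U) :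
    ContDiffOn ℝ ∞ (fun w : ModelE n × ModelD n ↦ w.2 (u w.1)) (U ×ˢ univ) :=
  contDiffOn_snd.clm_apply (hu.comp contDiffOn_fst fun _ hw ↦ hw.1)

lemma SmoothVectorField.contMDiff_momentumFn {u : (q : M) → TangentSpace 𝓘(ℝ, ModelE n) q}
    (hu : SmoothVectorField u) : ContMDiff (cotModel n) 𝓘(ℝ, ℝ) ∞ (momentumFn u) := by
  rw [contMDiff_cotBundle_iff]
  intro x
  have := contDiffOn_momentum (hu.contDiffOn_vecRep x)
  rw [← cotChart_target] at this
  exact this.congr fun w hw ↦ momentumFn_cotChart_symm x u hw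

lemma contDiffOn_base_comp {F : Type*} [NormedAddCommGroup F] [NormedSpace ℝ F] {g : M → F}
    (hg : ContMDiff 𝓘(ℝ, ModelE n) 𝓘(ℝ, F) ∞ g) (x : M) :
    ContDiffOn ℝ ∞ (fun y ↦ g ((chartAt (ModelE n) x).symm y)) (chartAt (ModelE n) x).target := by
  rw [← contMDiffOn_iff_contDiffOn]
  exact hg.comp_contMDiffOn (contMDiffOn_modelChart_symm x)

lemma lieDerivFun_eq {u : (q : M) → TangentSpace 𝓘(ℝ, ModelE n) q} {g : M → ℝ}
    (hg : ContMDiff 𝓘(ℝ, ModelE n) 𝓘(ℝ, ℝ) ∞ g) (x : M) {y : ModelE n}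
    (hy : y ∈ (chartAt (ModelE n) x).target) :
    lieDerivFun u g ((chartAt (ModelE n) x).symm y) =
      fderiv ℝ (fun y ↦ g ((chartAt (ModelE n) x).symm y)) y (vecRep x u y) := by
  set q := (chartAt (ModelE n) x).symm y with hq
  have hqx : q ∈ (chartAt (ModelE n) x).source := (chartAt (ModelE n) x).map_target hy
  have hqq := mem_chart_source (ModelE n) q
  have h1 : (mfderiv 𝓘(ℝ, ModelE n) 𝓘(ℝ, ℝ) g q : ModelE n →L[ℝ] ℝ) =
      fderiv ℝ (fun y ↦ g ((chartAt (ModelE n) q).symm y)) (chartAt (ModelE n) q q) := by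
    rw [(hg.mdifferentiableAt (by simp)).mfderiv, writtenInExtChartAt]
    simp only [mfld_simps, fderivWithin_univ]
    rfl
  have h2 : HasFDerivAt (fun y ↦ g ((chartAt (ModelE n) q).symm y))
      (mfderiv 𝓘(ℝ, ModelE n) 𝓘(ℝ, ℝ) g q : ModelE n →L[ℝ] ℝ) (baseTrans x q y) := by
    rw [h1]
    exact (((contDiffOn_base_comp hg q).contDiffAt ((chartAt (ModelE n) q).open_target.mem_nhds
      (mem_chart_target _ q))).differentiableAt (by simp)).hasFDerivAt
  have hτ : HasFDerivAt (baseTrans (n := n) x q) (tcc x q q) y := by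
    have := hasFDerivAt_baseTrans (n := n) hqx hqq
    rwa [(chartAt (ModelE n) x).right_inv hy] at this
  have h3 := h2.comp y hτ
  have h4 : fderiv ℝ (fun y ↦ g ((chartAt (ModelE n) x).symm y)) y =
      (mfderiv 𝓘(ℝ, ModelE n) 𝓘(ℝ, ℝ) g q : ModelE n →L[ℝ] ℝ).comp (tcc x q q) := by
    refine (h3.congr_of_eventuallyEq ?_).fderiv
    filter_upwards [(isOpen_overlap x q).mem_nhds ⟨hy, hqq⟩] with y' hy'
    simp only [Function.comp, baseTrans]
    rw [(chartAt (ModelE n) q).left_inv hy'.2]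
  rw [h4]
  exact congrArg (mfderiv 𝓘(ℝ, ModelE n) 𝓘(ℝ, ℝ) g q : ModelE n →L[ℝ] ℝ)
    (DFunLike.congr_fun (tcc_comp_symm (n := n) hqq hqx) (u q)).symm

lemma continuous_of_comp_cotChart_symm {h : CotBundle n M → ℝ}
    (hc : ∀ x : M, ContinuousOn (fun w ↦ h ((cotChart (n := n) x).symm w))
      (cotChart (n := n) x).target) : Continuous h := by
  rw [continuous_iff_continuousAt]
  intro z
  have hz : z ∈ (cotChart (n := n) z.proj).source :=
    mem_cotChart_source.2 (mem_chart_source _ _)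
  have h3 := (hc z.proj).comp (continuousOn_cotChart z.proj)
    (fun w hw ↦ (cotChart (n := n) z.proj).map_source hw)
  have h4 : ContinuousOn h (cotChart (n := n) z.proj).source :=
    h3.congr fun w hw ↦ by simp [(cotChart (n := n) z.proj).left_inv hw]
  exact h4.continuousAt ((isOpen_cotChart_source z.proj).mem_nhds hz)

lemma continuousOn_flatBracket {a b : ModelE n × ModelD n → ModelE n × ModelD n →L[ℝ] ℝ}
    {s : Set (ModelE n × ModelD n)} (ha : ContinuousOn a s) (hb : ContinuousOn b s) :
    ContinuousOn (fun w ↦ flatBracket (a w) (b w)) s := by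
  unfold flatBracket
  fun_prop

lemma ContDiffOn.continuousOn_fderiv_top {E F : Type*} [NormedAddCommGroup E] [NormedSpace ℝ E]
    [NormedAddCommGroup F] [NormedSpace ℝ F] {φ : E → F} {s : Set E} (h : ContDiffOn ℝ ∞ φ s)
    (hs : IsOpen s) : ContinuousOn (fderiv ℝ φ) s :=
  h.continuousOn_fderiv_of_isOpen hs (by simp)

lemma continuous_canonicalBracket {φ ψ : CotBundle n M → ℝ}
    (hφ : ContMDiff (cotModel n) 𝓘(ℝ, ℝ) ∞ φ) (hψ : ContMDiff (cotModel n) 𝓘(ℝ, ℝ) ∞ ψ) :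
    Continuous (canonicalBracket φ ψ) := by
  refine continuous_of_comp_cotChart_symm fun x ↦ ?_
  have ho := isOpen_cotChart_target (n := n) x
  refine (continuousOn_flatBracket
    ((contMDiff_cotBundle_iff.1 hφ x).continuousOn_fderiv_top ho)
    ((contMDiff_cotBundle_iff.1 hψ x).continuousOn_fderiv_top ho)).congr fun w hw ↦ ?_
  exact canonicalBracket_cotChart_symm hφ hψ x hw

lemma norm_flatBracket_le (a b : ModelE n × ModelD n →L[ℝ] ℝ) :
    |flatBracket a b| ≤ ∑ i : Fin n, 2 * (‖EuclideanSpace.single (𝕜 := ℝ) i (1 : ℝ)‖ *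
      ‖(EuclideanSpace.proj i : ModelD n)‖) * (‖a‖ * ‖b‖) := by
  unfold flatBracket
  refine (Finset.abs_sum_le_sum_abs _ _).trans (Finset.sum_le_sum fun i _ ↦ ?_)
  have h1 : ∀ c : ModelE n × ModelD n →L[ℝ] ℝ, |c (EuclideanSpace.single i 1, 0)| ≤
      ‖c‖ * ‖EuclideanSpace.single (𝕜 := ℝ) i (1 : ℝ)‖ := by
    intro c
    have := c.le_opNorm (EuclideanSpace.single i 1, 0)
    simpa [Prod.norm_def] using this
  have h2 : ∀ c : ModelE n × ModelD n →L[ℝ] ℝ, |c (0, EuclideanSpace.proj i)| ≤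
      ‖c‖ * ‖(EuclideanSpace.proj i : ModelD n)‖ := by
    intro c
    have := c.le_opNorm (0, EuclideanSpace.proj i)
    simpa [Prod.norm_def] using this
  refine (abs_sub _ _).trans ?_
  rw [abs_mul, abs_mul]
  have e1 := mul_le_mul (h1 a) (h2 b) (abs_nonneg _) (by positivity)
  have e2 := mul_le_mul (h1 b) (h2 a) (abs_nonneg _) (by positivity)
  nlinarith [e1, e2]

lemma exists_norm_flatBracket_le (n : ℕ) : ∃ C : ℝ, 0 ≤ C ∧
    ∀ a b : ModelE n × ModelD n →L[ℝ] ℝ, |flatBracket a b| ≤ C * (‖a‖ * ‖b‖) := by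
  refine ⟨∑ i : Fin n, 2 * (‖EuclideanSpace.single (𝕜 := ℝ) i (1 : ℝ)‖ *
      ‖(EuclideanSpace.proj i : ModelD n)‖), by positivity, fun a b ↦ ?_⟩
  rw [Finset.sum_mul]
  exact norm_flatBracket_le a b

end HamiltonianVectorFields

/-! ### The flow of a momentum function preserves volume: coordinate version -/

section MomentumFlow

variable {n : ℕ}

lemma hasFDerivAt_momentum {u : ModelE n → ModelE n} {y : ModelE n} (hu : DifferentiableAt ℝ u y)
    (η : ModelD n) :
    HasFDerivAt (fun w : ModelE n × ModelD n ↦ w.2 (u w.1))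
      ((η.comp ((fderiv ℝ u y).comp (.fst ℝ _ _))) +
        ((ContinuousLinearMap.apply ℝ ℝ (u y)).comp (.snd ℝ _ _))) (y, η) := by
  have hf : HasFDerivAt (Prod.fst : ModelE n × ModelD n → ModelE n) (.fst ℝ _ _) (y, η) :=
    hasFDerivAt_fst
  have hs : HasFDerivAt (Prod.snd : ModelE n × ModelD n → ModelD n) (.snd ℝ _ _) (y, η) :=
    hasFDerivAt_snd
  have h1 := HasFDerivAt.comp (g := u) (f := Prod.fst) (y, η) hu.hasFDerivAt hf
  refine (hs.clm_apply h1).congr_fderiv ?_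
  ext <;> simp

lemma fibreGrad_momentum {u : ModelE n → ModelE n} {y : ModelE n} (hu : DifferentiableAt ℝ u y)
    (η : ModelD n) : fibreGrad (fderiv ℝ (fun w : ModelE n × ModelD n ↦ w.2 (u w.1)) (y, η)) = u y := by
  refine (eq_fibreGrad fun p ↦ ?_).symm
  rw [(hasFDerivAt_momentum hu η).fderiv]
  simp

/-- The fibre gradient of ⟨u, p⟩ is u, and its base derivative is ⟨Du, p⟩: up to sign, this is
differentiation along the cotangent lift of u. -/
lemma flatBracket_momentum {u : ModelE n → ModelE n} {y : ModelE n} (hu : DifferentiableAt ℝ u y)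
    (η : ModelD n) (b : ModelE n × ModelD n →L[ℝ] ℝ) :
    flatBracket (fderiv ℝ (fun w : ModelE n × ModelD n ↦ w.2 (u w.1)) (y, η)) b =
      η (fderiv ℝ u y (fibreGrad b)) - b (u y, 0) := by
  rw [flatBracket_eq, fibreGrad_momentum hu, (hasFDerivAt_momentum hu η).fderiv]
  simp

/-- The coordinate expression of `{⟨u, p⟩, H}` integrates to zero. -/
lemma setIntegral_flatBracket_momentum {U L : Set (ModelE n)} (hU : IsOpen U) (hL : IsCompact L)
    (hLU : L ⊆ U) {u : ModelE n → ModelE n} (hu : ContDiffOn ℝ ∞ u U)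
    {H : ModelE n × ModelD n → ℝ} (hH : ContDiffOn ℝ ∞ H (U ×ˢ univ))
    (h0 : ∀ y ∈ U, y ∉ L → ∀ η, H (y, η) = 0)
    {C : ℝ} (hC : ∀ y ∈ L, ∀ η, (1 + ‖η‖) ^ (n + 2) * (|H (y, η)| + ‖fderiv ℝ H (y, η)‖) ≤ C) :
    ∫ w in U ×ˢ (univ : Set (ModelD n)),
      flatBracket (fderiv ℝ (fun w : ModelE n × ModelD n ↦ w.2 (u w.1)) w) (fderiv ℝ H w)
        ∂(coordVolume n) = 0 := by
  set V : Set (ModelE n × ModelD n) := U ×ˢ univ with hV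
  have hVo : IsOpen V := hU.prod isOpen_univ
  have hLo : IsOpen {w : ModelE n × ModelD n | w.1 ∉ L} :=
    hL.isClosed.isOpen_compl.preimage continuous_fst
  set g := V.indicator H with hg
  have hudiff : ∀ y ∈ U, DifferentiableAt ℝ u y := fun y hy ↦
    (hu.contDiffAt (hU.mem_nhds hy)).differentiableAt (by simp)
  have hDu : ContinuousOn (fderiv ℝ u) U := hu.continuousOn_fderiv_top hU
  have hDH : ContinuousOn (fderiv ℝ H) V := hH.continuousOn_fderiv_top hVo
  have hDH0 : ∀ w ∈ V, w.1 ∉ L → fderiv ℝ H w = 0 := by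
    intro w hw hwL
    have : H =ᶠ[𝓝 w] fun _ ↦ (0 : ℝ) := by
      filter_upwards [hVo.mem_nhds hw, hLo.mem_nhds hwL] with w' h1 h2
      exact h0 w'.1 h1.1 h2 w'.2
    rw [this.fderiv_eq, fderiv_fun_const]; rfl
  -- Extension by zero creates no singularity: a point outside V has its base coordinate outside the
  -- compact set L, and near such a point g vanishes.
  have hgd : ∀ w v, HasLineDerivAt ℝ g (V.indicator (fun w ↦ fderiv ℝ H w v) w) w v := by
    intro w v
    by_cases hw : w ∈ V
    · rw [indicator_of_mem hw]
      have h1 := ((hH.contDiffAt (hVo.mem_nhds hw)).differentiableAt (by simp)).hasFDerivAt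
      refine HasFDerivAt.hasLineDerivAt (h1.congr_of_eventuallyEq ?_) v
      filter_upwards [hVo.mem_nhds hw] with w' hw'
      rw [hg, indicator_of_mem hw']
    · rw [indicator_of_notMem hw]
      have hwL : w.1 ∉ L := fun h ↦ hw ⟨hLU h, mem_univ _⟩
      have h1 : HasFDerivAt g (0 : ModelE n × ModelD n →L[ℝ] ℝ) w := by
        refine (hasFDerivAt_const (0 : ℝ) w).congr_of_eventuallyEq ?_
        filter_upwards [hLo.mem_nhds hwL] with w' hw'
        by_cases h : w' ∈ V
        · rw [hg, indicator_of_mem h]; exact h0 w'.1 h.1 hw' w'.2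
        · rw [hg, indicator_of_notMem h]
      simpa using h1.hasLineDerivAt v
  -- The coefficients made from u are differentiable over U only. Integration by parts asks for
  -- their derivative on the support of g alone.
  have hgts : tsupport g ⊆ L ×ˢ univ := by
    refine closure_minimal ?_ (hL.isClosed.prod isClosed_univ)
    intro w hw
    by_contra h
    apply hw
    by_cases h' : w ∈ V
    · rw [hg, indicator_of_mem h']
      exact h0 w.1 h'.1 (fun h'' ↦ h ⟨h'', mem_univ _⟩) w.2
    · rw [hg, indicator_of_notMem h']
  have hpw : ∀ (η : ModelD n) (k : ℕ), k ≤ n + 2 → (1 + ‖η‖) ^ k ≤ (1 + ‖η‖) ^ (n + 2) :=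
    fun η k hk ↦ pow_le_pow_right₀ (by linarith [norm_nonneg η]) hk
  -- integrability of products
  have hint1 : ∀ (c : ModelE n × ModelD n → ℝ), ContinuousOn c V →
      (∃ B, ∀ y ∈ L, ∀ η, |c (y, η)| ≤ B * (1 + ‖η‖)) →
      Integrable (V.indicator fun w ↦ c w * H w) (coordVolume n) := by
    rintro c hc ⟨B, hB⟩
    rw [integrable_indicator_iff hVo.measurableSet]
    refine integrableOn_of_fibre_decay hU hL (hc.mul hH.continuousOn) ?_ (C := |B| * C) ?_
    · intro y hy hyL η; rw [h0 y hy hyL, mul_zero]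
    · intro y hy hyL η
      rw [abs_mul]
      have h1 := hC y hyL η
      have h2 : |c (y, η)| ≤ |B| * (1 + ‖η‖) :=
        (hB y hyL η).trans (by gcongr; exact le_abs_self B)
      -- Of the n + 2 powers in the hypothesis, one absorbs the linear growth of the coefficient in
      -- η; the other n + 1 give integrability.
      calc (1 + ‖η‖) ^ (n + 1) * (|c (y, η)| * |H (y, η)|)
          ≤ (1 + ‖η‖) ^ (n + 1) * ((|B| * (1 + ‖η‖)) *
              (|H (y, η)| + ‖fderiv ℝ H (y, η)‖)) := by
            gcongr; linarith [norm_nonneg (fderiv ℝ H (y, η))]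
        _ = |B| * ((1 + ‖η‖) ^ (n + 2) * (|H (y, η)| + ‖fderiv ℝ H (y, η)‖)) := by ring
        _ ≤ |B| * C := by gcongr
  have hint2 : ∀ (c : ModelE n × ModelD n → ℝ) (v : ModelE n × ModelD n), ContinuousOn c V →
      (∃ B, ∀ y ∈ L, ∀ η, |c (y, η)| ≤ B * (1 + ‖η‖)) →
      Integrable (V.indicator fun w ↦ c w * fderiv ℝ H w v) (coordVolume n) := by
    rintro c v hc ⟨B, hB⟩
    rw [integrable_indicator_iff hVo.measurableSet]
    refine integrableOn_of_fibre_decay hU hL (hc.mul (hDH.clm_apply continuousOn_const)) ?_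
      (C := |B| * C * ‖v‖) ?_
    · intro y hy hyL η; rw [hDH0 (y, η) ⟨hy, mem_univ _⟩ hyL]; simp
    · intro y hy hyL η
      rw [abs_mul]
      have h1 := hC y hyL η
      have h2 : |c (y, η)| ≤ |B| * (1 + ‖η‖) :=
        (hB y hyL η).trans (by gcongr; exact le_abs_self B)
      have h3 : |fderiv ℝ H (y, η) v| ≤ ‖fderiv ℝ H (y, η)‖ * ‖v‖ :=
        (fderiv ℝ H (y, η)).le_opNorm v
      calc (1 + ‖η‖) ^ (n + 1) * (|c (y, η)| * |fderiv ℝ H (y, η) v|)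
          ≤ (1 + ‖η‖) ^ (n + 1) * ((|B| * (1 + ‖η‖)) *
              ((|H (y, η)| + ‖fderiv ℝ H (y, η)‖) * ‖v‖)) := by
            gcongr
            exact h3.trans (by gcongr; linarith [abs_nonneg (H (y, η))])
        _ = |B| * ((1 + ‖η‖) ^ (n + 2) * (|H (y, η)| + ‖fderiv ℝ H (y, η)‖)) * ‖v‖ := by ring
        _ ≤ |B| * C * ‖v‖ := by gcongr
  -- the coefficient functions
  have hcu : ∀ i, ContinuousOn (fun w : ModelE n × ModelD n ↦ u w.1 i) V := by
    intro i
    have := (EuclideanSpace.proj (𝕜 := ℝ) i).continuous.comp_continuousOn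
      (hu.continuousOn.comp continuousOn_fst (s := V) fun w hw ↦ hw.1)
    exact this
  have hcD : ∀ i, ContinuousOn
      (fun w : ModelE n × ModelD n ↦ fderiv ℝ u w.1 (EuclideanSpace.single i 1)) V := fun i ↦
    (hDu.comp continuousOn_fst (s := V) fun w hw ↦ hw.1).clm_apply continuousOn_const
  have hbu : ∀ i, ∃ B, ∀ y ∈ L, ∀ η : ModelD n, |u y i| ≤ B * (1 + ‖η‖) := by
    intro i
    obtain ⟨B, hB⟩ := hL.exists_bound_of_continuousOn (hu.continuousOn.mono hLU)
    refine ⟨|B|, fun y hy η ↦ ?_⟩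
    have h1 : |u y i| ≤ |B| := (PiLp.norm_apply_le (u y) i).trans ((hB y hy).trans (le_abs_self _))
    nlinarith [norm_nonneg η, abs_nonneg B]
  have hbD : ∀ i, ∃ B, ∀ y ∈ L, ∀ η : ModelD n,
      |fderiv ℝ u y (EuclideanSpace.single i 1) i| ≤ B * (1 + ‖η‖) := by
    intro i
    obtain ⟨B, hB⟩ := hL.exists_bound_of_continuousOn
      ((hDu.mono hLU).clm_apply (continuousOn_const (c := EuclideanSpace.single i (1 : ℝ))))
    refine ⟨|B|, fun y hy η ↦ ?_⟩
    have h1 := (PiLp.norm_apply_le (fderiv ℝ u y (EuclideanSpace.single i 1)) i).trans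
      ((hB y hy).trans (le_abs_self _))
    rw [Real.norm_eq_abs] at h1
    nlinarith [norm_nonneg η, abs_nonneg B]
  have hbη : ∀ i, ∃ B, ∀ y ∈ L, ∀ η : ModelD n,
      |η (fderiv ℝ u y (EuclideanSpace.single i 1))| ≤ B * (1 + ‖η‖) := by
    intro i
    obtain ⟨B, hB⟩ := hL.exists_bound_of_continuousOn
      ((hDu.mono hLU).clm_apply (continuousOn_const (c := EuclideanSpace.single i (1 : ℝ))))
    refine ⟨|B|, fun y hy η ↦ ?_⟩
    have h1 := (η.le_opNorm (fderiv ℝ u y (EuclideanSpace.single i 1))).trans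
      (mul_le_mul_of_nonneg_left ((hB y hy).trans (le_abs_self _)) (norm_nonneg η))
    rw [Real.norm_eq_abs] at h1
    nlinarith [norm_nonneg η, abs_nonneg B]
  have hcη : ∀ i, ContinuousOn (fun w : ModelE n × ModelD n ↦
      w.2 (fderiv ℝ u w.1 (EuclideanSpace.single i 1))) V := fun i ↦
    continuousOn_snd.clm_apply (hcD i)
  have hcDi : ∀ i, ContinuousOn (fun w : ModelE n × ModelD n ↦
      fderiv ℝ u w.1 (EuclideanSpace.single i 1) i) V := fun i ↦
    (EuclideanSpace.proj (𝕜 := ℝ) i).continuous.comp_continuousOn (hcD i)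
  -- integration by parts in the fibre and in the base
  have ibp1 : ∀ i, ∫ w, V.indicator (fun w ↦ w.2 (fderiv ℝ u w.1 (EuclideanSpace.single i 1)) *
        fderiv ℝ H w (0, EuclideanSpace.proj i)) w ∂(coordVolume n) =
      - ∫ w, V.indicator (fun w ↦ fderiv ℝ u w.1 (EuclideanSpace.single i 1) i * H w) w
        ∂(coordVolume n) := by
    intro i
    have e1 : (V.indicator fun w ↦ w.2 (fderiv ℝ u w.1 (EuclideanSpace.single i 1)) *
        fderiv ℝ H w (0, EuclideanSpace.proj i)) = fun w : ModelE n × ModelD n ↦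
        ContinuousLinearMap.mul ℝ ℝ (w.2 (fderiv ℝ u w.1 (EuclideanSpace.single i 1)))
          (V.indicator (fun w ↦ fderiv ℝ H w (0, EuclideanSpace.proj i)) w) := by
      ext w; by_cases hw : w ∈ V <;> simp [hw]
    have e2 : (V.indicator fun w ↦ fderiv ℝ u w.1 (EuclideanSpace.single i 1) i * H w) =
        fun w ↦ ContinuousLinearMap.mul ℝ ℝ (fderiv ℝ u w.1 (EuclideanSpace.single i 1) i)
          (g w) := by
      ext w; by_cases hw : w ∈ V <;> simp [hw, hg]
    have e3 : (V.indicator fun w ↦ w.2 (fderiv ℝ u w.1 (EuclideanSpace.single i 1)) * H w) =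
        fun w ↦ ContinuousLinearMap.mul ℝ ℝ (w.2 (fderiv ℝ u w.1 (EuclideanSpace.single i 1)))
          (g w) := by
      ext w; by_cases hw : w ∈ V <;> simp [hw, hg]
    have i1 := hint2 _ (0, EuclideanSpace.proj i) (hcη i) (hbη i)
    have i2 := hint1 _ (hcDi i) (hbD i)
    have i3 := hint1 _ (hcη i) (hbη i)
    rw [e1] at i1 ⊢
    rw [e2] at i2 ⊢
    rw [e3] at i3
    refine integral_bilinear_hasLineDerivAt_right_eq_neg_left_of_integrable
      (v := (0, EuclideanSpace.proj i)) i2 i1 i3 (fun w hw ↦ ?_) (fun w _ ↦ hgd w _)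
    have := (hasDerivAt_id (0 : ℝ)).mul_const (fderiv ℝ u w.1 (EuclideanSpace.single i 1) i)
    simp only [HasLineDerivAt]
    simpa using (this.const_add (w.2 (fderiv ℝ u w.1 (EuclideanSpace.single i 1))))
  have ibp2 : ∀ i, ∫ w, V.indicator (fun w ↦ u w.1 i *
        fderiv ℝ H w (EuclideanSpace.single i 1, 0)) w ∂(coordVolume n) =
      - ∫ w, V.indicator (fun w ↦ fderiv ℝ u w.1 (EuclideanSpace.single i 1) i * H w) w
        ∂(coordVolume n) := by
    intro i
    have e1 : (V.indicator fun w ↦ u w.1 i * fderiv ℝ H w (EuclideanSpace.single i 1, 0)) =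
        fun w : ModelE n × ModelD n ↦ ContinuousLinearMap.mul ℝ ℝ (u w.1 i)
          (V.indicator (fun w ↦ fderiv ℝ H w (EuclideanSpace.single i 1, 0)) w) := by
      ext w; by_cases hw : w ∈ V <;> simp [hw]
    have e2 : (V.indicator fun w ↦ fderiv ℝ u w.1 (EuclideanSpace.single i 1) i * H w) =
        fun w ↦ ContinuousLinearMap.mul ℝ ℝ (fderiv ℝ u w.1 (EuclideanSpace.single i 1) i)
          (g w) := by
      ext w; by_cases hw : w ∈ V <;> simp [hw, hg]
    have e3 : (V.indicator fun w ↦ u w.1 i * H w) =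
        fun w ↦ ContinuousLinearMap.mul ℝ ℝ (u w.1 i) (g w) := by
      ext w; by_cases hw : w ∈ V <;> simp [hw, hg]
    have i1 := hint2 _ (EuclideanSpace.single i 1, 0) (hcu i) (hbu i)
    have i2 := hint1 _ (hcDi i) (hbD i)
    have i3 := hint1 _ (hcu i) (hbu i)
    rw [e1] at i1 ⊢
    rw [e2] at i2 ⊢
    rw [e3] at i3
    refine integral_bilinear_hasLineDerivAt_right_eq_neg_left_of_integrable
      (v := (EuclideanSpace.single i 1, 0)) i2 i1 i3 (fun w hw ↦ ?_) (fun w _ ↦ hgd w _)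
    have hd := (hudiff w.1 (hLU (hgts hw).1)).hasFDerivAt
    have hf : HasFDerivAt (Prod.fst : ModelE n × ModelD n → ModelE n) (.fst ℝ _ _) w :=
      hasFDerivAt_fst
    have h1 := HasFDerivAt.comp (g := u) (f := Prod.fst) w hd hf
    have h2 := HasFDerivAt.comp (g := (EuclideanSpace.proj i : ModelD n)) w
      (EuclideanSpace.proj i : ModelD n).hasFDerivAt h1
    exact h2.hasLineDerivAt (EuclideanSpace.single i 1, 0)
  have hsum : ∀ w ∈ V, flatBracket (fderiv ℝ (fun w : ModelE n × ModelD n ↦ w.2 (u w.1)) w)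
      (fderiv ℝ H w) = ∑ i : Fin n,
        (w.2 (fderiv ℝ u w.1 (EuclideanSpace.single i 1)) * fderiv ℝ H w (0, EuclideanSpace.proj i)
          - u w.1 i * fderiv ℝ H w (EuclideanSpace.single i 1, 0)) := by
    rintro ⟨y, η⟩ hw
    rw [flatBracket, (hasFDerivAt_momentum (hudiff y hw.1) η).fderiv]
    refine Finset.sum_congr rfl fun i _ ↦ ?_
    simp [mul_comm]
  -- Integration by parts in p_i and in q^i both leave -∫ (∂_i u^i) H. The two terms enter with
  -- opposite signs and cancel: the cotangent lift of u has divergence zero.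
  rw [setIntegral_congr_fun hVo.measurableSet hsum, integral_finsetSum]
  · refine Finset.sum_eq_zero fun i _ ↦ ?_
    rw [integral_sub, ← integral_indicator hVo.measurableSet, ← integral_indicator hVo.measurableSet,
      ibp1, ibp2, sub_self]
    · exact (integrable_indicator_iff hVo.measurableSet).1 (hint2 _ _ (hcη i) (hbη i))
    · exact (integrable_indicator_iff hVo.measurableSet).1 (hint2 _ _ (hcu i) (hbu i))
  · intro i _
    refine Integrable.sub ?_ ?_
    · exact (integrable_indicator_iff hVo.measurableSet).1 (hint2 _ _ (hcη i) (hbη i))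
    · exact (integrable_indicator_iff hVo.measurableSet).1 (hint2 _ _ (hcu i) (hbu i))

end MomentumFlow

/-! ### Brackets with momentum functions integrate to zero on T*M -/

section MomentumFlowIntegral

variable {n : ℕ} {M : Type*} [TopologicalSpace M] [ChartedSpace (ModelE n) M]
  [IsManifold 𝓘(ℝ, ModelE n) ∞ M]

/-- The function and its first derivatives in canonical coordinates are rapidly decreasing along
the fibres, locally uniformly on the base. -/
def FibreDecayOne (H : CotBundle n M → ℝ) : Prop :=
  ∀ (x : M) (L : Set (ModelE n)), IsCompact L → L ⊆ (chartAt (ModelE n) x).target → ∀ N : ℕ,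
    ∃ C, ∀ y ∈ L, ∀ η, (1 + ‖η‖) ^ N * (|H ((cotChart x).symm (y, η))| +
      ‖fderiv ℝ (fun w ↦ H ((cotChart x).symm w)) (y, η)‖) ≤ C

lemma contMDiff_base_proj {g : M → ℝ} (hg : ContMDiff 𝓘(ℝ, ModelE n) 𝓘(ℝ, ℝ) ∞ g) :
    ContMDiff (cotModel n) 𝓘(ℝ, ℝ) ∞ fun z : CotBundle n M ↦ g z.proj := by
  rw [contMDiff_cotBundle_iff]
  intro x
  have h : ContDiffOn ℝ ∞ (fun w : ModelE n × ModelD n ↦ g ((chartAt (ModelE n) x).symm w.1))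
      (cotChart (n := n) x).target :=
    (contDiffOn_base_comp hg x).comp contDiffOn_fst fun w hw ↦ mem_cotChart_target.1 hw
  exact h.congr fun w hw ↦ by rw [proj_cotChart_symm' x hw]

lemma ContMDiff.differentiableAt_cotChart {φ : CotBundle n M → ℝ}
    (hφ : ContMDiff (cotModel n) 𝓘(ℝ, ℝ) ∞ φ) (x : M) {w : ModelE n × ModelD n}
    (hw : w ∈ (cotChart (n := n) x).target) :
    DifferentiableAt ℝ (fun w ↦ φ ((cotChart (n := n) x).symm w)) w :=
  ((contMDiff_cotBundle_iff.1 hφ x).contDiffAt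
    ((isOpen_cotChart_target x).mem_nhds hw)).differentiableAt (by simp)

lemma fderiv_base_comp {x : M} {g : M → ℝ} (hg : ContMDiff 𝓘(ℝ, ModelE n) 𝓘(ℝ, ℝ) ∞ g)
    {w : ModelE n × ModelD n} (hw : w ∈ (cotChart (n := n) x).target) :
    fderiv ℝ (fun w ↦ g ((cotChart (n := n) x).symm w).proj) w =
      (fderiv ℝ (fun y ↦ g ((chartAt (ModelE n) x).symm y)) w.1).comp (.fst ℝ _ _) := by
  have h1 : DifferentiableAt ℝ (fun y ↦ g ((chartAt (ModelE n) x).symm y)) w.1 :=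
    ((contDiffOn_base_comp hg x).contDiffAt ((chartAt (ModelE n) x).open_target.mem_nhds
      (mem_cotChart_target.1 hw))).differentiableAt (by simp)
  have hf : HasFDerivAt (Prod.fst : ModelE n × ModelD n → ModelE n) (.fst ℝ _ _) w :=
    hasFDerivAt_fst
  have h2 := HasFDerivAt.comp (f := Prod.fst) w h1.hasFDerivAt hf
  refine (h2.congr_of_eventuallyEq ?_).fderiv
  filter_upwards [(isOpen_cotChart_target x).mem_nhds hw] with w' hw'
  rw [proj_cotChart_symm' x hw']; rfl

lemma abs_mul_add_norm_leibniz_le {E : Type*} [NormedAddCommGroup E] [NormedSpace ℝ E]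
    {a b B B' : ℝ} {a' b' : E →L[ℝ] ℝ} (h1 : ‖a‖ ≤ |B|) (h3 : ‖a'‖ ≤ |B'|) :
    |a * b| + ‖a • b' + b • a'‖ ≤ (2 * |B| + |B'|) * (|b| + ‖b'‖) := by
  have h4 : ‖a • b' + b • a'‖ ≤ |B| * ‖b'‖ + |b| * |B'| := by
    refine (norm_add_le _ _).trans ?_
    rw [norm_smul, norm_smul, Real.norm_eq_abs b]
    exact add_le_add (mul_le_mul_of_nonneg_right h1 (norm_nonneg _))
      (mul_le_mul_of_nonneg_left h3 (abs_nonneg _))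
  have h5 : |a * b| ≤ |B| * |b| := by
    rw [abs_mul]; exact mul_le_mul_of_nonneg_right h1 (abs_nonneg _)
  nlinarith [abs_nonneg B, abs_nonneg B', abs_nonneg b, norm_nonneg b',
    mul_nonneg (abs_nonneg B) (abs_nonneg b), mul_nonneg (abs_nonneg B) (norm_nonneg b'),
    mul_nonneg (abs_nonneg B') (norm_nonneg b')]

-- Derivatives of a base function are bounded over compact subsets of a chart, so the Leibniz rule
-- keeps the decay. This permits localization by partitions of unity and cutoffs.
set_option synthInstance.maxHeartbeats 200000 in
lemma FibreDecayOne.base_mul {H : CotBundle n M → ℝ} (hd : FibreDecayOne H)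
    (hH : ContMDiff (cotModel n) 𝓘(ℝ, ℝ) ∞ H)
    {g : M → ℝ} (hg : ContMDiff 𝓘(ℝ, ModelE n) 𝓘(ℝ, ℝ) ∞ g) :
    FibreDecayOne fun z ↦ g z.proj * H z := by
  intro x L hL hLx N
  obtain ⟨C, hC⟩ := hd x L hL hLx N
  have hgc := contDiffOn_base_comp hg x
  obtain ⟨B, hB⟩ := hL.exists_bound_of_continuousOn (hgc.continuousOn.mono hLx)
  obtain ⟨B', hB'⟩ := hL.exists_bound_of_continuousOn
    ((hgc.continuousOn_fderiv_top (chartAt (ModelE n) x).open_target).mono hLx)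
  refine ⟨(2 * |B| + |B'|) * C, fun y hy η ↦ ?_⟩
  have hw : (y, η) ∈ (cotChart (n := n) x).target := mem_cotChart_target.2 (hLx hy)
  have hfd := fderiv_fun_mul ((contMDiff_base_proj hg).differentiableAt_cotChart x hw)
    (hH.differentiableAt_cotChart x hw)
  beta_reduce
  rw [hfd, fderiv_base_comp hg hw, proj_cotChart_symm' x hw]
  have h1 := (hB y hy).trans (le_abs_self B)
  have h2 := (hB' y hy).trans (le_abs_self B')
  simp only at h1 h2 ⊢
  set a := g ((chartAt (ModelE n) x).symm y)
  set a' := fderiv ℝ (fun y ↦ g ((chartAt (ModelE n) x).symm y)) y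
  set b := H ((cotChart (n := n) x).symm (y, η))
  set b' := fderiv ℝ (fun w ↦ H ((cotChart (n := n) x).symm w)) (y, η)
  have h3 : ‖a'.comp (.fst ℝ (ModelE n) (ModelD n))‖ ≤ |B'| := by
    refine (ContinuousLinearMap.opNorm_comp_le _ _).trans ?_
    have := ContinuousLinearMap.norm_fst_le ℝ (ModelE n) (ModelD n)
    calc _ ≤ |B'| * 1 := by gcongr
      _ = _ := mul_one _
  calc _ ≤ (1 + ‖η‖) ^ N * ((2 * |B| + |B'|) * (|b| + ‖b'‖)) := by
        gcongr
        exact abs_mul_add_norm_leibniz_le (E := ModelE n × ModelD n) h1 h3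
    _ = (2 * |B| + |B'|) * ((1 + ‖η‖) ^ N * (|b| + ‖b'‖)) := by ring
    _ ≤ _ := by gcongr; exact hC y hy η

lemma canonicalBracket_congr {φ φ' ψ ψ' : CotBundle n M → ℝ} {z : CotBundle n M}
    (h : φ =ᶠ[𝓝 z] φ') (h' : ψ =ᶠ[𝓝 z] ψ') :
    canonicalBracket φ ψ z = canonicalBracket φ' ψ' z := by
  rw [canonicalBracket_eq, canonicalBracket_eq, h.mfderiv_eq, h'.mfderiv_eq]

lemma flatBracket_zero_left (b : ModelE n × ModelD n →L[ℝ] ℝ) : flatBracket 0 b = 0 := by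
  simp [flatBracket]

lemma flatBracket_zero_right (b : ModelE n × ModelD n →L[ℝ] ℝ) : flatBracket b 0 = 0 := by
  simp [flatBracket]

lemma flatBracket_swap (a b : ModelE n × ModelD n →L[ℝ] ℝ) :
    flatBracket a b = -flatBracket b a := by
  simp [flatBracket]

lemma flatBracket_add_right (a b c : ModelE n × ModelD n →L[ℝ] ℝ) :
    flatBracket a (b + c) = flatBracket a b + flatBracket a c := by
  rw [flatBracket, flatBracket, flatBracket, ← Finset.sum_add_distrib]
  refine Finset.sum_congr rfl fun i _ ↦ ?_
  simp only [add_apply]; ring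

lemma flatBracket_smul_right (a b : ModelE n × ModelD n →L[ℝ] ℝ) (c : ℝ) :
    flatBracket a (c • b) = c * flatBracket a b := by
  rw [flatBracket, flatBracket, Finset.mul_sum]
  refine Finset.sum_congr rfl fun i _ ↦ ?_
  simp only [smul_apply, smul_eq_mul]; ring

lemma flatBracket_add_left (a b c : ModelE n × ModelD n →L[ℝ] ℝ) :
    flatBracket (a + b) c = flatBracket a c + flatBracket b c := by
  rw [flatBracket_swap, flatBracket_add_right, flatBracket_swap c a, flatBracket_swap c b]; ring

lemma flatBracket_smul_left (a b : ModelE n × ModelD n →L[ℝ] ℝ) (c : ℝ) :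
    flatBracket (c • a) b = c * flatBracket a b := by
  rw [flatBracket_swap, flatBracket_smul_right, flatBracket_swap b a]; ring

lemma flatBracket_sum_right {ι : Type*} (s : Finset ι) (a : ModelE n × ModelD n →L[ℝ] ℝ)
    (b : ι → ModelE n × ModelD n →L[ℝ] ℝ) :
    flatBracket a (∑ i ∈ s, b i) = ∑ i ∈ s, flatBracket a (b i) := by
  classical
  induction s using Finset.induction_on with
  | empty => simp [flatBracket_zero_right]
  | insert i s hi ih => rw [Finset.sum_insert hi, Finset.sum_insert hi, flatBracket_add_right, ih]

lemma canonicalBracket_eq_zero_left {φ ψ : CotBundle n M → ℝ} {z : CotBundle n M}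
    (h : φ =ᶠ[𝓝 z] 0) : canonicalBracket φ ψ z = 0 := by
  rw [canonicalBracket_congr h Filter.EventuallyEq.rfl, canonicalBracket_eq]
  have : mfderiv (cotModel n) 𝓘(ℝ, ℝ) (0 : CotBundle n M → ℝ) z = 0 := mfderiv_const
  rw [this]
  exact flatBracket_zero_left _

lemma canonicalBracket_swap (φ ψ : CotBundle n M → ℝ) (z : CotBundle n M) :
    canonicalBracket φ ψ z = -canonicalBracket ψ φ z := flatBracket_swap _ _

lemma canonicalBracket_eq_zero_right {φ ψ : CotBundle n M → ℝ} {z : CotBundle n M}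
    (h : ψ =ᶠ[𝓝 z] 0) : canonicalBracket φ ψ z = 0 := by
  rw [canonicalBracket_swap, canonicalBracket_eq_zero_left h, neg_zero]

/-- The canonical bracket at a point in the preferred chart there. -/
lemma canonicalBracket_preferred {φ ψ : CotBundle n M → ℝ}
    (hφ : ContMDiff (cotModel n) 𝓘(ℝ, ℝ) ∞ φ) (hψ : ContMDiff (cotModel n) 𝓘(ℝ, ℝ) ∞ ψ)
    (z : CotBundle n M) : canonicalBracket φ ψ z =
      flatBracket (fderiv ℝ (fun w ↦ φ ((cotChart (n := n) z.proj).symm w)) (cotChart z.proj z))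
        (fderiv ℝ (fun w ↦ ψ ((cotChart (n := n) z.proj).symm w)) (cotChart z.proj z)) := by
  have hz : z ∈ (cotChart (n := n) z.proj).source :=
    mem_cotChart_source.2 (mem_chart_source _ _)
  rw [← canonicalBracket_cotChart_symm hφ hψ z.proj ((cotChart (n := n) z.proj).map_source hz),
    (cotChart (n := n) z.proj).left_inv hz]

lemma contMDiff_cotBundle_mul {φ ψ : CotBundle n M → ℝ}
    (hφ : ContMDiff (cotModel n) 𝓘(ℝ, ℝ) ∞ φ) (hψ : ContMDiff (cotModel n) 𝓘(ℝ, ℝ) ∞ ψ) :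
    ContMDiff (cotModel n) 𝓘(ℝ, ℝ) ∞ fun z ↦ φ z * ψ z :=
  contMDiff_cotBundle_iff.2 fun x ↦
    (contMDiff_cotBundle_iff.1 hφ x).mul (contMDiff_cotBundle_iff.1 hψ x)

lemma canonicalBracket_sum_right {ι : Type*} (s : Finset ι) {φ : CotBundle n M → ℝ}
    {ψ : ι → CotBundle n M → ℝ} (hφ : ContMDiff (cotModel n) 𝓘(ℝ, ℝ) ∞ φ)
    (hψ : ∀ i, ContMDiff (cotModel n) 𝓘(ℝ, ℝ) ∞ (ψ i)) (z : CotBundle n M) :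
    canonicalBracket φ (fun z ↦ ∑ i ∈ s, ψ i z) z = ∑ i ∈ s, canonicalBracket φ (ψ i) z := by
  have hsum : ContMDiff (cotModel n) 𝓘(ℝ, ℝ) ∞ (fun z ↦ ∑ i ∈ s, ψ i z) :=
    contMDiff_cotBundle_iff.2 fun x ↦ ContDiffOn.sum fun i _ ↦ contMDiff_cotBundle_iff.1 (hψ i) x
  have hz : cotChart z.proj z ∈ (cotChart (n := n) z.proj).target :=
    (cotChart (n := n) z.proj).map_source (mem_cotChart_source.2 (mem_chart_source _ _))
  rw [canonicalBracket_preferred hφ hsum, fderiv_fun_sum fun i _ ↦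
    (hψ i).differentiableAt_cotChart _ hz, flatBracket_sum_right]
  exact Finset.sum_congr rfl fun i _ ↦ (canonicalBracket_preferred hφ (hψ i) z).symm

lemma norm_fderiv_momentum_le {U L : Set (ModelE n)} (hU : IsOpen U) (hL : IsCompact L)
    (hLU : L ⊆ U) {u : ModelE n → ModelE n} (hu : ContDiffOn ℝ ∞ u U) :
    ∃ B, 0 ≤ B ∧ ∀ y ∈ L, ∀ η : ModelD n,
      ‖fderiv ℝ (fun w : ModelE n × ModelD n ↦ w.2 (u w.1)) (y, η)‖ ≤ B * (1 + ‖η‖) := by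
  obtain ⟨B, hB⟩ := hL.exists_bound_of_continuousOn (hu.continuousOn.mono hLU)
  obtain ⟨B', hB'⟩ := hL.exists_bound_of_continuousOn ((hu.continuousOn_fderiv_top hU).mono hLU)
  refine ⟨|B| + |B'|, by positivity, fun y hy η ↦ ?_⟩
  have hd := (hu.contDiffAt (hU.mem_nhds (hLU hy))).differentiableAt (by simp)
  rw [(hasFDerivAt_momentum hd η).fderiv]
  refine ContinuousLinearMap.opNorm_le_bound _ (by positivity) fun v ↦ ?_
  have h1 := (hB y hy).trans (le_abs_self B)
  have h2 := (hB' y hy).trans (le_abs_self B')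
  have hv1 : ‖v.1‖ ≤ ‖v‖ := norm_fst_le v
  have hv2 : ‖v.2‖ ≤ ‖v‖ := norm_snd_le v
  have e1 : ‖η (fderiv ℝ u y v.1)‖ ≤ ‖η‖ * (|B'| * ‖v‖) := by
    refine (η.le_opNorm _).trans ?_
    gcongr
    refine ((fderiv ℝ u y).le_opNorm _).trans ?_
    gcongr
  have e2 : ‖v.2 (u y)‖ ≤ ‖v‖ * |B| := by
    refine (v.2.le_opNorm _).trans ?_
    gcongr
  calc _ = ‖η (fderiv ℝ u y v.1) + v.2 (u y)‖ := by simp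
    _ ≤ ‖η‖ * (|B'| * ‖v‖) + ‖v‖ * |B| := (norm_add_le _ _).trans (add_le_add e1 e2)
    _ ≤ _ := by
      nlinarith [mul_nonneg (norm_nonneg η) (mul_nonneg (abs_nonneg B) (norm_nonneg v)),
        mul_nonneg (abs_nonneg B') (norm_nonneg v)]

variable [SigmaCompactSpace M] [T2Space M]

lemma integrable_canonicalBracket_momentum {u : (q : M) → TangentSpace 𝓘(ℝ, ModelE n) q}
    (hu : SmoothVectorField u) {H : CotBundle n M → ℝ}
    (hH : ContMDiff (cotModel n) 𝓘(ℝ, ℝ) ∞ H) (hd : FibreDecayOne H) {K : Set M}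
    (hK : IsCompact K) (h0 : ∀ z, z.proj ∉ K → canonicalBracket (momentumFn u) H z = 0) :
    Integrable (canonicalBracket (momentumFn u) H) (liouville n M) := by
  refine integrable_of_fibre_decay (continuous_canonicalBracket hu.contMDiff_momentumFn hH) hK h0 ?_
  intro x L hL hLx
  obtain ⟨C, hC⟩ := hd x L hL hLx (n + 2)
  obtain ⟨B, hB0, hB⟩ := norm_fderiv_momentum_le (chartAt (ModelE n) x).open_target hL hLx
    (hu.contDiffOn_vecRep x)
  obtain ⟨D, hD0, hD⟩ := exists_norm_flatBracket_le n
  refine ⟨D * (B * C), fun y hy η ↦ ?_⟩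
  have hw : (y, η) ∈ (cotChart (n := n) x).target := mem_cotChart_target.2 (hLx hy)
  rw [canonicalBracket_cotChart_symm hu.contMDiff_momentumFn hH x hw]
  have e : fderiv ℝ (fun w ↦ momentumFn u ((cotChart (n := n) x).symm w)) (y, η) =
      fderiv ℝ (fun w : ModelE n × ModelD n ↦ w.2 (vecRep x u w.1)) (y, η) := by
    apply Filter.EventuallyEq.fderiv_eq
    filter_upwards [(isOpen_cotChart_target x).mem_nhds hw] with w hw
    exact momentumFn_cotChart_symm x u hw
  rw [e]
  set a := fderiv ℝ (fun w : ModelE n × ModelD n ↦ w.2 (vecRep x u w.1)) (y, η)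
  set b := fderiv ℝ (fun w ↦ H ((cotChart (n := n) x).symm w)) (y, η)
  calc (1 + ‖η‖) ^ (n + 1) * |flatBracket a b|
      ≤ (1 + ‖η‖) ^ (n + 1) * (D * ((B * (1 + ‖η‖)) *
        (|H ((cotChart (n := n) x).symm (y, η))| + ‖b‖))) := by
        gcongr
        refine (hD a b).trans ?_
        gcongr
        · exact hB y hy η
        · linarith [abs_nonneg (H ((cotChart (n := n) x).symm (y, η)))]
    _ = D * (B * ((1 + ‖η‖) ^ (n + 2) * (|H ((cotChart (n := n) x).symm (y, η))| + ‖b‖))) := by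
        ring
    _ ≤ D * (B * C) := by gcongr; exact hC y hy η

/-- The bracket is linear in H, so a partition of unity splits H into pieces living over one chart
each, where the coordinate computation applies. -/
lemma integral_canonicalBracket_momentum_of_support {u : (q : M) → TangentSpace 𝓘(ℝ, ModelE n) q}
    (hu : SmoothVectorField u) {H : CotBundle n M → ℝ}
    (hH : ContMDiff (cotModel n) 𝓘(ℝ, ℝ) ∞ H) (hd : FibreDecayOne H) {K : Set M}
    (hK : IsCompact K) (h0 : ∀ z, z.proj ∉ K → H z = 0) :
    ∫ z, canonicalBracket (momentumFn u) H z ∂(liouville n M) = 0 := by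
  have hα := hu.contMDiff_momentumFn
  set ψ : M → CotBundle n M → ℝ := fun x z ↦ chartPartition n M x z.proj * H z with hψ
  have hψs : ∀ x, ContMDiff (cotModel n) 𝓘(ℝ, ℝ) ∞ (ψ x) := fun x ↦
    contMDiff_cotBundle_mul (contMDiff_base_proj (chartPartition n M x).contMDiff) hH
  have hψd : ∀ x, FibreDecayOne (ψ x) := fun x ↦
    hd.base_mul hH (chartPartition n M x).contMDiff
  have hψ0 : ∀ x z, z.proj ∉ tsupport (chartPartition n M x) ∩ K →
      canonicalBracket (momentumFn u) (ψ x) z = 0 := by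
    intro x z hz
    apply canonicalBracket_eq_zero_right
    have ho : IsOpen (TotalSpace.proj ⁻¹' (tsupport (chartPartition n M x) ∩ K)ᶜ :
        Set (CotBundle n M)) :=
      (((isClosed_tsupport _).inter hK.isClosed).isOpen_compl).preimage continuous_cotProj
    filter_upwards [ho.mem_nhds hz] with z' hz'
    by_cases h : z'.proj ∈ K
    · have : chartPartition n M x z'.proj = 0 :=
        image_eq_zero_of_notMem_tsupport fun h' ↦ hz' ⟨h', h⟩
      simp [hψ, this]
    · simp [hψ, h0 z' h]
  have hcK : ∀ x, IsCompact (tsupport (chartPartition n M x) ∩ K) := fun x ↦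
    hK.inter_left (isClosed_tsupport _)
  have hint : ∀ x, Integrable (canonicalBracket (momentumFn u) (ψ x)) (liouville n M) := fun x ↦
    integrable_canonicalBracket_momentum hu (hψs x) (hψd x) (hcK x) (hψ0 x)
  have e : H = fun z ↦ ∑ x ∈ activeCharts n hK, ψ x z :=
    funext (eq_sum_chartPartition_mul hK h0)
  rw [e]
  simp only [canonicalBracket_sum_right _ hα hψs]
  rw [integral_finsetSum _ fun x _ ↦ hint x]
  refine Finset.sum_eq_zero fun x _ ↦ ?_
  rw [integral_eq_chart x (fun z hz ↦ hψ0 x z fun h ↦ hz (tsupport_chartPartition_subset x h.1))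
    (hint x).aestronglyMeasurable]
  set L := chartAt (ModelE n) x '' (tsupport (chartPartition n M x) ∩ K) with hL
  have hLc : IsCompact L := (hcK x).image_of_continuousOn ((chartAt (ModelE n) x).continuousOn.mono
      (inter_subset_left.trans (tsupport_chartPartition_subset x)))
  have hLt : L ⊆ (chartAt (ModelE n) x).target := by
    rintro _ ⟨q, hq, rfl⟩
    exact (chartAt (ModelE n) x).map_source (tsupport_chartPartition_subset x hq.1)
  obtain ⟨C, hC⟩ := hψd x x L hLc hLt (n + 2)
  have hsm := contMDiff_cotBundle_iff.1 (hψs x) x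
  rw [cotChart_target] at hsm
  rw [← setIntegral_flatBracket_momentum (chartAt (ModelE n) x).open_target hLc hLt
    (hu.contDiffOn_vecRep x) hsm ?_ hC, ← cotChart_target]
  · refine setIntegral_congr_fun (isOpen_cotChart_target x).measurableSet fun w hw ↦ ?_
    beta_reduce
    rw [canonicalBracket_cotChart_symm hα (hψs x) x hw]
    congr 1
    apply Filter.EventuallyEq.fderiv_eq
    filter_upwards [(isOpen_cotChart_target x).mem_nhds hw] with w hw
    exact momentumFn_cotChart_symm x u hw
  · intro y hy hyL η
    rw [hψ]
    beta_reduce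
    rw [proj_cotChart_symm x hy]
    by_cases hq : (chartAt (ModelE n) x).symm y ∈ K
    · rw [image_eq_zero_of_notMem_tsupport (f := chartPartition n M x), zero_mul]
      intro hq'
      exact hyL ⟨_, ⟨hq', hq⟩, (chartAt (ModelE n) x).right_inv hy⟩
    · rw [h0 _ (by rw [proj_cotChart_symm x hy]; exact hq), mul_zero]

/-- A smooth cutoff that is `1` near a compact set. -/
lemma exists_cutoff {K : Set M} (hK : IsCompact K) :
    ∃ (θ : M → ℝ) (K' : Set M), ContMDiff 𝓘(ℝ, ModelE n) 𝓘(ℝ, ℝ) ∞ θ ∧ IsCompact K' ∧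
      (∀ᶠ q in 𝓝ˢ K, θ q = 1) ∧ ∀ q ∉ K', θ q = 0 := by
  have : LocallyCompactSpace M := ChartedSpace.locallyCompactSpace (ModelE n) M
  obtain ⟨K', hK', hKK'⟩ := exists_compact_superset hK
  obtain ⟨θ, h1, h0, -⟩ := exists_contMDiffMap_one_nhds_of_subset_interior
    (n := (⊤ : ℕ∞)) 𝓘(ℝ, ModelE n) hK.isClosed hKK'
  exact ⟨θ, K', θ.contMDiff, hK', h1, h0⟩

/-- The bracket of a momentum function and a rapidly decreasing function integrates to zero. -/
theorem integral_canonicalBracket_momentum {u : (q : M) → TangentSpace 𝓘(ℝ, ModelE n) q}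
    (hu : SmoothVectorField u) {H : CotBundle n M → ℝ}
    (hH : ContMDiff (cotModel n) 𝓘(ℝ, ℝ) ∞ H) (hd : FibreDecayOne H) {K : Set M}
    (hK : IsCompact K) (h0 : (∀ q ∉ K, u q = 0) ∨ ∀ z, z.proj ∉ K → H z = 0) :
    Integrable (canonicalBracket (momentumFn u) H) (liouville n M) ∧
    ∫ z, canonicalBracket (momentumFn u) H z ∂(liouville n M) = 0 := by
  have hoK : IsOpen (TotalSpace.proj ⁻¹' Kᶜ : Set (CotBundle n M)) :=
    hK.isClosed.isOpen_compl.preimage continuous_cotProj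
  rcases h0 with h0 | h0
  · have hα0 : ∀ z : CotBundle n M, z.proj ∉ K → momentumFn u =ᶠ[𝓝 z] 0 := by
      intro z hz
      filter_upwards [hoK.mem_nhds hz] with z' hz'
      rw [momentumFn, h0 _ hz']
      exact map_zero (cov z')
    refine ⟨integrable_canonicalBracket_momentum hu hH hd hK fun z hz ↦
      canonicalBracket_eq_zero_left (hα0 z hz), ?_⟩
    -- When only u is compactly supported, H may be replaced by θH: near points over K the two agree
    -- because θ = 1 there, and elsewhere ⟨u, p⟩ vanishes locally.
    obtain ⟨θ, K', hθ, hK', h1, h0'⟩ := exists_cutoff (n := n) hK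
    rw [← integral_canonicalBracket_momentum_of_support hu
      (contMDiff_cotBundle_mul (contMDiff_base_proj hθ) hH) (hd.base_mul hH hθ) hK'
      fun z hz ↦ by rw [h0' _ hz, zero_mul]]
    congr 1; ext z
    by_cases hz : z.proj ∈ K
    · apply canonicalBracket_congr Filter.EventuallyEq.rfl
      have h2 := continuous_cotProj.continuousAt.eventually
        (mem_nhdsSet_iff_forall.1 h1 z.proj hz)
      filter_upwards [h2] with z' hz'
      have : θ z'.proj = 1 := hz'
      rw [this, one_mul]
    · rw [canonicalBracket_eq_zero_left (hα0 z hz), canonicalBracket_eq_zero_left (hα0 z hz)]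
  · refine ⟨integrable_canonicalBracket_momentum hu hH hd hK fun z hz ↦
      canonicalBracket_eq_zero_right ?_,
      integral_canonicalBracket_momentum_of_support hu hH hd hK h0⟩
    filter_upwards [hoK.mem_nhds hz] with z' hz'
    exact h0 z' hz'

end MomentumFlowIntegral

/-! ### Rapid decrease along the fibres and smooth fibre integrals -/

section FibreDecay

variable {W D Q : Type} [NormedAddCommGroup W] [NormedSpace ℝ W] [NormedAddCommGroup D]
  [NormedSpace ℝ D] [NormedAddCommGroup Q] [NormedSpace ℝ Q]

/-- Smooth functions on `U × D`, rapidly decreasing in `D` with all their derivatives, locally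
uniformly on `U`. -/
def FibreDecayOn (U : Set W) (F : W × D → Q) : Prop :=
  ContDiffOn ℝ ∞ F (U ×ˢ univ) ∧ ∀ w₀ ∈ U, ∀ k N : ℕ, ∃ C : ℝ, ∀ᶠ w in 𝓝 w₀, ∀ η : D,
    (1 + ‖η‖) ^ N * ‖iteratedFDeriv ℝ k F (w, η)‖ ≤ C

namespace FibreDecayOn

variable {U : Set W} {F : W × D → Q}

lemma contDiffAt (h : FibreDecayOn U F) (hU : IsOpen U) {w : W} (hw : w ∈ U) (η : D) :
    ContDiffAt ℝ ∞ F (w, η) :=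
  h.1.contDiffAt ((hU.prod isOpen_univ).mem_nhds ⟨hw, mem_univ _⟩)

lemma clm_comp {Q' : Type} [NormedAddCommGroup Q'] [NormedSpace ℝ Q'] (h : FibreDecayOn U F)
    (hU : IsOpen U) (A : Q →L[ℝ] Q') : FibreDecayOn U fun w ↦ A (F w) := by
  refine ⟨A.contDiff.comp_contDiffOn h.1, fun w₀ hw₀ k N ↦ ?_⟩
  obtain ⟨C, hC⟩ := h.2 w₀ hw₀ k N
  refine ⟨‖A‖ * C, ?_⟩
  filter_upwards [hC, hU.mem_nhds hw₀] with w hw hwU η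
  calc _ ≤ (1 + ‖η‖) ^ N * (‖A‖ * ‖iteratedFDeriv ℝ k F (w, η)‖) := by
        gcongr
        exact A.norm_iteratedFDeriv_comp_left (N := ∞) (h.contDiffAt hU hwU η)
          (by exact_mod_cast le_top)
    _ = ‖A‖ * ((1 + ‖η‖) ^ N * ‖iteratedFDeriv ℝ k F (w, η)‖) := by ring
    _ ≤ _ := by gcongr; exact hw η

lemma fderiv (h : FibreDecayOn U F) (hU : IsOpen U) : FibreDecayOn U (fderiv ℝ F) := by
  refine ⟨h.1.fderiv_of_isOpen (hU.prod isOpen_univ) (by simp), fun w₀ hw₀ k N ↦ ?_⟩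
  obtain ⟨C, hC⟩ := h.2 w₀ hw₀ (k + 1) N
  refine ⟨C, hC.mono fun w hw η ↦ ?_⟩
  rw [norm_iteratedFDeriv_fderiv]
  exact hw η

/-- The partial derivative along the base. -/
lemma fderiv_base (h : FibreDecayOn U F) (hU : IsOpen U) :
    FibreDecayOn U fun w ↦ (_root_.fderiv ℝ F w).comp (ContinuousLinearMap.inl ℝ W D) :=
  (h.fderiv hU).clm_comp hU ((ContinuousLinearMap.compL ℝ W (W × D) Q).flip
    (ContinuousLinearMap.inl ℝ W D))

lemma hasFDerivAt_base (h : FibreDecayOn U F) (hU : IsOpen U) {w : W} (hw : w ∈ U) (η : D) :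
    HasFDerivAt (fun w ↦ F (w, η))
      ((_root_.fderiv ℝ F (w, η)).comp (ContinuousLinearMap.inl ℝ W D)) w :=
  ((h.contDiffAt hU hw η).differentiableAt (by simp)).hasFDerivAt.comp (f := fun w ↦ (w, η)) w
    (hasFDerivAt_prodMk_left w η)

lemma continuous_fibre (h : FibreDecayOn U F) {w : W} (hw : w ∈ U) :
    Continuous fun η ↦ F (w, η) :=
  continuousOn_univ.1 (h.1.continuousOn.comp (by fun_prop) fun _ _ ↦ ⟨hw, mem_univ _⟩)

lemma exists_bound (h : FibreDecayOn U F) {w₀ : W} (hw₀ : w₀ ∈ U) (N : ℕ) :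
    ∃ C, ∀ᶠ w in 𝓝 w₀, ∀ η : D, ‖F (w, η)‖ ≤ C * ((1 + ‖η‖) ^ N)⁻¹ := by
  obtain ⟨C, hC⟩ := h.2 w₀ hw₀ 0 N
  refine ⟨C, hC.mono fun w hw η ↦ ?_⟩
  have hp : 0 < (1 + ‖η‖) ^ N := by positivity
  rw [le_mul_inv_iff₀ hp, mul_comm]
  simpa only [norm_iteratedFDeriv_zero] using hw η

variable [MeasurableSpace D] [BorelSpace D] [SecondCountableTopology D] {μ : Measure D} {N₀ : ℕ}

lemma integrable (h : FibreDecayOn U F) (hμ : Integrable (fun η : D ↦ ((1 + ‖η‖) ^ N₀)⁻¹) μ)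
    {w : W} (hw : w ∈ U) : Integrable (fun η ↦ F (w, η)) μ := by
  obtain ⟨C, hC⟩ := h.exists_bound hw N₀
  exact (hμ.const_mul C).mono' (h.continuous_fibre hw).aestronglyMeasurable
    (Filter.Eventually.of_forall hC.self_of_nhds)

lemma hasFDerivAt_integral (h : FibreDecayOn U F) (hU : IsOpen U)
    (hμ : Integrable (fun η : D ↦ ((1 + ‖η‖) ^ N₀)⁻¹) μ) {w : W} (hw : w ∈ U) :
    HasFDerivAt (fun w ↦ ∫ η, F (w, η) ∂μ)
      (∫ η, (_root_.fderiv ℝ F (w, η)).comp (ContinuousLinearMap.inl ℝ W D) ∂μ) w := by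
  obtain ⟨C, hC⟩ := (h.fderiv_base hU).exists_bound hw N₀
  refine hasFDerivAt_integral_of_dominated_of_fderiv_le (Filter.inter_mem hC (hU.mem_nhds hw))
    ?_ (h.integrable hμ hw) ((h.fderiv_base hU).continuous_fibre hw).aestronglyMeasurable
    (F' := fun w η ↦ (_root_.fderiv ℝ F (w, η)).comp (ContinuousLinearMap.inl ℝ W D))
    (bound := fun η ↦ C * ((1 + ‖η‖) ^ N₀)⁻¹) ?_ (hμ.const_mul C) ?_
  · filter_upwards [hU.mem_nhds hw] with w hw
    exact (h.continuous_fibre hw).aestronglyMeasurable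
  · exact Filter.Eventually.of_forall fun η w hw ↦ hw.1 η
  · exact Filter.Eventually.of_forall fun η w hw ↦ h.hasFDerivAt_base hU hw.2 η

/-- The derivative of the fibre integral is the fibre integral of the base derivative, which is
again rapidly decreasing. The induction on the order changes the target space, since derivatives are
operator valued. -/
lemma contDiffOn_integral (h : FibreDecayOn U F) (hU : IsOpen U)
    (hμ : Integrable (fun η : D ↦ ((1 + ‖η‖) ^ N₀)⁻¹) μ) :
    ContDiffOn ℝ ∞ (fun w ↦ ∫ η, F (w, η) ∂μ) U := by
  rw [contDiffOn_infty]
  intro m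
  induction m generalizing Q with
  | zero =>
    exact contDiffOn_zero.2 fun w hw ↦
      (h.hasFDerivAt_integral hU hμ hw).continuousAt.continuousWithinAt
  | succ m ih =>
    push_cast
    rw [contDiffOn_succ_iff_hasFDerivWithinAt_of_uniqueDiffOn hU.uniqueDiffOn]
    exact ⟨by simp, _, ih (h.fderiv_base hU), fun w hw ↦
      (h.hasFDerivAt_integral hU hμ hw).hasFDerivWithinAt⟩

end FibreDecayOn

/-- For large |η| the derivatives of F are those of G; for |η| ≤ R they are bounded, together with
the polynomial weight, by compactness of the ball. -/
lemma FibreDecayOn.of_eq_off_compact {U : Set W} {F G : W × D → Q} [FiniteDimensional ℝ D]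
    (hG : FibreDecayOn U G)
    (hU : IsOpen U) (hF : ContDiffOn ℝ ∞ F (U ×ˢ univ))
    (h : ∀ w₀ ∈ U, ∃ R : ℝ, ∀ᶠ w in 𝓝 w₀, ∀ η : D, R < ‖η‖ → F (w, η) = G (w, η)) :
    FibreDecayOn U F := by
  refine ⟨hF, fun w₀ hw₀ k N ↦ ?_⟩
  obtain ⟨R, hR⟩ := h w₀ hw₀
  obtain ⟨C, hC⟩ := hG.2 w₀ hw₀ k N
  have hcont : ContinuousOn (fun v : W × D ↦ (1 + ‖v.2‖) ^ N * ‖iteratedFDeriv ℝ k F v‖)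
      (U ×ˢ univ) := by
    have h1 : ContinuousOn (iteratedFDeriv ℝ k F) (U ×ˢ univ) :=
      (hF.continuousOn_iteratedFDerivWithin (m := k) (by exact_mod_cast le_top)
        (hU.prod isOpen_univ).uniqueDiffOn).congr fun v hv ↦
          (iteratedFDerivWithin_of_isOpen k (hU.prod isOpen_univ) hv).symm
    exact ContinuousOn.mul (by fun_prop) h1.norm
  have hcomp : IsCompact (Metric.closedBall (0 : D) R) := by
    have := FiniteDimensional.proper ℝ D
    exact isCompact_closedBall _ _
  -- The bound at w₀, enlarged by one, persists for w near w₀ uniformly over the compact ball.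
  obtain ⟨B, hB⟩ : ∃ B : ℝ, ∀ᶠ w in 𝓝 w₀, ∀ η ∈ Metric.closedBall (0 : D) R,
      (1 + ‖η‖) ^ N * ‖iteratedFDeriv ℝ k F (w, η)‖ < B := by
    obtain ⟨B, hB⟩ := (hcomp.image_of_continuousOn (f := fun η : D ↦
      (1 + ‖η‖) ^ N * ‖iteratedFDeriv ℝ k F (w₀, η)‖)
        (hcont.comp (f := fun η : D ↦ (w₀, η)) (s := Metric.closedBall 0 R)
          (by fun_prop) fun η _ ↦ ⟨hw₀, mem_univ _⟩)).bddAbove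
    refine ⟨B + 1, hcomp.eventually_forall_of_forall_eventually
      (P := fun w η ↦ (1 + ‖η‖) ^ N * ‖iteratedFDeriv ℝ k F (w, η)‖ < B + 1) fun η hη ↦ ?_⟩
    have h1 := hB (mem_image_of_mem _ hη)
    exact (hcont.continuousAt ((hU.prod isOpen_univ).mem_nhds ⟨hw₀, mem_univ η⟩)).eventually
      (gt_mem_nhds (lt_of_le_of_lt h1 (lt_add_one B)))
  refine ⟨max B C, ?_⟩
  filter_upwards [hB, hC, hR.eventually_nhds, hU.mem_nhds hw₀] with w h1 h2 h3 hw η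
  by_cases hη : ‖η‖ ≤ R
  · exact (h1 η (by simpa using hη)).le.trans (le_max_left _ _)
  · refine le_trans (le_of_eq ?_) ((h2 η).trans (le_max_right _ _))
    -- The condition R < |η| is open and the agreement holds for all base points near w, so F and G
    -- agree in a full neighbourhood and have the same derivatives of every order.
    have : F =ᶠ[𝓝 (w, η)] G := by
      change ∀ᶠ v in 𝓝 (w, η), F v = G v
      have h4 : ∀ᶠ η' in 𝓝 η, R < ‖η'‖ :=
        continuous_norm.continuousAt.eventually (lt_mem_nhds (not_le.1 hη))
      rw [nhds_prod_eq]
      filter_upwards [h3.prod_mk h4] with v hv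
      exact hv.1 v.2 hv.2
    rw [(Filter.EventuallyEq.iteratedFDeriv ℝ this k).eq_of_nhds]

end FibreDecay

/-! ### Growth of the logarithm of a distribution function -/

section LogDecay

variable {W D Q : Type} [NormedAddCommGroup W] [NormedSpace ℝ W] [NormedAddCommGroup D]
  [NormedSpace ℝ D] [NormedAddCommGroup Q] [NormedSpace ℝ Q]

lemma exists_bound_of_locally {U K : Set W} (hK : IsCompact K) (hKU : K ⊆ U) {φ : W → D → ℝ}
    (h : ∀ w₀ ∈ U, ∃ C, ∀ᶠ w in 𝓝 w₀, ∀ η, φ w η ≤ C) : ∃ C, ∀ w ∈ K, ∀ η, φ w η ≤ C := by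
  refine hK.induction_on (p := fun s ↦ ∃ C, ∀ w ∈ s, ∀ η, φ w η ≤ C) ⟨0, by simp⟩
    (fun s t hst ⟨C, hC⟩ ↦ ⟨C, fun w hw ↦ hC w (hst hw)⟩) ?_ ?_
  · rintro s t ⟨C, hC⟩ ⟨C', hC'⟩
    refine ⟨max C C', ?_⟩
    rintro w (hw | hw) η
    · exact (hC w hw η).trans (le_max_left _ _)
    · exact (hC' w hw η).trans (le_max_right _ _)
  · intro w hw
    obtain ⟨C, hC⟩ := h w (hKU hw)
    exact ⟨_, mem_nhdsWithin_of_mem_nhds hC, C, fun w hw ↦ hw⟩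

/-- All positive powers of `exp l` are rapidly decreasing along the fibres. -/
def LogDecayOn (U : Set W) (l : W × D → ℝ) : Prop :=
  ContDiffOn ℝ ∞ l (U ×ˢ univ) ∧ ∀ s : ℝ, 0 < s → FibreDecayOn U fun v ↦ Real.exp (s * l v)

/-- The derivatives grow slower than any negative power of `exp l`. -/
def TemperateOn (U : Set W) (l : W × D → ℝ) (G : W × D → Q) : Prop :=
  ContDiffOn ℝ ∞ G (U ×ˢ univ) ∧ ∀ w₀ ∈ U, ∀ k : ℕ, ∀ ε : ℝ, 0 < ε → ∃ C : ℝ, ∀ᶠ w in 𝓝 w₀,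
    ∀ η : D, ‖iteratedFDeriv ℝ k G (w, η)‖ ≤ C * Real.exp (-(ε * l (w, η)))

lemma iteratedFDeriv_comp_clm {E : Type} [NormedAddCommGroup E] [NormedSpace ℝ E]
    {S : Set E} (hS : IsOpen S) {F : E → Q} (hF : ContDiffOn ℝ ∞ F S) (A : W →L[ℝ] E) {w : W}
    (hw : A w ∈ S) (k : ℕ) :
    iteratedFDeriv ℝ k (F ∘ A) w = (iteratedFDeriv ℝ k F (A w)).compContinuousLinearMap fun _ ↦ A := by
  have hS' : IsOpen (A ⁻¹' S) := hS.preimage A.continuous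
  rw [← iteratedFDerivWithin_of_isOpen k hS hw, ← iteratedFDerivWithin_of_isOpen k hS' hw]
  exact A.iteratedFDerivWithin_comp_right hF hS.uniqueDiffOn hS'.uniqueDiffOn hw
    (by exact_mod_cast le_top)

lemma norm_iteratedFDeriv_comp_clm_le {E : Type} [NormedAddCommGroup E] [NormedSpace ℝ E]
    {S : Set E} (hS : IsOpen S) {F : E → Q} (hF : ContDiffOn ℝ ∞ F S) (A : W →L[ℝ] E)
    (hA : ‖A‖ ≤ 1) {w : W} (hw : A w ∈ S) (k : ℕ) :
    ‖iteratedFDeriv ℝ k (F ∘ A) w‖ ≤ ‖iteratedFDeriv ℝ k F (A w)‖ := by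
  rw [iteratedFDeriv_comp_clm hS hF A hw]
  refine (ContinuousMultilinearMap.norm_compContinuousLinearMap_le _ _).trans ?_
  refine mul_le_of_le_one_right (norm_nonneg _) ?_
  exact Finset.prod_le_one (fun _ _ ↦ norm_nonneg _) fun _ _ ↦ hA

/-- The projection `((ξ, y), η) ↦ (y, η)`. -/
def dropParam (P W D : Type) [NormedAddCommGroup P] [NormedSpace ℝ P] [NormedAddCommGroup W]
    [NormedSpace ℝ W] [NormedAddCommGroup D] [NormedSpace ℝ D] : (P × W) × D →L[ℝ] W × D :=
  ((ContinuousLinearMap.snd ℝ P W).comp (.fst ℝ _ _)).prod (.snd ℝ _ _)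

lemma norm_dropParam_le {P : Type} [NormedAddCommGroup P] [NormedSpace ℝ P] :
    ‖dropParam P W D‖ ≤ 1 := by
  refine ContinuousLinearMap.opNorm_le_bound _ zero_le_one fun v ↦ ?_
  rw [one_mul]
  exact max_le ((norm_snd_le v.1).trans (norm_fst_le v)) (norm_snd_le v)

lemma FibreDecayOn.pullback {P : Type} [NormedAddCommGroup P] [NormedSpace ℝ P] {U : Set W}
    (hU : IsOpen U) {F : W × D → Q} (h : FibreDecayOn U F) (S : Set P) :
    FibreDecayOn (S ×ˢ U) fun v : (P × W) × D ↦ F (v.1.2, v.2) := by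
  refine ⟨h.1.comp (by fun_prop) fun v hv ↦ ⟨hv.1.2, mem_univ _⟩, fun w₀ hw₀ k N ↦ ?_⟩
  obtain ⟨C, hC⟩ := h.2 w₀.2 hw₀.2 k N
  refine ⟨C, ?_⟩
  filter_upwards [continuous_snd.continuousAt.eventually hC,
    continuous_snd.continuousAt.eventually (hU.mem_nhds hw₀.2)] with w hw hwU η
  refine le_trans ?_ (hw η)
  gcongr
  exact norm_iteratedFDeriv_comp_clm_le (hU.prod isOpen_univ) h.1 (dropParam P W D)
    norm_dropParam_le (w := (w, η)) ⟨hwU, mem_univ _⟩ k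

lemma LogDecayOn.pullback {P : Type} [NormedAddCommGroup P] [NormedSpace ℝ P] {U : Set W}
    (hU : IsOpen U) {l : W × D → ℝ} (h : LogDecayOn U l) (S : Set P) :
    LogDecayOn (S ×ˢ U) fun v : (P × W) × D ↦ l (v.1.2, v.2) :=
  ⟨h.1.comp (by fun_prop) fun v hv ↦ ⟨hv.1.2, mem_univ _⟩, fun s hs ↦
    (h.2 s hs).pullback hU S⟩

lemma LogDecayOn.exists_le {U : Set W} {l : W × D → ℝ} (h : LogDecayOn U l) {w₀ : W}
    (hw₀ : w₀ ∈ U) : ∃ Λ, ∀ᶠ w in 𝓝 w₀, ∀ η, l (w, η) ≤ Λ := by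
  obtain ⟨C, hC⟩ := (h.2 1 one_pos).exists_bound hw₀ 0
  refine ⟨C, hC.mono fun w hw η ↦ ?_⟩
  have h1 := hw η
  rw [Real.norm_of_nonneg (Real.exp_pos _).le] at h1
  simp only [one_mul, pow_zero, inv_one, mul_one] at h1
  linarith [Real.add_one_le_exp (l (w, η))]

lemma LogDecayOn.exists_exp_bound {U : Set W} {l : W × D → ℝ} (h : LogDecayOn U l) {w₀ : W}
    (hw₀ : w₀ ∈ U) {s : ℝ} (hs : 0 < s) (N : ℕ) :
    ∃ C, ∀ᶠ w in 𝓝 w₀, ∀ η, (1 + ‖η‖) ^ N * Real.exp (s * l (w, η)) ≤ C := by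
  obtain ⟨C, hC⟩ := (h.2 s hs).2 w₀ hw₀ 0 N
  refine ⟨C, hC.mono fun w hw η ↦ ?_⟩
  simpa only [norm_iteratedFDeriv_zero, Real.norm_of_nonneg (Real.exp_pos _).le] using hw η

/-- Positive values are bounded by |Λ|, and for negative ones ε|x| ≤ e^{ε|x|}. With x = log f, one
factor |log f| costs no more than f^{-ε}. -/
lemma abs_le_mul_exp_neg {x Λ ε : ℝ} (hε : 0 < ε) (hx : x ≤ Λ) :
    |x| ≤ (|Λ| * Real.exp (ε * |Λ|) + ε⁻¹) * Real.exp (-(ε * x)) := by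
  have hΛ := le_abs_self Λ
  rcases le_total 0 x with h0 | h0
  · rw [abs_of_nonneg h0]
    have h1 : 1 ≤ Real.exp (ε * |Λ|) * Real.exp (-(ε * x)) := by
      rw [← Real.exp_add]
      exact Real.one_le_exp (by nlinarith)
    calc x ≤ |Λ| * 1 := by linarith
      _ ≤ |Λ| * (Real.exp (ε * |Λ|) * Real.exp (-(ε * x))) := by gcongr
      _ ≤ _ := by
        have : 0 ≤ ε⁻¹ * Real.exp (-(ε * x)) := by positivity
        linarith
  · rw [abs_of_nonpos h0]
    have h1 : -(ε * x) ≤ Real.exp (-(ε * x)) := by linarith [Real.add_one_le_exp (-(ε * x))]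
    calc -x = ε⁻¹ * -(ε * x) := by field_simp
      _ ≤ ε⁻¹ * Real.exp (-(ε * x)) := by gcongr
      _ ≤ _ := by
        gcongr
        have : 0 ≤ |Λ| * Real.exp (ε * |Λ|) := by positivity
        linarith

/-- The logarithm of a function of which all powers are rapidly decreasing is temperate. -/
lemma LogDecayOn.temperate {U : Set W} (hU : IsOpen U) {l : W × D → ℝ} (h : LogDecayOn U l) :
    TemperateOn U l l := by
  refine ⟨h.1, fun w₀ hw₀ k ε hε ↦ ?_⟩
  rcases Nat.eq_zero_or_pos k with rfl | hk
  · obtain ⟨Λ, hΛ⟩ := h.exists_le hw₀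
    refine ⟨|Λ| * Real.exp (ε * |Λ|) + ε⁻¹, hΛ.mono fun w hw η ↦ ?_⟩
    rw [norm_iteratedFDeriv_zero, Real.norm_eq_abs]
    exact abs_le_mul_exp_neg hε (hw η)
  have hk' : (0 : ℝ) < k := by exact_mod_cast hk
  -- Differentiating log(e^{sl}) k times produces at most k quotients by e^{sl}; with s = ε/k they
  -- amount to e^{-εl}.
  set s := ε / k with hs
  have hs0 : 0 < s := by positivity
  have hb : ∀ i : ℕ, ∃ C, ∀ᶠ w in 𝓝 w₀, ∀ η : D,
      ‖iteratedFDeriv ℝ i (fun v ↦ Real.exp (s * l v)) (w, η)‖ ≤ C := fun i ↦ by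
    simpa using (h.2 s hs0).2 w₀ hw₀ i 0
  choose C hC using hb
  set B : ℝ := 1 + ∑ i ∈ Finset.range (k + 1), |C i| with hB
  have hCB : ∀ i ≤ k, C i ≤ B := fun i hi ↦ by
    have := Finset.single_le_sum (f := fun i ↦ |C i|) (fun i _ ↦ abs_nonneg _)
      (Finset.mem_range.2 (Nat.lt_succ_of_le hi))
    linarith [le_abs_self (C i)]
  have hB1 : 1 ≤ B := by
    have : 0 ≤ ∑ i ∈ Finset.range (k + 1), |C i| := Finset.sum_nonneg fun i _ ↦ abs_nonneg _
    linarith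
  set A : ℝ := ∑ i ∈ Finset.range (k + 1), ‖iteratedFDerivWithin ℝ i Real.log (Ioi 0) 1‖ with hA
  refine ⟨s⁻¹ * (k.factorial * A * B ^ k), ?_⟩
  have hall : ∀ᶠ w in 𝓝 w₀, ∀ i ≤ k, ∀ η : D,
      ‖iteratedFDeriv ℝ i (fun v ↦ Real.exp (s * l v)) (w, η)‖ ≤ C i := by
    have := (Filter.eventually_all_finset (Finset.range (k + 1))).2 fun i _ ↦ hC i
    exact this.mono fun w hw i hi ↦ hw i (Finset.mem_range.2 (Nat.lt_succ_of_le hi))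
  filter_upwards [hall, hU.mem_nhds hw₀] with w hw hwU η
  set v₀ : W × D := (w, η) with hv₀
  have hSo : IsOpen (U ×ˢ (univ : Set D)) := hU.prod isOpen_univ
  have hv₀S : v₀ ∈ U ×ˢ (univ : Set D) := ⟨hwU, mem_univ _⟩
  -- Multiplication by c changes the logarithm by a constant only, and gives c e^{sl} the value 1 at
  -- the point considered. The derivatives of log are then needed at 1 alone, so the constant A does
  -- not depend on the point.
  set c := Real.exp (-(s * l v₀)) with hc
  have hc0 : 0 < c := Real.exp_pos _
  have hg : ContDiffOn ℝ ∞ (fun v ↦ c * Real.exp (s * l v)) (U ×ˢ (univ : Set D)) :=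
    contDiffOn_const.mul (h.2 s hs0).1
  have hg1 : c * Real.exp (s * l v₀) = 1 := by rw [hc, ← Real.exp_add]; simp
  -- The estimate for compositions wants the i-th derivative bounded by an i-th power; from cB ≥ 1
  -- one gets cB ≤ (cB)^i for i ≥ 1.
  have hcB : 1 ≤ c * B := by
    have h0 := (hw 0 (Nat.zero_le _) η).trans (hCB 0 (Nat.zero_le _))
    rw [norm_iteratedFDeriv_zero, Real.norm_of_nonneg (Real.exp_pos _).le] at h0
    calc (1 : ℝ) = c * Real.exp (s * l v₀) := hg1.symm
      _ ≤ c * B := by gcongr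
  have hder : ∀ i ≤ k,
      ‖iteratedFDerivWithin ℝ i (fun v ↦ c * Real.exp (s * l v)) (U ×ˢ univ) v₀‖ ≤ c * B := by
    intro i hi
    have e := iteratedFDerivWithin_const_smul_apply (i := i) (a := c)
      (((h.2 s hs0).1 v₀ hv₀S).of_le (by exact_mod_cast le_top)) hSo.uniqueDiffOn hv₀S
    have e' : iteratedFDerivWithin ℝ i (fun v ↦ c * Real.exp (s * l v)) (U ×ˢ univ) v₀ =
      c • iteratedFDerivWithin ℝ i (fun v ↦ Real.exp (s * l v)) (U ×ˢ univ) v₀ := e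
    rw [e', norm_smul, Real.norm_of_nonneg hc0.le, iteratedFDerivWithin_of_isOpen i hSo hv₀S]
    gcongr
    exact (hw i hi η).trans (hCB i hi)
  have hlog : ContDiffOn ℝ ∞ Real.log (Ioi 0) :=
    Real.contDiffOn_log.mono fun x hx ↦ (ne_of_gt hx : x ≠ 0)
  have key := norm_iteratedFDerivWithin_comp_le (n := k) hlog hg (by exact_mod_cast le_top)
    (uniqueDiffOn_Ioi 0) hSo.uniqueDiffOn (fun v _ ↦ mul_pos hc0 (Real.exp_pos _)) hv₀S
    (C := A) (D := c * B)
    (fun i hi ↦ by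
      rw [hg1]
      exact Finset.single_le_sum (f := fun i ↦ ‖iteratedFDerivWithin ℝ i Real.log (Ioi 0) 1‖)
        (fun i _ ↦ norm_nonneg _) (Finset.mem_range.2 (Nat.lt_succ_of_le hi)))
    (fun i h1 hi ↦ (hder i hi).trans (le_self_pow₀ hcB (by omega)))
  have e1 : ∀ v, Real.log (c * Real.exp (s * l v)) = s * l v - s * l v₀ := fun v ↦ by
    rw [hc, ← Real.exp_add, Real.log_exp]; ring
  have e2 : (Real.log ∘ fun v ↦ c * Real.exp (s * l v)) = fun v ↦ s • l v - s * l v₀ :=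
    funext e1
  rw [e2, iteratedFDerivWithin_of_isOpen k hSo hv₀S] at key
  have e3 : iteratedFDeriv ℝ k (fun v ↦ s • l v - s * l v₀) v₀ = s • iteratedFDeriv ℝ k l v₀ := by
    have hl : ContDiffAt ℝ k l v₀ :=
      (h.1.contDiffAt (hSo.mem_nhds hv₀S)).of_le (by exact_mod_cast le_top)
    rw [← iteratedFDeriv_const_smul_apply' hl]
    have := iteratedFDeriv_sub_apply (i := k) (f := fun v ↦ s • l v) (g := fun _ ↦ s * l v₀)
      (x := v₀) (hl.const_smul s) contDiffAt_const
    rw [iteratedFDeriv_const_of_ne (by omega)] at this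
    exact this.trans (sub_zero _)
  rw [e3, norm_smul, Real.norm_of_nonneg hs0.le] at key
  have e4 : c ^ k = Real.exp (-(ε * l v₀)) := by
    rw [hc, ← Real.exp_nat_mul, hs]; congr 1; field_simp
  rw [mul_pow, e4] at key
  calc ‖iteratedFDeriv ℝ k l v₀‖ = s⁻¹ * (s * ‖iteratedFDeriv ℝ k l v₀‖) := by field_simp
    _ ≤ s⁻¹ * (k.factorial * A * (Real.exp (-(ε * l v₀)) * B ^ k)) := by gcongr
    _ = _ := by ring

end LogDecay

/-! ### Powers with variable exponents -/

section ExpDecay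

variable {W D Q : Type} [NormedAddCommGroup W] [NormedSpace ℝ W] [NormedAddCommGroup D]
  [NormedSpace ℝ D] [NormedAddCommGroup Q] [NormedSpace ℝ Q]

lemma TemperateOn.base {U : Set W} (hU : IsOpen U) {l : W × D → ℝ} (h : LogDecayOn U l)
    {G : W → Q} (hG : ContDiffOn ℝ ∞ G U) : TemperateOn U l fun v ↦ G v.1 := by
  refine ⟨hG.comp contDiffOn_fst fun v hv ↦ hv.1, fun w₀ hw₀ k ε hε ↦ ?_⟩
  obtain ⟨Λ, hΛ⟩ := h.exists_le hw₀
  have hc : ContinuousAt (fun w ↦ ‖iteratedFDeriv ℝ k G w‖) w₀ := by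
    have h1 : ContinuousOn (iteratedFDeriv ℝ k G) U :=
      (hG.continuousOn_iteratedFDerivWithin (m := k) (by exact_mod_cast le_top)
        hU.uniqueDiffOn).congr fun v hv ↦ (iteratedFDerivWithin_of_isOpen k hU hv).symm
    exact (h1.continuousAt (hU.mem_nhds hw₀)).norm
  set B := ‖iteratedFDeriv ℝ k G w₀‖ + 1
  refine ⟨B * Real.exp (ε * Λ), ?_⟩
  filter_upwards [hΛ, hc.eventually (gt_mem_nhds (lt_add_one _)), hU.mem_nhds hw₀]
    with w h1 h2 hw η
  have h3 : ‖iteratedFDeriv ℝ k (fun v : W × D ↦ G v.1) (w, η)‖ ≤ ‖iteratedFDeriv ℝ k G w‖ :=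
    norm_iteratedFDeriv_comp_clm_le hU hG (ContinuousLinearMap.fst ℝ W D)
      (ContinuousLinearMap.norm_fst_le ℝ W D) (w := (w, η)) hw k
  have h4 : 1 ≤ Real.exp (ε * Λ) * Real.exp (-(ε * l (w, η))) := by
    rw [← Real.exp_add]
    exact Real.one_le_exp (by nlinarith [h1 η])
  have hB : 0 ≤ B := by positivity
  calc _ ≤ B * 1 := by rw [mul_one]; exact h3.trans h2.le
    _ ≤ B * (Real.exp (ε * Λ) * Real.exp (-(ε * l (w, η)))) := by gcongr
    _ = _ := by ring

lemma TemperateOn.mul {U : Set W} (hU : IsOpen U) {l F G : W × D → ℝ} (hF : TemperateOn U l F)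
    (hG : TemperateOn U l G) : TemperateOn U l fun v ↦ F v * G v := by
  refine ⟨hF.1.mul hG.1, fun w₀ hw₀ k ε hε ↦ ?_⟩
  -- Each factor of a Leibniz term is allowed half of the growth.
  have hε2 : 0 < ε / 2 := by positivity
  choose C hC using fun i ↦ hF.2 w₀ hw₀ i (ε / 2) hε2
  choose C' hC' using fun i ↦ hG.2 w₀ hw₀ i (ε / 2) hε2
  have h1 := (Filter.eventually_all_finset (Finset.range (k + 1))).2 fun i _ ↦ hC i
  have h2 := (Filter.eventually_all_finset (Finset.range (k + 1))).2 fun i _ ↦ hC' i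
  refine ⟨∑ i ∈ Finset.range (k + 1), (k.choose i : ℝ) * |C i| * |C' (k - i)|, ?_⟩
  filter_upwards [h1, h2, hU.mem_nhds hw₀] with w h1 h2 hw η
  have hSo : IsOpen (U ×ˢ (univ : Set D)) := hU.prod isOpen_univ
  have hv : (w, η) ∈ U ×ˢ (univ : Set D) := ⟨hw, mem_univ _⟩
  have key := norm_iteratedFDerivWithin_mul_le hF.1 hG.1 hSo.uniqueDiffOn hv (n := k)
    (by exact_mod_cast le_top)
  simp only [iteratedFDerivWithin_of_isOpen _ hSo hv] at key
  refine key.trans ?_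
  rw [Finset.sum_mul]
  refine Finset.sum_le_sum fun i hi ↦ ?_
  have hi' : k - i ∈ Finset.range (k + 1) := by simp
  have e : Real.exp (-(ε * l (w, η))) =
      Real.exp (-(ε / 2 * l (w, η))) * Real.exp (-(ε / 2 * l (w, η))) := by
    rw [← Real.exp_add]; ring_nf
  have a1 : ‖iteratedFDeriv ℝ i F (w, η)‖ ≤ |C i| * Real.exp (-(ε / 2 * l (w, η))) :=
    (h1 i hi η).trans (by gcongr; exact le_abs_self _)
  have a2 : ‖iteratedFDeriv ℝ (k - i) G (w, η)‖ ≤ |C' (k - i)| * Real.exp (-(ε / 2 * l (w, η))) :=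
    (h2 _ hi' η).trans (by gcongr; exact le_abs_self _)
  rw [e]
  calc _ ≤ (k.choose i : ℝ) * (|C i| * Real.exp (-(ε / 2 * l (w, η)))) *
        (|C' (k - i)| * Real.exp (-(ε / 2 * l (w, η)))) := by gcongr
    _ = _ := by ring

lemma norm_iteratedFDeriv_exp (i : ℕ) (x : ℝ) :
    ‖iteratedFDeriv ℝ i Real.exp x‖ = Real.exp x := by
  rw [norm_iteratedFDeriv_eq_norm_iteratedDeriv, iteratedDeriv_eq_iterate, Real.iter_deriv_exp,
    Real.norm_of_nonneg (Real.exp_pos _).le]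

/-- Variable positive powers are rapidly decreasing. -/
lemma LogDecayOn.exp_mul {U : Set W} (hU : IsOpen U) {l : W × D → ℝ} (h : LogDecayOn U l)
    {a : W → ℝ} (ha : ContDiffOn ℝ ∞ a U) (ha0 : ∀ w ∈ U, 0 < a w) :
    FibreDecayOn U fun v ↦ Real.exp (a v.1 * l v) := by
  have hL : TemperateOn U l fun v ↦ a v.1 * l v :=
    (TemperateOn.base hU h ha).mul hU (h.temperate hU)
  refine ⟨Real.contDiff_exp.comp_contDiffOn hL.1, fun w₀ hw₀ k N ↦ ?_⟩
  obtain ⟨Λ₀, hΛ₀⟩ := h.exists_le hw₀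
  -- Nonnegativity of the bound lets it be multiplied by an upper bound of the exponent.
  set Λ := max Λ₀ 0
  have hΛ0 : 0 ≤ Λ := le_max_right _ _
  have hΛ : ∀ᶠ w in 𝓝 w₀, ∀ η, l (w, η) ≤ Λ :=
    hΛ₀.mono fun w hw η ↦ (hw η).trans (le_max_left _ _)
  -- Near w₀ one has 2c < a < 5c. One c pays for the polynomial weight, another for the growth of
  -- the derivatives, and the remaining exponent a - c - kε stays between 0 and 4c.
  set c := a w₀ / 4 with hc
  have hc0 : 0 < c := by have := ha0 w₀ hw₀; positivity
  have hac : ContinuousAt a w₀ := ha.continuousOn.continuousAt (hU.mem_nhds hw₀)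
  have hlow : ∀ᶠ w in 𝓝 w₀, 2 * c < a w :=
    hac.eventually (lt_mem_nhds (by linarith [ha0 w₀ hw₀]))
  have hup : ∀ᶠ w in 𝓝 w₀, a w < 5 * c := hac.eventually (gt_mem_nhds (by linarith [ha0 w₀ hw₀]))
  obtain ⟨C₁, hC₁⟩ := h.exists_exp_bound hw₀ hc0 N
  -- The k-th derivative brings up to k factors e^{-εl}; this choice gives kε ≤ c.
  set ε := c / (k + 1) with hε
  have hε0 : 0 < ε := by positivity
  choose C hC using fun i ↦ hL.2 w₀ hw₀ i ε hε0
  set B : ℝ := 1 + ∑ i ∈ Finset.range (k + 1), |C i| with hB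
  have hCB : ∀ i ≤ k, C i ≤ B := fun i hi ↦ by
    have := Finset.single_le_sum (f := fun i ↦ |C i|) (fun i _ ↦ abs_nonneg _)
      (Finset.mem_range.2 (Nat.lt_succ_of_le hi))
    linarith [le_abs_self (C i)]
  have hB1 : 1 ≤ B := by
    have : 0 ≤ ∑ i ∈ Finset.range (k + 1), |C i| := Finset.sum_nonneg fun i _ ↦ abs_nonneg _
    linarith
  have h1 := (Filter.eventually_all_finset (Finset.range (k + 1))).2 fun i _ ↦ hC i
  refine ⟨k.factorial * B ^ k * Real.exp (k * (ε * Λ)) * Real.exp (4 * c * Λ) * C₁, ?_⟩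
  filter_upwards [h1, hΛ, hlow, hup, hC₁, hU.mem_nhds hw₀] with w h1 hΛ hlow hup hC₁ hw η
  have hSo : IsOpen (U ×ˢ (univ : Set D)) := hU.prod isOpen_univ
  have hv : (w, η) ∈ U ×ˢ (univ : Set D) := ⟨hw, mem_univ _⟩
  set x := l (w, η)
  have hx : x ≤ Λ := hΛ η
  set d := B * Real.exp (ε * (Λ - x)) with hd
  have hexp1 : 1 ≤ Real.exp (ε * (Λ - x)) :=
    Real.one_le_exp (mul_nonneg hε0.le (by linarith))
  have hd1 : 1 ≤ d := one_le_mul_of_one_le_of_one_le hB1 hexp1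
  have hder : ∀ i, 1 ≤ i → i ≤ k →
      ‖iteratedFDerivWithin ℝ i (fun v : W × D ↦ a v.1 * l v) (U ×ˢ univ) (w, η)‖ ≤ d ^ i := by
    intro i h1i hi
    rw [iteratedFDerivWithin_of_isOpen i hSo hv]
    calc _ ≤ C i * Real.exp (-(ε * x)) := h1 i (Finset.mem_range.2 (Nat.lt_succ_of_le hi)) η
      _ ≤ B * Real.exp (ε * (Λ - x)) := by
        gcongr
        · exact hCB i hi
        · nlinarith
      _ ≤ d ^ i := le_self_pow₀ hd1 (by omega)
  have key := norm_iteratedFDerivWithin_comp_le (n := k) (t := univ) (g := Real.exp)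
    Real.contDiff_exp.contDiffOn hL.1 (by exact_mod_cast le_top) uniqueDiffOn_univ
    hSo.uniqueDiffOn (mapsTo_univ _ _) hv (C := Real.exp (a w * x)) (D := d)
    (fun i hi ↦ by rw [iteratedFDerivWithin_univ, norm_iteratedFDeriv_exp]) hder
  rw [iteratedFDerivWithin_of_isOpen k hSo hv] at key
  have e1 : Real.exp (a w * x) * d ^ k ≤
      B ^ k * Real.exp (k * (ε * Λ)) * Real.exp (4 * c * Λ) * Real.exp (c * x) := by
    rw [hd, mul_pow, ← Real.exp_nat_mul]
    have hkε : k * ε ≤ c := by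
      rw [hε, mul_div_assoc', div_le_iff₀ (by positivity)]; nlinarith
    have : a w * x + k * (ε * (Λ - x)) ≤ k * (ε * Λ) + 4 * c * Λ + c * x := by
      have h5 : (a w - c - k * ε) * x ≤ (a w - c - k * ε) * Λ :=
        mul_le_mul_of_nonneg_left hx (by linarith)
      have hkε0 : 0 ≤ k * ε := by positivity
      have h6 : (a w - c - k * ε) * Λ ≤ 4 * c * Λ :=
        mul_le_mul_of_nonneg_right (by linarith) hΛ0
      nlinarith
    calc _ = B ^ k * Real.exp (a w * x + k * (ε * (Λ - x))) := by rw [Real.exp_add]; ring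
      _ ≤ B ^ k * Real.exp (k * (ε * Λ) + 4 * c * Λ + c * x) := by gcongr
      _ = _ := by rw [Real.exp_add, Real.exp_add]; ring
  have hC₁η := hC₁ η
  calc _ ≤ (1 + ‖η‖) ^ N * (k.factorial * Real.exp (a w * x) * d ^ k) := by
        gcongr; exact key
    _ = (1 + ‖η‖) ^ N * k.factorial * (Real.exp (a w * x) * d ^ k) := by ring
    _ ≤ (1 + ‖η‖) ^ N * k.factorial *
        (B ^ k * Real.exp (k * (ε * Λ)) * Real.exp (4 * c * Λ) * Real.exp (c * x)) := by gcongr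
    _ = k.factorial * B ^ k * Real.exp (k * (ε * Λ)) * Real.exp (4 * c * Λ) *
        ((1 + ‖η‖) ^ N * Real.exp (c * x)) := by ring
    _ ≤ _ := by gcongr

lemma norm_iteratedFDeriv_snd_le (i : ℕ) (v : W × D) :
    ‖iteratedFDeriv ℝ i (Prod.snd : W × D → D) v‖ ≤ 1 + ‖v.2‖ := by
  rcases i with _ | i
  · rw [norm_iteratedFDeriv_zero]; linarith [norm_nonneg v.2]
  · rw [← norm_iteratedFDeriv_fderiv]
    have e : fderiv ℝ (Prod.snd : W × D → D) = fun _ ↦ ContinuousLinearMap.snd ℝ W D :=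
      funext fun _ ↦ fderiv_snd
    rw [e]
    rcases i with _ | i
    · rw [norm_iteratedFDeriv_zero]
      linarith [norm_nonneg v.2, ContinuousLinearMap.norm_snd_le ℝ W D]
    · rw [iteratedFDeriv_const_of_ne (by omega)]
      simp; positivity

lemma FibreDecayOn.smul_snd {U : Set W} (hU : IsOpen U) {F : W × D → ℝ} (h : FibreDecayOn U F) :
    FibreDecayOn U fun v ↦ F v • v.2 := by
  refine ⟨h.1.smul contDiffOn_snd, fun w₀ hw₀ k N ↦ ?_⟩
  choose C hC using fun i ↦ h.2 w₀ hw₀ i (N + 1)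
  have h1 := (Filter.eventually_all_finset (Finset.range (k + 1))).2 fun i _ ↦ hC i
  refine ⟨∑ i ∈ Finset.range (k + 1), (k.choose i : ℝ) * C i, ?_⟩
  filter_upwards [h1, hU.mem_nhds hw₀] with w h1 hw η
  have hSo : IsOpen (U ×ˢ (univ : Set D)) := hU.prod isOpen_univ
  have hv : (w, η) ∈ U ×ˢ (univ : Set D) := ⟨hw, mem_univ _⟩
  have key := norm_iteratedFDerivWithin_smul_le h.1
    (contDiffOn_snd : ContDiffOn ℝ ∞ (Prod.snd : W × D → D) (U ×ˢ univ)) hSo.uniqueDiffOn hv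
    (n := k) (by exact_mod_cast le_top)
  simp only [iteratedFDerivWithin_of_isOpen _ hSo hv] at key
  calc _ ≤ (1 + ‖η‖) ^ N * ∑ i ∈ Finset.range (k + 1), (k.choose i : ℝ) *
        ‖iteratedFDeriv ℝ i F (w, η)‖ * ‖iteratedFDeriv ℝ (k - i) Prod.snd (w, η)‖ := by
        gcongr
    _ ≤ (1 + ‖η‖) ^ N * ∑ i ∈ Finset.range (k + 1), (k.choose i : ℝ) *
        ‖iteratedFDeriv ℝ i F (w, η)‖ * (1 + ‖η‖) := by
        gcongr with i hi; exact norm_iteratedFDeriv_snd_le _ _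
    _ = ∑ i ∈ Finset.range (k + 1), (k.choose i : ℝ) *
        ((1 + ‖η‖) ^ (N + 1) * ‖iteratedFDeriv ℝ i F (w, η)‖) := by
        rw [Finset.mul_sum]; exact Finset.sum_congr rfl fun i _ ↦ by ring
    _ ≤ _ := Finset.sum_le_sum fun i hi ↦ by gcongr; exact h1 i hi η

end ExpDecay

/-! ### Generating functions of families with a parameter -/

section ParameterFamilies

variable {W Q : Type} [NormedAddCommGroup W] [NormedSpace ℝ W] [NormedAddCommGroup Q]
  [NormedSpace ℝ Q]

/-- Families on `V`, smooth in a parameter `ξ ∈ I` and vanishing for `ξ ∉ K`. -/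
def SmoothFamilyOn (I : Set ℝ) (V : Set W) (K : Set ℝ) (fam : ℝ → W → Q) : Prop :=
  ContDiffOn ℝ ∞ (fun v : ℝ × W ↦ fam v.1 v.2) (I ×ˢ V) ∧ ∀ ξ ∈ I \ K, ∀ w ∈ V, fam ξ w = 0

lemma Set.OrdConnected.uniqueDiffOn {I : Set ℝ} (hI : I.OrdConnected)
    (hIint : (interior I).Nonempty) : UniqueDiffOn ℝ I :=
  uniqueDiffOn_convex hI.convex hIint

namespace SmoothFamilyOn

variable {I K : Set ℝ} {V : Set W} {fam : ℝ → W → Q}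

lemma hasFDerivAt (h : SmoothFamilyOn I V K fam) (hV : IsOpen V) {ξ : ℝ} (hξ : ξ ∈ I) {w : W}
    (hw : w ∈ V) : HasFDerivAt (fam ξ) (_root_.fderiv ℝ (fam ξ) w) w := by
  have h1 : ContDiffOn ℝ ∞ (fam ξ) V :=
    h.1.comp (f := fun w ↦ (ξ, w)) (by fun_prop) fun w hw ↦ ⟨hξ, hw⟩
  exact ((h1.contDiffAt (hV.mem_nhds hw)).differentiableAt (by simp)).hasFDerivAt

lemma fderiv_eq (h : SmoothFamilyOn I V K fam) (hV : IsOpen V) {ξ : ℝ} (hξ : ξ ∈ I) {w : W}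
    (hw : w ∈ V) : _root_.fderiv ℝ (fam ξ) w =
      (fderivWithin ℝ (fun v : ℝ × W ↦ fam v.1 v.2) (I ×ˢ V) (ξ, w)).comp (.inr ℝ ℝ W) := by
  have h1 := ((h.1.differentiableOn (by simp)) (ξ, w) ⟨hξ, hw⟩).hasFDerivWithinAt
  have h2 : HasFDerivWithinAt (fam ξ) _ V w :=
    h1.comp (f := fun w ↦ (ξ, w)) w (hasFDerivAt_prodMk_right ξ w).hasFDerivWithinAt
      fun w hw ↦ ⟨hξ, hw⟩
  exact (h2.hasFDerivAt (hV.mem_nhds hw)).fderiv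

/-- Since I may contain endpoints, joint smoothness is expressed within I × V. The base derivative
is a component of the derivative within this set, hence again a smooth family. -/
lemma fderiv (h : SmoothFamilyOn I V K fam) (hV : IsOpen V) (hI : UniqueDiffOn ℝ I) :
    SmoothFamilyOn I V K fun ξ ↦ _root_.fderiv ℝ (fam ξ) := by
  refine ⟨?_, fun ξ hξ w hw ↦ ?_⟩
  · have h1 : ContDiffOn ℝ ∞ (fderivWithin ℝ (fun v : ℝ × W ↦ fam v.1 v.2) (I ×ˢ V)) (I ×ˢ V) :=
      h.1.fderivWithin (hI.prod hV.uniqueDiffOn) (by simp)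
    exact (h1.clm_comp contDiffOn_const).congr fun v hv ↦ h.fderiv_eq hV hv.1 hv.2
  · have : fam ξ =ᶠ[𝓝 w] fun _ ↦ 0 := by
      filter_upwards [hV.mem_nhds hw] with w hw using h.2 ξ hξ w hw
    exact this.fderiv_eq.trans (congrFun (fderiv_fun_const 0) w)

lemma const_mul_param {fam : ℝ → W → ℝ} (h : SmoothFamilyOn I V K fam) :
    SmoothFamilyOn I V K fun ξ w ↦ ξ * fam ξ w :=
  ⟨contDiffOn_fst.mul h.1, fun ξ hξ w hw ↦ by simp [h.2 ξ hξ w hw]⟩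

lemma exp_mul {fam : ℝ → W → ℝ} (h : SmoothFamilyOn I V K fam) :
    SmoothFamilyOn I (V ×ˢ (univ : Set ℝ)) K fun ξ v ↦ Real.exp (ξ * v.2) * fam ξ v.1 := by
  refine ⟨ContDiffOn.mul (by fun_prop) ?_, fun ξ hξ v hv ↦ by simp [h.2 ξ hξ v.1 hv.1]⟩
  exact h.1.comp (f := fun v : ℝ × (W × ℝ) ↦ (v.1, v.2.1)) (by fun_prop)
    fun v hv ↦ ⟨hv.1, hv.2.1⟩

lemma continuousOn_param (h : SmoothFamilyOn I V K fam) {w : W} (hw : w ∈ V) :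
    ContinuousOn (fun ξ ↦ fam ξ w) I :=
  h.1.continuousOn.comp (f := fun ξ ↦ (ξ, w)) (by fun_prop) fun ξ hξ ↦ ⟨hξ, hw⟩

lemma integrableOn (h : SmoothFamilyOn I V K fam) (hI : MeasurableSet I) (hK : IsCompact K)
    (hKI : K ⊆ I) {w : W} (hw : w ∈ V) : IntegrableOn (fun ξ ↦ fam ξ w) I := by
  have h1 : IntegrableOn (fun ξ ↦ fam ξ w) K :=
    ((h.continuousOn_param hw).mono hKI).integrableOn_compact hK
  exact h1.of_forall_sdiff_eq_zero hI fun ξ hξ ↦ h.2 ξ hξ w hw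

variable [FiniteDimensional ℝ W]

lemma hasFDerivAt_integral (h : SmoothFamilyOn I V K fam) (hV : IsOpen V) (hI : UniqueDiffOn ℝ I)
    (hIm : MeasurableSet I) (hK : IsCompact K) (hKI : K ⊆ I) {w : W} (hw : w ∈ V) :
    HasFDerivAt (fun w ↦ ∫ ξ in I, fam ξ w) (∫ ξ in I, _root_.fderiv ℝ (fam ξ) w) w := by
  have hd := h.fderiv hV hI
  have : ProperSpace W := FiniteDimensional.proper ℝ W
  obtain ⟨r, hr0, hr⟩ := Metric.nhds_basis_closedBall.mem_iff.1 (hV.mem_nhds hw)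
  obtain ⟨B, hB⟩ := (hK.prod (isCompact_closedBall w r)).exists_bound_of_continuousOn
    (hd.1.continuousOn.mono (prod_mono hKI hr))
  refine hasFDerivAt_integral_of_dominated_of_fderiv_le (Metric.closedBall_mem_nhds w hr0)
    ?_ (h.integrableOn hIm hK hKI hw) ((hd.continuousOn_param hw).aestronglyMeasurable hIm)
    (F' := fun w ξ ↦ _root_.fderiv ℝ (fam ξ) w) (bound := K.indicator fun _ ↦ B) ?_ ?_ ?_
  · filter_upwards [hV.mem_nhds hw] with w hw
    exact (h.continuousOn_param hw).aestronglyMeasurable hIm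
  · refine (ae_restrict_iff' hIm).2 (Filter.Eventually.of_forall fun ξ hξ w hw ↦ ?_)
    by_cases hξK : ξ ∈ K
    · rw [indicator_of_mem hξK]
      exact hB (ξ, w) ⟨hξK, hw⟩
    · rw [indicator_of_notMem hξK]
      exact (congrArg norm (hd.2 ξ ⟨hξ, hξK⟩ w (hr hw))).trans_le norm_zero.le
  · exact ((integrable_indicator_iff hK.measurableSet).2
      (integrableOn_const hK.measure_lt_top.ne)).mono_measure Measure.restrict_le_self
  · exact (ae_restrict_iff' hIm).2 (Filter.Eventually.of_forall fun ξ hξ w hw ↦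
      h.hasFDerivAt hV hξ (hr hw))

lemma contDiffOn_integral (h : SmoothFamilyOn I V K fam) (hV : IsOpen V) (hI : UniqueDiffOn ℝ I)
    (hIm : MeasurableSet I) (hK : IsCompact K) (hKI : K ⊆ I) :
    ContDiffOn ℝ ∞ (fun w ↦ ∫ ξ in I, fam ξ w) V := by
  rw [contDiffOn_infty]
  intro m
  induction m generalizing Q with
  | zero =>
    exact contDiffOn_zero.2 fun w hw ↦
      (h.hasFDerivAt_integral hV hI hIm hK hKI hw).continuousAt.continuousWithinAt
  | succ m ih =>
    push_cast
    rw [contDiffOn_succ_iff_hasFDerivWithinAt_of_uniqueDiffOn hV.uniqueDiffOn]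
    exact ⟨by simp, _, ih (h.fderiv hV hI), fun w hw ↦
      (h.hasFDerivAt_integral hV hI hIm hK hKI hw).hasFDerivWithinAt⟩

end SmoothFamilyOn

/-- The generating function `∫_I e^{ξ s} g_ξ dξ + ∑_{a < N} s^a g_a`. -/
def genFn (I : Set ℝ) (N : ℕ) (fam : ℝ → W → ℝ) (jet : ℕ → W → ℝ) (v : W × ℝ) : ℝ :=
  (∫ ξ in I, Real.exp (ξ * v.2) * fam ξ v.1) + ∑ a ∈ Finset.range N, v.2 ^ a * jet a v.1

variable [FiniteDimensional ℝ W] {I K : Set ℝ} {V : Set W} {fam : ℝ → W → ℝ} {jet : ℕ → W → ℝ}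
  {N : ℕ}

lemma contDiffOn_genFn (h : SmoothFamilyOn I V K fam) (hj : ∀ a, ContDiffOn ℝ ∞ (jet a) V)
    (hV : IsOpen V) (hI : UniqueDiffOn ℝ I) (hIm : MeasurableSet I) (hK : IsCompact K)
    (hKI : K ⊆ I) : ContDiffOn ℝ ∞ (genFn I N fam jet) (V ×ˢ univ) := by
  refine ContDiffOn.add (h.exp_mul.contDiffOn_integral (hV.prod isOpen_univ) hI hIm hK hKI) ?_
  refine ContDiffOn.sum fun a _ ↦ ContDiffOn.mul (by fun_prop) ?_
  exact (hj a).comp contDiffOn_fst fun v hv ↦ hv.1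

/-- Both partial derivatives are again generating functions: base derivatives act on the
coefficients, while ∂_s multiplies the family by ξ and shifts the polynomial coefficients, because
∂_s s^{a+1} = (a+1) s^a. -/
lemma fderiv_genFn_apply (h : SmoothFamilyOn I V K fam) (hj : ∀ a, ContDiffOn ℝ ∞ (jet a) V)
    (hN : ∀ a, N ≤ a → ∀ w ∈ V, jet a w = 0)
    (hV : IsOpen V) (hI : UniqueDiffOn ℝ I) (hIm : MeasurableSet I) (hK : IsCompact K)
    (hKI : K ⊆ I) {w : W} (hw : w ∈ V) (s : ℝ) (v : W) (t : ℝ) :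
    fderiv ℝ (genFn I N fam jet) (w, s) (v, t) =
      genFn I N (fun ξ w ↦ fderiv ℝ (fam ξ) w v) (fun a w ↦ fderiv ℝ (jet a) w v) (w, s) +
      t * genFn I N (fun ξ w ↦ ξ * fam ξ w) (fun a w ↦ (a + 1) * jet (a + 1) w) (w, s) := by
  have hVo : IsOpen (V ×ˢ (univ : Set ℝ)) := hV.prod isOpen_univ
  have hws : (w, s) ∈ V ×ˢ (univ : Set ℝ) := ⟨hw, mem_univ _⟩
  have h1 := h.exp_mul.hasFDerivAt_integral hVo hI hIm hK hKI hws
  have hjd : ∀ a, HasFDerivAt (jet a) (fderiv ℝ (jet a) w) w := fun a ↦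
    (((hj a).contDiffAt (hV.mem_nhds hw)).differentiableAt (by simp)).hasFDerivAt
  have hfst : HasFDerivAt (Prod.fst : W × ℝ → W) (.fst ℝ _ _) (w, s) := hasFDerivAt_fst
  have hsnd : HasFDerivAt (Prod.snd : W × ℝ → ℝ) (.snd ℝ _ _) (w, s) := hasFDerivAt_snd
  have h2 : HasFDerivAt (fun v : W × ℝ ↦ ∑ a ∈ Finset.range N, v.2 ^ a * jet a v.1) _ (w, s) :=
    HasFDerivAt.fun_sum fun a _ ↦ (hsnd.pow a).mul
      (HasFDerivAt.comp (g := jet a) (f := Prod.fst) (w, s) (hjd a) hfst)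
  have e1 : ∀ ξ ∈ I, fderiv ℝ (fun v : W × ℝ ↦ Real.exp (ξ * v.2) * fam ξ v.1) (w, s) (v, t) =
      Real.exp (ξ * s) * fderiv ℝ (fam ξ) w v + t * (Real.exp (ξ * s) * (ξ * fam ξ w)) := by
    intro ξ hξ
    have h3 : HasFDerivAt (fun v : W × ℝ ↦ Real.exp (ξ * v.2) * fam ξ v.1) _ (w, s) :=
      ((hsnd.const_mul ξ).exp).mul
        (HasFDerivAt.comp (g := fam ξ) (f := Prod.fst) (w, s) (h.hasFDerivAt hV hξ hw) hfst)
    rw [h3.fderiv]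
    simp
    ring
  have hint1 : IntegrableOn (fun ξ ↦ Real.exp (ξ * s) * fderiv ℝ (fam ξ) w v) I := by
    have hd := h.fderiv hV hI
    have : SmoothFamilyOn I V K fun ξ w ↦ fderiv ℝ (fam ξ) w v :=
      ⟨hd.1.clm_apply contDiffOn_const, fun ξ hξ w hw ↦ by simp [hd.2 ξ hξ w hw]⟩
    exact this.exp_mul.integrableOn hIm hK hKI hws
  have hint2 : IntegrableOn (fun ξ ↦ t * (Real.exp (ξ * s) * (ξ * fam ξ w))) I :=
    (h.const_mul_param.exp_mul.integrableOn hIm hK hKI hws).const_mul t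
  have hint3 := (h.exp_mul.fderiv hVo hI).integrableOn hIm hK hKI hws
  have h4 : HasFDerivAt (genFn I N fam jet) _ (w, s) := h1.add h2
  rw [h4.fderiv, add_apply, ContinuousLinearMap.integral_apply hint3,
    setIntegral_congr_fun hIm e1, integral_add hint1 hint2, integral_const_mul]
  simp only [genFn]
  -- Reindexing by one: the term a = 0 carries the factor a, and the coefficient with index N
  -- vanishes, so the same range serves on both sides.
  have e2 : ∀ (s : ℝ), ∑ a ∈ Finset.range N, (a * s ^ (a - 1)) * jet a w =
      ∑ a ∈ Finset.range N, s ^ a * ((a + 1) * jet (a + 1) w) := by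
    intro s
    have h5 := Finset.sum_range_succ (fun a : ℕ ↦ (a * s ^ (a - 1)) * jet a w) N
    rw [hN N le_rfl w hw, mul_zero, add_zero, Finset.sum_range_succ'] at h5
    rw [← h5]
    simp only [Nat.cast_zero, zero_mul, add_zero, Nat.add_sub_cancel]
    exact Finset.sum_congr rfl fun a _ ↦ by push_cast; ring
  rw [← e2]
  simp only [sum_apply, add_apply, smul_apply, ContinuousLinearMap.comp_apply,
    ContinuousLinearMap.coe_fst', ContinuousLinearMap.coe_snd', smul_eq_mul, nsmul_eq_mul,
    Finset.sum_add_distrib, Finset.mul_sum, mul_add]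
  have e3 : ∀ a : ℕ, jet a w * (a * s ^ (a - 1) * t) = t * (a * s ^ (a - 1) * jet a w) :=
    fun a ↦ by ring
  simp only [e3]
  ring

/-- As s is bounded above, only s → -∞ matters. There the least exponent in K dominates, and it is
at least -1/2 + r. Powers of s are no worse, because κ = 1/2 - r > 0 makes e^{-κs} exponentially
large. -/
lemma exists_genFn_weight (N : ℕ) {K : Set ℝ} (hK : IsCompact K) {r : ℝ} (hr : r ≤ 1 / 4)
    (hKr : ∀ ξ ∈ K, -1 / 2 + r ≤ ξ) (Λ : ℝ) :
    ∃ C, 0 ≤ C ∧ ∀ s ≤ Λ, (∀ ξ ∈ K, Real.exp (ξ * s) ≤ C * Real.exp ((-1 / 2 + r) * s)) ∧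
      ∀ a < N, |s| ^ a ≤ C * Real.exp ((-1 / 2 + r) * s) := by
  obtain ⟨R, hR⟩ := hK.isBounded.exists_norm_le
  set κ := 1 / 2 - r with hκ
  have hκ0 : 0 < κ := by linarith
  set C₁ := Real.exp ((|R| + κ) * |Λ|)
  set C₂ : ℕ → ℝ := fun a ↦ a.factorial / κ ^ a * Real.exp (2 * κ * |Λ|)
  have hC₂ : ∀ a, 0 ≤ C₂ a := fun a ↦ by positivity
  refine ⟨C₁ + ∑ a ∈ Finset.range N, C₂ a, ?_, fun s hs ↦ ⟨fun ξ hξ ↦ ?_, fun a ha ↦ ?_⟩⟩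
  · exact add_nonneg (Real.exp_pos _).le (Finset.sum_nonneg fun a _ ↦ hC₂ a)
  · have h1 : Real.exp (ξ * s) ≤ C₁ * Real.exp ((-1 / 2 + r) * s) := by
      rw [← Real.exp_add]
      apply Real.exp_le_exp.2
      have h2 : ξ ≤ |R| := (le_abs_self ξ).trans ((hR ξ hξ).trans (le_abs_self R))
      have h3 : (ξ + κ) * s ≤ (ξ + κ) * |Λ| :=
        mul_le_mul_of_nonneg_left (hs.trans (le_abs_self Λ)) (by linarith [hKr ξ hξ])
      have h4 : (ξ + κ) * |Λ| ≤ (|R| + κ) * |Λ| :=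
        mul_le_mul_of_nonneg_right (by linarith) (abs_nonneg _)
      have h5 : ξ * s = (ξ + κ) * s + (-1 / 2 + r) * s := by rw [hκ]; ring
      linarith
    refine h1.trans (mul_le_mul_of_nonneg_right ?_ (Real.exp_pos _).le)
    linarith [Finset.sum_nonneg fun a (_ : a ∈ Finset.range N) ↦ hC₂ a]
  · have h1 : |s| ^ a ≤ C₂ a * Real.exp ((-1 / 2 + r) * s) := by
      have h2 := Real.pow_div_factorial_le_exp (κ * |s|) (by positivity) a
      have h3 : Real.exp (κ * |s|) ≤ Real.exp (2 * κ * |Λ|) * Real.exp ((-1 / 2 + r) * s) := by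
        rw [← Real.exp_add]
        apply Real.exp_le_exp.2
        have h4 : |s| ≤ 2 * |Λ| - s := by
          rcases abs_cases s with ⟨h, -⟩ | ⟨h, -⟩
          · linarith [le_abs_self Λ]
          · linarith [abs_nonneg Λ]
        have h5 : κ * |s| ≤ κ * (2 * |Λ| - s) := mul_le_mul_of_nonneg_left h4 hκ0.le
        have h6 : κ * (2 * |Λ| - s) = 2 * κ * |Λ| + (-1 / 2 + r) * s := by rw [hκ]; ring
        linarith
      calc |s| ^ a = a.factorial / κ ^ a * ((κ * |s|) ^ a / a.factorial) := by
            rw [mul_pow]; field_simp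
        _ ≤ a.factorial / κ ^ a * (Real.exp (2 * κ * |Λ|) * Real.exp ((-1 / 2 + r) * s)) := by
            gcongr; exact h2.trans h3
        _ = _ := by ring
    refine h1.trans (mul_le_mul_of_nonneg_right ?_ (Real.exp_pos _).le)
    have := Finset.single_le_sum (f := C₂) (fun i _ ↦ hC₂ i) (Finset.mem_range.2 ha)
    linarith [Real.exp_pos ((|R| + κ) * |Λ|)]

lemma abs_genFn_le (hIm : MeasurableSet I) (hK : IsCompact K) (hKI : K ⊆ I) {s c B : ℝ} {w : W}
    (hz : ∀ ξ ∈ I \ K, fam ξ w = 0)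
    (h1 : ∀ ξ ∈ K, Real.exp (ξ * s) ≤ c) (h2 : ∀ a < N, |s| ^ a ≤ c)
    (h3 : ∀ ξ ∈ K, |fam ξ w| ≤ B) (h4 : ∀ a < N, |jet a w| ≤ B) :
    |genFn I N fam jet (w, s)| ≤ (volume.real K + N) * B * c := by
  rw [genFn, setIntegral_eq_of_subset_of_forall_sdiff_eq_zero hIm hKI
    fun ξ hξ ↦ by simp [hz ξ hξ]]
  refine (abs_add_le _ _).trans ?_
  have e1 : |∫ ξ in K, Real.exp (ξ * s) * fam ξ w| ≤ c * B * volume.real K := by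
    refine norm_setIntegral_le_of_norm_le_const (f := fun ξ ↦ Real.exp (ξ * s) * fam ξ w)
      hK.measure_lt_top fun ξ hξ ↦ ?_
    rw [norm_mul, Real.norm_of_nonneg (Real.exp_pos _).le]
    exact mul_le_mul (h1 ξ hξ) (h3 ξ hξ) (norm_nonneg _) ((Real.exp_pos _).le.trans (h1 ξ hξ))
  have e2 : |∑ a ∈ Finset.range N, s ^ a * jet a w| ≤ N * (c * B) := by
    refine (Finset.abs_sum_le_sum_abs _ _).trans ?_
    have : ∀ a ∈ Finset.range N, |s ^ a * jet a w| ≤ c * B := fun a ha ↦ by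
      have ha := Finset.mem_range.1 ha
      rw [abs_mul, abs_pow]
      exact mul_le_mul (h2 a ha) (h4 a ha) (abs_nonneg _)
        ((pow_nonneg (abs_nonneg s) a).trans (h2 a ha))
    simpa using Finset.sum_le_card_nsmul _ _ _ this
  calc _ ≤ c * B * volume.real K + N * (c * B) := add_le_add e1 e2
    _ = _ := by ring

/-- Generating functions and their first derivatives grow slower than `e^{-s / 2}`. -/
lemma exists_genFn_bound (h : SmoothFamilyOn I V K fam) (hj : ∀ a, ContDiffOn ℝ ∞ (jet a) V)
    (hN : ∀ a, N ≤ a → ∀ w ∈ V, jet a w = 0)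
    (hV : IsOpen V) (hI : UniqueDiffOn ℝ I) (hIm : MeasurableSet I) (hK : IsCompact K)
    (hKI : K ⊆ I) {r : ℝ} (hr : r ≤ 1 / 4) (hKr : ∀ ξ ∈ K, -1 / 2 + r ≤ ξ) {L : Set W}
    (hL : IsCompact L) (hLV : L ⊆ V) (Λ : ℝ) :
    ∃ C, 0 ≤ C ∧ ∀ w ∈ L, ∀ s ≤ Λ, |genFn I N fam jet (w, s)| ≤ C * Real.exp ((-1 / 2 + r) * s) ∧
      ‖fderiv ℝ (genFn I N fam jet) (w, s)‖ ≤ C * Real.exp ((-1 / 2 + r) * s) := by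
  obtain ⟨C, hC0, hC⟩ := exists_genFn_weight N hK hr hKr Λ
  have hd := h.fderiv hV hI
  -- The range is N + 1 because the s-derivative uses coefficients with index a + 1, a < N.
  have hjet : ∀ {Q : Type} [NormedAddCommGroup Q] (j : ℕ → W → Q), (∀ a, ContinuousOn (j a) V) →
      ∃ B, 0 ≤ B ∧ ∀ w ∈ L, ∀ a < N + 1, ‖j a w‖ ≤ B := by
    intro Q _ j hjc
    choose B hB using fun a ↦ hL.exists_bound_of_continuousOn ((hjc a).mono hLV)
    refine ⟨∑ a ∈ Finset.range (N + 1), |B a|, Finset.sum_nonneg fun _ _ ↦ abs_nonneg _,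
      fun w hw a ha ↦ (hB a w hw).trans ((le_abs_self _).trans ?_)⟩
    exact Finset.single_le_sum (f := fun a ↦ |B a|) (fun i _ ↦ abs_nonneg _) (Finset.mem_range.2 ha)
  obtain ⟨B₁, hB₁⟩ := (hK.prod hL).exists_bound_of_continuousOn
    (h.1.continuousOn.mono (prod_mono hKI hLV))
  obtain ⟨B₂, hB₂⟩ := (hK.prod hL).exists_bound_of_continuousOn
    (hd.1.continuousOn.mono (prod_mono hKI hLV))
  obtain ⟨B₃, hB₃0, hB₃⟩ := hjet jet fun a ↦ (hj a).continuousOn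
  obtain ⟨B₄, hB₄0, hB₄⟩ := hjet (fun a ↦ fderiv ℝ (jet a)) fun a ↦
    (hj a).continuousOn_fderiv_of_isOpen hV (by simp)
  obtain ⟨R, hR⟩ := hK.isBounded.exists_norm_le
  set B := |B₁| + |B₂| + B₃ + B₄ with hB
  have hB0 : 0 ≤ B := by positivity
  -- T bounds both factors created by ∂_s: ξ in the family and a + 1 in the polynomial part.
  set T := |R| + N + 1 with hT
  have hT1 : 1 ≤ T := by
    have : (0 : ℝ) ≤ N := Nat.cast_nonneg N
    linarith [abs_nonneg R]
  have hm0 : 0 ≤ volume.real K + N := by positivity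
  have b1 : ∀ ξ ∈ K, ∀ w ∈ L, |fam ξ w| ≤ B := fun ξ hξ w hw ↦ by
    have : |fam ξ w| ≤ B₁ := hB₁ (ξ, w) ⟨hξ, hw⟩
    linarith [le_abs_self B₁, abs_nonneg B₂]
  have b3 : ∀ a < N + 1, ∀ w ∈ L, |jet a w| ≤ B := fun a ha w hw ↦ by
    have : |jet a w| ≤ B₃ := hB₃ w hw a ha
    linarith [abs_nonneg B₁, abs_nonneg B₂]
  refine ⟨(volume.real K + N) * B * C * (1 + T), by positivity, fun w hw s hs ↦ ?_⟩
  obtain ⟨c1, c2⟩ := hC s hs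
  set c := C * Real.exp ((-1 / 2 + r) * s) with hc
  have hc0 : 0 ≤ c := by positivity
  have g1 : |genFn I N fam jet (w, s)| ≤ (volume.real K + N) * B * c :=
    abs_genFn_le hIm hK hKI (fun ξ hξ ↦ h.2 ξ hξ w (hLV hw)) c1 c2
      (fun ξ hξ ↦ b1 ξ hξ w hw) fun a ha ↦ b3 a (by omega) w hw
  have g2 : |genFn I N (fun ξ w ↦ ξ * fam ξ w) (fun a w ↦ (a + 1) * jet (a + 1) w) (w, s)| ≤
      (volume.real K + N) * (T * B) * c := by
    refine abs_genFn_le hIm hK hKI (fun ξ hξ ↦ by simp [h.2 ξ hξ w (hLV hw)])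
      c1 c2 (fun ξ hξ ↦ ?_) fun a ha ↦ ?_
    · rw [abs_mul]
      refine mul_le_mul ?_ (b1 ξ hξ w hw) (abs_nonneg _) (by linarith)
      have : |ξ| ≤ R := hR ξ hξ
      have hN0 : (0 : ℝ) ≤ N := Nat.cast_nonneg N
      linarith [le_abs_self R]
    · rw [abs_mul, abs_of_nonneg (by positivity : (0 : ℝ) ≤ a + 1)]
      refine mul_le_mul ?_ (b3 (a + 1) (by omega) w hw) (abs_nonneg _) (by linarith)
      have : (a : ℝ) ≤ N := by exact_mod_cast ha.le
      linarith [abs_nonneg R]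
  have g3 : ∀ v, |genFn I N (fun ξ w ↦ fderiv ℝ (fam ξ) w v) (fun a w ↦ fderiv ℝ (jet a) w v)
      (w, s)| ≤ (volume.real K + N) * (B * ‖v‖) * c := by
    intro v
    refine abs_genFn_le hIm hK hKI
      (fun ξ hξ ↦ by simp [hd.2 ξ hξ w (hLV hw)]) c1 c2 (fun ξ hξ ↦ ?_) fun a ha ↦ ?_
    · refine ((fderiv ℝ (fam ξ) w).le_opNorm v).trans ?_
      gcongr
      have : ‖fderiv ℝ (fam ξ) w‖ ≤ B₂ := hB₂ (ξ, w) ⟨hξ, hw⟩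
      linarith [le_abs_self B₂, abs_nonneg B₁]
    · refine ((fderiv ℝ (jet a) w).le_opNorm v).trans ?_
      gcongr
      have : ‖fderiv ℝ (jet a) w‖ ≤ B₄ := hB₄ w hw a (by omega)
      linarith [abs_nonneg B₁, abs_nonneg B₂]
  have hcc : (volume.real K + N) * B * C * (1 + T) * Real.exp ((-1 / 2 + r) * s) =
      (volume.real K + N) * B * c * (1 + T) := by rw [hc]; ring
  rw [hcc]
  have hM : 0 ≤ (volume.real K + N) * B * c := by positivity
  refine ⟨g1.trans (le_mul_of_one_le_right hM (by linarith)), ?_⟩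
  refine ContinuousLinearMap.opNorm_le_bound _ (by positivity) ?_
  rintro ⟨v, t⟩
  rw [fderiv_genFn_apply h hj hN hV hI hIm hK hKI (hLV hw)]
  have hv : ‖v‖ ≤ ‖(v, t)‖ := norm_fst_le (v, t)
  have ht : |t| ≤ ‖(v, t)‖ := norm_snd_le (v, t)
  refine (norm_add_le _ _).trans ?_
  rw [norm_mul]
  calc _ ≤ (volume.real K + N) * (B * ‖v‖) * c + |t| * ((volume.real K + N) * (T * B) * c) := by
        exact add_le_add (g3 v) (mul_le_mul_of_nonneg_left g2 (abs_nonneg t))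
    _ ≤ (volume.real K + N) * (B * ‖(v, t)‖) * c +
        ‖(v, t)‖ * ((volume.real K + N) * (T * B) * c) := by gcongr
    _ = _ := by ring

end ParameterFamilies

/-! ### Smoothness of the densities attached to a distribution function -/

section FibreIntegralSmoothness

variable {n : ℕ} {M : Type*} [TopologicalSpace M] [ChartedSpace (ModelE n) M]
  [IsManifold 𝓘(ℝ, ModelE n) ∞ M]

/-- The logarithm of a distribution function in canonical coordinates. -/
def logRep (f : CotBundle n M → ℝ) (x : M) (w : ModelE n × ModelD n) : ℝ :=
  Real.log (f ((cotChart x).symm w))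

lemma exp_mul_logRep {f : CotBundle n M → ℝ} (hf : ∀ z, 0 < f z) (x : M) (s : ℝ)
    (w : ModelE n × ModelD n) : Real.exp (s * logRep f x w) = f ((cotChart x).symm w) ^ s := by
  rw [logRep, Real.rpow_def_of_pos (hf _), mul_comm]

lemma contDiffOn_logRep {f : CotBundle n M → ℝ} (hf : ContMDiff (cotModel n) 𝓘(ℝ, ℝ) ∞ f)
    (h0 : ∀ z, 0 < f z) (x : M) :
    ContDiffOn ℝ ∞ (logRep f x) ((chartAt (ModelE n) x).target ×ˢ univ) := by
  rw [← cotChart_target]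
  exact (contMDiff_cotBundle_iff.1 hf x).log fun w _ ↦ (h0 _).ne'

lemma logDecayOn_logRep {f : CotBundle n M → ℝ} (hf : f ∈ PosDistributions n M) (x : M) :
    LogDecayOn (chartAt (ModelE n) x).target (logRep f x) := by
  obtain ⟨hs, h0, hd⟩ := hf
  refine ⟨contDiffOn_logRep hs h0 x, fun s hs0 ↦ ⟨Real.contDiff_exp.comp_contDiffOn
    (contDiffOn_const.mul (contDiffOn_logRep hs h0 x)), fun y₀ hy₀ k N ↦ ?_⟩⟩
  obtain ⟨K, hK, hKt, hKc⟩ := LocallyCompactSpace.local_compact_nhds y₀ _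
    ((chartAt (ModelE n) x).open_target.mem_nhds hy₀)
  obtain ⟨C, hC⟩ := hd x K hKc hKt s hs0 k N
  refine ⟨C, ?_⟩
  filter_upwards [hK] with y hy η
  simpa only [exp_mul_logRep h0] using hC y hy η

variable [T2Space M]

/-- A compact set meets the fibres over a neighbourhood in a bounded set. -/
lemma exists_fibre_radius {K : Set (CotBundle n M)} (hK : IsCompact K) (x : M) {y₀ : ModelE n}
    (hy₀ : y₀ ∈ (chartAt (ModelE n) x).target) : ∃ R : ℝ, ∀ᶠ y in 𝓝 y₀, ∀ η : ModelD n,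
      R < ‖η‖ → (cotChart x).symm (y, η) ∉ K := by
  obtain ⟨L, hL, hLt, hLc⟩ := LocallyCompactSpace.local_compact_nhds y₀ _
    ((chartAt (ModelE n) x).open_target.mem_nhds hy₀)
  have hL' : IsCompact ((chartAt (ModelE n) x).symm '' L) :=
    hLc.image_of_continuousOn ((chartAt (ModelE n) x).continuousOn_symm.mono hLt)
  have hKL : IsCompact (K ∩ TotalSpace.proj ⁻¹' ((chartAt (ModelE n) x).symm '' L)) :=
    hK.inter_right (hL'.isClosed.preimage continuous_cotProj)
  have hsub : K ∩ TotalSpace.proj ⁻¹' ((chartAt (ModelE n) x).symm '' L) ⊆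
      (cotChart (n := n) x).source := by
    rintro z ⟨-, y, hy, hyz⟩
    rw [mem_cotChart_source, ← hyz]
    exact (chartAt (ModelE n) x).map_target (hLt hy)
  obtain ⟨R, hR⟩ := (hKL.image_of_continuousOn
    ((continuousOn_cotChart x).mono hsub)).isBounded.exists_norm_le
  refine ⟨R, ?_⟩
  filter_upwards [hL] with y hy η hη hzK
  have hw : (y, η) ∈ (cotChart (n := n) x).target := mem_cotChart_target.2 (hLt hy)
  have h1 := hR _ (mem_image_of_mem _ (show (cotChart x).symm (y, η) ∈ _ from
    ⟨hzK, y, hy, (proj_cotChart_symm x (hLt hy) η).symm⟩))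
  rw [(cotChart (n := n) x).right_inv hw] at h1
  exact absurd ((norm_snd_le (y, η)).trans h1) (not_le.2 hη)

section Kernels

variable {P : Type} [NormedAddCommGroup P] [NormedSpace ℝ P]

/-- A family of functions on `T*M` that are, in canonical coordinates, rapidly decreasing along
the fibres together with all derivatives. -/
def FibreDecayFamily (S : Set P) (h : P → CotBundle n M → ℝ) : Prop :=
  ∀ x : M, FibreDecayOn (S ×ˢ (chartAt (ModelE n) x).target)
    fun v : (P × ModelE n) × ModelD n ↦ h v.1.1 ((cotChart x).symm (v.1.2, v.2))

lemma FibreDecayFamily.smoothDensityOn {S : Set P} (hS : IsOpen S) {h : P → CotBundle n M → ℝ}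
    (hh : FibreDecayFamily S h) :
    SmoothDensityOn n S fun p (q : M) ↦ ∫ η, h p (mkCot q η) ∂(covectorVolume n) := by
  intro x
  refine ((hh x).contDiffOn_integral (hS.prod (chartAt (ModelE n) x).open_target)
    integrable_one_add_norm_covector).congr fun w hw ↦ ?_
  exact densityRep_fibreIntegral x (h w.1) hw.2

lemma FibreDecayFamily.smoothCovDensityOn {S : Set P} (hS : IsOpen S) {h : P → CotBundle n M → ℝ}
    (hh : FibreDecayFamily S h) :
    SmoothCovDensityOn S fun p (q : M) ↦ ∫ η, h p (mkCot q η) • η ∂(covectorVolume n) := by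
  intro x
  have hU := hS.prod (chartAt (ModelE n) x).open_target
  refine (((hh x).smul_snd hU).contDiffOn_integral hU integrable_one_add_norm_covector).congr
    fun w hw ↦ ?_
  exact covDensityRep_fibreIntegral x (h w.1) hw.2

lemma FibreDecayFamily.integrable_smul {S : Set P} (hS : IsOpen S) {h : P → CotBundle n M → ℝ}
    (hh : FibreDecayFamily S h) {p : P} (hp : p ∈ S) (q : M) :
    Integrable (fun η ↦ h p (mkCot q η) • η) (covectorVolume n) := by
  have := ((hh q).smul_snd (hS.prod (chartAt (ModelE n) q).open_target)).integrable
    (w := (p, chartAt (ModelE n) q q)) integrable_one_add_norm_covector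
    ⟨hp, mem_chart_target _ _⟩
  simpa only [cotChart_symm_preferred] using this

lemma FibreDecayOn.hasDerivAt_integral_comp {W Q : Type} [NormedAddCommGroup W] [NormedSpace ℝ W]
    [NormedAddCommGroup Q] [NormedSpace ℝ Q] [CompleteSpace Q] {U : Set W}
    {F : W × ModelD n → Q} (h : FibreDecayOn U F) (hU : IsOpen U) {w : ℝ → W} {w' : W} {t : ℝ}
    (hw : HasDerivAt w w' t) (ht : w t ∈ U) :
    HasDerivAt (fun t ↦ ∫ η, F (w t, η) ∂(covectorVolume n))
      (∫ η, deriv (fun t ↦ F (w t, η)) t ∂(covectorVolume n)) t := by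
  have h1 := (h.hasFDerivAt_integral hU integrable_one_add_norm_covector ht).comp_hasDerivAt t hw
  have h2 := (h.fderiv_base hU).integrable integrable_one_add_norm_covector ht
  convert h1 using 1
  · rfl
  rw [ContinuousLinearMap.integral_apply h2]
  congr 1; ext η
  exact ((h.hasFDerivAt_base hU ht η).comp_hasDerivAt t hw).deriv

lemma FibreDecayFamily.hasDerivAt {S : Set P} (hS : IsOpen S) {h : P → CotBundle n M → ℝ}
    (hh : FibreDecayFamily S h) {p : ℝ → P} {p' : P} {t : ℝ} (hp : HasDerivAt p p' t)
    (ht : p t ∈ S) (q : M) :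
    HasDerivAt (fun t ↦ ∫ η, h (p t) (mkCot q η) ∂(covectorVolume n))
      (∫ η, deriv (fun t ↦ h (p t) (mkCot q η)) t ∂(covectorVolume n)) t := by
  have := (hh q).hasDerivAt_integral_comp (hS.prod (chartAt (ModelE n) q).open_target)
    (hp.prodMk (hasDerivAt_const t (chartAt (ModelE n) q q))) ⟨ht, mem_chart_target _ _⟩
  simpa only [cotChart_symm_preferred] using this

lemma FibreDecayFamily.hasDerivAt_smul {S : Set P} (hS : IsOpen S) {h : P → CotBundle n M → ℝ}
    (hh : FibreDecayFamily S h) {p : ℝ → P} {p' : P} {t : ℝ} (hp : HasDerivAt p p' t)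
    (ht : p t ∈ S) (q : M) :
    HasDerivAt (fun t ↦ ∫ η, h (p t) (mkCot q η) • η ∂(covectorVolume n))
      (∫ η, deriv (fun t ↦ h (p t) (mkCot q η) • η) t ∂(covectorVolume n)) t := by
  have hU := hS.prod (chartAt (ModelE n) q).open_target
  have := ((hh q).smul_snd hU).hasDerivAt_integral_comp hU
    (hp.prodMk (hasDerivAt_const t (chartAt (ModelE n) q q))) ⟨ht, mem_chart_target _ _⟩
  simpa only [cotChart_symm_preferred] using this

/-- The parameter counts as part of the base: f^a with a function a on P × M is a power with
variable exponent. Joint smoothness in ξ and q is thus a single application of `LogDecayOn.exp_mul`.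
-/
lemma fibreDecayFamily_rpow {f : CotBundle n M → ℝ} (hf : f ∈ PosDistributions n M) {S : Set P}
    (hS : IsOpen S) {a : P → ℝ} (ha : ContDiff ℝ ∞ a) (ha0 : ∀ p ∈ S, 0 < a p) :
    FibreDecayFamily S fun p z ↦ f z ^ a p := by
  intro x
  have h1 := ((logDecayOn_logRep hf x).pullback (chartAt (ModelE n) x).open_target S).exp_mul
    (hS.prod (chartAt (ModelE n) x).open_target) (a := fun w ↦ a w.1)
    (ha.comp contDiff_fst).contDiffOn fun w hw ↦ ha0 _ hw.1
  simpa only [exp_mul_logRep hf.2.1] using h1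

end Kernels

section Variations

variable {f : CotBundle n M → ℝ} {c : ℝ → CotBundle n M → ℝ}

lemma IsKineticVariation.contDiffOn (hc : IsKineticVariation f c) (x : M) :
    ContDiffOn ℝ ∞ (fun v : ℝ × (ModelE n × ModelD n) ↦ c v.1 ((cotChart x).symm v.2))
      (univ ×ˢ ((chartAt (ModelE n) x).target ×ˢ univ)) := by
  rw [← cotChart_target, ← contMDiffOn_iff_contDiffOn]
  have h2 : ContMDiffOn 𝓘(ℝ, ModelE n × ModelD n) (cotModel n) ∞ (cotChart (n := n) x).symm
      (cotChart (n := n) x).target := contMDiffOn_extChartAt_symm _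
  have h3 : ContMDiffOn 𝓘(ℝ, ℝ × (ModelE n × ModelD n)) 𝓘(ℝ, ModelE n × ModelD n) ∞
      (Prod.snd : ℝ × (ModelE n × ModelD n) → _) (univ ×ˢ (cotChart (n := n) x).target) :=
    contDiff_snd.contMDiff.contMDiffOn
  have h4 : ContMDiffOn 𝓘(ℝ, ℝ × (ModelE n × ModelD n)) 𝓘(ℝ, ℝ) ∞
      (Prod.fst : ℝ × (ModelE n × ModelD n) → _) (univ ×ˢ (cotChart (n := n) x).target) :=
    contDiff_fst.contMDiff.contMDiffOn
  exact hc.2.2.1.comp_contMDiffOn (h4.prodMk (h2.comp h3 fun v hv ↦ hv.2))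

/-- A variation coincides with f off a compact set, so the decay of f^a passes to it. Time and
exponent are both functions of the parameter p, which covers smoothness in t alone and in (t, ξ). -/
lemma IsKineticVariation.fibreDecayFamily (hf : f ∈ PosDistributions n M)
    (hc : IsKineticVariation f c) {P : Type} [NormedAddCommGroup P] [NormedSpace ℝ P] {S : Set P}
    (hS : IsOpen S) {a τ : P → ℝ} (ha : ContDiff ℝ ∞ a) (ha0 : ∀ p ∈ S, 0 < a p)
    (hτ : ContDiff ℝ ∞ τ) : FibreDecayFamily S fun p z ↦ c (τ p) z ^ a p := by
  intro x
  refine (fibreDecayFamily_rpow hf hS ha ha0 x).of_eq_off_compact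
    (hS.prod (chartAt (ModelE n) x).open_target) ?_ ?_
  · refine ContDiffOn.rpow ?_ (by fun_prop) fun v _ ↦ ((hc.2.1 _).2.1 _).ne'
    exact (hc.contDiffOn x).comp
      (f := fun v : (P × ModelE n) × ModelD n ↦ (τ v.1.1, (v.1.2, v.2))) (by fun_prop)
      fun v hv ↦ ⟨mem_univ _, hv.1.2, mem_univ _⟩
  · obtain ⟨K, hK, hK0⟩ := hc.2.2.2
    rintro ⟨p, y⟩ ⟨-, hy⟩
    obtain ⟨R, hR⟩ := exists_fibre_radius hK x hy
    refine ⟨R, ?_⟩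
    filter_upwards [continuous_snd.continuousAt.eventually hR] with w hw η hη
    rw [hK0 _ _ (hw η hη)]

end Variations

end FibreIntegralSmoothness

/-! ### Images of variations under J -/

section VariationTransport

variable {n : ℕ} {M : Type*} [TopologicalSpace M] [ChartedSpace (ModelE n) M]
  [IsManifold 𝓘(ℝ, ModelE n) ∞ M] [T2Space M]

lemma SmoothDensityOn.mono {P : Type*} [NormedAddCommGroup P] [NormedSpace ℝ P] {S T : Set P}
    {c : P → M → ℝ} (h : SmoothDensityOn n T c) (hST : S ⊆ T) : SmoothDensityOn n S c :=
  fun x ↦ (h x).mono (prod_mono hST Subset.rfl)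

/-- The velocity of a variation. -/
def kineticVelocity (c : ℝ → CotBundle n M → ℝ) (z : CotBundle n M) : ℝ := deriv (fun t ↦ c t z) 0

section Velocity

variable {f : CotBundle n M → ℝ} {c : ℝ → CotBundle n M → ℝ}

lemma IsKineticVariation.differentiableAt (hc : IsKineticVariation f c) (z : CotBundle n M)
    (t : ℝ) : DifferentiableAt ℝ (fun t ↦ c t z) t := by
  have hz : cotChart z.proj z ∈ (cotChart (n := n) z.proj).target :=
    (cotChart (n := n) z.proj).map_source (mem_cotChart_source.2 (mem_chart_source _ _))
  have h1 := (hc.contDiffOn z.proj).comp (f := fun t ↦ (t, cotChart z.proj z)) (s := univ)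
    (by fun_prop) fun t _ ↦ ⟨mem_univ _, by rw [← cotChart_target]; exact hz⟩
  have h2 : DifferentiableAt ℝ _ t :=
    (contDiffOn_univ.1 h1).contDiffAt.differentiableAt (by simp)
  have e := (cotChart (n := n) z.proj).left_inv
    (mem_cotChart_source.2 (mem_chart_source _ _) : z ∈ (cotChart (n := n) z.proj).source)
  simpa only [Function.comp_def, e] using h2

lemma IsKineticVariation.hasDerivAt (hc : IsKineticVariation f c) (z : CotBundle n M) :
    HasDerivAt (fun t ↦ c t z) (kineticVelocity c z) 0 :=
  (hc.differentiableAt z 0).hasDerivAt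

lemma IsKineticVariation.contMDiff_velocity (hc : IsKineticVariation f c) :
    ContMDiff (cotModel n) 𝓘(ℝ, ℝ) ∞ (kineticVelocity c) := by
  rw [contMDiff_cotBundle_iff]
  intro x
  have ho : IsOpen ((univ : Set ℝ) ×ˢ ((chartAt (ModelE n) x).target ×ˢ (univ : Set (ModelD n)))) :=
    isOpen_univ.prod ((chartAt (ModelE n) x).open_target.prod isOpen_univ)
  have h1 := (hc.contDiffOn x).fderiv_of_isOpen (m := ∞) ho (by simp)
  have h2 : ContDiffOn ℝ ∞ (fun w : ModelE n × ModelD n ↦ fderiv ℝ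
      (fun v : ℝ × (ModelE n × ModelD n) ↦ c v.1 ((cotChart x).symm v.2)) (0, w) (1, 0))
      (cotChart (n := n) x).target := by
    rw [cotChart_target]
    exact (h1.comp (f := fun w : ModelE n × ModelD n ↦ ((0 : ℝ), w)) (by fun_prop)
      fun w hw ↦ ⟨mem_univ _, hw⟩).clm_apply contDiffOn_const
  refine h2.congr fun w hw ↦ ?_
  rw [cotChart_target] at hw
  have h3 : DifferentiableAt ℝ (fun v : ℝ × (ModelE n × ModelD n) ↦
      c v.1 ((cotChart x).symm v.2)) (0, w) :=
    ((hc.contDiffOn x).contDiffAt (ho.mem_nhds ⟨mem_univ _, hw⟩)).differentiableAt (by simp)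
  exact (h3.hasFDerivAt.comp_hasDerivAt (f := fun t : ℝ ↦ (t, w)) (0 : ℝ)
    ((hasDerivAt_id _).prodMk (hasDerivAt_const _ w))).deriv

lemma IsKineticVariation.exists_compact (hc : IsKineticVariation f c) :
    ∃ K, IsCompact K ∧ ∀ z ∉ K, kineticVelocity c z = 0 := by
  obtain ⟨K, hK, h⟩ := hc.2.2.2
  refine ⟨K, hK, fun z hz ↦ ?_⟩
  have : (fun t ↦ c t z) = fun _ ↦ f z := funext fun t ↦ h t z hz
  rw [kineticVelocity, this, deriv_const]

lemma isSmooth_combinedJ (hf : f ∈ PosDistributions n M) {I : Set ℝ}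
    (hI : I ⊆ Ioi (-1 / 2 : ℝ)) : (combinedJ f).IsSmooth I := by
  constructor
  · have h := (fibreDecayFamily_rpow hf (P := ℝ) isOpen_univ (a := fun _ ↦ 1) contDiff_const
      fun _ _ ↦ one_pos).smoothCovDensityOn isOpen_univ
    simp only [Real.rpow_one] at h
    exact h
  -- The interval I need not be open; smoothness is obtained on the open half-line ξ > -1, where the
  -- exponent 1 + ξ is positive, and restricted.
  · have h := (fibreDecayFamily_rpow hf (P := ℝ) isOpen_Ioi (S := Ioi (-1)) (a := fun ξ ↦ 1 + ξ)
      (by fun_prop) fun ξ (hξ : -1 < ξ) ↦ by linarith).smoothDensityOn isOpen_Ioi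
    exact SmoothDensityOn.mono h fun ξ hξ ↦ by
      have : -1 / 2 < ξ := hI hξ
      show -1 < ξ; linarith

/-- The images of a kinetic variation form a variation of the image. -/
lemma IsKineticVariation.isPathVariation (hf : f ∈ PosDistributions n M)
    (hc : IsKineticVariation f c) {I : Set ℝ} (hI : I ⊆ Ioi (-1 / 2 : ℝ)) :
    IsPathVariation I (combinedJ f) fun t ↦ combinedJ (c t) := by
  refine ⟨by beta_reduce; rw [hc.1], fun t ↦ isSmooth_combinedJ (hc.2.1 t) hI, ?_, ?_, ?_⟩
  · have h := (hc.fibreDecayFamily hf (P := ℝ) isOpen_univ (a := fun _ ↦ 1) (τ := fun t ↦ t)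
      contDiff_const (fun _ _ ↦ one_pos) contDiff_id).smoothCovDensityOn isOpen_univ
    simp only [Real.rpow_one] at h
    exact h
  · have ho : IsOpen ((univ : Set ℝ) ×ˢ Ioi (-1 : ℝ)) := isOpen_univ.prod isOpen_Ioi
    have h := (hc.fibreDecayFamily hf (P := ℝ × ℝ) ho (a := fun p ↦ 1 + p.2) (τ := fun p ↦ p.1)
      (by fun_prop) (fun p hp ↦ by have : -1 < p.2 := hp.2; linarith)
      contDiff_fst).smoothDensityOn ho
    exact SmoothDensityOn.mono h (prod_mono Subset.rfl fun ξ hξ ↦ by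
      have : -1 / 2 < ξ := hI hξ
      show -1 < ξ; linarith)
  · obtain ⟨K, hK, h⟩ := hc.2.2.2
    refine ⟨TotalSpace.proj '' K, hK.image continuous_cotProj, fun t q hq ↦ ?_⟩
    have e : ∀ p : ModelD n, c t (mkCot q p) = f (mkCot q p) := fun p ↦
      h t _ fun hm ↦ hq ⟨_, hm, rfl⟩
    constructor
    · exact integral_congr_ae (Filter.Eventually.of_forall fun p ↦ by
        show c t (mkCot q p) • p = f (mkCot q p) • p
        rw [e])
    · intro ξ _
      exact integral_congr_ae (Filter.Eventually.of_forall fun p ↦ by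
        show c t (mkCot q p) ^ (1 + ξ) = f (mkCot q p) ^ (1 + ξ)
        rw [e])

lemma IsKineticVariation.velocity_mom (hf : f ∈ PosDistributions n M)
    (hc : IsKineticVariation f c) (q : M) :
    (pathVelocity fun t ↦ combinedJ (c t)).mom q =
      ∫ p, kineticVelocity c (mkCot q p) • p ∂(covectorVolume n) := by
  have h := (hc.fibreDecayFamily hf (P := ℝ) isOpen_univ (a := fun _ ↦ 1) (τ := fun t ↦ t)
    contDiff_const (fun _ _ ↦ one_pos) contDiff_id).hasDerivAt_smul isOpen_univ
    (hasDerivAt_id (0 : ℝ)) (mem_univ _) q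
  simp only [Real.rpow_one] at h
  refine h.deriv.trans (integral_congr_ae (Filter.Eventually.of_forall fun p ↦ ?_))
  exact ((hc.hasDerivAt (mkCot q p)).smul_const p).deriv

/-- Differentiation of c^{1+ξ} under the integral. The result has the kernel form (b₀ + b₁ξ) e^{ξ
log f} k with b₀ = b₁ = 1 and k the velocity; the density of J[f] itself has this form with b₀ = 1,
b₁ = 0, k = f. `pathPairing_kernel` treats both together. -/
lemma IsKineticVariation.velocity_dens (hf : f ∈ PosDistributions n M)
    (hc : IsKineticVariation f c) {ξ : ℝ} (hξ : -1 < ξ) (q : M) :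
    (pathVelocity fun t ↦ combinedJ (c t)).dens ξ q =
      ∫ p, (1 + ξ) * Real.exp (ξ * Real.log (f (mkCot q p))) * kineticVelocity c (mkCot q p)
        ∂(covectorVolume n) := by
  have h := (hc.fibreDecayFamily hf (P := ℝ) isOpen_univ (a := fun _ ↦ 1 + ξ) (τ := fun t ↦ t)
    contDiff_const (fun _ _ ↦ by linarith) contDiff_id).hasDerivAt isOpen_univ
    (hasDerivAt_id (0 : ℝ)) (mem_univ _) q
  refine h.deriv.trans (integral_congr_ae (Filter.Eventually.of_forall fun p ↦ ?_))
  have hpos : 0 < c 0 (mkCot q p) := (hc.2.1 0).2.1 _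
  have e := ((hc.hasDerivAt (mkCot q p)).rpow_const (p := 1 + ξ) (Or.inl hpos.ne')).deriv
  refine e.trans ?_
  rw [hc.1, show 1 + ξ - 1 = ξ by ring, Real.rpow_def_of_pos (hf.2.1 _), mul_comm (Real.log _) ξ]
  ring

end Velocity

end VariationTransport

/-! ### Fibre integrals with weights (log f)^m f^ξ, and their ξ-derivatives -/

section FibreWeights

variable {n : ℕ} {M : Type*} [TopologicalSpace M] [ChartedSpace (ModelE n) M]
  [IsManifold 𝓘(ℝ, ModelE n) ∞ M] [T2Space M]

/-- Locally uniformly on the base, `k` is bounded by a multiple of `f`. -/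
def KernelBound (f k : CotBundle n M → ℝ) : Prop :=
  ∀ (x : M) (L : Set (ModelE n)), IsCompact L → L ⊆ (chartAt (ModelE n) x).target →
    ∃ C, ∀ y ∈ L, ∀ η, |k ((cotChart x).symm (y, η))| ≤ C * f ((cotChart x).symm (y, η))

lemma kernelBound_self {f : CotBundle n M → ℝ} (h0 : ∀ z, 0 < f z) : KernelBound f f :=
  fun x L _ _ ↦ ⟨1, fun y _ η ↦ by rw [abs_of_pos (h0 _), one_mul]⟩

lemma kernelBound_of_compact {f k : CotBundle n M → ℝ} (hf : Continuous f) (h0 : ∀ z, 0 < f z)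
    (hk : Continuous k) {K : Set (CotBundle n M)} (hK : IsCompact K) (hs : ∀ z ∉ K, k z = 0) :
    KernelBound f k := by
  obtain ⟨C, hC⟩ := hK.exists_bound_of_continuousOn
    (hk.div hf fun z ↦ (h0 z).ne').continuousOn
  refine fun x L _ _ ↦ ⟨|C|, fun y _ η ↦ ?_⟩
  set z := (cotChart (n := n) x).symm (y, η)
  by_cases hz : z ∈ K
  · have h1 := (hC z hz).trans (le_abs_self C)
    rwa [Real.norm_eq_abs, Pi.div_apply, abs_div, abs_of_pos (h0 z), div_le_iff₀ (h0 z)] at h1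
  · rw [hs z hz, abs_zero]
    exact mul_nonneg (abs_nonneg _) (h0 z).le

lemma exp_logRep {f : CotBundle n M → ℝ} (h0 : ∀ z, 0 < f z) (x : M) (w : ModelE n × ModelD n) :
    Real.exp (logRep f x w) = f ((cotChart x).symm w) := Real.exp_log (h0 _)

lemma exists_weight_bound {f k : CotBundle n M → ℝ} (hf : f ∈ PosDistributions n M)
    (hk : KernelBound f k) {ξ : ℝ} (hξ : -1 < ξ) (m N : ℕ) (x : M) {L : Set (ModelE n)}
    (hL : IsCompact L) (hLt : L ⊆ (chartAt (ModelE n) x).target) :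
    ∃ C, ∀ y ∈ L, ∀ η, (1 + ‖η‖) ^ N * (|logRep f x (y, η)| ^ m *
      Real.exp (ξ * logRep f x (y, η)) * |k ((cotChart x).symm (y, η))|) ≤ C := by
  have hl := logDecayOn_logRep hf x
  obtain ⟨Λ, hΛ⟩ := exists_bound_of_locally hL hLt (φ := fun y η ↦ logRep f x (y, η))
    fun y hy ↦ hl.exists_le hy
  obtain ⟨B, hB⟩ := hk x L hL hLt
  -- Since k is bounded by f, the power f^{1+ξ} is available. Each of the m logarithms costs f^{-ε},
  -- which leaves f^ε for the polynomial weight.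
  set ε := (1 + ξ) / (m + 1) with hε
  have hε0 : 0 < ε := by
    have : 0 < 1 + ξ := by linarith
    positivity
  have hs : 0 < 1 + ξ - m * ε := by
    have : (m + 1) * ε = 1 + ξ := by rw [hε]; field_simp
    linarith
  obtain ⟨C, hC⟩ := exists_bound_of_locally hL hLt
    (φ := fun y η ↦ (1 + ‖η‖) ^ N * Real.exp ((1 + ξ - m * ε) * logRep f x (y, η)))
    fun y hy ↦ hl.exists_exp_bound hy hs N
  set A := |Λ| * Real.exp (ε * |Λ|) + ε⁻¹
  have hA : 0 ≤ A := by positivity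
  refine ⟨A ^ m * |B| * C, fun y hy η ↦ ?_⟩
  set l := logRep f x (y, η)
  have h1 : |l| ^ m ≤ A ^ m * Real.exp (-(m * ε * l)) := by
    have := pow_le_pow_left₀ (abs_nonneg l) (abs_le_mul_exp_neg hε0 (hΛ y hy η)) m
    rwa [mul_pow, ← Real.exp_nat_mul, show (m : ℝ) * -(ε * l) = -(m * ε * l) by ring] at this
  have h2 : |k ((cotChart x).symm (y, η))| ≤ |B| * Real.exp l := by
    refine (hB y hy η).trans ?_
    rw [← exp_logRep hf.2.1]
    gcongr
    exact le_abs_self B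
  calc _ ≤ (1 + ‖η‖) ^ N * (A ^ m * Real.exp (-(m * ε * l)) * Real.exp (ξ * l) *
        (|B| * Real.exp l)) := by gcongr
    _ = A ^ m * |B| * ((1 + ‖η‖) ^ N * Real.exp ((1 + ξ - m * ε) * l)) := by
        rw [show (1 + ξ - m * ε) * l = -(m * ε * l) + ξ * l + l by ring, Real.exp_add,
          Real.exp_add]
        ring
    _ ≤ _ := by gcongr; exact hC y hy η

lemma continuous_weight {f k : CotBundle n M → ℝ} (hf : f ∈ PosDistributions n M)
    (hk : Continuous k) (ξ : ℝ) (m : ℕ) :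
    Continuous fun z ↦ Real.log (f z) ^ m * Real.exp (ξ * Real.log (f z)) * k z := by
  have h1 : Continuous fun z ↦ Real.log (f z) := hf.1.continuous.log fun z ↦ (hf.2.1 z).ne'
  fun_prop

lemma continuous_mkCot (q : M) : Continuous fun p : ModelD n ↦ mkCot q p := by
  have h1 : ContinuousOn (fun p : ModelD n ↦ (cotChart q).symm (chartAt (ModelE n) q q, p)) univ :=
    (continuousOn_cotChart_symm q).comp (by fun_prop) fun p _ ↦
      mem_cotChart_target.2 (mem_chart_target _ _)
  simpa only [cotChart_symm_preferred, continuousOn_univ] using h1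

lemma integrable_fibre_weight {f k : CotBundle n M → ℝ} (hf : f ∈ PosDistributions n M)
    (hk : KernelBound f k) (hkc : Continuous k) {ξ : ℝ} (hξ : -1 < ξ) (m : ℕ) (q : M) :
    Integrable (fun p ↦ Real.log (f (mkCot q p)) ^ m * Real.exp (ξ * Real.log (f (mkCot q p))) *
      k (mkCot q p)) (covectorVolume n) := by
  obtain ⟨C, hC⟩ := exists_weight_bound hf hk hξ m (n + 1) q (L := {chartAt (ModelE n) q q})
    isCompact_singleton (by simp)
  refine (integrable_one_add_norm_covector.const_mul C).mono'
    ((continuous_weight hf hkc ξ m).comp (continuous_mkCot q)).aestronglyMeasurable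
    (Filter.Eventually.of_forall fun p ↦ ?_)
  have h1 := hC _ rfl p
  rw [logRep, cotChart_symm_preferred] at h1
  rw [le_mul_inv_iff₀ (by positivity), norm_mul, norm_mul, norm_pow, Real.norm_eq_abs,
    Real.norm_eq_abs, Real.norm_eq_abs, abs_of_pos (Real.exp_pos _), mul_comm]
  exact h1

lemma integrable_fibre_smul {f k : CotBundle n M → ℝ} (hf : f ∈ PosDistributions n M)
    (hk : KernelBound f k) (hkc : Continuous k) (q : M) :
    Integrable (fun p ↦ k (mkCot q p) • p) (covectorVolume n) := by
  obtain ⟨C, hC⟩ := exists_weight_bound hf hk (ξ := 0) (by norm_num) 0 (n + 2) q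
    (L := {chartAt (ModelE n) q q}) isCompact_singleton (by simp)
  refine (integrable_one_add_norm_covector.const_mul C).mono'
    ((hkc.comp (continuous_mkCot q)).smul continuous_id).aestronglyMeasurable
    (Filter.Eventually.of_forall fun p ↦ ?_)
  have h1 := hC _ rfl p
  rw [logRep, cotChart_symm_preferred] at h1
  simp only [pow_zero, zero_mul, Real.exp_zero, one_mul] at h1
  rw [le_mul_inv_iff₀ (by positivity), norm_smul, Real.norm_eq_abs]
  calc |k (mkCot q p)| * ‖p‖ * (1 + ‖p‖) ^ (n + 1)
      ≤ |k (mkCot q p)| * (1 + ‖p‖) * (1 + ‖p‖) ^ (n + 1) := by gcongr; linarith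
    _ = (1 + ‖p‖) ^ (n + 2) * |k (mkCot q p)| := by ring
    _ ≤ C := h1

lemma iteratedDerivWithin_eq_of_chain {I : Set ℝ} (hI : UniqueDiffOn ℝ I) {φ : ℕ → ℝ → ℝ}
    {g : ℝ → ℝ} (h0 : ∀ ξ ∈ I, g ξ = φ 0 ξ)
    (h : ∀ a, ∀ ξ ∈ I, HasDerivWithinAt (φ a) (φ (a + 1) ξ) I ξ) (a : ℕ) :
    ∀ ξ ∈ I, iteratedDerivWithin a g I ξ = φ a ξ := by
  induction a with
  | zero => simpa using h0
  | succ a ih =>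
    intro ξ hξ
    rw [iteratedDerivWithin_succ, derivWithin_congr ih (ih ξ hξ)]
    exact (h a ξ hξ).derivWithin (hI ξ hξ)

/-- Depending on the sign of l, one of the two end exponents dominates. This bounds all powers f^ξ
with ξ in an interval by two of them. -/
lemma exp_mul_le_add {c₁ c₂ ξ : ℝ} (h1 : c₁ ≤ ξ) (h2 : ξ ≤ c₂) (l : ℝ) :
    Real.exp (ξ * l) ≤ Real.exp (c₁ * l) + Real.exp (c₂ * l) := by
  rcases le_total 0 l with hl | hl
  · have : Real.exp (ξ * l) ≤ Real.exp (c₂ * l) := Real.exp_le_exp.2 (by gcongr)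
    linarith [Real.exp_pos (c₁ * l)]
  · have : Real.exp (ξ * l) ≤ Real.exp (c₁ * l) :=
      Real.exp_le_exp.2 (mul_le_mul_of_nonpos_right h1 hl)
    linarith [Real.exp_pos (c₂ * l)]

/-- The coefficient `∂ᵃ/∂ξᵃ ((b₀ + b₁ ξ) e^{ξ l}) = jetWeight b₀ b₁ a ξ l * e^{ξ l}`. -/
def jetWeight (b₀ b₁ : ℝ) (a : ℕ) (ξ l : ℝ) : ℝ := (b₀ + b₁ * ξ) * l ^ a + b₁ * (a * l ^ (a - 1))

lemma hasDerivAt_jetWeight (b₀ b₁ : ℝ) (a : ℕ) (ξ l : ℝ) :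
    HasDerivAt (fun ξ ↦ jetWeight b₀ b₁ a ξ l * Real.exp (ξ * l))
      (jetWeight b₀ b₁ (a + 1) ξ l * Real.exp (ξ * l)) ξ := by
  have h1 : HasDerivAt (fun ξ ↦ Real.exp (ξ * l)) _ ξ := ((hasDerivAt_id ξ).mul_const l).exp
  have h2 : HasDerivAt (fun ξ ↦ jetWeight b₀ b₁ a ξ l) (b₁ * l ^ a) ξ := by
    unfold jetWeight
    have : HasDerivAt (fun ξ : ℝ ↦ (b₀ + b₁ * ξ) * l ^ a + b₁ * (a * l ^ (a - 1)))
      ((b₁ * 1) * l ^ a) ξ :=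
      ((((hasDerivAt_id ξ).const_mul b₁).const_add b₀).mul_const (l ^ a)).add_const _
    rwa [mul_one] at this
  have h3 := h2.mul h1
  refine h3.congr_deriv ?_
  unfold jetWeight
  -- For a = 0 the truncated exponent a - 1 stands behind the factor a = 0.
  rcases a with _ | a
  · simp; ring
  · push_cast
    simp only [id]
    ring

lemma abs_jetWeight_le {b₀ b₁ ξ c : ℝ} (hξ : |ξ| ≤ c) (a : ℕ) (l : ℝ) :
    |jetWeight b₀ b₁ a ξ l| ≤
      (|b₀| + |b₁| * c) * |l| ^ a + |b₁| * a * |l| ^ (a - 1) := by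
  unfold jetWeight
  refine (abs_add_le _ _).trans ?_
  rw [abs_mul, abs_mul, abs_mul, abs_pow, abs_pow, Nat.abs_cast, mul_assoc]
  gcongr
  refine (abs_add_le _ _).trans ?_
  rw [abs_mul]
  gcongr

/-- Differentiation under the integral is dominated, uniformly for ξ near ξ₀, by weights with the
two end exponents of an interval contained in ξ > -1. -/
lemma hasDerivAt_integral_jetWeight {f k : CotBundle n M → ℝ} (hf : f ∈ PosDistributions n M)
    (hk : KernelBound f k) (hkc : Continuous k) (b₀ b₁ : ℝ) (q : M) (a : ℕ) {ξ₀ : ℝ}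
    (hξ₀ : -1 < ξ₀) :
    HasDerivAt (fun ξ ↦ ∫ p, jetWeight b₀ b₁ a ξ (Real.log (f (mkCot q p))) *
        Real.exp (ξ * Real.log (f (mkCot q p))) * k (mkCot q p) ∂(covectorVolume n))
      (∫ p, jetWeight b₀ b₁ (a + 1) ξ₀ (Real.log (f (mkCot q p))) *
        Real.exp (ξ₀ * Real.log (f (mkCot q p))) * k (mkCot q p) ∂(covectorVolume n)) ξ₀ := by
  set l : ModelD n → ℝ := fun p ↦ Real.log (f (mkCot q p)) with hl
  have hlc : Continuous l :=
    (hf.1.continuous.log fun z ↦ (hf.2.1 z).ne').comp (continuous_mkCot q)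
  have hkc' : Continuous fun p ↦ k (mkCot q p) := hkc.comp (continuous_mkCot q)
  have hcont : ∀ a ξ, Continuous fun p ↦
      jetWeight b₀ b₁ a ξ (l p) * Real.exp (ξ * l p) * k (mkCot q p) := fun a ξ ↦ by
    have : Continuous fun p ↦ jetWeight b₀ b₁ a ξ (l p) * Real.exp (ξ * l p) := by
      unfold jetWeight; fun_prop
    exact this.mul hkc'
  -- The midpoint between -1 and ξ₀.
  set c₁ := (ξ₀ - 1) / 2 with hc₁
  set c₂ := ξ₀ + 1 with hc₂
  have hc₁' : -1 < c₁ := by linarith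
  have hc₂' : -1 < c₂ := by linarith
  set c := |c₁| + |c₂|
  have hcξ : ∀ ξ ∈ Icc c₁ c₂, |ξ| ≤ c := fun ξ hξ ↦ by
    have h1 := neg_abs_le c₁
    have h2 := le_abs_self c₂
    exact abs_le.2 ⟨by linarith [hξ.1, abs_nonneg c₂], by linarith [hξ.2, abs_nonneg c₁]⟩
  set w : ℕ → ℝ → ModelD n → ℝ := fun m ξ p ↦ |l p| ^ m * Real.exp (ξ * l p) * |k (mkCot q p)|
  have hw : ∀ m ξ, -1 < ξ → Integrable (w m ξ) (covectorVolume n) := fun m ξ hξ ↦ by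
    refine (integrable_fibre_weight hf hk hkc hξ m q).norm.congr
      (Filter.Eventually.of_forall fun p ↦ ?_)
    simp only [norm_mul, norm_pow, Real.norm_eq_abs, abs_of_pos (Real.exp_pos _)]
    rfl
  set B : ℕ → ModelD n → ℝ := fun a p ↦ (|b₀| + |b₁| * c) * (w a c₁ p + w a c₂ p) +
    |b₁| * a * (w (a - 1) c₁ p + w (a - 1) c₂ p)
  have hBi : ∀ a, Integrable (B a) (covectorVolume n) := fun a ↦
    (((hw a c₁ hc₁').add (hw a c₂ hc₂')).const_mul _).add
      (((hw (a - 1) c₁ hc₁').add (hw (a - 1) c₂ hc₂')).const_mul _)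
  have hBb : ∀ a, ∀ p, ∀ ξ ∈ Icc c₁ c₂,
      ‖jetWeight b₀ b₁ a ξ (l p) * Real.exp (ξ * l p) * k (mkCot q p)‖ ≤ B a p := by
    intro a p ξ hξ
    rw [norm_mul, norm_mul, Real.norm_eq_abs, Real.norm_eq_abs, Real.norm_eq_abs,
      abs_of_pos (Real.exp_pos _)]
    have h1 := abs_jetWeight_le (b₀ := b₀) (b₁ := b₁) (hcξ ξ hξ) a (l p)
    have h2 := exp_mul_le_add hξ.1 hξ.2 (l p)
    have hc0 : 0 ≤ c := by positivity
    calc _ ≤ ((|b₀| + |b₁| * c) * |l p| ^ a + |b₁| * a * |l p| ^ (a - 1)) *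
          (Real.exp (c₁ * l p) + Real.exp (c₂ * l p)) * |k (mkCot q p)| := by gcongr
      _ = B a p := by simp only [B, w]; ring
  have hmem : Icc c₁ c₂ ∈ 𝓝 ξ₀ := Icc_mem_nhds (by linarith) (by linarith)
  exact (hasDerivAt_integral_of_dominated_loc_of_deriv_le (bound := B (a + 1)) hmem
    (Filter.Eventually.of_forall fun ξ ↦ (hcont a ξ).aestronglyMeasurable)
    ((hBi a).mono' (hcont a ξ₀).aestronglyMeasurable (Filter.Eventually.of_forall fun p ↦
      hBb a p ξ₀ (mem_of_mem_nhds hmem)))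
    (hcont (a + 1) ξ₀).aestronglyMeasurable
    (Filter.Eventually.of_forall fun p ξ hξ ↦ hBb (a + 1) p ξ hξ) (hBi _)
    (Filter.Eventually.of_forall fun p ξ _ ↦
      (hasDerivAt_jetWeight b₀ b₁ a ξ (l p)).mul_const _)).2

/-- Jets at `ξ = 0` of fibre integrals. -/
lemma iteratedDerivWithin_fibreIntegral {f k : CotBundle n M → ℝ} (hf : f ∈ PosDistributions n M)
    (hk : KernelBound f k) (hkc : Continuous k) {b₀ b₁ : ℝ} {I : Set ℝ} (hI : UniqueDiffOn ℝ I)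
    (hI0 : (0 : ℝ) ∈ I) (hIl : I ⊆ Ioi (-1 / 2 : ℝ)) {q : M} {d : ℝ → ℝ}
    (hd : ∀ ξ ∈ I, d ξ = ∫ p, (b₀ + b₁ * ξ) * Real.exp (ξ * Real.log (f (mkCot q p))) *
      k (mkCot q p) ∂(covectorVolume n)) (a : ℕ) :
    iteratedDerivWithin a d I 0 = ∫ p, (b₀ * Real.log (f (mkCot q p)) ^ a +
      b₁ * (a * Real.log (f (mkCot q p)) ^ (a - 1))) * k (mkCot q p) ∂(covectorVolume n) := by
  have h1 := iteratedDerivWithin_eq_of_chain hI (g := d)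
    (φ := fun a ξ ↦ ∫ p, jetWeight b₀ b₁ a ξ (Real.log (f (mkCot q p))) *
        Real.exp (ξ * Real.log (f (mkCot q p))) * k (mkCot q p) ∂(covectorVolume n))
    (fun ξ hξ ↦ by rw [hd ξ hξ]; simp [jetWeight])
    (fun a ξ hξ ↦ (hasDerivAt_integral_jetWeight hf hk hkc b₀ b₁ q a (by
      have : -1 / 2 < ξ := hIl hξ
      linarith)).hasDerivWithinAt) a 0 hI0
  rw [h1]
  simp [jetWeight]

end FibreWeights

/-! ### The dual pairing as an integral over phase space -/

section KernelPairing

variable {n : ℕ} {M : Type*} [TopologicalSpace M] [ChartedSpace (ModelE n) M]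
  [IsManifold 𝓘(ℝ, ModelE n) ∞ M]

/-- The generating function `∫_I e^{ξ s} g_ξ(q) dξ + ∑ₐ sᵃ gₐ(q)`. -/
def PathAlg.gen (I : Set ℝ) (X : PathAlg n M) (q : M) (s : ℝ) : ℝ :=
  (∫ ξ in I, Real.exp (ξ * s) * X.fam ξ q) + ∑ᶠ a : ℕ, s ^ a * X.jet a q

/-- The element whose generating function is the derivative of that of `X`. -/
def PathAlg.shift (X : PathAlg n M) : PathAlg n M where
  vec := X.vec
  fam ξ q := ξ * X.fam ξ q
  jet a q := (a + 1) * X.jet (a + 1) q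

/-- Vanishing off a set of base points. -/
def PathAlg.VanishesOff (I : Set ℝ) (X : PathAlg n M) (K : Set M) : Prop :=
  ∀ q ∉ K, X.vec q = 0 ∧ (∀ ξ ∈ I, X.fam ξ q = 0) ∧ ∀ a, X.jet a q = 0

lemma PathAlg.VanishesOff.shift {I : Set ℝ} {X : PathAlg n M} {K : Set M}
    (h : X.VanishesOff I K) : X.shift.VanishesOff I K := fun q hq ↦
  ⟨(h q hq).1, fun ξ hξ ↦ by simp [PathAlg.shift, (h q hq).2.1 ξ hξ],
    fun a ↦ by simp [PathAlg.shift, (h q hq).2.2 (a + 1)]⟩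

lemma contMDiff_base_const_mul (a : ℝ) {g : M → ℝ} (hg : ContMDiff 𝓘(ℝ, ModelE n) 𝓘(ℝ, ℝ) ∞ g) :
    ContMDiff 𝓘(ℝ, ModelE n) 𝓘(ℝ, ℝ) ∞ fun q ↦ a * g q :=
  (contDiff_const.mul contDiff_id : ContDiff ℝ ∞ fun x : ℝ ↦ a * x).contMDiff.comp hg

lemma PathAlg.IsRegular.shift {I : Set ℝ} {X : PathAlg n M} (h : X.IsRegular I) :
    X.shift.IsRegular I := by
  obtain ⟨hv, hf, ⟨K, hK, hKI, hK0⟩, hj, A, hA⟩ := h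
  refine ⟨hv, ?_, ⟨K, hK, hKI, fun ξ hξ q ↦ by simp [PathAlg.shift, hK0 ξ hξ q]⟩,
    fun a ↦ contMDiff_base_const_mul _ (hj (a + 1)), A,
    fun a ha q ↦ by simp [PathAlg.shift, hA (a + 1) (by omega) q]⟩
  have h1 : ContMDiffOn (𝓘(ℝ, ℝ).prod 𝓘(ℝ, ModelE n)) 𝓘(ℝ, ℝ) ∞ (fun w : ℝ × M ↦ w.1)
    (I ×ˢ univ) := contMDiff_fst.contMDiffOn
  exact (contDiff_mul (𝕜 := ℝ) (n := ∞)).contMDiff.comp_contMDiffOn (h1.prodMk_space hf)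

lemma PathAlg.IsRegular.continuousOn_fam {I : Set ℝ} {X : PathAlg n M} (h : X.IsRegular I) :
    ContinuousOn (fun w : ℝ × M ↦ X.fam w.1 w.2) (I ×ˢ univ) := h.2.1.continuousOn

lemma PathAlg.IsRegular.continuous_fam {I : Set ℝ} {X : PathAlg n M} (h : X.IsRegular I) {ξ : ℝ}
    (hξ : ξ ∈ I) : Continuous (X.fam ξ) :=
  continuousOn_univ.1 (h.continuousOn_fam.comp (f := fun q ↦ (ξ, q)) (by fun_prop)
    fun q _ ↦ ⟨hξ, mem_univ _⟩)

lemma PathAlg.IsRegular.integrableOn_exp_mul_fam {I : Set ℝ} {X : PathAlg n M} (h : X.IsRegular I)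
    (hIm : MeasurableSet I) (q : M) (s : ℝ) :
    IntegrableOn (fun ξ ↦ Real.exp (ξ * s) * X.fam ξ q) I := by
  obtain ⟨K, hK, hKI, hK0⟩ := h.2.2.1
  have h1 : ContinuousOn (fun ξ ↦ X.fam ξ q) I :=
    h.continuousOn_fam.comp (f := fun ξ ↦ (ξ, q)) (by fun_prop) fun ξ hξ ↦ ⟨hξ, mem_univ _⟩
  have h2 : ContinuousOn (fun ξ ↦ Real.exp (ξ * s) * X.fam ξ q) I := by fun_prop
  exact ((h2.mono hKI).integrableOn_compact hK).of_forall_sdiff_eq_zero hIm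
    fun ξ hξ ↦ by simp [hK0 ξ hξ q]

lemma PathAlg.gen_eq_sum {X : PathAlg n M} {N : ℕ} (hN : ∀ a, N ≤ a → ∀ q, X.jet a q = 0)
    (I : Set ℝ) (q : M) (s : ℝ) : X.gen I q s = (∫ ξ in I, Real.exp (ξ * s) * X.fam ξ q) +
      ∑ a ∈ Finset.range N, s ^ a * X.jet a q := by
  rw [PathAlg.gen, finsum_eq_sum_of_support_subset]
  intro a ha
  simp only [Finset.coe_range, mem_Iio]
  by_contra h
  exact ha (by simp [hN a (not_lt.1 h) q])

/-- Since ξ e^{ξs} and a s^{a-1} are the s-derivatives of e^{ξs} and s^a, weighting by b₀ + b₁ξ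
corresponds to the operator b₀ + b₁∂_s on generating functions. -/
lemma PathAlg.IsRegular.gen_combination {I : Set ℝ} {X : PathAlg n M} (h : X.IsRegular I)
    (hIm : MeasurableSet I) {N : ℕ} (hN : ∀ a, N ≤ a → ∀ q, X.jet a q = 0) (b₀ b₁ s : ℝ) (q : M) :
    (∫ ξ in I, (b₀ + b₁ * ξ) * Real.exp (ξ * s) * X.fam ξ q) +
      ∑ a ∈ Finset.range N, (b₀ * s ^ a + b₁ * (a * s ^ (a - 1))) * X.jet a q =
    b₀ * X.gen I q s + b₁ * X.shift.gen I q s := by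
  have hN' : ∀ a, N ≤ a → ∀ q, X.shift.jet a q = 0 := fun a ha q ↦ by
    simp [PathAlg.shift, hN (a + 1) (by omega)]
  rw [PathAlg.gen_eq_sum hN, PathAlg.gen_eq_sum hN']
  have e1 : ∫ ξ in I, (b₀ + b₁ * ξ) * Real.exp (ξ * s) * X.fam ξ q =
      b₀ * (∫ ξ in I, Real.exp (ξ * s) * X.fam ξ q) +
        b₁ * ∫ ξ in I, Real.exp (ξ * s) * X.shift.fam ξ q := by
    rw [← integral_const_mul, ← integral_const_mul, ← integral_add
      ((h.integrableOn_exp_mul_fam hIm q s).const_mul _)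
      ((h.shift.integrableOn_exp_mul_fam hIm q s).const_mul _)]
    refine integral_congr_ae (Filter.Eventually.of_forall fun ξ ↦ ?_)
    simp only [PathAlg.shift]; ring
  have e2 : ∑ a ∈ Finset.range N, (a * s ^ (a - 1)) * X.jet a q =
      ∑ a ∈ Finset.range N, s ^ a * X.shift.jet a q := by
    have h5 := Finset.sum_range_succ (fun a : ℕ ↦ (a * s ^ (a - 1)) * X.jet a q) N
    rw [hN N le_rfl q, mul_zero, add_zero, Finset.sum_range_succ'] at h5
    rw [← h5]
    simp only [Nat.cast_zero, zero_mul, add_zero, Nat.add_sub_cancel]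
    exact Finset.sum_congr rfl fun a _ ↦ by simp only [PathAlg.shift]; push_cast; ring
  rw [e1, mul_add, mul_add, ← e2, Finset.mul_sum, Finset.mul_sum]
  have e3 : ∑ a ∈ Finset.range N, (b₀ * s ^ a + b₁ * (a * s ^ (a - 1))) * X.jet a q =
      ∑ a ∈ Finset.range N, b₀ * (s ^ a * X.jet a q) +
      ∑ a ∈ Finset.range N, b₁ * (a * s ^ (a - 1) * X.jet a q) := by
    rw [← Finset.sum_add_distrib]
    exact Finset.sum_congr rfl fun a _ ↦ by ring
  rw [e3]; ring

variable [SigmaCompactSpace M] [T2Space M]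

lemma integrable_of_weight {f k h : CotBundle n M → ℝ} (hf : f ∈ PosDistributions n M)
    (hk : KernelBound f k) {ξ : ℝ} (hξ : -1 < ξ) (m : ℕ) (hc : Continuous h) {K : Set M}
    (hK : IsCompact K) (hs : ∀ z, z.proj ∉ K → h z = 0)
    (hb : ∀ (x : M) (L : Set (ModelE n)), IsCompact L → L ⊆ (chartAt (ModelE n) x).target →
      ∃ C, ∀ y ∈ L, ∀ η, |h ((cotChart x).symm (y, η))| ≤ C * ((1 + ‖η‖) * (|logRep f x (y, η)| ^ m *
      Real.exp (ξ * logRep f x (y, η)) * |k ((cotChart x).symm (y, η))|))) :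
    Integrable h (liouville n M) := by
  refine integrable_of_fibre_decay hc hK hs fun x L hL hLt ↦ ?_
  obtain ⟨C, hC⟩ := hb x L hL hLt
  obtain ⟨B, hB⟩ := exists_weight_bound hf hk hξ m (n + 2) x hL hLt
  refine ⟨|C| * B, fun y hy η ↦ ?_⟩
  set w := |logRep f x (y, η)| ^ m * Real.exp (ξ * logRep f x (y, η)) *
    |k ((cotChart x).symm (y, η))| with hw
  have hw0 : 0 ≤ w := by positivity
  calc _ ≤ (1 + ‖η‖) ^ (n + 1) * (|C| * ((1 + ‖η‖) * w)) := by
        gcongr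
        exact (hC y hy η).trans (by gcongr; exact le_abs_self C)
    _ = |C| * ((1 + ‖η‖) ^ (n + 2) * w) := by ring
    _ ≤ _ := by gcongr; exact hB y hy η

lemma integrable_base_mul_weight {f k : CotBundle n M → ℝ} (hf : f ∈ PosDistributions n M)
    (hk : KernelBound f k) (hkc : Continuous k) {ξ : ℝ} (hξ : -1 < ξ) (m : ℕ) {g : M → ℝ}
    (hg : Continuous g) {K : Set M} (hK : IsCompact K)
    (hs : ∀ z, z.proj ∉ K → g z.proj * k z = 0) :
    Integrable (fun z ↦ g z.proj *
      (Real.log (f z) ^ m * Real.exp (ξ * Real.log (f z)) * k z)) (liouville n M) := by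
  refine integrable_of_weight hf hk hξ m
    ((hg.comp continuous_cotProj).mul (continuous_weight hf hkc ξ m)) hK
    (fun z hz ↦ by rw [mul_left_comm, hs z hz, mul_zero]) fun x L hL hLt ↦ ?_
  obtain ⟨B, hB⟩ := hL.exists_bound_of_continuousOn (f := fun y ↦ g ((chartAt (ModelE n) x).symm y))
    (hg.comp_continuousOn ((chartAt (ModelE n) x).continuousOn_symm.mono hLt))
  refine ⟨|B|, fun y hy η ↦ ?_⟩
  rw [proj_cotChart_symm x (hLt hy), abs_mul, abs_mul, abs_mul, abs_pow,
    abs_of_pos (Real.exp_pos _)]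
  have h1 := (hB y hy).trans (le_abs_self B)
  rw [Real.norm_eq_abs] at h1
  change _ * (|logRep f x (y, η)| ^ m * Real.exp (ξ * logRep f x (y, η)) * _) ≤ _
  set w := |logRep f x (y, η)| ^ m * Real.exp (ξ * logRep f x (y, η)) *
    |k ((cotChart x).symm (y, η))|
  have hw0 : 0 ≤ w := by positivity
  gcongr
  exact le_mul_of_one_le_left hw0 (by linarith [norm_nonneg η])

lemma integrable_mul_momentumFn {f k : CotBundle n M → ℝ} (hf : f ∈ PosDistributions n M)
    (hk : KernelBound f k) (hkc : Continuous k) {u : (q : M) → TangentSpace 𝓘(ℝ, ModelE n) q}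
    (hu : SmoothVectorField u) {K : Set M} (hK : IsCompact K)
    (hs : ∀ z, z.proj ∉ K → k z * momentumFn u z = 0) :
    Integrable (fun z ↦ k z * momentumFn u z) (liouville n M) := by
  refine integrable_of_weight hf hk (ξ := 0) (by norm_num) 0
    (hkc.mul hu.contMDiff_momentumFn.continuous) hK hs fun x L hL hLt ↦ ?_
  obtain ⟨B, hB⟩ := hL.exists_bound_of_continuousOn ((hu.contDiffOn_vecRep x).continuousOn.mono hLt)
  refine ⟨|B|, fun y hy η ↦ ?_⟩
  rw [abs_mul, momentumFn_cotChart_symm x u (mem_cotChart_target.2 (hLt hy))]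
  simp only [pow_zero, zero_mul, Real.exp_zero, one_mul]
  have h1 : |η (vecRep x u y)| ≤ ‖η‖ * |B| :=
    (η.le_opNorm _).trans (by gcongr; exact (hB y hy).trans (le_abs_self B))
  calc _ ≤ |k ((cotChart x).symm (y, η))| * (‖η‖ * |B|) := by gcongr
    _ ≤ |k ((cotChart x).symm (y, η))| * ((1 + ‖η‖) * |B|) := by gcongr; linarith
    _ = _ := by ring

/-- Joint integrability in the parameter and on phase space. -/
lemma integrable_fam_weight {f k : CotBundle n M → ℝ} (hf : f ∈ PosDistributions n M)
    (hk : KernelBound f k) (hkc : Continuous k) (b₀ b₁ : ℝ) {I : Set ℝ} (hIm : MeasurableSet I)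
    (hIl : I ⊆ Ioi (-1 / 2 : ℝ)) {X : PathAlg n M} (hX : X.IsRegular I) {K : Set M}
    (hK : IsCompact K) (hs : ∀ ξ ∈ I, ∀ z, z.proj ∉ K → X.fam ξ z.proj * k z = 0) :
    Integrable (fun w : ℝ × CotBundle n M ↦
      (b₀ + b₁ * w.1) * Real.exp (w.1 * Real.log (f w.2)) * k w.2 * X.fam w.1 w.2.proj)
      ((volume.restrict I).prod (liouville n M)) := by
  obtain ⟨S, hS, hSI, hS0⟩ := hX.2.2.1
  obtain ⟨R, hR⟩ := hS.isBounded.exists_norm_le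
  obtain ⟨B, hB⟩ := (hS.prod hK).exists_bound_of_continuousOn
    (hX.continuousOn_fam.mono (prod_mono hSI (subset_univ _)))
  -- Neither k nor the family alone needs compact base support; a continuous weight equal to 1 on K
  -- gives an integrable majorant in both cases.
  obtain ⟨θ, K', hθ, hK', h1, h0⟩ := exists_cutoff (n := n) hK
  set c := |R| with hc
  have hw : ∀ ξ : ℝ, -1 < ξ → Integrable (fun z : CotBundle n M ↦
      ‖θ z.proj * (Real.log (f z) ^ 0 * Real.exp (ξ * Real.log (f z)) * k z)‖) (liouville n M) :=
    fun ξ hξ ↦ (integrable_base_mul_weight hf hk hkc hξ 0 hθ.continuous hK'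
      fun z hz ↦ by rw [h0 _ hz, zero_mul]).norm
  -- All exponents ξ ∈ S lie between -1/2 and c, so the two end exponents suffice.
  set G : CotBundle n M → ℝ := fun z ↦
    ‖θ z.proj * (Real.log (f z) ^ 0 * Real.exp (-1 / 2 * Real.log (f z)) * k z)‖ +
    ‖θ z.proj * (Real.log (f z) ^ 0 * Real.exp (c * Real.log (f z)) * k z)‖ with hG
  have hGi : Integrable G (liouville n M) :=
    (hw _ (by norm_num)).add (hw c (by linarith [abs_nonneg R]))
  have hSint : Integrable (S.indicator fun _ : ℝ ↦ (|b₀| + |b₁| * c) * |B|) (volume.restrict I) :=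
    ((integrable_indicator_iff hS.measurableSet).2
      (integrableOn_const hS.measure_lt_top.ne)).mono_measure Measure.restrict_le_self
  have hres : (volume.restrict I).prod (liouville n M) =
      (volume.prod (liouville n M)).restrict (I ×ˢ univ) := by
    rw [← Measure.prod_restrict, Measure.restrict_univ]
  refine (hSint.mul_prod hGi).mono' ?_ ?_
  · rw [hres]
    refine ContinuousOn.aestronglyMeasurable ?_ (hIm.prod MeasurableSet.univ)
    have hl : Continuous fun z ↦ Real.log (f z) := hf.1.continuous.log fun z ↦ (hf.2.1 z).ne'
    have h2 : ContinuousOn (fun w : ℝ × CotBundle n M ↦ X.fam w.1 w.2.proj) (I ×ˢ univ) :=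
      hX.continuousOn_fam.comp (f := fun w : ℝ × CotBundle n M ↦ (w.1, w.2.proj))
        (continuous_fst.prodMk (continuous_cotProj.comp continuous_snd)).continuousOn
        fun w hw ↦ ⟨hw.1, mem_univ _⟩
    refine ContinuousOn.mul (Continuous.continuousOn ?_) h2
    have h3 : Continuous fun w : ℝ × CotBundle n M ↦ Real.log (f w.2) := hl.comp continuous_snd
    have h4 : Continuous fun w : ℝ × CotBundle n M ↦ k w.2 := hkc.comp continuous_snd
    fun_prop
  · rw [hres]
    refine (ae_restrict_iff' (hIm.prod MeasurableSet.univ)).2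
      (Filter.Eventually.of_forall ?_)
    rintro ⟨ξ, z⟩ ⟨hξ, -⟩
    by_cases hξS : ξ ∈ S
    swap
    · simp [hS0 ξ ⟨hξ, hξS⟩, hξS]
    have hG0 : 0 ≤ G z := by positivity
    simp only [indicator_of_mem hξS]
    by_cases hz : z.proj ∈ K
    swap
    · rw [mul_assoc, mul_comm (k z), hs ξ hξ z hz, mul_zero, norm_zero]
      positivity
    have hθ1 : θ z.proj = 1 := Filter.Eventually.self_of_nhds (p := fun q ↦ θ q = 1)
      (mem_nhdsSet_iff_forall.1 h1 z.proj hz)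
    have hξR : |ξ| ≤ c := (hR ξ hξS).trans (le_abs_self R)
    have e1 : |X.fam ξ z.proj| ≤ |B| := (hB (ξ, z.proj) ⟨hξS, hz⟩).trans (le_abs_self B)
    have e2 : Real.exp (ξ * Real.log (f z)) * |k z| ≤ G z := by
      rw [hG]
      simp only [hθ1, one_mul, pow_zero, norm_mul, Real.norm_eq_abs, abs_of_pos (Real.exp_pos _)]
      rw [← add_mul]
      refine mul_le_mul_of_nonneg_right (exp_mul_le_add ?_ ?_ _) (abs_nonneg _)
      · have : -1 / 2 < ξ := hIl hξ
        linarith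
      · exact (le_abs_self ξ).trans hξR
    have e3 : |b₀ + b₁ * ξ| ≤ |b₀| + |b₁| * c := by
      refine (abs_add_le _ _).trans ?_
      rw [abs_mul]
      gcongr
    simp only [norm_mul, Real.norm_eq_abs, abs_of_pos (Real.exp_pos _)]
    calc |b₀ + b₁ * ξ| * Real.exp (ξ * Real.log (f z)) * |k z| * |X.fam ξ z.proj|
        = |b₀ + b₁ * ξ| * |X.fam ξ z.proj| * (Real.exp (ξ * Real.log (f z)) * |k z|) := by ring
      _ ≤ (|b₀| + |b₁| * c) * |B| * G z := by gcongr

/-- The pairing of the fibre integrals of a kernel is an integral over phase space. -/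
theorem pathPairing_kernel {f k : CotBundle n M → ℝ} (hf : f ∈ PosDistributions n M)
    (hk : KernelBound f k) (hkc : Continuous k) {b₀ b₁ : ℝ} {I : Set ℝ} (hI : UniqueDiffOn ℝ I)
    (hIm : MeasurableSet I) (hI0 : (0 : ℝ) ∈ I) (hIl : I ⊆ Ioi (-1 / 2 : ℝ)) {X : PathAlg n M}
    (hX : X.IsRegular I) {K : Set M} (hK : IsCompact K)
    (h0 : (∀ z, z.proj ∉ K → k z = 0) ∨ X.VanishesOff I K) {ζ : PathDual n M}
    (hm : ∀ q, ζ.mom q = ∫ p, k (mkCot q p) • p ∂(covectorVolume n))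
    (hd : ∀ ξ ∈ I, ∀ q, ζ.dens ξ q = ∫ p, (b₀ + b₁ * ξ) *
      Real.exp (ξ * Real.log (f (mkCot q p))) * k (mkCot q p) ∂(covectorVolume n)) :
    Integrable (fun z ↦ k z * (momentumFn X.vec z + (b₀ * X.gen I z.proj (Real.log (f z)) +
      b₁ * X.shift.gen I z.proj (Real.log (f z))))) (liouville n M) ∧
    pathPairing I ζ X = ∫ z, k z * (momentumFn X.vec z + (b₀ * X.gen I z.proj (Real.log (f z)) +
      b₁ * X.shift.gen I z.proj (Real.log (f z)))) ∂(liouville n M) := by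
  obtain ⟨A, hA⟩ := hX.2.2.2.2
  have hN : ∀ a, A + 1 ≤ a → ∀ q, X.jet a q = 0 := fun a ha ↦ hA a (by omega)
  have hvs : ∀ z : CotBundle n M, z.proj ∉ K → k z * momentumFn X.vec z = 0 := by
    intro z hz
    rcases h0 with h0 | h0
    · rw [h0 z hz, zero_mul]
    · rw [momentumFn, (h0 _ hz).1]
      exact (congrArg (k z * ·) (map_zero (cov z))).trans (mul_zero _)
  have hfs : ∀ ξ ∈ I, ∀ z : CotBundle n M, z.proj ∉ K → X.fam ξ z.proj * k z = 0 := by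
    intro ξ hξ z hz
    rcases h0 with h0 | h0
    · rw [h0 z hz, mul_zero]
    · rw [(h0 _ hz).2.1 ξ hξ, zero_mul]
  have hjs : ∀ a, ∀ z : CotBundle n M, z.proj ∉ K → X.jet a z.proj * k z = 0 := by
    intro a z hz
    rcases h0 with h0 | h0
    · rw [h0 z hz, mul_zero]
    · rw [(h0 _ hz).2.2 a, zero_mul]
  -- momentum
  have i1 := integrable_mul_momentumFn hf hk hkc hX.1 hK hvs
  have t1 : densityIntegral n (fun q : M ↦ ζ.mom q (X.vec q)) =
      ∫ z, k z * momentumFn X.vec z ∂(liouville n M) := by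
    rw [← densityIntegral_fibreIntegral i1 hK hvs]
    congr 1; ext q
    rw [hm]
    refine (ContinuousLinearMap.integral_apply (integrable_fibre_smul hf hk hkc q) _).trans ?_
    rfl
  -- the family
  have i2 := integrable_fam_weight hf hk hkc b₀ b₁ hIm hIl hX hK hfs
  have t2 : ∫ ξ in I, densityIntegral n (fun q : M ↦ ζ.dens ξ q * X.fam ξ q) =
      ∫ z, (∫ ξ in I, (b₀ + b₁ * ξ) * Real.exp (ξ * Real.log (f z)) * k z * X.fam ξ z.proj)
        ∂(liouville n M) := by
    rw [← integral_integral_swap i2]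
    refine setIntegral_congr_fun hIm fun ξ hξ ↦ ?_
    have hξ' : -1 / 2 < ξ := hIl hξ
    have i := (integrable_base_mul_weight hf hk hkc (by linarith : -1 < ξ) 0
      (hX.continuous_fam hξ) hK (hfs ξ hξ)).const_mul (b₀ + b₁ * ξ)
    have e : (fun z : CotBundle n M ↦ (b₀ + b₁ * ξ) * (X.fam ξ z.proj *
        (Real.log (f z) ^ 0 * Real.exp (ξ * Real.log (f z)) * k z))) =
        fun z ↦ (b₀ + b₁ * ξ) * Real.exp (ξ * Real.log (f z)) * k z * X.fam ξ z.proj := by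
      ext z; ring
    rw [e] at i
    rw [← densityIntegral_fibreIntegral i hK fun z hz ↦ by
      rw [mul_assoc, mul_comm (k z), hfs ξ hξ z hz, mul_zero]]
    congr 1; ext q
    rw [hd ξ hξ, ← integral_mul_const]
    rfl
  -- the jets
  have i3 : ∀ a, Integrable (fun z : CotBundle n M ↦ (b₀ * Real.log (f z) ^ a +
      b₁ * (a * Real.log (f z) ^ (a - 1))) * k z * X.jet a z.proj) (liouville n M) := by
    intro a
    have j1 := (integrable_base_mul_weight hf hk hkc (ξ := 0) (by norm_num) a
      (hX.2.2.2.1 a).continuous hK (hjs a)).const_mul b₀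
    have j2 := (integrable_base_mul_weight hf hk hkc (ξ := 0) (by norm_num) (a - 1)
      (hX.2.2.2.1 a).continuous hK (hjs a)).const_mul (b₁ * a)
    refine (j1.add j2).congr (Filter.Eventually.of_forall fun z ↦ ?_)
    simp only [zero_mul, Real.exp_zero, Pi.add_apply]; ring
  have t3 : ∑ᶠ a : ℕ, densityIntegral n
      (fun q : M ↦ iteratedDerivWithin a (fun ξ ↦ ζ.dens ξ q) I 0 * X.jet a q) =
      ∑ a ∈ Finset.range (A + 1), ∫ z, (b₀ * Real.log (f z) ^ a +
      b₁ * (a * Real.log (f z) ^ (a - 1))) * k z * X.jet a z.proj ∂(liouville n M) := by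
    have t : ∀ a, densityIntegral n
      (fun q : M ↦ iteratedDerivWithin a (fun ξ ↦ ζ.dens ξ q) I 0 * X.jet a q) =
      ∫ z, (b₀ * Real.log (f z) ^ a +
      b₁ * (a * Real.log (f z) ^ (a - 1))) * k z * X.jet a z.proj ∂(liouville n M) := by
      intro a
      rw [← densityIntegral_fibreIntegral (i3 a) hK fun z hz ↦ by
        rw [mul_assoc, mul_comm (k z), hjs a z hz, mul_zero]]
      congr 1; ext q
      rw [iteratedDerivWithin_fibreIntegral hf hk hkc hI hI0 hIl (fun ξ hξ ↦ hd ξ hξ q) a,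
        ← integral_mul_const]
      rfl
    simp only [t]
    apply finsum_eq_sum_of_support_subset
    intro a ha
    simp only [Finset.coe_range, mem_Iio]
    by_contra h
    exact ha (by simp [hN a (not_lt.1 h)])
  have i2' := i2.integral_prod_right
  have i3' := integrable_finsetSum (Finset.range (A + 1)) fun a _ ↦ i3 a
  have e : (fun z : CotBundle n M ↦ k z * (momentumFn X.vec z +
      (b₀ * X.gen I z.proj (Real.log (f z)) + b₁ * X.shift.gen I z.proj (Real.log (f z))))) =
      fun z ↦ k z * momentumFn X.vec z + (∫ ξ in I, (b₀ + b₁ * ξ) *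
        Real.exp (ξ * Real.log (f z)) * k z * X.fam ξ z.proj) +
        ∑ a ∈ Finset.range (A + 1), (b₀ * Real.log (f z) ^ a +
      b₁ * (a * Real.log (f z) ^ (a - 1))) * k z * X.jet a z.proj := by
    ext z
    rw [← hX.gen_combination hIm hN, mul_add, mul_add, ← integral_const_mul, Finset.mul_sum,
      add_assoc]
    congr 2
    · exact integral_congr_ae (Filter.Eventually.of_forall fun ξ ↦ by ring)
    · exact Finset.sum_congr rfl fun a _ ↦ by ring
  rw [e]
  refine ⟨(i1.add i2').add i3', ?_⟩
  rw [pathPairing, t1, t2, t3, ← integral_finsetSum _ fun a _ ↦ i3 a]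
  exact ((integral_add (i1.add i2') i3').trans (congrArg (· + _) (integral_add i1 i2'))).symm

end KernelPairing

/-! ### Functional derivatives of pulled back functionals -/

section KineticDerivative

variable {n : ℕ} {M : Type*} [TopologicalSpace M] [ChartedSpace (ModelE n) M]
  [IsManifold 𝓘(ℝ, ModelE n) ∞ M]

/-- The family of functions in the chart at `x`. -/
def PathAlg.famRep (X : PathAlg n M) (x : M) (ξ : ℝ) (y : ModelE n) : ℝ :=
  X.fam ξ ((chartAt (ModelE n) x).symm y)

/-- The jet coefficients in the chart at `x`. -/
def PathAlg.jetRep (X : PathAlg n M) (x : M) (a : ℕ) (y : ModelE n) : ℝ :=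
  X.jet a ((chartAt (ModelE n) x).symm y)

lemma PathAlg.IsRegular.contDiffOn_famRep {I : Set ℝ} {X : PathAlg n M} (h : X.IsRegular I)
    (x : M) : ContDiffOn ℝ ∞ (fun v : ℝ × ModelE n ↦ X.famRep x v.1 v.2)
      (I ×ˢ (chartAt (ModelE n) x).target) := by
  rw [← contMDiffOn_iff_contDiffOn]
  have h3 : ContMDiffOn 𝓘(ℝ, ℝ × ModelE n) 𝓘(ℝ, ModelE n) ∞
      (Prod.snd : ℝ × ModelE n → _) (I ×ˢ (chartAt (ModelE n) x).target) :=
    contDiff_snd.contMDiff.contMDiffOn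
  have h4 : ContMDiffOn 𝓘(ℝ, ℝ × ModelE n) 𝓘(ℝ, ℝ) ∞
      (Prod.fst : ℝ × ModelE n → _) (I ×ˢ (chartAt (ModelE n) x).target) :=
    contDiff_fst.contMDiff.contMDiffOn
  exact h.2.1.comp (h4.prodMk ((contMDiffOn_modelChart_symm x).comp h3 fun v hv ↦ hv.2))
    fun v hv ↦ ⟨hv.1, mem_univ _⟩

lemma PathAlg.IsRegular.exists_smoothFamily {I : Set ℝ} {X : PathAlg n M} (h : X.IsRegular I) :
    ∃ S, IsCompact S ∧ S ⊆ I ∧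
      ∀ x, SmoothFamilyOn I (chartAt (ModelE n) x).target S (X.famRep x) := by
  obtain ⟨S, hS, hSI, hS0⟩ := h.2.2.1
  exact ⟨S, hS, hSI, fun x ↦ ⟨h.contDiffOn_famRep x, fun ξ hξ y _ ↦ hS0 ξ hξ _⟩⟩

lemma PathAlg.IsRegular.contDiffOn_jetRep {I : Set ℝ} {X : PathAlg n M} (h : X.IsRegular I)
    (x : M) (a : ℕ) : ContDiffOn ℝ ∞ (X.jetRep x a) (chartAt (ModelE n) x).target :=
  contDiffOn_base_comp (h.2.2.2.1 a) x

lemma PathAlg.IsRegular.exists_order {I : Set ℝ} {X : PathAlg n M} (h : X.IsRegular I) :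
    ∃ N, ∀ a, N ≤ a → ∀ q, X.jet a q = 0 := by
  obtain ⟨A, hA⟩ := h.2.2.2.2
  exact ⟨A + 1, fun a ha ↦ hA a (by omega)⟩

lemma PathAlg.gen_chart_symm {X : PathAlg n M} {N : ℕ} (hN : ∀ a, N ≤ a → ∀ q, X.jet a q = 0)
    (I : Set ℝ) (x : M) (y : ModelE n) (s : ℝ) :
    X.gen I ((chartAt (ModelE n) x).symm y) s = genFn I N (X.famRep x) (X.jetRep x) (y, s) :=
  PathAlg.gen_eq_sum hN I _ s

/-- The generating function evaluated at the logarithm of a distribution function. -/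
def PathAlg.genLog (I : Set ℝ) (X : PathAlg n M) (f : CotBundle n M → ℝ) (z : CotBundle n M) : ℝ :=
  X.gen I z.proj (Real.log (f z))

lemma PathAlg.genLog_cotChart_symm {X : PathAlg n M} {N : ℕ}
    (hN : ∀ a, N ≤ a → ∀ q, X.jet a q = 0) (I : Set ℝ) (f : CotBundle n M → ℝ) (x : M)
    {w : ModelE n × ModelD n} (hw : w ∈ (cotChart (n := n) x).target) :
    X.genLog I f ((cotChart x).symm w) =
      genFn I N (X.famRep x) (X.jetRep x) (w.1, logRep f x w) := by
  rw [PathAlg.genLog, proj_cotChart_symm' x hw, PathAlg.gen_chart_symm hN]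
  rfl

lemma PathAlg.IsRegular.contMDiff_genLog {I : Set ℝ} (hI : UniqueDiffOn ℝ I)
    (hIm : MeasurableSet I) {X : PathAlg n M} (hX : X.IsRegular I) {f : CotBundle n M → ℝ}
    (hf : ContMDiff (cotModel n) 𝓘(ℝ, ℝ) ∞ f) (h0 : ∀ z, 0 < f z) :
    ContMDiff (cotModel n) 𝓘(ℝ, ℝ) ∞ (X.genLog I f) := by
  rw [contMDiff_cotBundle_iff]
  intro x
  obtain ⟨N, hN⟩ := hX.exists_order
  obtain ⟨S, hS, hSI, hfam⟩ := hX.exists_smoothFamily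
  have h1 := contDiffOn_genFn (N := N) (hfam x) (hX.contDiffOn_jetRep x)
    (chartAt (ModelE n) x).open_target hI hIm hS hSI
  have h2 : ContDiffOn ℝ ∞ (fun w : ModelE n × ModelD n ↦
      genFn I N (X.famRep x) (X.jetRep x) (w.1, logRep f x w)) (cotChart (n := n) x).target := by
    rw [cotChart_target]
    exact h1.comp (contDiffOn_fst.prodMk (contDiffOn_logRep hf h0 x))
      fun w hw ↦ ⟨hw.1, mem_univ _⟩
  exact h2.congr fun w hw ↦ PathAlg.genLog_cotChart_symm hN I f x hw

lemma contMDiff_cotBundle_add {φ ψ : CotBundle n M → ℝ}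
    (hφ : ContMDiff (cotModel n) 𝓘(ℝ, ℝ) ∞ φ) (hψ : ContMDiff (cotModel n) 𝓘(ℝ, ℝ) ∞ ψ) :
    ContMDiff (cotModel n) 𝓘(ℝ, ℝ) ∞ fun z ↦ φ z + ψ z :=
  contMDiff_cotBundle_iff.2 fun x ↦
    (contMDiff_cotBundle_iff.1 hφ x).add (contMDiff_cotBundle_iff.1 hψ x)

/-- The functional derivative of a pulled back functional. -/
def PathAlg.pullback (I : Set ℝ) (X : PathAlg n M) (f : CotBundle n M → ℝ) (z : CotBundle n M) :
    ℝ := momentumFn X.vec z + (X.genLog I f z + X.shift.genLog I f z)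

lemma PathAlg.IsRegular.contMDiff_pullback {I : Set ℝ} (hI : UniqueDiffOn ℝ I)
    (hIm : MeasurableSet I) {X : PathAlg n M} (hX : X.IsRegular I) {f : CotBundle n M → ℝ}
    (hf : ContMDiff (cotModel n) 𝓘(ℝ, ℝ) ∞ f) (h0 : ∀ z, 0 < f z) :
    ContMDiff (cotModel n) 𝓘(ℝ, ℝ) ∞ (X.pullback I f) :=
  contMDiff_cotBundle_add hX.1.contMDiff_momentumFn (contMDiff_cotBundle_add
    (hX.contMDiff_genLog hI hIm hf h0) (hX.shift.contMDiff_genLog hI hIm hf h0))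

variable [T2Space M]

/-- Powers of h agree with powers of f for large covectors, locally uniformly on the base, and a
compact part does not affect decay. -/
lemma posDistributions_of_eq_off_compact {f h : CotBundle n M → ℝ}
    (hf : f ∈ PosDistributions n M) (hh : ContMDiff (cotModel n) 𝓘(ℝ, ℝ) ∞ h)
    (h0 : ∀ z, 0 < h z) {K : Set (CotBundle n M)} (hK : IsCompact K) (hs : ∀ z ∉ K, h z = f z) :
    h ∈ PosDistributions n M := by
  refine ⟨hh, h0, fun x L hL hLt s hs0 k N ↦ ?_⟩
  have h1 := (logDecayOn_logRep hf x).2 s hs0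
  have h2 : FibreDecayOn (chartAt (ModelE n) x).target
      fun w ↦ h ((cotChart (n := n) x).symm w) ^ s := by
    refine h1.of_eq_off_compact (chartAt (ModelE n) x).open_target ?_ fun y hy ↦ ?_
    · rw [← cotChart_target]
      exact (contMDiff_cotBundle_iff.1 hh x).rpow contDiffOn_const fun w _ ↦ (h0 _).ne'
    · obtain ⟨R, hR⟩ := exists_fibre_radius hK x hy
      refine ⟨R, hR.mono fun y hy η hη ↦ ?_⟩
      rw [exp_mul_logRep hf.2.1, hs _ (hy η hη)]
  exact exists_bound_of_locally hL hLt (φ := fun y η ↦ (1 + ‖η‖) ^ N *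
    ‖iteratedFDeriv ℝ k (fun w ↦ h ((cotChart (n := n) x).symm w) ^ s) (y, η)‖)
    fun y hy ↦ h2.2 y hy k N

/-- The exponential keeps positivity for all times without any smallness of χ. As f > 0, the
velocities fχ are as general as the test functions χ. -/
lemma isKineticVariation_mul_exp {f χ : CotBundle n M → ℝ} (hf : f ∈ PosDistributions n M)
    (hχ : ContMDiff (cotModel n) 𝓘(ℝ, ℝ) ∞ χ) (hc : HasCompactSupport χ) :
    IsKineticVariation f (fun t z ↦ f z * Real.exp (t * χ z)) ∧
      ∀ z, deriv (fun t ↦ f z * Real.exp (t * χ z)) 0 = f z * χ z := by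
  have hz : ∀ t : ℝ, ∀ z ∉ tsupport χ, f z * Real.exp (t * χ z) = f z := fun t z hz ↦ by
    rw [image_eq_zero_of_notMem_tsupport hz, mul_zero, Real.exp_zero, mul_one]
  refine ⟨⟨?_, fun t ↦ ?_, ?_, tsupport χ, hc, hz⟩, fun z ↦ ?_⟩
  · ext z; simp
  · refine posDistributions_of_eq_off_compact hf ?_ (fun z ↦ mul_pos (hf.2.1 z) (Real.exp_pos _))
      hc (hz t)
    refine contMDiff_cotBundle_mul hf.1 ?_
    exact (Real.contDiff_exp.comp (contDiff_const.mul contDiff_id) :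
      ContDiff ℝ ∞ fun x : ℝ ↦ Real.exp (t * x)).contMDiff.comp hχ
  · have h1 : ContMDiff (𝓘(ℝ, ℝ).prod (cotModel n)) 𝓘(ℝ, ℝ) ∞
        (fun w : ℝ × CotBundle n M ↦ w.1) := contMDiff_fst
    have h2 : ContMDiff (𝓘(ℝ, ℝ).prod (cotModel n)) 𝓘(ℝ, ℝ) ∞
        (fun w : ℝ × CotBundle n M ↦ χ w.2) := hχ.comp contMDiff_snd
    have h3 : ContMDiff (𝓘(ℝ, ℝ).prod (cotModel n)) 𝓘(ℝ, ℝ) ∞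
        (fun w : ℝ × CotBundle n M ↦ f w.2) := hf.1.comp contMDiff_snd
    have h4 : ContDiff ℝ ∞ fun v : ℝ × ℝ × ℝ ↦ v.1 * Real.exp (v.2.1 * v.2.2) := by fun_prop
    exact h4.contMDiff.comp (h3.prodMk_space (h1.prodMk_space h2))
  · have h1 := ((((hasDerivAt_id (0 : ℝ)).mul_const (χ z)).exp).const_mul (f z)).deriv
    simpa only [id, zero_mul, Real.exp_zero, one_mul] using h1

variable [SigmaCompactSpace M]

/-- The test function is a bump at z₀ times φ - ψ; the difference of the two integrals is then the
integral of a continuous nonnegative function, positive at z₀ if φ and ψ differ there. -/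
lemma eq_of_integral_eq_of_compactSupport {φ ψ : CotBundle n M → ℝ}
    (hφ : ContMDiff (cotModel n) 𝓘(ℝ, ℝ) ∞ φ) (hψ : ContMDiff (cotModel n) 𝓘(ℝ, ℝ) ∞ ψ)
    (h : ∀ χ : CotBundle n M → ℝ, ContMDiff (cotModel n) 𝓘(ℝ, ℝ) ∞ χ → HasCompactSupport χ →
      ∫ z, χ z * φ z ∂(liouville n M) = ∫ z, χ z * ψ z ∂(liouville n M)) : φ = ψ := by
  ext z₀
  let b : SmoothBumpFunction (cotModel n) z₀ := Classical.arbitrary _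
  have hbs : ContMDiff (cotModel n) 𝓘(ℝ, ℝ) ∞ b := b.contMDiff
  have hδ : ContMDiff (cotModel n) 𝓘(ℝ, ℝ) ∞ fun z ↦ φ z - ψ z :=
    contMDiff_cotBundle_iff.2 fun x ↦
      (contMDiff_cotBundle_iff.1 hφ x).sub (contMDiff_cotBundle_iff.1 hψ x)
  set χ : CotBundle n M → ℝ := fun z ↦ b z * (φ z - ψ z) with hχ
  have hχs := contMDiff_cotBundle_mul hbs hδ
  have hχc : HasCompactSupport χ := b.hasCompactSupport.mul_right
  have key := h χ hχs hχc
  have hint : ∀ {φ : CotBundle n M → ℝ}, Continuous φ →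
      Integrable (fun z ↦ χ z * φ z) (liouville n M) := fun {φ} h ↦
    (hχs.continuous.mul h).integrable_of_hasCompactSupport hχc.mul_right
  rw [← sub_eq_zero, ← integral_sub (hint hφ.continuous) (hint hψ.continuous)] at key
  by_contra hne
  have hcont : Continuous fun z ↦ χ z * φ z - χ z * ψ z :=
    (hχs.continuous.mul hφ.continuous).sub (hχs.continuous.mul hψ.continuous)
  have e : ∀ z, χ z * φ z - χ z * ψ z = b z * (φ z - ψ z) ^ 2 := fun z ↦ by
    rw [hχ]; ring
  refine (hcont.integral_pos_of_hasCompactSupport_nonneg_nonzero (μ := liouville n M)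
    (hχc.mul_right.sub hχc.mul_right) (fun z ↦ ?_) (x := z₀) ?_).ne' key
  · rw [Pi.zero_apply, e]
    exact mul_nonneg b.nonneg (sq_nonneg _)
  · rw [e, b.eq_one, one_mul]
    exact pow_ne_zero 2 (sub_ne_zero.2 hne)

/-- Functional derivatives of functionals of the distribution function are unique. -/
theorem HasKineticDeriv.unique {F : (CotBundle n M → ℝ) → ℝ} {f φ ψ : CotBundle n M → ℝ}
    (hf : f ∈ PosDistributions n M) (hφ : HasKineticDeriv F f φ) (hψ : HasKineticDeriv F f ψ) :
    φ = ψ := by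
  have h := eq_of_integral_eq_of_compactSupport (contMDiff_cotBundle_mul hf.1 hφ.1)
    (contMDiff_cotBundle_mul hf.1 hψ.1) fun χ hχ hχc ↦ by
      obtain ⟨hvar, hder⟩ := isKineticVariation_mul_exp hf hχ hχc
      have key := (hφ.2 _ hvar).unique (hψ.2 _ hvar)
      simp only [hder] at key
      simpa only [mul_left_comm, mul_assoc] using key
  ext z
  exact mul_left_cancel₀ (hf.2.1 z).ne' (congrFun h z)

/-- The functional derivative of `F ∘ J`. -/
theorem HasPathDeriv.hasKineticDeriv {I : Set ℝ} (hI : UniqueDiffOn ℝ I) (hIm : MeasurableSet I)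
    (hI0 : (0 : ℝ) ∈ I) (hIl : I ⊆ Ioi (-1 / 2 : ℝ)) {F : PathDual n M → ℝ}
    {f : CotBundle n M → ℝ} (hf : f ∈ PosDistributions n M) {X : PathAlg n M}
    (hX : HasPathDeriv I F (combinedJ f) X) :
    HasKineticDeriv (F ∘ combinedJ) f (X.pullback I f) := by
  refine ⟨hX.1.contMDiff_pullback hI hIm hf.1 hf.2.1, fun c hc ↦ ?_⟩
  obtain ⟨K, hK, hK0⟩ := hc.exists_compact
  have hvc := hc.contMDiff_velocity.continuous
  have h1 := pathPairing_kernel hf (kernelBound_of_compact hf.1.continuous hf.2.1 hvc hK hK0) hvc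
    (b₀ := 1) (b₁ := 1) hI hIm hI0 hIl hX.1 (hK.image continuous_cotProj)
    (Or.inl fun z hz ↦ hK0 z fun h ↦ hz ⟨z, h, rfl⟩)
    (ζ := pathVelocity fun t ↦ combinedJ (c t)) (hc.velocity_mom hf) fun ξ hξ q ↦ by
      have : -1 / 2 < ξ := hIl hξ
      rw [hc.velocity_dens hf (by linarith) q]
      simp only [one_mul]
  have h2 := hX.2 _ (hc.isPathVariation hf hIl)
  rw [h1.2] at h2
  simp only [one_mul] at h2
  exact h2

end KineticDerivative

/-! ### Functions of q and log f with exponential growth bounds -/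

section ExponentialGrowth

variable {W D : Type} [NormedAddCommGroup W] [NormedSpace ℝ W] [NormedAddCommGroup D]
  [NormedSpace ℝ D]

/-- Growth at most like `exp (c s)` as `s → -∞`, with one derivative, locally uniformly on `V`. -/
def ExpGrowthOn (V : Set W) (c : ℝ) (Γ : W × ℝ → ℝ) : Prop :=
  ContDiffOn ℝ ∞ Γ (V ×ˢ univ) ∧ ∀ L, IsCompact L → L ⊆ V → ∀ Λ : ℝ, ∃ C, 0 ≤ C ∧
    ∀ w ∈ L, ∀ s ≤ Λ, |Γ (w, s)| ≤ C * Real.exp (c * s) ∧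
      ‖fderiv ℝ Γ (w, s)‖ ≤ C * Real.exp (c * s)

lemma hasFDerivAt_comp_level {V : Set W} {Γ : W × ℝ → ℝ} (hΓ : ContDiffOn ℝ ∞ Γ (V ×ˢ univ))
    (hV : IsOpen V) {l : W × D → ℝ} (hl : ContDiffOn ℝ ∞ l (V ×ˢ univ)) {w : W × D} (hw : w.1 ∈ V) :
    HasFDerivAt (fun v : W × D ↦ Γ (v.1, l v))
      ((fderiv ℝ Γ (w.1, l w)).comp ((ContinuousLinearMap.fst ℝ W D).prod (fderiv ℝ l w))) w := by
  have h1 := ((hΓ.contDiffAt ((hV.prod isOpen_univ).mem_nhds (x := (w.1, l w)) ⟨hw, mem_univ (l w)⟩)).differentiableAt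
    (by simp)).hasFDerivAt
  have h2 := ((hl.contDiffAt ((hV.prod isOpen_univ).mem_nhds (x := w)
    ⟨hw, mem_univ w.2⟩)).differentiableAt (by simp)).hasFDerivAt
  have hf : HasFDerivAt (Prod.fst : W × D → W) (.fst ℝ W D) w := hasFDerivAt_fst
  exact h1.comp (f := fun v : W × D ↦ (v.1, l v)) w (hf.prodMk h2)

/-- The first-order case of temperateness, uniform over a compact set: a derivative of l = log f
costs an arbitrarily small negative power of f. The summand 1 is included because l is bounded
above. -/
lemma LogDecayOn.exists_level_bounds {V : Set W} (hV : IsOpen V) {l : W × D → ℝ}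
    (hl : LogDecayOn V l) {L : Set W} (hL : IsCompact L) (hLV : L ⊆ V) {ε : ℝ} (hε : 0 < ε) :
    ∃ Λ C, 0 ≤ C ∧ ∀ w ∈ L, ∀ η, l (w, η) ≤ Λ ∧
      1 + ‖fderiv ℝ l (w, η)‖ ≤ C * Real.exp (-(ε * l (w, η))) := by
  obtain ⟨Λ, hΛ⟩ := exists_bound_of_locally hL hLV (φ := fun y η ↦ l (y, η))
    fun y hy ↦ hl.exists_le hy
  obtain ⟨C, hC⟩ := exists_bound_of_locally hL hLV
    (φ := fun y η ↦ ‖fderiv ℝ l (y, η)‖ * Real.exp (ε * l (y, η))) fun y hy ↦ by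
      obtain ⟨C, hC⟩ := (hl.temperate hV).2 y hy 1 ε hε
      refine ⟨C, hC.mono fun w hw η ↦ ?_⟩
      rw [← le_div_iff₀ (Real.exp_pos _), div_eq_mul_inv, ← Real.exp_neg,
        ← norm_iteratedFDeriv_one]
      exact hw η
  refine ⟨Λ, Real.exp (ε * Λ) + |C|, by positivity, fun w hw η ↦ ⟨hΛ w hw η, ?_⟩⟩
  rw [add_mul]
  refine add_le_add ?_ ?_
  · rw [← Real.exp_add]
    exact Real.one_le_exp (by nlinarith [hΛ w hw η])
  · rw [Real.exp_neg, ← div_eq_mul_inv, le_div_iff₀ (Real.exp_pos _)]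
    exact (hC w hw η).trans (le_abs_self C)

lemma norm_comp_fst_prod_le (a : W × ℝ →L[ℝ] ℝ) (b : W × D →L[ℝ] ℝ) :
    ‖a.comp ((ContinuousLinearMap.fst ℝ W D).prod b)‖ ≤ ‖a‖ * (1 + ‖b‖) := by
  refine (a.opNorm_comp_le _).trans ?_
  gcongr
  refine ContinuousLinearMap.opNorm_le_bound _ (by positivity) fun v ↦ ?_
  refine max_le ?_ ?_
  · have h1 : ‖v.1‖ ≤ ‖v‖ := norm_fst_le v
    change ‖v.1‖ ≤ _
    nlinarith [norm_nonneg b, norm_nonneg v]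
  · have h1 := b.le_opNorm v
    change ‖b v‖ ≤ _
    nlinarith [norm_nonneg b, norm_nonneg v]

/-- Bounds for the composition of a function of exponential growth with a logarithm. -/
lemma ExpGrowthOn.exists_comp_bound {V : Set W} (hV : IsOpen V) {c : ℝ} {Γ : W × ℝ → ℝ}
    (hΓ : ExpGrowthOn V c Γ) {l : W × D → ℝ} (hl : LogDecayOn V l) {L : Set W} (hL : IsCompact L)
    (hLV : L ⊆ V) {ε : ℝ} (hε : 0 < ε) :
    ∃ C, 0 ≤ C ∧ ∀ w ∈ L, ∀ η, |Γ (w, l (w, η))| ≤ C * Real.exp ((c - ε) * l (w, η)) ∧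
      ‖fderiv ℝ (fun v : W × D ↦ Γ (v.1, l v)) (w, η)‖ ≤ C * Real.exp ((c - ε) * l (w, η)) := by
  obtain ⟨Λ, C, hC0, hC⟩ := hl.exists_level_bounds hV hL hLV hε
  obtain ⟨B, hB0, hB⟩ := hΓ.2 L hL hLV Λ
  have key : ∀ w ∈ L, ∀ η, ∀ A ≤ B * Real.exp (c * l (w, η)), 0 ≤ A →
      A * (1 + ‖fderiv ℝ l (w, η)‖) ≤ B * C * Real.exp ((c - ε) * l (w, η)) := by
    intro w hw η A hA hA0
    calc A * (1 + ‖fderiv ℝ l (w, η)‖) ≤ B * Real.exp (c * l (w, η)) *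
        (C * Real.exp (-(ε * l (w, η)))) := by gcongr; exact (hC w hw η).2
      _ = B * C * (Real.exp (c * l (w, η)) * Real.exp (-(ε * l (w, η)))) := by ring
      _ = _ := by rw [← Real.exp_add]; ring_nf
  refine ⟨B * C, by positivity, fun w hw η ↦ ⟨?_, ?_⟩⟩
  · refine le_trans ?_ (key w hw η _ (hB w hw _ (hC w hw η).1).1 (abs_nonneg _))
    nlinarith [abs_nonneg (Γ (w, l (w, η))), norm_nonneg (fderiv ℝ l (w, η))]
  · rw [(hasFDerivAt_comp_level hΓ.1 hV hl.1 (w := (w, η)) (hLV hw)).fderiv]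
    exact (norm_comp_fst_prod_le _ _).trans
      (key w hw η _ (hB w hw _ (hC w hw η).1).2 (norm_nonneg _))

/-- `exp l · Γ(·, l)` is rapidly decreasing with its first derivatives. -/
lemma ExpGrowthOn.exists_exp_mul_bound {V : Set W} (hV : IsOpen V) {c : ℝ} {Γ : W × ℝ → ℝ}
    (hΓ : ExpGrowthOn V c Γ) (hc : -1 < c) {l : W × D → ℝ} (hl : LogDecayOn V l) {L : Set W}
    (hL : IsCompact L) (hLV : L ⊆ V) (N : ℕ) :
    ∃ C, ∀ w ∈ L, ∀ η, (1 + ‖η‖) ^ N * (|Real.exp (l (w, η)) * Γ (w, l (w, η))| +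
      ‖fderiv ℝ (fun v : W × D ↦ Real.exp (l v) * Γ (v.1, l v)) (w, η)‖) ≤ C := by
  -- With e^l from the prefactor, e^{(c-ε)l} from Γ or its derivative and e^{-εl} from the
  -- derivative of l, the total exponent is 1 + c - 2ε = ε > 0, enough for any polynomial weight.
  set ε := (1 + c) / 3 with hεd
  have hε : 0 < ε := by rw [hεd]; linarith
  obtain ⟨B, hB0, hB⟩ := hΓ.exists_comp_bound hV hl hL hLV hε
  obtain ⟨Λ, C, hC0, hC⟩ := hl.exists_level_bounds hV hL hLV hε
  obtain ⟨A, hA⟩ := exists_bound_of_locally hL hLV (φ := fun y η ↦ (1 + ‖η‖) ^ N *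
    Real.exp (ε * l (y, η))) fun y hy ↦ hl.exists_exp_bound hy hε N
  refine ⟨2 * (B * C) * A, fun w hw η ↦ ?_⟩
  have h1 := (hasFDerivAt_comp_level hΓ.1 hV hl.1 (w := (w, η)) (hLV hw))
  have h2 := ((hl.1.contDiffAt ((hV.prod isOpen_univ).mem_nhds (x := (w, η))
    ⟨hLV hw, mem_univ η⟩)).differentiableAt (by simp)).hasFDerivAt.exp
  have h3 := (h2.mul h1).fderiv
  rw [← h1.fderiv] at h3
  rw [show fderiv ℝ (fun v : W × D ↦ Real.exp (l v) * Γ (v.1, l v)) (w, η) = _ from h3]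
  obtain ⟨b1, b2⟩ := hB w hw η
  obtain ⟨-, c2⟩ := hC w hw η
  set t := l (w, η)
  set g := Γ (w, t)
  set d := fderiv ℝ (fun v : W × D ↦ Γ (v.1, l v)) (w, η)
  set e := fderiv ℝ l (w, η)
  have n1 : ‖Real.exp t • d + g • Real.exp t • e‖ ≤ Real.exp t * ‖d‖ + |g| * (Real.exp t * ‖e‖) := by
    refine (norm_add_le _ _).trans ?_
    rw [norm_smul, norm_smul, norm_smul, Real.norm_of_nonneg (Real.exp_pos t).le, Real.norm_eq_abs]
  have n2 : Real.exp t * (B * Real.exp ((c - ε) * t)) * (C * Real.exp (-(ε * t))) =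
      B * C * Real.exp (ε * t) := by
    calc _ = B * C * (Real.exp t * Real.exp ((c - ε) * t) * Real.exp (-(ε * t))) := by ring
      _ = _ := by
        rw [← Real.exp_add, ← Real.exp_add]
        congr 2
        rw [hεd]; ring
  have n3 : |Real.exp t * g| + (Real.exp t * ‖d‖ + |g| * (Real.exp t * ‖e‖)) ≤
      2 * (B * C * Real.exp (ε * t)) := by
    rw [abs_mul, abs_of_pos (Real.exp_pos t), ← n2]
    have hE := Real.exp_pos t
    have m1 : Real.exp t * |g| * (1 + ‖e‖) ≤
        Real.exp t * (B * Real.exp ((c - ε) * t)) * (C * Real.exp (-(ε * t))) := by gcongr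
    have m2 : Real.exp t * ‖d‖ * 1 ≤
        Real.exp t * (B * Real.exp ((c - ε) * t)) * (C * Real.exp (-(ε * t))) := by
      gcongr
      linarith [norm_nonneg e]
    linarith
  calc _ ≤ (1 + ‖η‖) ^ N * (2 * (B * C * Real.exp (ε * t))) := by
        gcongr
        exact (add_le_add_right n1 _).trans n3
    _ = 2 * (B * C) * ((1 + ‖η‖) ^ N * Real.exp (ε * t)) := by ring
    _ ≤ _ := by gcongr; exact hA w hw η

end ExponentialGrowth

/-! ### Total derivatives along a fibre -/

section LevelFlux

variable {D : Type} [NormedAddCommGroup D] [NormedSpace ℝ D] [FiniteDimensional ℝ D]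
  [MeasurableSpace D] [BorelSpace D] (μ : Measure D) [μ.IsAddHaarMeasure]

/-- The antiderivative is taken from -∞, where r is integrable; it then inherits the exponential
decay, with a factor 1/ε. -/
lemma exists_antideriv_of_exp_bound {r : ℝ → ℝ} (hr : Continuous r) {C ε Λ : ℝ} (hε : 0 < ε)
    (hb : ∀ s ≤ Λ, |r s| ≤ C * Real.exp (ε * s)) :
    ∃ S : ℝ → ℝ, (∀ s, HasDerivAt S (r s) s) ∧ ∀ s ≤ Λ, |S s| ≤ C / ε * Real.exp (ε * s) := by
  have hi : ∀ s ≤ Λ, IntegrableOn r (Iic s) := fun s hs ↦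
    ((integrableOn_exp_mul_Iic hε s).const_mul C).mono' hr.aestronglyMeasurable.restrict
      ((ae_restrict_iff' measurableSet_Iic).2 (Filter.Eventually.of_forall fun t ht ↦
        hb t (le_trans ht hs)))
  have hii : ∀ s, IntegrableOn r (Iic s) := fun s ↦ by
    have h1 := (hi (min s Λ) (min_le_right _ _)).union
      (hr.continuousOn.integrableOn_compact (isCompact_Icc (a := min s Λ) (b := s)))
    refine h1.mono_set fun t ht ↦ ?_
    rcases le_total t (min s Λ) with h | h
    · exact Or.inl h
    · exact Or.inr ⟨h, ht⟩
  refine ⟨fun s ↦ ∫ t in Iic s, r t, fun s ↦ ?_, fun s hs ↦ ?_⟩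
  · have h1 : (fun s ↦ ∫ t in Iic s, r t) = fun s ↦ (∫ t in Iic 0, r t) + ∫ t in (0)..s, r t := by
      ext s
      rw [← intervalIntegral.integral_Iic_sub_Iic (hii 0) (hii s)]
      ring
    rw [h1]
    exact (intervalIntegral.integral_hasDerivAt_right (hr.intervalIntegrable _ _)
      (hr.stronglyMeasurableAtFilter _ _) hr.continuousAt).const_add _
  · refine (norm_integral_le_of_norm_le (f := r) ((integrableOn_exp_mul_Iic hε s).const_mul C)
      ((ae_restrict_iff' measurableSet_Iic).2 (Filter.Eventually.of_forall fun t ht ↦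
        hb t (le_trans ht hs)))).trans_eq ?_
    rw [integral_const_mul, integral_exp_mul_Iic hε]
    ring

/-- If S' = r, then r(l) dl = d(S ∘ l). This is a total derivative of an integrable function, and
integration by parts against the constant 1 gives zero. -/
lemma integral_level_flux_scalar {l : D → ℝ} (hl : ContDiff ℝ 1 l) {r : ℝ → ℝ} (hr : Continuous r)
    {C ε Λ : ℝ} (hε : 0 < ε) (hb : ∀ s ≤ Λ, |r s| ≤ C * Real.exp (ε * s)) (hΛ : ∀ η, l η ≤ Λ)
    (hi : Integrable (fun η ↦ Real.exp (ε * l η)) μ)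
    (v : D) (hi' : Integrable (fun η ↦ r (l η) * fderiv ℝ l η v) μ) :
    ∫ η, r (l η) * fderiv ℝ l η v ∂μ = 0 := by
  obtain ⟨S, hS, hSb⟩ := exists_antideriv_of_exp_bound hr hε hb
  have hd : ∀ η, HasFDerivAt (fun η ↦ S (l η)) (r (l η) • fderiv ℝ l η) η := fun η ↦
    (hS (l η)).comp_hasFDerivAt η ((hl.differentiable one_ne_zero) η).hasFDerivAt
  have hSc : Continuous S := continuous_iff_continuousAt.2 fun s ↦ (hS s).continuousAt
  have h1 := integral_mul_fderiv_eq_neg_fderiv_mul_of_integrable (μ := μ) (v := v)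
    (f := fun _ : D ↦ (1 : ℝ)) (g := fun η ↦ S (l η)) (by simp) ?_ ?_
    (fun _ _ ↦ differentiableAt_const _) (fun η _ ↦ (hd η).differentiableAt)
  · simpa [(hd _).fderiv] using h1
  · simpa [(hd _).fderiv] using hi'
  · simp only [one_mul]
    exact (hi.const_mul (C / ε)).mono' (hSc.comp hl.continuous).aestronglyMeasurable
      (Filter.Eventually.of_forall fun η ↦ hSb _ (hΛ η))

/-- The flux of a vector field that depends on the fibre variable only through `l` integrates to
zero. -/
theorem integral_level_flux {l : D → ℝ} (hl : ContDiff ℝ 1 l) {R : ℝ → D} (hR : Continuous R)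
    {C ε Λ : ℝ} (hε : 0 < ε) (hb : ∀ s ≤ Λ, ‖R s‖ ≤ C * Real.exp (ε * s)) (hΛ : ∀ η, l η ≤ Λ)
    (hi : Integrable (fun η ↦ Real.exp (ε * l η)) μ)
    (hi' : Integrable (fun η ↦ Real.exp (ε * l η) * ‖fderiv ℝ l η‖) μ) :
    ∫ η, fderiv ℝ l η (R (l η)) ∂μ = 0 := by
  let b := Module.finBasis ℝ D
  have hc : ∀ i, Continuous fun s ↦ b.coord i (R s) := fun i ↦
    (LinearMap.continuous_of_finiteDimensional (b.coord i)).comp hR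
  have hbd : ∀ i, ∀ s ≤ Λ, |b.coord i (R s)| ≤
      ‖LinearMap.toContinuousLinearMap (b.coord i)‖ * C * Real.exp (ε * s) := fun i s hs ↦ by
    refine ((LinearMap.toContinuousLinearMap (b.coord i)).le_opNorm (R s)).trans ?_
    rw [mul_assoc]
    gcongr
    exact hb s hs
  have hint : ∀ i, Integrable (fun η ↦ b.coord i (R (l η)) * fderiv ℝ l η (b i)) μ := fun i ↦ by
    refine (hi'.const_mul (‖LinearMap.toContinuousLinearMap (b.coord i)‖ * C * ‖b i‖)).mono'
      (((hc i).comp hl.continuous).mul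
        ((hl.continuous_fderiv one_ne_zero).clm_apply continuous_const)).aestronglyMeasurable
      (Filter.Eventually.of_forall fun η ↦ ?_)
    rw [norm_mul]
    calc _ ≤ ‖LinearMap.toContinuousLinearMap (b.coord i)‖ * C * Real.exp (ε * l η) *
          (‖fderiv ℝ l η‖ * ‖b i‖) :=
          mul_le_mul (hbd i _ (hΛ η)) ((fderiv ℝ l η).le_opNorm _) (norm_nonneg _)
            ((abs_nonneg _).trans (hbd i _ (hΛ η)))
      _ = _ := by ring
  have e : ∀ η, fderiv ℝ l η (R (l η)) = ∑ i, b.coord i (R (l η)) * fderiv ℝ l η (b i) := fun η ↦ by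
    conv_lhs => rw [← b.sum_repr (R (l η)), map_sum]
    simp only [map_smul, smul_eq_mul, Module.Basis.coord_apply]
  simp only [e]
  rw [integral_finsetSum _ fun i _ ↦ hint i]
  exact Finset.sum_eq_zero fun i _ ↦
    integral_level_flux_scalar μ hl (hc i) hε (hbd i) hΛ hi (b i) (hint i)

end LevelFlux

/-! ### The semidirect product bracket and its generating function -/

section BracketOfPullbacks

variable {n : ℕ} {M : Type*} [TopologicalSpace M] [ChartedSpace (ModelE n) M]
  [IsManifold 𝓘(ℝ, ModelE n) ∞ M]

open VectorField in
/-- The Lie bracket of vector fields in preferred coordinates. -/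
lemma mlieBracket_preferred (u v : (q : M) → TangentSpace 𝓘(ℝ, ModelE n) q) (q : M) :
    mlieBracket 𝓘(ℝ, ModelE n) u v q =
      fderiv ℝ (vecRep q v) (chartAt (ModelE n) q q) (u q) -
        fderiv ℝ (vecRep q u) (chartAt (ModelE n) q q) (v q) := by
  have hq := mem_chart_source (ModelE n) q
  have h1 : ∀ w : (q : M) → TangentSpace 𝓘(ℝ, ModelE n) q,
      ∀ᶠ y in 𝓝 (chartAt (ModelE n) q q),
      mpullbackWithin 𝓘(ℝ, ModelE n) 𝓘(ℝ, ModelE n) (extChartAt 𝓘(ℝ, ModelE n) q).symm w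
        -- Pulling back along the inverse chart means applying the inverse of its derivative, which
        -- is the change of tangent coordinates to the chart at q.
        (range 𝓘(ℝ, ModelE n)) y = vecRep q w y := by
    intro w
    filter_upwards [(chartAt (ModelE n) q).open_target.mem_nhds (mem_chart_target _ q)] with y hy
    have hy' : y ∈ (extChartAt 𝓘(ℝ, ModelE n) q).target := by simpa only [mfld_simps] using hy
    have hs := (chartAt (ModelE n) q).map_target hy
    have h2 : (mfderivWithin 𝓘(ℝ, ModelE n) 𝓘(ℝ, ModelE n) (extChartAt 𝓘(ℝ, ModelE n) q).symm
        (range 𝓘(ℝ, ModelE n)) y).inverse =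
        tcc ((chartAt (ModelE n) q).symm y) q ((chartAt (ModelE n) q).symm y) :=
      (ContinuousLinearMap.inverse_eq
        (mfderivWithin_extChartAt_symm_comp_mfderiv_extChartAt hy')
        (mfderiv_extChartAt_comp_mfderivWithin_extChartAt_symm hy')).trans
        (mfderiv_chartAt_eq_tangentCoordChange (I := 𝓘(ℝ, ModelE n)) hs)
    exact DFunLike.congr_fun h2 (w ((chartAt (ModelE n) q).symm y))
  have h2 : (mfderiv 𝓘(ℝ, ModelE n) 𝓘(ℝ, ModelE n) (extChartAt 𝓘(ℝ, ModelE n) q) q).inverse =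
      ContinuousLinearMap.id ℝ (ModelE n) := by
    have h3 : mfderiv 𝓘(ℝ, ModelE n) 𝓘(ℝ, ModelE n) (extChartAt 𝓘(ℝ, ModelE n) q) q =
        ContinuousLinearMap.id ℝ (ModelE n) :=
      (mfderiv_chartAt_eq_tangentCoordChange (I := 𝓘(ℝ, ModelE n)) hq).trans (tcc_self hq)
    exact (congrArg _ h3).trans ContinuousLinearMap.inverse_id
  have h4 : (extChartAt 𝓘(ℝ, ModelE n) q).symm ⁻¹' univ ∩ range 𝓘(ℝ, ModelE n) =
      (univ : Set (ModelE n)) := by simp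
  have h5 : lieBracketWithin ℝ
      (mpullbackWithin 𝓘(ℝ, ModelE n) 𝓘(ℝ, ModelE n) (extChartAt 𝓘(ℝ, ModelE n) q).symm u
        (range 𝓘(ℝ, ModelE n)))
      (mpullbackWithin 𝓘(ℝ, ModelE n) 𝓘(ℝ, ModelE n) (extChartAt 𝓘(ℝ, ModelE n) q).symm v
        (range 𝓘(ℝ, ModelE n)))
      ((extChartAt 𝓘(ℝ, ModelE n) q).symm ⁻¹' univ ∩ range 𝓘(ℝ, ModelE n))
      (extChartAt 𝓘(ℝ, ModelE n) q q) =
      lieBracket ℝ (vecRep q u) (vecRep q v) (chartAt (ModelE n) q q) := by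
    rw [h4]
    refine (congrFun lieBracketWithin_univ _).trans ?_
    exact Filter.EventuallyEq.lieBracket_vectorField_eq (h1 u) (h1 v)
  have h6 := (DFunLike.congr_fun h2 _).trans h5
  rw [lieBracket, vecRep_preferred, vecRep_preferred] at h6
  exact h6

lemma contMDiff_of_contDiffOn_chart {g : M → ℝ}
    (h : ∀ x, ContDiffOn ℝ ∞ (fun y ↦ g ((chartAt (ModelE n) x).symm y))
      (chartAt (ModelE n) x).target) : ContMDiff 𝓘(ℝ, ModelE n) 𝓘(ℝ, ℝ) ∞ g := by
  intro q
  have h1 : ContMDiffAt 𝓘(ℝ, ModelE n) 𝓘(ℝ, ModelE n) ∞ (chartAt (ModelE n) q) q :=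
    contMDiffOn_chart.contMDiffAt ((chartAt (ModelE n) q).open_source.mem_nhds
      (mem_chart_source _ q))
  have h2 := ((h q).contDiffAt ((chartAt (ModelE n) q).open_target.mem_nhds
    (mem_chart_target _ q))).contMDiffAt
  refine (h2.comp q h1).congr_of_eventuallyEq ?_
  filter_upwards [(chartAt (ModelE n) q).open_source.mem_nhds (mem_chart_source _ q)] with q' hq'
  exact congrArg g ((chartAt (ModelE n) q).left_inv hq').symm

lemma contMDiffOn_of_contDiffOn_chart {I : Set ℝ} {g : ℝ → M → ℝ}
    (h : ∀ x, ContDiffOn ℝ ∞ (fun v : ℝ × ModelE n ↦ g v.1 ((chartAt (ModelE n) x).symm v.2))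
      (I ×ˢ (chartAt (ModelE n) x).target)) :
    ContMDiffOn (𝓘(ℝ, ℝ).prod 𝓘(ℝ, ModelE n)) 𝓘(ℝ, ℝ) ∞ (fun w : ℝ × M ↦ g w.1 w.2)
      (I ×ˢ univ) := by
  rintro ⟨ξ, q⟩ ⟨hξ, -⟩
  have ho : (univ : Set ℝ) ×ˢ (chartAt (ModelE n) q).source ∈ 𝓝 (ξ, q) :=
    prod_mem_nhds Filter.univ_mem ((chartAt (ModelE n) q).open_source.mem_nhds
      (mem_chart_source _ q))
  rw [← contMDiffWithinAt_inter ho]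
  have h1 : ContMDiffOn (𝓘(ℝ, ℝ).prod 𝓘(ℝ, ModelE n)) 𝓘(ℝ, ModelE n) ∞
      (fun w : ℝ × M ↦ chartAt (ModelE n) q w.2)
      (I ×ˢ univ ∩ univ ×ˢ (chartAt (ModelE n) q).source) :=
    (contMDiffOn_chart (I := 𝓘(ℝ, ModelE n)) (n := ∞)).comp contMDiff_snd.contMDiffOn
      fun w hw ↦ hw.2.2
  have h2 : ContMDiffOn (𝓘(ℝ, ℝ).prod 𝓘(ℝ, ModelE n)) 𝓘(ℝ, ℝ) ∞ (fun w : ℝ × M ↦ w.1)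
      (I ×ˢ univ ∩ univ ×ˢ (chartAt (ModelE n) q).source) := contMDiff_fst.contMDiffOn
  have h3 := (h q).contMDiffOn.comp (h2.prodMk_space h1)
    fun w hw ↦ ⟨hw.1.1, (chartAt (ModelE n) q).map_source hw.2.2⟩
  refine (h3.congr fun w hw ↦ ?_) _ ⟨⟨hξ, mem_univ _⟩, mem_univ _, mem_chart_source _ q⟩
  exact congrArg (g w.1) ((chartAt (ModelE n) q).left_inv hw.2.2).symm

/-- The Lie derivative of all functions along `u`. -/
def PathAlg.along (u : (q : M) → TangentSpace 𝓘(ℝ, ModelE n) q) (Y : PathAlg n M) :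
    PathAlg n M where
  vec := u
  fam ξ q := lieDerivFun u (Y.fam ξ) q
  jet a q := lieDerivFun u (Y.jet a) q

lemma lieDerivFun_eq_zero_of_vec {u : (q : M) → TangentSpace 𝓘(ℝ, ModelE n) q} {q : M}
    (h : u q = 0) (g : M → ℝ) : lieDerivFun u g q = 0 := by
  rw [lieDerivFun, h]
  exact map_zero (mfderiv 𝓘(ℝ, ModelE n) 𝓘(ℝ, ℝ) g q)

lemma lieDerivFun_eq_zero_of_eventuallyEq (u : (q : M) → TangentSpace 𝓘(ℝ, ModelE n) q) {q : M}
    {g : M → ℝ} (h : g =ᶠ[𝓝 q] fun _ ↦ 0) : lieDerivFun u g q = 0 := by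
  rw [lieDerivFun, h.mfderiv_eq, mfderiv_const]
  rfl

lemma PathAlg.IsRegular.contMDiff_fam {I : Set ℝ} {Y : PathAlg n M} (h : Y.IsRegular I) {ξ : ℝ}
    (hξ : ξ ∈ I) : ContMDiff 𝓘(ℝ, ModelE n) 𝓘(ℝ, ℝ) ∞ (Y.fam ξ) :=
  contMDiff_of_contDiffOn_chart fun x ↦
    (h.contDiffOn_famRep x).comp (f := fun y ↦ (ξ, y)) (by fun_prop) fun y hy ↦ ⟨hξ, hy⟩

lemma PathAlg.IsRegular.along {I : Set ℝ} (hI : UniqueDiffOn ℝ I) {Y : PathAlg n M}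
    (h : Y.IsRegular I) {u : (q : M) → TangentSpace 𝓘(ℝ, ModelE n) q} (hu : SmoothVectorField u) :
    (Y.along u).IsRegular I := by
  obtain ⟨S, hS, hSI, hfam⟩ := h.exists_smoothFamily
  refine ⟨hu, contMDiffOn_of_contDiffOn_chart fun x ↦ ?_, ?_, fun a ↦
    contMDiff_of_contDiffOn_chart fun x ↦ ?_, ?_⟩
  · have h1 := ((hfam x).fderiv (chartAt (ModelE n) x).open_target hI).1
    have h2 : ContDiffOn ℝ ∞ (fun v : ℝ × ModelE n ↦ vecRep x u v.2)
        (I ×ˢ (chartAt (ModelE n) x).target) :=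
      (hu.contDiffOn_vecRep x).comp contDiffOn_snd fun v hv ↦ hv.2
    exact (h1.clm_apply h2).congr fun v hv ↦ lieDerivFun_eq (h.contMDiff_fam hv.1) x hv.2
  · obtain ⟨K, hK, hKI, hK0⟩ := h.2.2.1
    refine ⟨K, hK, hKI, fun ξ hξ q ↦ lieDerivFun_eq_zero_of_eventuallyEq u
      (Filter.Eventually.of_forall fun q ↦ hK0 ξ hξ q)⟩
  · have h1 := (h.contDiffOn_jetRep x a).fderiv_of_isOpen (m := ∞)
      (chartAt (ModelE n) x).open_target (by simp)
    exact (h1.clm_apply (hu.contDiffOn_vecRep x)).congr fun y hy ↦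
      lieDerivFun_eq (h.2.2.2.1 a) x hy
  · obtain ⟨A, hA⟩ := h.2.2.2.2
    exact ⟨A, fun a ha q ↦ lieDerivFun_eq_zero_of_eventuallyEq u
      (Filter.Eventually.of_forall fun q ↦ hA a ha q)⟩

lemma contMDiff_base_sub {g h : M → ℝ} (hg : ContMDiff 𝓘(ℝ, ModelE n) 𝓘(ℝ, ℝ) ∞ g)
    (hh : ContMDiff 𝓘(ℝ, ModelE n) 𝓘(ℝ, ℝ) ∞ h) :
    ContMDiff 𝓘(ℝ, ModelE n) 𝓘(ℝ, ℝ) ∞ fun q ↦ g q - h q :=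
  contMDiff_of_contDiffOn_chart fun x ↦ (contDiffOn_base_comp hg x).sub (contDiffOn_base_comp hh x)

lemma SmoothVectorField.mlieBracket {u v : (q : M) → TangentSpace 𝓘(ℝ, ModelE n) q}
    (hu : SmoothVectorField u) (hv : SmoothVectorField v) :
    SmoothVectorField (VectorField.mlieBracket 𝓘(ℝ, ModelE n) u v) := by
  have : IsManifold 𝓘(ℝ, ModelE n) ((⊤ : ℕ∞) + 1) M := ‹IsManifold 𝓘(ℝ, ModelE n) ∞ M›
  have : IsManifold 𝓘(ℝ, ModelE n) (minSmoothness ℝ 2) M := by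
    rw [minSmoothness_of_isRCLikeNormedField]
    exact IsManifold.of_le (n := ∞) (WithTop.coe_le_coe.2 (le_top : (2 : ℕ∞) ≤ ⊤))
  exact ContDiff.mlieBracket_vectorField (m := (⊤ : ℕ∞)) (n := (⊤ : ℕ∞)) hu hv (by simp)

lemma PathAlg.IsRegular.lie {I : Set ℝ} (hI : UniqueDiffOn ℝ I) {X Y : PathAlg n M}
    (hX : X.IsRegular I) (hY : Y.IsRegular I) : (X.lie Y).IsRegular I := by
  have h1 := hY.along hI hX.1
  have h2 := hX.along hI hY.1
  obtain ⟨-, a1, ⟨K, hK, hKI, hK0⟩, a3, A, hA⟩ := h1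
  obtain ⟨-, b1, ⟨K', hK', hKI', hK0'⟩, b3, B, hB⟩ := h2
  refine ⟨hX.1.mlieBracket hY.1, ?_, ⟨K ∪ K', hK.union hK', union_subset hKI hKI', ?_⟩,
    fun a ↦ contMDiff_base_sub (a3 a) (b3 a), max A B, fun a ha q ↦ ?_⟩
  · exact a1.sub b1
  · intro ξ hξ q
    have e1 := hK0 ξ ⟨hξ.1, fun h ↦ hξ.2 (Or.inl h)⟩ q
    have e2 := hK0' ξ ⟨hξ.1, fun h ↦ hξ.2 (Or.inr h)⟩ q
    exact (congrArg₂ (· - ·) e1 e2).trans (sub_zero 0)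
  · have e1 := hA a (lt_of_le_of_lt (le_max_left _ _) ha) q
    have e2 := hB a (lt_of_le_of_lt (le_max_right _ _) ha) q
    exact (congrArg₂ (· - ·) e1 e2).trans (sub_zero 0)

/-- The generating function is linear in the family and the jets; a common bound for the orders of
the distributions turns the finite sums into sums over one range. -/
lemma PathAlg.gen_lie {I : Set ℝ} (hI : UniqueDiffOn ℝ I) (hIm : MeasurableSet I)
    {X Y : PathAlg n M} (hX : X.IsRegular I) (hY : Y.IsRegular I) (q : M) (s : ℝ) :
    (X.lie Y).gen I q s = (Y.along X.vec).gen I q s - (X.along Y.vec).gen I q s := by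
  have h1 := hY.along hI hX.1
  have h2 := hX.along hI hY.1
  obtain ⟨N, hN⟩ := h1.exists_order
  obtain ⟨N', hN'⟩ := h2.exists_order
  have e1 : ∀ a, max N N' ≤ a → ∀ q, (Y.along X.vec).jet a q = 0 :=
    fun a ha ↦ hN a (le_trans (le_max_left _ _) ha)
  have e2 : ∀ a, max N N' ≤ a → ∀ q, (X.along Y.vec).jet a q = 0 :=
    fun a ha ↦ hN' a (le_trans (le_max_right _ _) ha)
  have e3 : ∀ a, max N N' ≤ a → ∀ q, (X.lie Y).jet a q = 0 := fun a ha q ↦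
    (congrArg₂ (· - ·) (e1 a ha q) (e2 a ha q)).trans (sub_zero 0)
  rw [PathAlg.gen_eq_sum e1, PathAlg.gen_eq_sum e2, PathAlg.gen_eq_sum e3, add_sub_add_comm,
    ← integral_sub (h1.integrableOn_exp_mul_fam hIm q s) (h2.integrableOn_exp_mul_fam hIm q s),
    ← Finset.sum_sub_distrib]
  simp only [← mul_sub]
  rfl

/-- The bracket is a bilinear differential operator, and off the closed set K one argument vanishes
in a neighbourhood. Compact support of one functional derivative is therefore enough. -/
lemma PathAlg.VanishesOff.lie_of_isClosed {I : Set ℝ} {X Y : PathAlg n M} {K : Set M}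
    (hK : IsClosed K) (h : X.VanishesOff I K ∨ Y.VanishesOff I K) : (X.lie Y).VanishesOff I K := by
  intro q hq
  have hn : ∀ᶠ q' in 𝓝 q, q' ∉ K := hK.isOpen_compl.mem_nhds hq
  rcases h with h | h
  · refine ⟨?_, fun ξ hξ ↦ ?_, fun a ↦ ?_⟩
    · have e : X.vec =ᶠ[𝓝 q] (0 : (q : M) → TangentSpace 𝓘(ℝ, ModelE n) q) := hn.mono fun q' hq' ↦ (h q' hq').1
      exact (e.mlieBracket_vectorField_eq Filter.EventuallyEq.rfl).trans
        (congrFun VectorField.mlieBracket_zero_left q)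
    · refine (congrArg₂ (· - ·) (lieDerivFun_eq_zero_of_vec (h q hq).1 _)
        (lieDerivFun_eq_zero_of_eventuallyEq _ ?_)).trans (sub_zero 0)
      exact hn.mono fun q' hq' ↦ (h q' hq').2.1 ξ hξ
    · refine (congrArg₂ (· - ·) (lieDerivFun_eq_zero_of_vec (h q hq).1 _)
        (lieDerivFun_eq_zero_of_eventuallyEq _ ?_)).trans (sub_zero 0)
      exact hn.mono fun q' hq' ↦ (h q' hq').2.2 a
  · refine ⟨?_, fun ξ hξ ↦ ?_, fun a ↦ ?_⟩
    · have e : Y.vec =ᶠ[𝓝 q] (0 : (q : M) → TangentSpace 𝓘(ℝ, ModelE n) q) := hn.mono fun q' hq' ↦ (h q' hq').1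
      exact (Filter.EventuallyEq.rfl.mlieBracket_vectorField_eq e).trans
        (congrFun VectorField.mlieBracket_zero_right q)
    · refine (congrArg₂ (· - ·) (lieDerivFun_eq_zero_of_eventuallyEq _ ?_)
        (lieDerivFun_eq_zero_of_vec (h q hq).1 _)).trans (sub_zero 0)
      exact hn.mono fun q' hq' ↦ (h q' hq').2.1 ξ hξ
    · refine (congrArg₂ (· - ·) (lieDerivFun_eq_zero_of_eventuallyEq _ ?_)
        (lieDerivFun_eq_zero_of_vec (h q hq).1 _)).trans (sub_zero 0)
      exact hn.mono fun q' hq' ↦ (h q' hq').2.2 a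

end BracketOfPullbacks

/-! ### Brackets of momentum functions with functions of q and log f -/

section BracketIdentity

variable {n : ℕ} {M : Type*} [TopologicalSpace M] [ChartedSpace (ModelE n) M]
  [IsManifold 𝓘(ℝ, ModelE n) ∞ M]

lemma canonicalBracket_add_right {α φ ψ : CotBundle n M → ℝ}
    (hα : ContMDiff (cotModel n) 𝓘(ℝ, ℝ) ∞ α) (hφ : ContMDiff (cotModel n) 𝓘(ℝ, ℝ) ∞ φ)
    (hψ : ContMDiff (cotModel n) 𝓘(ℝ, ℝ) ∞ ψ) (z : CotBundle n M) :
    canonicalBracket α (fun z ↦ φ z + ψ z) z =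
      canonicalBracket α φ z + canonicalBracket α ψ z := by
  have hz := mem_cotChart_source.2 (mem_chart_source (ModelE n) z.proj)
  have hw := (cotChart (n := n) z.proj).map_source hz
  rw [canonicalBracket_preferred hα (contMDiff_cotBundle_add hφ hψ),
    canonicalBracket_preferred hα hφ, canonicalBracket_preferred hα hψ, ← flatBracket_add_right,
    fderiv_fun_add (hφ.differentiableAt_cotChart _ hw) (hψ.differentiableAt_cotChart _ hw)]

lemma canonicalBracket_mul_right {α φ ψ : CotBundle n M → ℝ}
    (hα : ContMDiff (cotModel n) 𝓘(ℝ, ℝ) ∞ α) (hφ : ContMDiff (cotModel n) 𝓘(ℝ, ℝ) ∞ φ)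
    (hψ : ContMDiff (cotModel n) 𝓘(ℝ, ℝ) ∞ ψ) (z : CotBundle n M) :
    canonicalBracket α (fun z ↦ φ z * ψ z) z =
      φ z * canonicalBracket α ψ z + ψ z * canonicalBracket α φ z := by
  have hz := mem_cotChart_source.2 (mem_chart_source (ModelE n) z.proj)
  have hw := (cotChart (n := n) z.proj).map_source hz
  rw [canonicalBracket_preferred hα (contMDiff_cotBundle_mul hφ hψ),
    canonicalBracket_preferred hα hφ, canonicalBracket_preferred hα hψ,
    fderiv_fun_mul (hφ.differentiableAt_cotChart _ hw) (hψ.differentiableAt_cotChart _ hw),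
    flatBracket_add_right, flatBracket_smul_right, flatBracket_smul_right,
    (cotChart (n := n) z.proj).left_inv hz]

lemma contMDiff_log {f : CotBundle n M → ℝ} (hf : ContMDiff (cotModel n) 𝓘(ℝ, ℝ) ∞ f)
    (h0 : ∀ z, 0 < f z) : ContMDiff (cotModel n) 𝓘(ℝ, ℝ) ∞ fun z ↦ Real.log (f z) :=
  contMDiff_cotBundle_iff.2 fun x ↦ (contMDiff_cotBundle_iff.1 hf x).log fun _ _ ↦ (h0 _).ne'

lemma canonicalBracket_log {α f : CotBundle n M → ℝ}
    (hα : ContMDiff (cotModel n) 𝓘(ℝ, ℝ) ∞ α) (hf : ContMDiff (cotModel n) 𝓘(ℝ, ℝ) ∞ f)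
    (h0 : ∀ z, 0 < f z) (z : CotBundle n M) :
    canonicalBracket α f z = f z * canonicalBracket α (fun z ↦ Real.log (f z)) z := by
  have hz := mem_cotChart_source.2 (mem_chart_source (ModelE n) z.proj)
  have hw := (cotChart (n := n) z.proj).map_source hz
  rw [canonicalBracket_preferred hα hf, canonicalBracket_preferred hα (contMDiff_log hf h0),
    ← flatBracket_smul_right]
  congr 1
  have h1 := ((hf.differentiableAt_cotChart _ hw).hasFDerivAt.log (h0 _).ne').fderiv
  rw [h1, (cotChart (n := n) z.proj).left_inv hz, smul_inv_smul₀ (h0 z).ne']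

/-- The base part of the derivative of `Y.genLog`. -/
def baseDeriv (I : Set ℝ) (N : ℕ) (Y : PathAlg n M) (x : M) (y : ModelE n) (s : ℝ) :
    ModelE n →L[ℝ] ℝ :=
  (fderiv ℝ (genFn I N (Y.famRep x) (Y.jetRep x)) (y, s)).comp (.inl ℝ (ModelE n) ℝ)

/-- Chain rule for Γ(q, log f): the base differential of Γ plus ∂_sΓ times the differential of log
f, where ∂_sΓ is the generating function of the shifted element. -/
lemma fderiv_genLog {I : Set ℝ} (hI : UniqueDiffOn ℝ I) (hIm : MeasurableSet I) {Y : PathAlg n M}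
    (hY : Y.IsRegular I) {N : ℕ} (hN : ∀ a, N ≤ a → ∀ q, Y.jet a q = 0) {f : CotBundle n M → ℝ}
    (hf : ContMDiff (cotModel n) 𝓘(ℝ, ℝ) ∞ f) (h0 : ∀ z, 0 < f z) (x : M)
    {w : ModelE n × ModelD n} (hw : w ∈ (cotChart (n := n) x).target) :
    fderiv ℝ (fun w ↦ Y.genLog I f ((cotChart (n := n) x).symm w)) w =
      (baseDeriv I N Y x w.1 (logRep f x w)).comp (.fst ℝ (ModelE n) (ModelD n)) +
        Y.shift.genLog I f ((cotChart x).symm w) • fderiv ℝ (logRep f x) w := by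
  obtain ⟨S, hS, hSI, hfam⟩ := hY.exists_smoothFamily
  have hV := (chartAt (ModelE n) x).open_target
  have hy : w.1 ∈ (chartAt (ModelE n) x).target := mem_cotChart_target.1 hw
  have h1 := hasFDerivAt_comp_level (contDiffOn_genFn (N := N) (hfam x) (hY.contDiffOn_jetRep x)
    hV hI hIm hS hSI) hV (contDiffOn_logRep hf h0 x) hy
  have h2 : fderiv ℝ (fun w ↦ Y.genLog I f ((cotChart (n := n) x).symm w)) w = _ :=
    (h1.congr_of_eventuallyEq (by
      filter_upwards [(isOpen_cotChart_target x).mem_nhds hw] with w' hw'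
      exact PathAlg.genLog_cotChart_symm hN I f x hw')).fderiv
  rw [h2]
  have hN' : ∀ a, N ≤ a → ∀ q, Y.shift.jet a q = 0 := fun a ha q ↦ by
    simp [PathAlg.shift, hN (a + 1) (by omega)]
  have hA := fun v t ↦ fderiv_genFn_apply (N := N) (hfam x) (hY.contDiffOn_jetRep x)
    (fun a ha y _ ↦ hN a ha _) hV hI hIm hS hSI hy (logRep f x w) v t
  ext v
  · change fderiv ℝ (genFn I N (Y.famRep x) (Y.jetRep x)) (w.1, logRep f x w)
      (v, fderiv ℝ (logRep f x) w (v, 0)) =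
      fderiv ℝ (genFn I N (Y.famRep x) (Y.jetRep x)) (w.1, logRep f x w) (v, 0) +
      Y.shift.genLog I f ((cotChart x).symm w) * fderiv ℝ (logRep f x) w (v, 0)
    rw [hA, hA, zero_mul, add_zero, PathAlg.genLog_cotChart_symm hN' I f x hw]
    exact congrArg _ (mul_comm _ _)
  · change fderiv ℝ (genFn I N (Y.famRep x) (Y.jetRep x)) (w.1, logRep f x w)
      (0, fderiv ℝ (logRep f x) w (0, v)) =
      fderiv ℝ (genFn I N (Y.famRep x) (Y.jetRep x)) (w.1, logRep f x w) (0, 0) +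
      Y.shift.genLog I f ((cotChart x).symm w) * fderiv ℝ (logRep f x) w (0, v)
    rw [hA, hA, zero_mul, add_zero, PathAlg.genLog_cotChart_symm hN' I f x hw]
    exact congrArg _ (mul_comm _ _)

/-- At fixed s, differentiating Γ along u differentiates each coefficient function, which is the Lie
derivative. -/
lemma baseDeriv_vecRep {I : Set ℝ} (hI : UniqueDiffOn ℝ I) (hIm : MeasurableSet I)
    {Y : PathAlg n M} (hY : Y.IsRegular I) {N : ℕ} (hN : ∀ a, N ≤ a → ∀ q, Y.jet a q = 0)
    (u : (q : M) → TangentSpace 𝓘(ℝ, ModelE n) q) (x : M) {y : ModelE n}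
    (hy : y ∈ (chartAt (ModelE n) x).target) (s : ℝ) :
    baseDeriv I N Y x y s (vecRep x u y) =
      (Y.along u).gen I ((chartAt (ModelE n) x).symm y) s := by
  obtain ⟨S, hS, hSI, hfam⟩ := hY.exists_smoothFamily
  have hN' : ∀ a, N ≤ a → ∀ q, (Y.along u).jet a q = 0 := fun a ha q ↦
    lieDerivFun_eq_zero_of_eventuallyEq u (Filter.Eventually.of_forall fun q ↦ hN a ha q)
  change fderiv ℝ (genFn I N (Y.famRep x) (Y.jetRep x)) (y, s) (vecRep x u y, 0) = _
  rw [fderiv_genFn_apply (N := N) (hfam x) (hY.contDiffOn_jetRep x)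
    (fun a ha y _ ↦ hN a ha _) (chartAt (ModelE n) x).open_target hI hIm hS hSI hy, zero_mul,
    add_zero, PathAlg.gen_eq_sum hN', genFn]
  congr 1
  · refine setIntegral_congr_fun hIm fun ξ hξ ↦ ?_
    exact congrArg _ (lieDerivFun_eq (hY.contMDiff_fam hξ) x hy).symm
  · refine Finset.sum_congr rfl fun a _ ↦ ?_
    exact congrArg _ (lieDerivFun_eq (hY.2.2.2.1 a) x hy).symm

lemma fibreGrad_comp_fst (c : ModelE n →L[ℝ] ℝ) :
    fibreGrad (c.comp (.fst ℝ (ModelE n) (ModelD n))) = 0 := by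
  simp [fibreGrad]

lemma fderiv_momentumFn (u : (q : M) → TangentSpace 𝓘(ℝ, ModelE n) q) (x : M)
    {w : ModelE n × ModelD n} (hw : w ∈ (cotChart (n := n) x).target) :
    fderiv ℝ (fun w ↦ momentumFn u ((cotChart (n := n) x).symm w)) w =
      fderiv ℝ (fun w : ModelE n × ModelD n ↦ w.2 (vecRep x u w.1)) w := by
  apply Filter.EventuallyEq.fderiv_eq
  filter_upwards [(isOpen_cotChart_target x).mem_nhds hw] with w hw
  exact momentumFn_cotChart_symm x u hw

lemma differentiableAt_vecRep {u : (q : M) → TangentSpace 𝓘(ℝ, ModelE n) q}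
    (hu : SmoothVectorField u) (x : M) {y : ModelE n} (hy : y ∈ (chartAt (ModelE n) x).target) :
    DifferentiableAt ℝ (vecRep x u) y :=
  ((hu.contDiffOn_vecRep x).contDiffAt ((chartAt (ModelE n) x).open_target.mem_nhds
    hy)).differentiableAt (by simp)

/-- The bracket of a momentum function with a function of `q` and `log f`. -/
lemma canonicalBracket_momentum_genLog {I : Set ℝ} (hI : UniqueDiffOn ℝ I)
    (hIm : MeasurableSet I) {Y : PathAlg n M} (hY : Y.IsRegular I) {f : CotBundle n M → ℝ}
    (hf : ContMDiff (cotModel n) 𝓘(ℝ, ℝ) ∞ f) (h0 : ∀ z, 0 < f z)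
    {u : (q : M) → TangentSpace 𝓘(ℝ, ModelE n) q} (hu : SmoothVectorField u) (z : CotBundle n M) :
    canonicalBracket (momentumFn u) (Y.genLog I f) z =
      Y.shift.genLog I f z * canonicalBracket (momentumFn u) (fun z ↦ Real.log (f z)) z -
        (Y.along u).genLog I f z := by
  obtain ⟨N, hN⟩ := hY.exists_order
  have hz := mem_cotChart_source.2 (mem_chart_source (ModelE n) z.proj)
  have hw := (cotChart (n := n) z.proj).map_source hz
  set w := cotChart (n := n) z.proj z with hwd
  have hzw : (cotChart (n := n) z.proj).symm w = z := (cotChart (n := n) z.proj).left_inv hz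
  have hy : w.1 ∈ (chartAt (ModelE n) z.proj).target := mem_cotChart_target.1 hw
  have hzp : z.proj = (chartAt (ModelE n) z.proj).symm w.1 :=
    (congrArg TotalSpace.proj hzw).symm.trans (proj_cotChart_symm' _ hw)
  rw [canonicalBracket_preferred hu.contMDiff_momentumFn (hY.contMDiff_genLog hI hIm hf h0),
    canonicalBracket_preferred hu.contMDiff_momentumFn (contMDiff_log hf h0), ← hwd,
    fderiv_genLog hI hIm hY hN hf h0 _ hw, hzw, flatBracket_add_right, flatBracket_smul_right,
    fderiv_momentumFn u _ hw]
  change flatBracket (fderiv ℝ _ (w.1, w.2)) _ + _ * flatBracket (fderiv ℝ _ w) (fderiv ℝ (logRep f z.proj) w) =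
    _ * flatBracket (fderiv ℝ _ w) (fderiv ℝ (logRep f z.proj) w) - _
  rw [flatBracket_momentum (differentiableAt_vecRep hu _ hy), fibreGrad_comp_fst]
  have h1 : logRep f z.proj w = Real.log (f z) := by rw [logRep, hzw]
  have h2 := baseDeriv_vecRep hI hIm hY hN u z.proj hy (logRep f z.proj w)
  rw [h1, ← hzp] at h2
  simp only [map_zero, zero_sub]
  rw [h1]
  change -(baseDeriv I N Y z.proj w.1 (Real.log (f z)) (vecRep z.proj u w.1)) + _ = _ - (Y.along u).gen I z.proj (Real.log (f z))
  rw [h2]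
  ring

lemma cotChart_fst {x : M} {z : CotBundle n M} (hz : z ∈ (cotChart (n := n) x).source) :
    (cotChart x z).1 = chartAt (ModelE n) x z.proj := by
  have hw := (cotChart (n := n) x).map_source hz
  have h1 : z.proj = (chartAt (ModelE n) x).symm (cotChart x z).1 :=
    (congrArg TotalSpace.proj ((cotChart (n := n) x).left_inv hz)).symm.trans
      (proj_cotChart_symm' _ hw)
  exact (((chartAt (ModelE n) x).right_inv (mem_cotChart_target.1 hw)).symm.trans
    (congrArg (chartAt (ModelE n) x) h1.symm))

/-- With the sign convention of the canonical bracket, u ↦ ⟨u, p⟩ is an antihomomorphism; this is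
the source of the minus sign in the Lie–Poisson brackets. The computation takes place in the
preferred chart at the base point, where a vector is its own coordinate vector. -/
lemma canonicalBracket_momentum_momentum {u v : (q : M) → TangentSpace 𝓘(ℝ, ModelE n) q}
    (hu : SmoothVectorField u) (hv : SmoothVectorField v) (z : CotBundle n M) :
    canonicalBracket (momentumFn u) (momentumFn v) z =
      -momentumFn (VectorField.mlieBracket 𝓘(ℝ, ModelE n) u v) z := by
  have hz := mem_cotChart_source.2 (mem_chart_source (ModelE n) z.proj)
  have hw := (cotChart (n := n) z.proj).map_source hz
  set w := cotChart (n := n) z.proj z with hwd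
  have hzw : (cotChart (n := n) z.proj).symm w = z := (cotChart (n := n) z.proj).left_inv hz
  have hy : w.1 ∈ (chartAt (ModelE n) z.proj).target := mem_cotChart_target.1 hw
  have hw1 : w.1 = chartAt (ModelE n) z.proj z.proj := cotChart_fst hz
  have h3 := momentumFn_cotChart_symm z.proj (VectorField.mlieBracket 𝓘(ℝ, ModelE n) u v) hw
  rw [hzw, hw1, vecRep_preferred, mlieBracket_preferred, ← hw1] at h3
  rw [canonicalBracket_preferred hu.contMDiff_momentumFn hv.contMDiff_momentumFn, ← hwd,
    fderiv_momentumFn u _ hw, fderiv_momentumFn v _ hw, h3]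
  change flatBracket (fderiv ℝ _ (w.1, w.2)) (fderiv ℝ _ (w.1, w.2)) = _
  rw [flatBracket_momentum (differentiableAt_vecRep hu _ hy),
    fibreGrad_momentum (differentiableAt_vecRep hv _ hy),
    (hasFDerivAt_momentum (differentiableAt_vecRep hv _ hy) w.2).fderiv]
  have e1 : vecRep z.proj u w.1 = u z.proj := by rw [hw1, vecRep_preferred]
  have e2 : vecRep z.proj v w.1 = v z.proj := by rw [hw1, vecRep_preferred]
  simp only [add_apply, ContinuousLinearMap.comp_apply, ContinuousLinearMap.coe_fst',
    ContinuousLinearMap.coe_snd', e1, e2]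
  have e3 : ∀ v : ModelE n, ContinuousLinearMap.apply ℝ ℝ v (0 : ModelD n) = 0 :=
    fun v ↦ map_zero _
  refine (congrArg (fun t : ℝ ↦ w.2 (fderiv ℝ (vecRep z.proj u) w.1 (v z.proj)) -
    (w.2 (fderiv ℝ (vecRep z.proj v) w.1 (u z.proj)) + t)) (e3 (v z.proj))).trans ?_
  rw [add_zero]
  exact (map_sub w.2 _ _).symm.trans ((congrArg w.2 (neg_sub _ _).symm).trans (map_neg w.2 _))

end BracketIdentity

/-! ### Brackets of two functions of q and log f -/

section LevelBracket

variable {W D : Type} [NormedAddCommGroup W] [NormedSpace ℝ W] [NormedAddCommGroup D]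
  [NormedSpace ℝ D]

lemma ExpGrowthOn.add {V : Set W} (hV : IsOpen V) {c : ℝ} {Γ Γ' : W × ℝ → ℝ}
    (h : ExpGrowthOn V c Γ) (h' : ExpGrowthOn V c Γ') :
    ExpGrowthOn V c fun v ↦ Γ v + Γ' v := by
  refine ⟨h.1.add h'.1, fun L hL hLV Λ ↦ ?_⟩
  obtain ⟨C, hC0, hC⟩ := h.2 L hL hLV Λ
  obtain ⟨C', hC0', hC'⟩ := h'.2 L hL hLV Λ
  refine ⟨C + C', by positivity, fun w hw s hs ↦ ?_⟩
  have hd : ∀ {Γ : W × ℝ → ℝ}, ContDiffOn ℝ ∞ Γ (V ×ˢ univ) → DifferentiableAt ℝ Γ (w, s) :=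
    fun h ↦ (h.contDiffAt ((hV.prod isOpen_univ).mem_nhds (x := (w, s))
      ⟨hLV hw, mem_univ s⟩)).differentiableAt (by simp)
  rw [fderiv_fun_add (hd h.1) (hd h'.1), add_mul]
  exact ⟨(abs_add_le _ _).trans (add_le_add (hC w hw s hs).1 (hC' w hw s hs).1),
    (norm_add_le _ _).trans (add_le_add (hC w hw s hs).2 (hC' w hw s hs).2)⟩

/-- The direction in which `l` is differentiated in the bracket of two functions of `(q, l)`. -/
def levelFlux (A B : W × ℝ →L[ℝ] ℝ) : W →L[ℝ] ℝ :=
  B (0, 1) • A.comp (.inl ℝ W ℝ) - A (0, 1) • B.comp (.inl ℝ W ℝ)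

lemma norm_levelFlux_le {A B : W × ℝ →L[ℝ] ℝ} {a b : ℝ} (hA : ‖A‖ ≤ a) (hB : ‖B‖ ≤ b) :
    ‖levelFlux A B‖ ≤ 2 * (a * b) := by
  have h1 : ∀ A : W × ℝ →L[ℝ] ℝ, ‖A.comp (.inl ℝ W ℝ)‖ ≤ ‖A‖ := fun A ↦ by
    refine (A.opNorm_comp_le _).trans (mul_le_of_le_one_right (norm_nonneg _) ?_)
    exact ContinuousLinearMap.norm_inl_le_one ℝ W ℝ
  have h2 : ∀ A : W × ℝ →L[ℝ] ℝ, ‖A (0, 1)‖ ≤ ‖A‖ := fun A ↦ by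
    refine (A.le_opNorm _).trans (mul_le_of_le_one_right (norm_nonneg _) ?_)
    simp [Prod.norm_def]
  have ha := (norm_nonneg _).trans hA
  have hb := (norm_nonneg _).trans hB
  refine (norm_sub_le _ _).trans ?_
  rw [norm_smul, norm_smul]
  have e1 := mul_le_mul ((h2 B).trans hB) ((h1 A).trans hA) (norm_nonneg _) hb
  have e2 := mul_le_mul ((h2 A).trans hA) ((h1 B).trans hB) (norm_nonneg _) ha
  linarith

/-- Two base differentials commute and dl commutes with itself. Only the cross terms survive, and
the bracket of a base differential c with dl is the derivative of l in the fibre direction c. -/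
lemma flatBracket_level {n : ℕ} (A B : ModelE n × ℝ →L[ℝ] ℝ) (d : ModelE n × ModelD n →L[ℝ] ℝ) :
    flatBracket (A.comp ((ContinuousLinearMap.fst ℝ (ModelE n) (ModelD n)).prod d))
      (B.comp ((ContinuousLinearMap.fst ℝ (ModelE n) (ModelD n)).prod d)) =
      d (0, levelFlux A B) := by
  have h1 : ∀ A : ModelE n × ℝ →L[ℝ] ℝ,
      A.comp ((ContinuousLinearMap.fst ℝ (ModelE n) (ModelD n)).prod d) =
        (A.comp (.inl ℝ (ModelE n) ℝ)).comp (.fst ℝ (ModelE n) (ModelD n)) + A (0, 1) • d := by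
    intro A
    ext v
    · change A (v, d (v, 0)) = A (v, 0) + A (0, 1) * d (v, 0)
      rw [mul_comm, ← smul_eq_mul, ← map_smul, ← map_add]
      simp
    · change A (0, d (0, v)) = A (0, 0) + A (0, 1) * d (0, v)
      rw [mul_comm, ← smul_eq_mul, ← map_smul, ← map_add]
      simp
  have h2 : ∀ c c' : ModelE n →L[ℝ] ℝ, flatBracket (c.comp (.fst ℝ (ModelE n) (ModelD n)))
      (c'.comp (.fst ℝ (ModelE n) (ModelD n))) = 0 := fun c c' ↦ by
    rw [flatBracket_eq, fibreGrad_comp_fst, fibreGrad_comp_fst]; simp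
  have h3 : ∀ c : ModelE n →L[ℝ] ℝ, flatBracket (c.comp (.fst ℝ (ModelE n) (ModelD n))) d =
      d (0, c) := fun c ↦ by
    rw [flatBracket_eq, fibreGrad_comp_fst, apply_fibreGrad d c]
    have h0 : d ((0 : ModelE n), (0 : ModelD n)) = 0 := map_zero d
    simp [h0]
  have h4 : flatBracket d d = 0 := by rw [flatBracket_eq, sub_self]
  rw [h1, h1, flatBracket_add_right, flatBracket_add_left, flatBracket_add_left,
    flatBracket_smul_right, flatBracket_smul_right, flatBracket_smul_left, flatBracket_smul_left,
    h2, h3, h4, flatBracket_swap d, h3]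
  have h5 : ((0 : ModelE n), levelFlux A B) = B (0, 1) • ((0 : ModelE n), A.comp (.inl ℝ _ ℝ)) -
      A (0, 1) • ((0 : ModelE n), B.comp (.inl ℝ _ ℝ)) := by
    ext1 <;> simp [levelFlux]
  rw [h5, map_sub, map_smul, map_smul, smul_eq_mul, smul_eq_mul]
  ring

/-- Along a fibre, the bracket of two functions of `(q, l)` times `exp l` integrates to zero. -/
theorem integral_exp_mul_flatBracket_level {n : ℕ} {V : Set (ModelE n)} (hV : IsOpen V)
    {l : ModelE n × ModelD n → ℝ} (hl : LogDecayOn V l) {r : ℝ} (hr : 0 < r)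
    {Γ Γ' : ModelE n × ℝ → ℝ} (hΓ : ExpGrowthOn V (-1 / 2 + r) Γ)
    (hΓ' : ExpGrowthOn V (-1 / 2 + r) Γ') {y : ModelE n} (hy : y ∈ V) :
    ∫ η, Real.exp (l (y, η)) * flatBracket
      (fderiv ℝ (fun v : ModelE n × ModelD n ↦ Γ (v.1, l v)) (y, η))
      (fderiv ℝ (fun v : ModelE n × ModelD n ↦ Γ' (v.1, l v)) (y, η)) ∂(covectorVolume n) = 0 := by
  obtain ⟨Λ, C, hC0, hC⟩ := hl.exists_level_bounds hV isCompact_singleton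
    (singleton_subset_iff.2 hy) hr
  obtain ⟨B, hB0, hB⟩ := hΓ.2 {y} isCompact_singleton (singleton_subset_iff.2 hy) Λ
  obtain ⟨B', hB0', hB'⟩ := hΓ'.2 {y} isCompact_singleton (singleton_subset_iff.2 hy) Λ
  set R : ℝ → ModelD n := fun s ↦
    Real.exp s • levelFlux (fderiv ℝ Γ (y, s)) (fderiv ℝ Γ' (y, s)) with hR
  have hc : ∀ {Γ : ModelE n × ℝ → ℝ}, ContDiffOn ℝ ∞ Γ (V ×ˢ univ) →
      Continuous fun s : ℝ ↦ fderiv ℝ Γ (y, s) := fun h ↦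
    continuousOn_univ.1 ((h.continuousOn_fderiv_top (hV.prod isOpen_univ)).comp
      (f := fun s : ℝ ↦ (y, s)) (by fun_prop) fun s _ ↦ ⟨hy, mem_univ _⟩)
  have hRc : Continuous R := by
    have h1 := hc hΓ.1
    have h2 := hc hΓ'.1
    have hinl : ∀ {T : ℝ → ModelE n × ℝ →L[ℝ] ℝ}, Continuous T → Continuous fun s ↦
        (T s).comp (ContinuousLinearMap.inl ℝ (ModelE n) ℝ) := fun h ↦
      h.clm_comp continuous_const
    exact Real.continuous_exp.smul (((h2.clm_apply continuous_const).smul (hinl h1)).sub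
      ((h1.clm_apply continuous_const).smul (hinl h2)))
  -- Here the bound -1/2 is used: the exponent is 1 + 2(-1/2 + r) = 2r, which is positive.
  have hRb : ∀ s ≤ Λ, ‖R s‖ ≤ 2 * (B * B') * Real.exp ((2 * r) * s) := by
    intro s hs
    rw [hR, norm_smul, Real.norm_of_nonneg (Real.exp_pos s).le]
    have h1 := norm_levelFlux_le (hB y rfl s hs).2 (hB' y rfl s hs).2
    calc _ ≤ Real.exp s * (2 * (B * Real.exp ((-1 / 2 + r) * s) *
          (B' * Real.exp ((-1 / 2 + r) * s)))) := by gcongr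
      _ = 2 * (B * B') * (Real.exp s * Real.exp ((-1 / 2 + r) * s) *
          Real.exp ((-1 / 2 + r) * s)) := by ring
      _ = _ := by
        rw [← Real.exp_add, ← Real.exp_add]
        ring_nf
  have hlc : ContDiff ℝ ∞ fun η ↦ l (y, η) :=
    contDiffOn_univ.1 (hl.1.comp (f := fun η ↦ (y, η)) (by fun_prop) fun η _ ↦ ⟨hy, mem_univ _⟩)
  have hld : ∀ η, fderiv ℝ (fun η ↦ l (y, η)) η =
      (fderiv ℝ l (y, η)).comp (.inr ℝ (ModelE n) (ModelD n)) := fun η ↦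
    (((hl.1.contDiffAt ((hV.prod isOpen_univ).mem_nhds (x := (y, η))
      ⟨hy, mem_univ η⟩)).differentiableAt (by simp)).hasFDerivAt.comp (f := fun η ↦ (y, η)) η
      (hasFDerivAt_prodMk_right y η)).fderiv
  have hint : ∀ s, 0 < s → Integrable (fun η ↦ Real.exp (s * l (y, η))) (covectorVolume n) :=
    fun s hs ↦ (hl.2 s hs).integrable integrable_one_add_norm_covector hy
  have key := integral_level_flux (covectorVolume n) (hlc.of_le (by simp)) hRc
    (ε := 2 * r) (by positivity) hRb (fun η ↦ (hC y rfl η).1) (hint _ (by positivity)) ?_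
  · rw [← key]
    congr 1
    ext η
    rw [(hasFDerivAt_comp_level hΓ.1 hV hl.1 (w := (y, η)) hy).fderiv,
      (hasFDerivAt_comp_level hΓ'.1 hV hl.1 (w := (y, η)) hy).fderiv, flatBracket_level, hld, hR,
      map_smul]
    rfl
  -- Of the exponent 2r, half pays for the derivative of l, and e^{rl} remains integrable.
  · refine ((hint r hr).const_mul C).mono' ?_ (Filter.Eventually.of_forall fun η ↦ ?_)
    · exact ((Real.continuous_exp.comp (continuous_const.mul hlc.continuous)).mul
        (hlc.continuous_fderiv (by simp)).norm).aestronglyMeasurable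
    · have h1 : ‖fderiv ℝ (fun η ↦ l (y, η)) η‖ ≤ C * Real.exp (-(r * l (y, η))) := by
        refine le_trans ?_ (hC y rfl η).2
        rw [hld]
        have := (fderiv ℝ l (y, η)).opNorm_comp_le (.inr ℝ (ModelE n) (ModelD n))
        have h2 := ContinuousLinearMap.norm_inr_le_one ℝ (ModelE n) (ModelD n)
        nlinarith [norm_nonneg (fderiv ℝ l (y, η))]
      rw [norm_mul, norm_norm, Real.norm_of_nonneg (Real.exp_pos _).le]
      calc _ ≤ Real.exp (2 * r * l (y, η)) * (C * Real.exp (-(r * l (y, η)))) := by gcongr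
        _ = C * (Real.exp (2 * r * l (y, η)) * Real.exp (-(r * l (y, η)))) := by ring
        _ = _ := by rw [← Real.exp_add]; ring_nf

end LevelBracket

/-! ### The entropy parts drop out of the kinetic bracket -/

section KineticBracket

lemma mul_norm_mul_norm_le {E : Type*} [NormedAddCommGroup E] [NormedSpace ℝ E]
    {a b : E →L[ℝ] ℝ} {A B D : ℝ} (hD : 0 ≤ D) (ha : ‖a‖ ≤ A) (hb : ‖b‖ ≤ B) :
    D * (‖a‖ * ‖b‖) ≤ D * (A * B) :=
  mul_le_mul_of_nonneg_left (mul_le_mul ha hb (norm_nonneg _) ((norm_nonneg _).trans ha)) hD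

variable {n : ℕ} {M : Type*} [TopologicalSpace M] [ChartedSpace (ModelE n) M]
  [IsManifold 𝓘(ℝ, ModelE n) ∞ M]

/-- The generating functions of regular elements have moderate growth. -/
lemma PathAlg.IsRegular.exists_growth {I : Set ℝ} (hI : UniqueDiffOn ℝ I) (hIm : MeasurableSet I)
    (hIl : I ⊆ Ioi (-1 / 2 : ℝ)) {X : PathAlg n M} (hX : X.IsRegular I) {N : ℕ}
    (hN : ∀ a, N ≤ a → ∀ q, X.jet a q = 0) :
    ∃ r₀ : ℝ, 0 < r₀ ∧ ∀ r ≤ r₀, ∀ x : M,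
      ExpGrowthOn (chartAt (ModelE n) x).target (-1 / 2 + r)
        (genFn I N (X.famRep x) (X.jetRep x)) := by
  obtain ⟨S, hS, hSI, hfam⟩ := hX.exists_smoothFamily
  -- The parameter support is compact, so it keeps a positive distance from -1/2 even if I comes
  -- arbitrarily close to it.
  obtain ⟨δ, hδ0, hδ⟩ : ∃ δ : ℝ, 0 < δ ∧ ∀ ξ ∈ S, -1 / 2 + δ ≤ ξ := by
    rcases S.eq_empty_or_nonempty with h | h
    · exact ⟨1, one_pos, by simp [h]⟩
    · obtain ⟨ξ₀, h0, h1⟩ := hS.exists_isLeast h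
      have : -1 / 2 < ξ₀ := hIl (hSI h0)
      exact ⟨ξ₀ + 1 / 2, by linarith, fun ξ hξ ↦ by linarith [h1 hξ]⟩
  refine ⟨min (1 / 4) δ, lt_min (by norm_num) hδ0, fun r hr x ↦ ?_⟩
  have hV := (chartAt (ModelE n) x).open_target
  exact ⟨contDiffOn_genFn (hfam x) (hX.contDiffOn_jetRep x) hV hI hIm hS hSI, fun L hL hLV Λ ↦
    exists_genFn_bound (hfam x) (hX.contDiffOn_jetRep x) (fun a ha y _ ↦ hN a ha _) hV hI hIm hS
      hSI (hr.trans (min_le_left _ _)) (fun ξ hξ ↦ by linarith [hδ ξ hξ, min_le_right (1 / 4) δ])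
      hL hLV Λ⟩

/-- The part of the pulled back functional derivative that depends on `q` and `log f` only. -/
def PathAlg.entropyPart (I : Set ℝ) (X : PathAlg n M) (f : CotBundle n M → ℝ)
    (z : CotBundle n M) : ℝ := X.genLog I f z + X.shift.genLog I f z

lemma PathAlg.IsRegular.contMDiff_entropyPart {I : Set ℝ} (hI : UniqueDiffOn ℝ I)
    (hIm : MeasurableSet I) {X : PathAlg n M} (hX : X.IsRegular I) {f : CotBundle n M → ℝ}
    (hf : ContMDiff (cotModel n) 𝓘(ℝ, ℝ) ∞ f) (h0 : ∀ z, 0 < f z) :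
    ContMDiff (cotModel n) 𝓘(ℝ, ℝ) ∞ (X.entropyPart I f) :=
  contMDiff_cotBundle_add (hX.contMDiff_genLog hI hIm hf h0)
    (hX.shift.contMDiff_genLog hI hIm hf h0)

/-- In every chart, the entropy part is a function of `q` and `log f` of moderate growth. -/
lemma PathAlg.IsRegular.exists_entropyPart_growth {I : Set ℝ} (hI : UniqueDiffOn ℝ I)
    (hIm : MeasurableSet I) (hIl : I ⊆ Ioi (-1 / 2 : ℝ)) {X : PathAlg n M} (hX : X.IsRegular I)
    (f : CotBundle n M → ℝ) : ∃ r₀ : ℝ, 0 < r₀ ∧ ∃ Γ : M → ModelE n × ℝ → ℝ,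
      (∀ r ≤ r₀, ∀ x, ExpGrowthOn (chartAt (ModelE n) x).target (-1 / 2 + r) (Γ x)) ∧
      ∀ x, ∀ w ∈ (cotChart (n := n) x).target,
        X.entropyPart I f ((cotChart x).symm w) = Γ x (w.1, logRep f x w) := by
  obtain ⟨N, hN⟩ := hX.exists_order
  have hN' : ∀ a, N ≤ a → ∀ q, X.shift.jet a q = 0 := fun a ha q ↦ by
    simp [PathAlg.shift, hN (a + 1) (by omega)]
  obtain ⟨r₁, h1, H1⟩ := hX.exists_growth hI hIm hIl hN
  obtain ⟨r₂, h2, H2⟩ := hX.shift.exists_growth hI hIm hIl hN'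
  refine ⟨min r₁ r₂, lt_min h1 h2, fun x v ↦ genFn I N (X.famRep x) (X.jetRep x) v +
    genFn I N (X.shift.famRep x) (X.shift.jetRep x) v, fun r hr x ↦ ?_, fun x w hw ↦ ?_⟩
  · exact (H1 r (hr.trans (min_le_left _ _)) x).add (chartAt (ModelE n) x).open_target
      (H2 r (hr.trans (min_le_right _ _)) x)
  · rw [PathAlg.entropyPart, PathAlg.genLog_cotChart_symm hN I f x hw,
      PathAlg.genLog_cotChart_symm hN' I f x hw]

variable [T2Space M] [SigmaCompactSpace M]

/-- Only one generating function is multiplied by f, so growth with an exponent above -1 would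
suffice; the available exponent exceeds -1/2. -/
lemma PathAlg.IsRegular.fibreDecayOne_mul_genLog {I : Set ℝ} (hI : UniqueDiffOn ℝ I)
    (hIm : MeasurableSet I) (hIl : I ⊆ Ioi (-1 / 2 : ℝ)) {X : PathAlg n M} (hX : X.IsRegular I)
    {f : CotBundle n M → ℝ} (hf : f ∈ PosDistributions n M) :
    FibreDecayOne fun z ↦ f z * X.genLog I f z := by
  obtain ⟨N, hN⟩ := hX.exists_order
  obtain ⟨r₀, h0, H⟩ := hX.exists_growth hI hIm hIl hN
  intro x L hL hLt k
  obtain ⟨C, hC⟩ := (H r₀ le_rfl x).exists_exp_mul_bound (chartAt (ModelE n) x).open_target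
    (by linarith) (logDecayOn_logRep hf x) hL hLt k
  refine ⟨C, fun y hy η ↦ ?_⟩
  have hw : (y, η) ∈ (cotChart (n := n) x).target := mem_cotChart_target.2 (hLt hy)
  have e : ∀ w ∈ (cotChart (n := n) x).target,
      f ((cotChart x).symm w) * X.genLog I f ((cotChart x).symm w) =
      Real.exp (logRep f x w) * genFn I N (X.famRep x) (X.jetRep x) (w.1, logRep f x w) :=
    fun w hw ↦ by rw [exp_logRep hf.2.1, PathAlg.genLog_cotChart_symm hN I f x hw]
  have e' : fderiv ℝ (fun w ↦ f ((cotChart (n := n) x).symm w) *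
      X.genLog I f ((cotChart x).symm w)) (y, η) = _ :=
    Filter.EventuallyEq.fderiv_eq (by
      filter_upwards [(isOpen_cotChart_target x).mem_nhds hw] with w hw
      exact e w hw)
  beta_reduce
  rw [e', e _ hw]
  exact hC y hy η

lemma PathAlg.VanishesOff.gen_eq_zero {I : Set ℝ} (hIm : MeasurableSet I) {X : PathAlg n M}
    {K : Set M} (h : X.VanishesOff I K) {q : M} (hq : q ∉ K) (s : ℝ) : X.gen I q s = 0 := by
  rw [PathAlg.gen, setIntegral_congr_fun hIm (g := fun _ ↦ 0) fun ξ hξ ↦ by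
    simp only [(h q hq).2.1 ξ hξ, mul_zero]]
  simp [(h q hq).2.2]

lemma canonicalBracket_entropyPart_vanishes {I : Set ℝ}
    (hIm : MeasurableSet I) {X Y : PathAlg n M} {f : CotBundle n M → ℝ} {K : Set M}
    (hK : IsClosed K) (h : X.VanishesOff I K ∨ Y.VanishesOff I K) {z : CotBundle n M}
    (hz : z.proj ∉ K) :
    canonicalBracket (X.entropyPart I f) (Y.entropyPart I f) z = 0 := by
  have ho : ∀ᶠ z' in 𝓝 z, (z' : CotBundle n M).proj ∉ K :=
    (hK.isOpen_compl.preimage continuous_cotProj).mem_nhds hz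
  have hB : ∀ {X : PathAlg n M}, X.VanishesOff I K → X.entropyPart I f =ᶠ[𝓝 z] 0 := fun h ↦ by
    filter_upwards [ho] with z' hz'
    rw [PathAlg.entropyPart, PathAlg.genLog, PathAlg.genLog, h.gen_eq_zero hIm hz',
      h.shift.gen_eq_zero hIm hz']
    simp
  rcases h with h | h
  · exact canonicalBracket_eq_zero_left (hB h)
  · exact canonicalBracket_eq_zero_right (hB h)

/-- The entropy parts do not contribute to the kinetic bracket. -/
theorem integral_mul_canonicalBracket_entropyPart {I : Set ℝ} (hI : UniqueDiffOn ℝ I)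
    (hIm : MeasurableSet I) (hIl : I ⊆ Ioi (-1 / 2 : ℝ)) {X Y : PathAlg n M}
    (hX : X.IsRegular I) (hY : Y.IsRegular I) {f : CotBundle n M → ℝ}
    (hf : f ∈ PosDistributions n M) {K : Set M} (hK : IsCompact K)
    (h : X.VanishesOff I K ∨ Y.VanishesOff I K) :
    Integrable (fun z ↦ f z * canonicalBracket (X.entropyPart I f) (Y.entropyPart I f) z)
      (liouville n M) ∧
    ∫ z, f z * canonicalBracket (X.entropyPart I f) (Y.entropyPart I f) z ∂(liouville n M) = 0 := by
  obtain ⟨r₁, hr₁, Γ, hΓ, eΓ⟩ := hX.exists_entropyPart_growth hI hIm hIl f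
  obtain ⟨r₂, hr₂, Γ', hΓ', eΓ'⟩ := hY.exists_entropyPart_growth hI hIm hIl f
  -- The growth bounds hold for every r up to the respective threshold, so both functions can share
  -- one r.
  set r := min r₁ r₂ with hrd
  have hr : 0 < r := lt_min hr₁ hr₂
  have hsX := hX.contMDiff_entropyPart hI hIm hf.1 hf.2.1
  have hsY := hY.contMDiff_entropyPart hI hIm hf.1 hf.2.1
  have e : ∀ x, ∀ w ∈ (cotChart (n := n) x).target,
      f ((cotChart x).symm w) *
        canonicalBracket (X.entropyPart I f) (Y.entropyPart I f) ((cotChart x).symm w) =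
      Real.exp (logRep f x w) * flatBracket
        (fderiv ℝ (fun v : ModelE n × ModelD n ↦ Γ x (v.1, logRep f x v)) w)
        (fderiv ℝ (fun v : ModelE n × ModelD n ↦ Γ' x (v.1, logRep f x v)) w) := by
    intro x w hw
    have hev := (isOpen_cotChart_target x).mem_nhds hw
    have e1 : fderiv ℝ (fun w ↦ X.entropyPart I f ((cotChart (n := n) x).symm w)) w = _ :=
      Filter.EventuallyEq.fderiv_eq (by filter_upwards [hev] with w hw using eΓ x w hw)
    have e2 : fderiv ℝ (fun w ↦ Y.entropyPart I f ((cotChart (n := n) x).symm w)) w = _ :=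
      Filter.EventuallyEq.fderiv_eq (by filter_upwards [hev] with w hw using eΓ' x w hw)
    rw [canonicalBracket_cotChart_symm hsX hsY x hw, e1, e2, exp_logRep hf.2.1]
  have h0 : ∀ z : CotBundle n M, z.proj ∉ K →
      f z * canonicalBracket (X.entropyPart I f) (Y.entropyPart I f) z = 0 := fun z hz ↦ by
    rw [canonicalBracket_entropyPart_vanishes hIm hK.isClosed h hz, mul_zero]
  have hint : Integrable (fun z ↦ f z *
      canonicalBracket (X.entropyPart I f) (Y.entropyPart I f) z) (liouville n M) := by
    refine integrable_of_fibre_decay (hf.1.continuous.mul (continuous_canonicalBracket hsX hsY))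
      hK h0 fun x L hL hLt ↦ ?_
    have hV := (chartAt (ModelE n) x).open_target
    have hl := logDecayOn_logRep hf x
    obtain ⟨B, hB0, hB⟩ := (hΓ r (min_le_left _ _) x).exists_comp_bound hV hl hL hLt
      (half_pos hr)
    obtain ⟨B', hB0', hB'⟩ := (hΓ' r (min_le_right _ _) x).exists_comp_bound hV hl hL hLt
      (half_pos hr)
    obtain ⟨D, hD0, hD⟩ := exists_norm_flatBracket_le n
    obtain ⟨A, hA⟩ := exists_bound_of_locally hL hLt (φ := fun y η ↦ (1 + ‖η‖) ^ (n + 1) *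
      Real.exp (r * logRep f x (y, η))) fun y hy ↦ hl.exists_exp_bound hy hr (n + 1)
    refine ⟨D * (B * B') * A, fun y hy η ↦ ?_⟩
    rw [e x _ (mem_cotChart_target.2 (hLt hy)), abs_mul, abs_of_pos (Real.exp_pos _)]
    have b1 := (hB y hy η).2
    have b2 := (hB' y hy η).2
    set t := logRep f x (y, η)
    have key := (hD (fderiv ℝ (fun v : ModelE n × ModelD n ↦ Γ x (v.1, logRep f x v)) (y, η))
      (fderiv ℝ (fun v : ModelE n × ModelD n ↦ Γ' x (v.1, logRep f x v)) (y, η))).trans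
      (mul_norm_mul_norm_le (E := ModelE n × ModelD n) hD0 b1 b2)
    -- Each differential costs an additional r/2, and the total exponent is 1 + 2(-1/2 + r - r/2) =
    -- r > 0.
    calc _ ≤ (1 + ‖η‖) ^ (n + 1) * (Real.exp t * (D * (B * Real.exp ((-1 / 2 + r - r / 2) * t) *
          (B' * Real.exp ((-1 / 2 + r - r / 2) * t))))) := by gcongr
      _ = D * (B * B') * ((1 + ‖η‖) ^ (n + 1) * (Real.exp t *
          Real.exp ((-1 / 2 + r - r / 2) * t) * Real.exp ((-1 / 2 + r - r / 2) * t))) := by ring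
      _ = D * (B * B') * ((1 + ‖η‖) ^ (n + 1) * Real.exp (r * t)) := by
        rw [← Real.exp_add, ← Real.exp_add]
        ring_nf
      _ ≤ _ := by gcongr; exact hA y hy η
  refine ⟨hint, ?_⟩
  rw [← densityIntegral_fibreIntegral hint hK h0]
  -- The integral vanishes already fibre by fibre; the preferred chart at q describes the fibre over
  -- q.
  have hz : (fun q : M ↦ ∫ p, f (mkCot q p) *
      canonicalBracket (X.entropyPart I f) (Y.entropyPart I f) (mkCot q p) ∂(covectorVolume n)) =
      fun _ ↦ 0 := by
    ext q
    rw [← integral_exp_mul_flatBracket_level (chartAt (ModelE n) q).open_target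
      (logDecayOn_logRep hf q) hr (hΓ r (min_le_left _ _) q) (hΓ' r (min_le_right _ _) q)
      (mem_chart_target _ q)]
    congr 1
    ext η
    rw [← e q _ (mem_cotChart_target.2 (mem_chart_target _ q)), cotChart_symm_preferred]
  rw [hz]
  simp [densityIntegral, densityRep]

end KineticBracket

/-! ### The combined map is a Poisson map -/

section CombinedMap

variable {n : ℕ} {M : Type*} [TopologicalSpace M] [ChartedSpace (ModelE n) M]
  [IsManifold 𝓘(ℝ, ModelE n) ∞ M]

/-- The decomposition behind the theorem: the first term on the right integrates to minus the
pairing with the Lie bracket, and the other three integrate to zero. -/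
lemma canonicalBracket_pullback {I : Set ℝ} (hI : UniqueDiffOn ℝ I) (hIm : MeasurableSet I)
    {X Y : PathAlg n M} (hX : X.IsRegular I) (hY : Y.IsRegular I) {f : CotBundle n M → ℝ}
    (hf : ContMDiff (cotModel n) 𝓘(ℝ, ℝ) ∞ f) (h0 : ∀ z, 0 < f z) (z : CotBundle n M) :
    f z * canonicalBracket (X.pullback I f) (Y.pullback I f) z =
      -(f z * (momentumFn (X.lie Y).vec z + (X.lie Y).genLog I f z)) +
      canonicalBracket (momentumFn X.vec) (fun z ↦ f z * Y.shift.genLog I f z) z -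
      canonicalBracket (momentumFn Y.vec) (fun z ↦ f z * X.shift.genLog I f z) z +
      f z * canonicalBracket (X.entropyPart I f) (Y.entropyPart I f) z := by
  -- One has {P_u, Γ} = ∂_sΓ {P_u, log f} - L_uΓ. Times f, its first term is ∂_sΓ {P_u, f}, which
  -- combines with f {P_u, ∂_sΓ} to {P_u, f ∂_sΓ}. The summand ∂_sΓ of the entropy part thus
  -- completes a total bracket.
  have key : ∀ {u : (q : M) → TangentSpace 𝓘(ℝ, ModelE n) q} {Y : PathAlg n M},
      SmoothVectorField u → Y.IsRegular I →
      f z * canonicalBracket (momentumFn u) (Y.entropyPart I f) z =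
        canonicalBracket (momentumFn u) (fun z ↦ f z * Y.shift.genLog I f z) z -
          f z * (Y.along u).genLog I f z := by
    intro u Y hu hY
    have hα := hu.contMDiff_momentumFn
    have h1 := hY.contMDiff_genLog hI hIm hf h0
    have h2 := hY.shift.contMDiff_genLog hI hIm hf h0
    have e1 : canonicalBracket (momentumFn u) (Y.entropyPart I f) z = _ :=
      canonicalBracket_add_right hα h1 h2 z
    rw [e1, canonicalBracket_momentum_genLog hI hIm hY hf h0 hu,
      canonicalBracket_mul_right hα hf h2, canonicalBracket_log hα hf h0]
    ring
  have hαX := hX.1.contMDiff_momentumFn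
  have hαY := hY.1.contMDiff_momentumFn
  have hBX := hX.contMDiff_entropyPart hI hIm hf h0
  have hBY := hY.contMDiff_entropyPart hI hIm hf h0
  have hpX := hX.contMDiff_pullback hI hIm hf h0
  have e1 : canonicalBracket (X.pullback I f) (Y.pullback I f) z = _ :=
    canonicalBracket_add_right hpX hαY hBY z
  have e2 : canonicalBracket (momentumFn Y.vec) (X.pullback I f) z = _ :=
    canonicalBracket_add_right hαY hαX hBX z
  have e3 : canonicalBracket (Y.entropyPart I f) (X.pullback I f) z = _ :=
    canonicalBracket_add_right hBY hαX hBX z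
  have kX := key hY.1 hX
  have kY := key hX.1 hY
  have hmm := canonicalBracket_momentum_momentum hY.1 hX.1 z
  have hmm' := canonicalBracket_momentum_momentum hX.1 hY.1 z
  have eg : (X.lie Y).genLog I f z = (Y.along X.vec).genLog I f z - (X.along Y.vec).genLog I f z :=
    PathAlg.gen_lie hI hIm hX hY _ _
  rw [e1, canonicalBracket_swap (X.pullback I f), canonicalBracket_swap (X.pullback I f), e2, e3,
    canonicalBracket_swap (momentumFn Y.vec) (momentumFn X.vec), hmm',
    canonicalBracket_swap (Y.entropyPart I f) (momentumFn X.vec),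
    canonicalBracket_swap (Y.entropyPart I f) (X.entropyPart I f), eg]
  change _ = -(f z * (momentumFn (VectorField.mlieBracket 𝓘(ℝ, ModelE n) X.vec Y.vec) z + _)) +
    _ - _ + _
  linear_combination kY - kX

variable [T2Space M] [SigmaCompactSpace M]

lemma powerDensity_eq {f : CotBundle n M → ℝ} (h0 : ∀ z, 0 < f z) (ξ : ℝ) (q : M) :
    powerDensity f ξ q = ∫ p, (1 + 0 * ξ) * Real.exp (ξ * Real.log (f (mkCot q p))) *
      f (mkCot q p) ∂(covectorVolume n) := by
  rw [powerDensity]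
  congr 1
  ext p
  change f (mkCot q p) ^ (1 + ξ) = _
  rw [Real.rpow_def_of_pos (h0 _), mul_add, mul_one, Real.exp_add, Real.exp_log (h0 _)]
  ring_nf

lemma pathPairing_combinedJ {I : Set ℝ} (hI : UniqueDiffOn ℝ I) (hIm : MeasurableSet I)
    (hI0 : (0 : ℝ) ∈ I) (hIl : I ⊆ Ioi (-1 / 2 : ℝ)) {f : CotBundle n M → ℝ}
    (hf : f ∈ PosDistributions n M) {X : PathAlg n M} (hX : X.IsRegular I) {K : Set M}
    (hK : IsCompact K) (h0 : X.VanishesOff I K) :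
    Integrable (fun z ↦ f z * (momentumFn X.vec z + X.genLog I f z)) (liouville n M) ∧
    pathPairing I (combinedJ f) X =
      ∫ z, f z * (momentumFn X.vec z + X.genLog I f z) ∂(liouville n M) := by
  have h := pathPairing_kernel hf (kernelBound_self hf.2.1) hf.1.continuous (b₀ := 1) (b₁ := 0)
    hI hIm hI0 hIl hX hK (Or.inr h0) (ζ := combinedJ f) (fun q ↦ rfl)
    fun ξ _ q ↦ powerDensity_eq hf.2.1 ξ q
  simp only [one_mul, zero_mul, add_zero] at h
  exact h

/-- The kinetic bracket of pulled back functionals. -/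
theorem integral_kineticBracket_pullback {I : Set ℝ} (hI : UniqueDiffOn ℝ I)
    (hIm : MeasurableSet I) (hI0 : (0 : ℝ) ∈ I) (hIl : I ⊆ Ioi (-1 / 2 : ℝ)) {X Y : PathAlg n M}
    (hX : X.IsRegular I) (hY : Y.IsRegular I) {f : CotBundle n M → ℝ}
    (hf : f ∈ PosDistributions n M) {K : Set M} (hK : IsCompact K)
    (h : X.VanishesOff I K ∨ Y.VanishesOff I K) :
    Integrable (fun z ↦ f z * canonicalBracket (X.pullback I f) (Y.pullback I f) z)
      (liouville n M) ∧
    ∫ z, f z * canonicalBracket (X.pullback I f) (Y.pullback I f) z ∂(liouville n M) =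
      -pathPairing I (combinedJ f) (X.lie Y) := by
  have hH : ∀ {X : PathAlg n M}, X.IsRegular I →
      ContMDiff (cotModel n) 𝓘(ℝ, ℝ) ∞ fun z ↦ f z * X.shift.genLog I f z := fun hX ↦
    contMDiff_cotBundle_mul hf.1 (hX.shift.contMDiff_genLog hI hIm hf.1 hf.2.1)
  have key : ∀ {X Y : PathAlg n M}, X.IsRegular I → Y.IsRegular I →
      (X.VanishesOff I K ∨ Y.VanishesOff I K) →
      Integrable (canonicalBracket (momentumFn X.vec) fun z ↦ f z * Y.shift.genLog I f z)
        (liouville n M) ∧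
      ∫ z, canonicalBracket (momentumFn X.vec) (fun z ↦ f z * Y.shift.genLog I f z) z
        ∂(liouville n M) = 0 := fun hX hY h ↦
    integral_canonicalBracket_momentum hX.1 (hH hY)
      (hY.shift.fibreDecayOne_mul_genLog hI hIm hIl hf) hK
      (h.imp (fun h q hq ↦ (h q hq).1) fun h z hz ↦ by
        rw [PathAlg.genLog, h.shift.gen_eq_zero hIm hz, mul_zero])
  obtain ⟨i1, e1⟩ := key hX hY h
  obtain ⟨i2, e2⟩ := key hY hX h.symm
  obtain ⟨i3, e3⟩ := integral_mul_canonicalBracket_entropyPart hI hIm hIl hX hY hf hK h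
  obtain ⟨i4, e4⟩ := pathPairing_combinedJ hI hIm hI0 hIl hf (hX.lie hI hY) hK
    (PathAlg.VanishesOff.lie_of_isClosed hK.isClosed h)
  have e : (fun z ↦ f z * canonicalBracket (X.pullback I f) (Y.pullback I f) z) = _ :=
    funext (canonicalBracket_pullback hI hIm hX hY hf.1 hf.2.1)
  rw [e, e4]
  refine ⟨((i4.neg.add i1).sub i2).add i3, ?_⟩
  refine (integral_add ((i4.neg.add i1).sub i2) i3).trans ?_
  rw [e3, add_zero]
  refine (integral_sub (i4.neg.add i1) i2).trans ?_
  rw [e2, sub_zero]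
  refine (integral_add i4.neg i1).trans ?_
  rw [e1, add_zero]
  exact integral_neg _

/-- The combined map is a Poisson map. -/
theorem isPoissonMap_combinedJ {I : Set ℝ} (hI : UniqueDiffOn ℝ I) (hIm : MeasurableSet I)
    (hI0 : (0 : ℝ) ∈ I) (hIl : I ⊆ Ioi (-1 / 2 : ℝ)) :
    IsPoissonMap (kineticSpace n M) (pathSpace n M I) combinedJ := by
  intro (f : CotBundle n M → ℝ) (hf : f ∈ PosDistributions n M)
  refine ⟨isSmooth_combinedJ hf hIl, fun (F : PathDual n M → ℝ) (G : PathDual n M → ℝ) ⟨hF, hG, hc⟩ ↦ ?_⟩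
  have : Nonempty (PathAlg n M) := ⟨⟨fun _ ↦ 0, fun _ _ ↦ 0, fun _ _ ↦ 0⟩⟩
  have hX : HasPathDeriv I F (combinedJ f) (pathDeriv I F (combinedJ f)) :=
    Classical.epsilon_spec hF
  have hY : HasPathDeriv I G (combinedJ f) (pathDeriv I G (combinedJ f)) :=
    Classical.epsilon_spec hG
  have kX := hX.hasKineticDeriv hI hIm hI0 hIl hf
  have kY := hY.hasKineticDeriv hI hIm hI0 hIl hf
  -- The bracket is defined through an arbitrary choice of derivative; uniqueness identifies the
  -- chosen one with the explicit one.
  have eX : kineticDeriv (F ∘ combinedJ) f = _ :=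
    HasKineticDeriv.unique hf (Classical.epsilon_spec ⟨_, kX⟩) kX
  have eY : kineticDeriv (G ∘ combinedJ) f = _ :=
    HasKineticDeriv.unique hf (Classical.epsilon_spec ⟨_, kY⟩) kY
  obtain ⟨K, hK, hv⟩ : ∃ K, IsCompact K ∧ ((pathDeriv I F (combinedJ f)).VanishesOff I K ∨
      (pathDeriv I G (combinedJ f)).VanishesOff I K) := by
    rcases hc with ⟨K, hK, h⟩ | ⟨K, hK, h⟩
    · exact ⟨K, hK, Or.inl h⟩
    · exact ⟨K, hK, Or.inr h⟩
  obtain ⟨h1, h2⟩ := integral_kineticBracket_pullback hI hIm hI0 hIl hX.1 hY.1 hf hK hv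
  refine ⟨⟨⟨_, kX⟩, ⟨_, kY⟩, ?_⟩, ?_⟩
  · change Integrable (fun z ↦ f z * canonicalBracket (kineticDeriv (F ∘ combinedJ) f)
      (kineticDeriv (G ∘ combinedJ) f) z) (liouville n M)
    rw [eX, eY]; exact h1
  · change ∫ z, f z * canonicalBracket (kineticDeriv (F ∘ combinedJ) f)
      (kineticDeriv (G ∘ combinedJ) f) z ∂(liouville n M) = _
    rw [eX, eY]; exact h2

end CombinedMap

/-! ### Convergence, the dual formula for J, and jets of J -/

section Convergence

variable {n : ℕ} {M : Type*} [TopologicalSpace M] [ChartedSpace (ModelE n) M]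
  [IsManifold 𝓘(ℝ, ModelE n) ∞ M] [T2Space M] [SigmaCompactSpace M]

lemma mul_momentum_add_genLog {I : Set ℝ} {X : PathAlg n M} (hj : ∀ a q, X.jet a q = 0)
    {f : CotBundle n M → ℝ} (h0 : ∀ z, 0 < f z) (z : CotBundle n M) :
    f z * (momentumFn X.vec z + X.genLog I f z) = covectorApply z.snd (X.vec z.proj) * f z +
      ∫ ξ in I, f z ^ (1 + ξ) * X.fam ξ z.proj := by
  have h1 : X.genLog I f z = ∫ ξ in I, Real.exp (ξ * Real.log (f z)) * X.fam ξ z.proj := by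
    rw [PathAlg.genLog, PathAlg.gen]
    simp [hj]
  rw [h1, mul_add, mul_comm (f z) (momentumFn X.vec z), ← integral_const_mul]
  congr 1
  congr 1
  ext ξ
  rw [Real.rpow_def_of_pos (h0 z), mul_add, mul_one, Real.exp_add, Real.exp_log (h0 z),
    mul_comm (Real.log (f z)), mul_assoc]

theorem combinedJ_pairing {I : Set ℝ} (hI : UniqueDiffOn ℝ I) (hIm : MeasurableSet I)
    (hI0 : (0 : ℝ) ∈ I) (hIl : I ⊆ Ioi (-1 / 2 : ℝ)) {f : CotBundle n M → ℝ}
    (hf : f ∈ PosDistributions n M) {X : PathAlg n M} (hX : X.IsRegular I)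
    (hc : X.CompactlySupported I) (hj : ∀ a q, X.jet a q = 0) :
    Integrable (fun z : CotBundle n M ↦ covectorApply z.snd (X.vec z.proj) * f z +
      ∫ ξ in I, f z ^ (1 + ξ) * X.fam ξ z.proj) (liouville n M) ∧
    pathPairing I (combinedJ f) X =
      ∫ z : CotBundle n M, (covectorApply z.snd (X.vec z.proj) * f z +
        ∫ ξ in I, f z ^ (1 + ξ) * X.fam ξ z.proj) ∂(liouville n M) := by
  obtain ⟨K, hK, h0⟩ := hc
  have h := pathPairing_combinedJ hI hIm hI0 hIl hf hX hK h0
  simp only [mul_momentum_add_genLog hj hf.2.1] at h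
  exact h

lemma integrable_momentumDensity {f : CotBundle n M → ℝ} (hf : f ∈ PosDistributions n M) (q : M) :
    Integrable (fun p : ModelD n ↦ f ⟨q, p⟩ • p) (covectorVolume n) :=
  integrable_fibre_smul hf (kernelBound_self hf.2.1) hf.1.continuous q

lemma integrable_powerDensity {f : CotBundle n M → ℝ} (hf : f ∈ PosDistributions n M) {ξ : ℝ}
    (hξ : -1 < ξ) (q : M) :
    Integrable (fun p : ModelD n ↦ f ⟨q, p⟩ ^ (1 + ξ)) (covectorVolume n) := by
  have h := integrable_fibre_weight hf (kernelBound_self hf.2.1) hf.1.continuous hξ 0 q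
  refine h.congr (Filter.Eventually.of_forall fun p ↦ ?_)
  change _ = f (mkCot q p) ^ (1 + ξ)
  rw [Real.rpow_def_of_pos (hf.2.1 _), mul_add, mul_one, Real.exp_add,
    Real.exp_log (hf.2.1 _)]
  ring_nf

/-- The jet truncation of the combined map. -/
theorem jetTruncation_combinedJ {I : Set ℝ} (hI : UniqueDiffOn ℝ I)
    (hI0 : (0 : ℝ) ∈ I) (hIl : I ⊆ Ioi (-1 / 2 : ℝ)) {f : CotBundle n M → ℝ}
    (hf : f ∈ PosDistributions n M) (A : ℕ) : jetTruncation I A (combinedJ f) = fluidJ A f := by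
  have key : ∀ (a : ℕ) (q : M), iteratedDerivWithin a (fun ξ ↦ powerDensity f ξ q) I 0 =
      entropyDensity f a q := by
    intro a q
    rw [iteratedDerivWithin_fibreIntegral hf (kernelBound_self hf.2.1) hf.1.continuous (b₀ := 1)
      (b₁ := 0) hI hI0 hIl (fun ξ _ ↦ powerDensity_eq hf.2.1 ξ q) a, entropyDensity]
    congr 1
    ext p
    change _ = f (mkCot q p) * Real.log (f (mkCot q p)) ^ a
    ring
  rw [jetTruncation, fluidJ]
  congr 1
  ext a q
  exact key a q

end Convergence

/-! ### Iterated derivatives within an interval, with parameters -/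

section ParameterDerivatives

variable {W Q : Type*} [NormedAddCommGroup W] [NormedSpace ℝ W] [NormedAddCommGroup Q]
  [NormedSpace ℝ Q]

lemma derivWithin_eq_fderivWithin_prod {I : Set ℝ} {U : Set W} (hI : UniqueDiffOn ℝ I)
    {G : ℝ × W → Q} (hG : DifferentiableOn ℝ G (I ×ˢ U)) {ξ : ℝ} (hξ : ξ ∈ I) {w : W}
    (hw : w ∈ U) :
    derivWithin (fun ξ ↦ G (ξ, w)) I ξ = fderivWithin ℝ G (I ×ˢ U) (ξ, w) (1, 0) := by
  have h1 := (hG (ξ, w) ⟨hξ, hw⟩).hasFDerivWithinAt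
  have h2 : HasFDerivWithinAt (fun ξ ↦ G (ξ, w)) _ I ξ :=
    h1.comp (f := fun ξ ↦ (ξ, w)) ξ (hasFDerivAt_prodMk_left ξ w).hasFDerivWithinAt
      fun ξ hξ ↦ ⟨hξ, hw⟩
  rw [h2.hasDerivWithinAt.derivWithin (hI ξ hξ)]
  rfl

/-- Iterated derivatives in one variable depend smoothly on parameters. -/
lemma contDiffOn_iteratedDerivWithin {I : Set ℝ} {U : Set W} (hI : UniqueDiffOn ℝ I)
    (hU : IsOpen U) {G : ℝ × W → Q} (hG : ContDiffOn ℝ ∞ G (I ×ˢ U)) (a : ℕ) :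
    ContDiffOn ℝ ∞ (fun v : ℝ × W ↦ iteratedDerivWithin a (fun ξ ↦ G (ξ, v.2)) I v.1)
      (I ×ˢ U) := by
  induction a with
  | zero => simpa only [iteratedDerivWithin_zero] using hG
  | succ a ih =>
    have h1 : ContDiffOn ℝ ∞ (fun v : ℝ × W ↦ fderivWithin ℝ
        (fun v : ℝ × W ↦ iteratedDerivWithin a (fun ξ ↦ G (ξ, v.2)) I v.1) (I ×ˢ U) v (1, 0))
        (I ×ˢ U) :=
      (ih.fderivWithin (m := ∞) (hI.prod hU.uniqueDiffOn) (by simp)).clm_apply contDiffOn_const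
    refine h1.congr fun v hv ↦ ?_
    rw [iteratedDerivWithin_succ,
      ← derivWithin_eq_fderivWithin_prod hI (ih.differentiableOn (by simp)) hv.1 hv.2]

/-- Symmetry of the second derivative within I × ℝ. It holds at endpoints of I as well, since they
are limits of interior points. -/
lemma derivWithin_deriv_comm {I : Set ℝ} (hI : UniqueDiffOn ℝ I) (hIc : I ⊆ closure (interior I))
    {h : ℝ × ℝ → ℝ} (hh : ContDiffOn ℝ ∞ h (I ×ˢ univ)) {ξ : ℝ} (hξ : ξ ∈ I) (t : ℝ) :
    deriv (fun t ↦ derivWithin (fun ξ ↦ h (ξ, t)) I ξ) t =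
      derivWithin (fun ξ ↦ deriv (fun t ↦ h (ξ, t)) t) I ξ := by
  set S : Set (ℝ × ℝ) := I ×ˢ univ with hS
  have hSu : UniqueDiffOn ℝ S := hI.prod uniqueDiffOn_univ
  have hd : ∀ {h : ℝ × ℝ → ℝ}, ContDiffOn ℝ ∞ h S → ∀ ξ ∈ I, ∀ t,
      deriv (fun t ↦ h (ξ, t)) t = fderivWithin ℝ h S (ξ, t) (0, 1) := by
    intro h hh ξ hξ t
    have h1 := (hh.differentiableOn (by simp) (ξ, t) ⟨hξ, mem_univ t⟩).hasFDerivWithinAt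
    have h2 : HasFDerivWithinAt (fun t ↦ h (ξ, t)) _ univ t :=
      h1.comp (f := fun t ↦ (ξ, t)) t (hasFDerivAt_prodMk_right ξ t).hasFDerivWithinAt
        fun t _ ↦ ⟨hξ, mem_univ t⟩
    rw [(hasFDerivWithinAt_univ.1 h2).hasDerivAt.deriv]
    rfl
  have hf := hh.fderivWithin (m := ∞) hSu (by simp)
  have hfa : ∀ v : ℝ × ℝ, ContDiffOn ℝ ∞ (fun p ↦ fderivWithin ℝ h S p v) S := fun v ↦
    hf.clm_apply contDiffOn_const
  have e1 : deriv (fun t ↦ derivWithin (fun ξ ↦ h (ξ, t)) I ξ) t =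
      fderivWithin ℝ (fun p ↦ fderivWithin ℝ h S p (1, 0)) S (ξ, t) (0, 1) := by
    rw [← hd (hfa (1, 0)) ξ hξ t]
    congr 1
    ext t
    exact derivWithin_eq_fderivWithin_prod hI (hh.differentiableOn (by simp)) hξ (mem_univ t)
  have e2 : derivWithin (fun ξ ↦ deriv (fun t ↦ h (ξ, t)) t) I ξ =
      fderivWithin ℝ (fun p ↦ fderivWithin ℝ h S p (0, 1)) S (ξ, t) (1, 0) := by
    rw [← derivWithin_eq_fderivWithin_prod hI ((hfa (0, 1)).differentiableOn (by simp)) hξ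
      (mem_univ t)]
    exact derivWithin_congr (fun ξ hξ ↦ hd hh ξ hξ t) (hd hh ξ hξ t)
  have hp : (ξ, t) ∈ S := ⟨hξ, mem_univ t⟩
  have e3 : ∀ v w : ℝ × ℝ, fderivWithin ℝ (fun p ↦ fderivWithin ℝ h S p v) S (ξ, t) w =
      fderivWithin ℝ (fderivWithin ℝ h S) S (ξ, t) w v := by
    intro v w
    rw [fderivWithin_clm_apply (hSu _ hp) (hf.differentiableOn (by simp) _ hp)
      (differentiableWithinAt_const v)]
    simp
  have hsym : IsSymmSndFDerivWithinAt ℝ h S (ξ, t) := by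
    refine (hh _ hp).isSymmSndFDerivWithinAt (by
      rw [minSmoothness_of_isRCLikeNormedField]
      exact WithTop.coe_le_coe.2 (le_top : (2 : ℕ∞) ≤ ⊤)) hSu ?_ hp
    rw [hS, interior_prod_eq, closure_prod_eq, interior_univ, closure_univ]
    exact ⟨hIc hξ, mem_univ _⟩
  rw [e1, e2, e3, e3]
  exact hsym.eq _ _

/-- Iterated derivatives in one variable commute with the derivative in another one. -/
lemma deriv_iteratedDerivWithin {I : Set ℝ} (hI : UniqueDiffOn ℝ I)
    (hIc : I ⊆ closure (interior I)) (a : ℕ) :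
    ∀ {h : ℝ × ℝ → ℝ}, ContDiffOn ℝ ∞ h (I ×ˢ univ) → ∀ {ξ : ℝ}, ξ ∈ I → ∀ t : ℝ,
    deriv (fun t ↦ iteratedDerivWithin a (fun ξ ↦ h (ξ, t)) I ξ) t =
      iteratedDerivWithin a (fun ξ ↦ deriv (fun t ↦ h (ξ, t)) t) I ξ := by
  induction a with
  | zero => intro h _ ξ _ t; simp only [iteratedDerivWithin_zero]
  | succ a ih =>
    intro h hh ξ hξ t
    have h1 : ContDiffOn ℝ ∞ (fun v : ℝ × ℝ ↦ derivWithin (fun ξ ↦ h (ξ, v.2)) I v.1)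
        (I ×ˢ univ) := by
      simpa only [iteratedDerivWithin_one] using contDiffOn_iteratedDerivWithin hI isOpen_univ hh 1
    simp only [iteratedDerivWithin_succ']
    rw [ih h1 hξ t]
    exact iteratedDerivWithin_congr (fun ξ hξ ↦ derivWithin_deriv_comm hI hIc hh hξ t) hξ

end ParameterDerivatives

/-! ### Integrals of densities and the inclusion dual to jet truncation -/

section DensityIntegral

variable {n : ℕ} {M : Type*} [TopologicalSpace M] [ChartedSpace (ModelE n) M]
  [IsManifold 𝓘(ℝ, ModelE n) ∞ M]

variable (n) in
/-- Continuity of a density. -/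
def ContinuousDensity (c : M → ℝ) : Prop :=
  ∀ x : M, ContinuousOn (densityRep (n := n) x c) (chartAt (ModelE n) x).target

lemma ContinuousDensity.mul {c g : M → ℝ} (hc : ContinuousDensity n c) (hg : Continuous g) :
    ContinuousDensity n fun q ↦ c q * g q := fun x ↦
  ((hc x).mul (hg.comp_continuousOn (chartAt (ModelE n) x).continuousOn_symm)).congr
    fun _ _ ↦ (mul_assoc _ _ _).symm

/-- In a chart, the Jacobian that pulls back the covector cancels against the one that carries the
coordinate vector to preferred coordinates. -/
lemma continuousDensity_apply_vec {m : M → ModelD n}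
    (hm : ∀ x, ContinuousOn (covDensityRep x m) (chartAt (ModelE n) x).target)
    {u : (q : M) → TangentSpace 𝓘(ℝ, ModelE n) q} (hu : SmoothVectorField u) :
    ContinuousDensity n fun q ↦ m q (u q) := fun x ↦
  ((hm x).clm_apply (hu.contDiffOn_vecRep x).continuousOn).congr fun y hy ↦
    congrArg (fun v ↦ |(toPreferred x y).det| * m ((chartAt (ModelE n) x).symm y) v)
      (toPreferred_vecRep x u hy).symm

variable [T2Space M] [SigmaCompactSpace M]

lemma densityIntegral_zero : densityIntegral n (fun _ : M ↦ 0) = 0 := by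
  simp [densityIntegral, densityRep]

/-- Neither the sum over charts nor the integrals are additive unconditionally. A common compact
support leaves the same finitely many charts for all summands, and continuity over it gives
integrability in each. -/
lemma densityIntegral_sum {ι : Type*} [Fintype ι] {c : ι → M → ℝ} (hc : ∀ i, ContinuousDensity n (c i))
    {K : Set M} (hK : IsCompact K) (h0 : ∀ i, ∀ q ∉ K, c i q = 0) :
    densityIntegral n (fun q ↦ ∑ i, c i q) = ∑ i, densityIntegral n (c i) := by
  have e : ∀ {c : M → ℝ}, (∀ q ∉ K, c q = 0) → densityIntegral n c =
      ∑ x ∈ activeCharts n hK, ∫ y in (chartAt (ModelE n) x).target,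
        chartPartition n M x ((chartAt (ModelE n) x).symm y) * densityRep x c y := by
    intro c h0
    refine finsum_eq_sum_of_support_subset _ fun x hx ↦ ?_
    by_contra h
    refine hx (setIntegral_eq_zero_of_forall_eq_zero fun y _ ↦ ?_)
    by_cases hq : (chartAt (ModelE n) x).symm y ∈ K
    · rw [chartPartition_eq_zero_of_notMem hK h hq, zero_mul]
    · rw [densityRep, h0 _ hq, mul_zero, mul_zero]
  have hi : ∀ i x, IntegrableOn (fun y ↦ chartPartition n M x ((chartAt (ModelE n) x).symm y) *
      densityRep x (c i) y) (chartAt (ModelE n) x).target := by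
    intro i x
    have hL : IsCompact (chartAt (ModelE n) x '' (tsupport (chartPartition n M x) ∩ K)) :=
      (hK.inter_left (isClosed_tsupport _)).image_of_continuousOn
        ((chartAt (ModelE n) x).continuousOn.mono
          (inter_subset_left.trans (tsupport_chartPartition_subset x)))
    have hLt : chartAt (ModelE n) x '' (tsupport (chartPartition n M x) ∩ K) ⊆
        (chartAt (ModelE n) x).target := by
      rintro _ ⟨q, hq, rfl⟩
      exact (chartAt (ModelE n) x).map_source (tsupport_chartPartition_subset x hq.1)
    have hcont : ContinuousOn (fun y ↦ chartPartition n M x ((chartAt (ModelE n) x).symm y) *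
        densityRep x (c i) y) (chartAt (ModelE n) x).target :=
      ((continuous_chartPartition x).comp_continuousOn
        (chartAt (ModelE n) x).continuousOn_symm).mul (hc i x)
    refine ((hcont.mono hLt).integrableOn_compact hL).of_forall_sdiff_eq_zero
      (chartAt (ModelE n) x).open_target.measurableSet fun y hy ↦ ?_
    by_cases hq : (chartAt (ModelE n) x).symm y ∈ K
    · have : (chartAt (ModelE n) x).symm y ∉ tsupport (chartPartition n M x) := fun h ↦
        hy.2 ⟨_, ⟨h, hq⟩, (chartAt (ModelE n) x).right_inv hy.1⟩
      rw [image_eq_zero_of_notMem_tsupport this, zero_mul]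
    · rw [densityRep, h0 i _ hq, mul_zero, mul_zero]
  rw [e fun q hq ↦ Finset.sum_eq_zero fun i _ ↦ h0 i q hq, Finset.sum_congr rfl fun i _ ↦ e (h0 i),
    Finset.sum_comm]
  refine Finset.sum_congr rfl fun x _ ↦ ?_
  rw [← integral_finsetSum _ fun i _ ↦ hi i x]
  congr 1
  ext y
  simp only [densityRep, Finset.mul_sum]

variable {A : ℕ}

/-- An element of `𝔰_A` as a path algebra element with distributional part only. -/
def FluidAlg.lift (X : FluidAlg n M A) : PathAlg n M where
  vec := X.vec
  fam _ _ := 0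
  jet a q := if h : a < A + 1 then X.fn ⟨a, h⟩ q else 0

lemma FluidAlg.lift_jet (X : FluidAlg n M A) (a : Fin (A + 1)) : X.lift.jet a = X.fn a := by
  ext q
  exact dif_pos a.2

lemma FluidAlg.lift_jet_of_lt (X : FluidAlg n M A) {a : ℕ} (ha : A < a) : X.lift.jet a = fun _ ↦ 0 := by
  ext q
  exact dif_neg (by omega)

lemma FluidAlg.IsRegular.lift {X : FluidAlg n M A} (h : X.IsRegular) (I : Set ℝ) :
    X.lift.IsRegular I := by
  refine ⟨h.1, contMDiffOn_const, ⟨∅, isCompact_empty, empty_subset _, fun _ _ _ ↦ rfl⟩,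
    fun a ↦ ?_, A, fun a ha q ↦ congrFun (X.lift_jet_of_lt ha) q⟩
  by_cases ha : a < A + 1
  · rw [show X.lift.jet a = X.fn ⟨a, ha⟩ from X.lift_jet ⟨a, ha⟩]
    exact h.2 _
  · rw [X.lift_jet_of_lt (by omega)]
    exact contMDiff_const

/-- Both brackets differentiate each function separately along the vector fields, so the inclusion
is a Lie algebra homomorphism; its transpose, the truncation, is then expected to be Poisson. -/
lemma FluidAlg.lift_lie (X Y : FluidAlg n M A) : X.lift.lie Y.lift = (X.lie Y).lift := by
  have h0 : ∀ u : (q : M) → TangentSpace 𝓘(ℝ, ModelE n) q, ∀ q : M,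
      lieDerivFun u (fun _ ↦ 0) q = 0 := fun u q ↦
    lieDerivFun_eq_zero_of_eventuallyEq u Filter.EventuallyEq.rfl
  have hf : ∀ ξ q, (X.lift.lie Y.lift).fam ξ q = 0 := fun ξ q ↦
    (congrArg₂ (· - ·) (h0 _ q) (h0 _ q)).trans (sub_zero 0)
  have hj : ∀ a q, (X.lift.lie Y.lift).jet a q = (X.lie Y).lift.jet a q := fun a q ↦ by
    change lieDerivFun X.vec (Y.lift.jet a) q - lieDerivFun Y.vec (X.lift.jet a) q = _
    by_cases ha : a < A + 1
    · rw [show X.lift.jet a = X.fn ⟨a, ha⟩ from X.lift_jet ⟨a, ha⟩,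
        show Y.lift.jet a = Y.fn ⟨a, ha⟩ from Y.lift_jet ⟨a, ha⟩,
        show (X.lie Y).lift.jet a = (X.lie Y).fn ⟨a, ha⟩ from (X.lie Y).lift_jet ⟨a, ha⟩]
      rfl
    · rw [X.lift_jet_of_lt (by omega), Y.lift_jet_of_lt (by omega),
        (X.lie Y).lift_jet_of_lt (by omega)]
      exact (congrArg₂ (· - ·) (h0 _ q) (h0 _ q)).trans (sub_zero 0)
  change PathAlg.mk _ (X.lift.lie Y.lift).fam (X.lift.lie Y.lift).jet =
    PathAlg.mk _ (X.lie Y).lift.fam (X.lie Y).lift.jet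
  congr 1
  · exact funext₂ hf
  · exact funext₂ hj

/-- The jet truncation is dual to the inclusion `FluidAlg.lift`. -/
theorem pathPairing_lift {I : Set ℝ} {z : PathDual n M}
    (hm : ∀ x, ContinuousOn (covDensityRep x z.mom) (chartAt (ModelE n) x).target)
    (hd : ∀ a, ContinuousDensity n ((jetTruncation I A z).dens a)) {X : FluidAlg n M A}
    (hX : X.IsRegular) {K : Set M} (hK : IsCompact K)
    (h0 : (∀ q ∉ K, z.mom q = 0 ∧ ∀ a, (jetTruncation I A z).dens a q = 0) ∨
      ∀ q ∉ K, X.vec q = 0 ∧ ∀ a, X.fn a q = 0) :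
    pathPairing I z X.lift = fluidPairing (jetTruncation I A z) X := by
  have e1 : (∫ ξ in I, densityIntegral n (fun q : M ↦ z.dens ξ q * X.lift.fam ξ q)) = 0 := by
    simp only [FluidAlg.lift, mul_zero, densityIntegral_zero, integral_zero]
  have e2 : (∑ᶠ a : ℕ, densityIntegral n
      (fun q : M ↦ iteratedDerivWithin a (fun ξ ↦ z.dens ξ q) I 0 * X.lift.jet a q)) =
      ∑ a : Fin (A + 1), densityIntegral n fun q ↦ (jetTruncation I A z).dens a q * X.fn a q := by
    rw [finsum_eq_sum_of_support_subset (s := Finset.range (A + 1)), Finset.sum_range]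
    · refine Finset.sum_congr rfl fun a _ ↦ ?_
      rw [X.lift_jet a]
      rfl
    · intro a ha
      rw [Finset.coe_range, mem_Iio]
      by_contra h
      refine ha ?_
      beta_reduce
      rw [X.lift_jet_of_lt (by omega)]
      simp only [mul_zero, densityIntegral_zero]
  -- The momentum term is taken as one further summand, with index `none`.
  have e3 := densityIntegral_sum (n := n) (ι := Option (Fin (A + 1)))
    (c := fun i q ↦ i.elim (z.mom q (X.vec q)) fun a ↦ (jetTruncation I A z).dens a q * X.fn a q)
    (fun i ↦ by
      cases i with
      | none => exact continuousDensity_apply_vec hm hX.1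
      | some a => exact (hd a).mul (hX.2 a).continuous) hK (fun i q hq ↦ by
      cases i with
      | none =>
        rcases h0 with h0 | h0
        · exact DFunLike.congr_fun (h0 q hq).1 (X.vec q)
        · exact (congrArg (z.mom q) (h0 q hq).1).trans (map_zero (z.mom q))
      | some a =>
        rcases h0 with h0 | h0
        · exact mul_eq_zero_of_left ((h0 q hq).2 a) _
        · exact mul_eq_zero_of_right _ ((h0 q hq).2 a))
  simp only [Fintype.sum_option, Option.elim_none, Option.elim_some] at e3
  rw [pathPairing, e1, e2, add_zero, fluidPairing]
  exact e3.symm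

end DensityIntegral

/-! ### Jet truncation of variations and the derivative of F ∘ T_A -/

section FluidTransport

variable {n : ℕ} {M : Type*} [TopologicalSpace M] [ChartedSpace (ModelE n) M]
  [IsManifold 𝓘(ℝ, ModelE n) ∞ M]

lemma toPreferred_self (q : M) :
    toPreferred q (chartAt (ModelE n) q q) = ContinuousLinearMap.id ℝ (ModelE n) := by
  rw [toPreferred_eq, (chartAt (ModelE n) q).left_inv (mem_chart_source _ q),
    tcc_self (mem_chart_source _ q)]

/-- The preferred chart has Jacobian 1 at its own point. Smoothness in charts thus yields smoothness
in the parameters at a fixed point of M. -/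
lemma densityRep_self (c : M → ℝ) (q : M) : densityRep (n := n) q c (chartAt (ModelE n) q q) = c q := by
  rw [densityRep, toPreferred_self, (chartAt (ModelE n) q).left_inv (mem_chart_source _ q)]
  simp [ContinuousLinearMap.det]

lemma covDensityRep_self (m : M → ModelD n) (q : M) :
    covDensityRep q m (chartAt (ModelE n) q q) = m q := by
  rw [covDensityRep, toPreferred_self, (chartAt (ModelE n) q).left_inv (mem_chart_source _ q)]
  simp [ContinuousLinearMap.det]

lemma continuousOn_deriv_param {E F : Type*} [NormedAddCommGroup E] [NormedSpace ℝ E]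
    [NormedAddCommGroup F] [NormedSpace ℝ F] {U : Set E} (hU : IsOpen U) {G : ℝ × E → F}
    (hG : ContDiffOn ℝ ∞ G (univ ×ˢ U)) (t : ℝ) :
    ContinuousOn (fun y ↦ deriv (fun t ↦ G (t, y)) t) U := by
  have ho : IsOpen ((univ : Set ℝ) ×ˢ U) := isOpen_univ.prod hU
  have h1 : ContinuousOn (fun y ↦ fderiv ℝ G (t, y) (1, 0)) U :=
    ((hG.continuousOn_fderiv_of_isOpen ho (by simp)).comp (f := fun y ↦ (t, y)) (by fun_prop)
      fun y hy ↦ ⟨mem_univ t, hy⟩).clm_apply continuousOn_const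
  refine h1.congr fun y hy ↦ ?_
  have h2 : HasFDerivAt G _ (t, y) := ((hG.contDiffAt (ho.mem_nhds ⟨mem_univ t, hy⟩)).differentiableAt
    (by simp)).hasFDerivAt
  have h3 := h2.comp (f := fun t ↦ (t, y)) t (hasFDerivAt_prodMk_left t y)
  exact h3.hasDerivAt.deriv

lemma SmoothDensityOn.continuousDensity_deriv {ρ : ℝ → M → ℝ} (h : SmoothDensityOn n univ ρ) (t : ℝ) :
    ContinuousDensity n fun q ↦ deriv (fun t ↦ ρ t q) t := fun x ↦
  (continuousOn_deriv_param (chartAt (ModelE n) x).open_target (h x) t).congr fun _ _ ↦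
    (deriv_const_mul_field _).symm

lemma SmoothCovDensityOn.continuousOn_deriv {m : ℝ → M → ModelD n} (h : SmoothCovDensityOn univ m)
    (t : ℝ) (x : M) : ContinuousOn (covDensityRep x fun q ↦ deriv (fun t ↦ m t q) t)
      (chartAt (ModelE n) x).target := by
  refine (continuousOn_deriv_param (chartAt (ModelE n) x).open_target (h x) t).congr fun y _ ↦ ?_
  set q := (chartAt (ModelE n) x).symm y with hq
  have h1 : DifferentiableAt ℝ (fun t ↦ m t q) t := by
    have h2 := (h q).comp (s := univ) (f := fun t : ℝ ↦ (t, chartAt (ModelE n) q q)) (by fun_prop)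
      fun t _ ↦ ⟨mem_univ t, mem_chart_target _ q⟩
    refine ((contDiffOn_univ.1 h2).differentiable (by simp)).differentiableAt.congr_of_eventuallyEq
      (Filter.Eventually.of_forall fun t ↦ (covDensityRep_self (m t) q).symm)
  have h2 := ((|(toPreferred x y).det| • (ContinuousLinearMap.compL ℝ (ModelE n) (ModelE n) ℝ).flip
    (toPreferred x y)).hasFDerivAt.comp_hasDerivAt t h1.hasDerivAt).deriv
  exact h2.symm

/-- The Jacobian factor of a density does not depend on ξ, so it commutes with ∂_ξ^a and the
ξ-derivatives can be taken in the chart. -/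
lemma SmoothDensityOn.iteratedDerivWithin {P : Type*} [NormedAddCommGroup P] [NormedSpace ℝ P]
    {I : Set ℝ} (hI : UniqueDiffOn ℝ I) (hI0 : (0 : ℝ) ∈ I) {ρ : P → ℝ → M → ℝ}
    (h : SmoothDensityOn n (univ ×ˢ I) fun w : P × ℝ ↦ ρ w.1 w.2) (a : ℕ) :
    SmoothDensityOn n univ fun (p : P) q ↦ iteratedDerivWithin a (fun ξ ↦ ρ p ξ q) I 0 := by
  intro x
  have h1 : ContDiffOn ℝ ∞ (fun v : ℝ × (P × ModelE n) ↦ densityRep x (ρ v.2.1 v.1) v.2.2)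
      (I ×ˢ (univ ×ˢ (chartAt (ModelE n) x).target)) :=
    (h x).comp (f := fun v : ℝ × (P × ModelE n) ↦ ((v.2.1, v.1), v.2.2)) (by fun_prop)
      fun v hv ↦ ⟨⟨mem_univ _, hv.1⟩, hv.2.2⟩
  have h2 := contDiffOn_iteratedDerivWithin hI
    (isOpen_univ.prod (chartAt (ModelE n) x).open_target) h1 a
  refine (h2.comp (f := fun w ↦ ((0 : ℝ), w)) (by fun_prop) fun w hw ↦ ⟨hI0, hw⟩).congr
    fun w _ ↦ ?_
  exact (iteratedDerivWithin_const_mul_field _ _).symm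

lemma PathDual.IsSmooth.jetTruncation {I : Set ℝ} (hI : UniqueDiffOn ℝ I) (hI0 : (0 : ℝ) ∈ I)
    {z : PathDual n M} (hz : z.IsSmooth I) (A : ℕ) : (jetTruncation I A z).IsSmooth := by
  refine ⟨hz.1, fun a ↦ SmoothDensityOn.iteratedDerivWithin (P := ℝ) hI hI0
    (ρ := fun _ ↦ z.dens) (fun x ↦ ?_) a⟩
  exact (hz.2 x).comp (f := fun v : (ℝ × ℝ) × ModelE n ↦ (v.1.2, v.2)) (by fun_prop)
    fun v hv ↦ ⟨hv.1.2, hv.2⟩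

lemma IsPathVariation.jetTruncation {I : Set ℝ} (hI : UniqueDiffOn ℝ I) (hI0 : (0 : ℝ) ∈ I)
    {z : PathDual n M} {c : ℝ → PathDual n M} (hc : IsPathVariation I z c) (A : ℕ) :
    IsFluidVariation (jetTruncation I A z) fun t ↦ jetTruncation I A (c t) := by
  refine ⟨congrArg _ hc.1, fun t ↦ (hc.2.1 t).jetTruncation hI hI0 A, hc.2.2.1, fun a ↦
    SmoothDensityOn.iteratedDerivWithin (P := ℝ) hI hI0 (ρ := fun t ↦ (c t).dens) hc.2.2.2.1 a, ?_⟩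
  obtain ⟨K, hK, h⟩ := hc.2.2.2.2
  exact ⟨K, hK, fun t q hq ↦ ⟨(h t q hq).1, fun a ↦
    iteratedDerivWithin_congr (fun ξ hξ ↦ (h t q hq).2 ξ hξ) hI0⟩⟩

/-- The truncation is linear, but it commutes with d/dt only because mixed partial derivatives in t
and ξ can be exchanged, including at ξ = 0 as an endpoint of I. -/
lemma IsPathVariation.jetTruncation_velocity {I : Set ℝ} (hI : UniqueDiffOn ℝ I)
    (hIc : I ⊆ closure (interior I)) (hI0 : (0 : ℝ) ∈ I)
    {z : PathDual n M} {c : ℝ → PathDual n M} (hc : IsPathVariation I z c) (A : ℕ) :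
    _root_.jetTruncation I A (pathVelocity c) = fluidVelocity fun t ↦ _root_.jetTruncation I A (c t) := by
  have h1 : ∀ q : M, ContDiffOn ℝ ∞ (fun w : ℝ × ℝ ↦ (c w.2).dens w.1 q) (I ×ˢ univ) := by
    intro q
    refine ((hc.2.2.2.1 q).comp (f := fun w : ℝ × ℝ ↦ ((w.2, w.1), chartAt (ModelE n) q q))
      (by fun_prop) fun w hw ↦ ⟨⟨mem_univ _, hw.1⟩, mem_chart_target _ q⟩).congr fun w _ ↦ ?_
    exact (densityRep_self _ q).symm
  have h2 : ∀ (a : Fin (A + 1)) (q : M), (_root_.jetTruncation I A (pathVelocity c)).dens a q =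
      (fluidVelocity fun t ↦ _root_.jetTruncation I A (c t)).dens a q := fun a q ↦
    (deriv_iteratedDerivWithin hI hIc a (h1 q) hI0 0).symm
  exact congrArg (FluidDual.mk _) (funext₂ h2)

variable [T2Space M] [SigmaCompactSpace M] {A : ℕ}

/-- The functional derivative of `F ∘ T_A`. -/
theorem HasFluidDeriv.hasPathDeriv {I : Set ℝ} (hI : UniqueDiffOn ℝ I)
    (hIc : I ⊆ closure (interior I)) (hI0 : (0 : ℝ) ∈ I) {F : FluidDual n M A → ℝ}
    {z : PathDual n M} {X : FluidAlg n M A} (hX : HasFluidDeriv F (jetTruncation I A z) X) :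
    HasPathDeriv I (F ∘ jetTruncation I A) z X.lift := by
  refine ⟨hX.1.lift I, fun c hc ↦ ?_⟩
  have hv := hc.jetTruncation hI hI0 A
  have e := hc.jetTruncation_velocity hI hIc hI0 A
  obtain ⟨K, hK, h⟩ := hv.2.2.2.2
  have hm : ∀ x, ContinuousOn (covDensityRep x (pathVelocity c).mom) (chartAt (ModelE n) x).target :=
    fun x ↦ hv.2.2.1.continuousOn_deriv 0 x
  have hd : ∀ a, ContinuousDensity n ((fluidVelocity fun t ↦ jetTruncation I A (c t)).dens a) :=
    fun a ↦ (hv.2.2.2.1 a).continuousDensity_deriv 0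
  have h1 : ∀ q ∉ K, (pathVelocity c).mom q = 0 := fun q hq ↦ by
    have : (fun t ↦ (c t).mom q) = fun _ ↦ z.mom q := funext fun t ↦ (h t q hq).1
    exact (congrArg (fun f ↦ deriv f 0) this).trans (deriv_const _ _)
  have h2 : ∀ q ∉ K, ∀ a, (fluidVelocity fun t ↦ jetTruncation I A (c t)).dens a q = 0 :=
    fun q hq a ↦ by
      have : (fun t ↦ (jetTruncation I A (c t)).dens a q) = fun _ ↦ (jetTruncation I A z).dens a q :=
        funext fun t ↦ (h t q hq).2 a
      exact (congrArg (fun f ↦ deriv f 0) this).trans (deriv_const _ _)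
  rw [← e] at hd h2
  rw [pathPairing_lift hm hd hX.1 hK (Or.inl fun q hq ↦ ⟨h1 q hq, h2 q hq⟩), e]
  exact hX.2 _ hv

end FluidTransport

/-! ### Test directions on the path space -/

section PathDerivUnique

variable {n : ℕ} {M : Type*} [TopologicalSpace M] [ChartedSpace (ModelE n) M]
  [IsManifold 𝓘(ℝ, ModelE n) ∞ M]

/-- Straight lines are variations. -/
lemma isPathVariation_line {I : Set ℝ} {z δ : PathDual n M} (hz : z.IsSmooth I) (hδ : δ.IsSmooth I)
    {K : Set M} (hK : IsCompact K) (h0 : ∀ q ∉ K, δ.mom q = 0 ∧ ∀ ξ ∈ I, δ.dens ξ q = 0) :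
    ∃ c, IsPathVariation I z c ∧ pathVelocity c = δ := by
  have e1 : ∀ (x : M) (t : ℝ) (y : ModelE n), covDensityRep x (fun q ↦ z.mom q + t • δ.mom q) y =
      covDensityRep x z.mom y + t • covDensityRep x δ.mom y := fun x t y ↦ by
    rw [covDensityRep, covDensityRep, covDensityRep, ContinuousLinearMap.add_comp,
      ContinuousLinearMap.smul_comp, smul_add, smul_comm t]
  have e2 : ∀ (x : M) (ξ t : ℝ) (y : ModelE n),
      densityRep x (fun q ↦ z.dens ξ q + t * δ.dens ξ q) y =
      densityRep x (z.dens ξ) y + t * densityRep x (δ.dens ξ) y := fun x ξ t y ↦ by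
    rw [densityRep, densityRep, densityRep]
    ring
  refine ⟨fun t ↦ ⟨fun q ↦ z.mom q + t • δ.mom q, fun ξ q ↦ z.dens ξ q + t * δ.dens ξ q⟩,
    ⟨?_, fun t ↦ ⟨fun x ↦ ?_, fun x ↦ ?_⟩, fun x ↦ ?_, fun x ↦ ?_, K, hK, fun t q hq ↦ ⟨?_, ?_⟩⟩, ?_⟩
  · simp only [zero_smul, zero_mul, add_zero]
  · exact ((hz.1 x).add ((contDiffOn_const (c := t)).smul (hδ.1 x))).congr fun w _ ↦ e1 x t w.2
  · exact ((hz.2 x).add (contDiffOn_const.mul (hδ.2 x))).congr fun w _ ↦ e2 x w.1 t w.2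
  · exact ((hz.1 x).add (contDiffOn_fst.smul (hδ.1 x))).congr fun w _ ↦ e1 x w.1 w.2
  · have hp : MapsTo (fun v : (ℝ × ℝ) × ModelE n ↦ (v.1.2, v.2))
        ((univ ×ˢ I) ×ˢ (chartAt (ModelE n) x).target) (I ×ˢ (chartAt (ModelE n) x).target) :=
      fun v hv ↦ ⟨hv.1.2, hv.2⟩
    have hf : ContDiffOn ℝ ∞ (fun v : (ℝ × ℝ) × ModelE n ↦ (v.1.2, v.2))
      ((univ ×ˢ I) ×ˢ (chartAt (ModelE n) x).target) := by fun_prop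
    have ht : ContDiffOn ℝ ∞ (fun v : (ℝ × ℝ) × ModelE n ↦ v.1.1)
      ((univ ×ˢ I) ×ˢ (chartAt (ModelE n) x).target) := by fun_prop
    exact (((hz.2 x).comp hf hp).add (ht.mul ((hδ.2 x).comp hf hp))).congr
      fun v _ ↦ e2 x v.1.2 v.1.1 v.2
  · change z.mom q + t • δ.mom q = z.mom q
    rw [(h0 q hq).1, smul_zero, add_zero]
  · intro ξ hξ
    change z.dens ξ q + t * δ.dens ξ q = z.dens ξ q
    rw [(h0 q hq).2 ξ hξ, mul_zero, add_zero]
  · have h1 : ∀ q, deriv (fun t : ℝ ↦ z.mom q + t • δ.mom q) 0 = δ.mom q := fun q ↦ by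
      simpa using (((hasDerivAt_id (0 : ℝ)).smul_const (δ.mom q)).const_add (z.mom q)).deriv
    have h2 : ∀ ξ q, deriv (fun t : ℝ ↦ z.dens ξ q + t * δ.dens ξ q) 0 = δ.dens ξ q := fun ξ q ↦ by
      simp
    exact congrArg₂ PathDual.mk (funext h1) (funext₂ h2)

variable [T2Space M]

lemma mul_norm_iteratedFDeriv_zero {E F : Type*} [NormedAddCommGroup E] [NormedSpace ℝ E]
    [NormedAddCommGroup F] [NormedSpace ℝ F] (s : ℝ) (k : ℕ) (w : E) :
    s * ‖iteratedFDeriv ℝ k (fun _ : E ↦ (0 : F)) w‖ = 0 := by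
  rw [iteratedFDeriv_fun_zero, Pi.zero_apply, norm_zero, mul_zero]

lemma fibreDecayFamily_of_hasCompactSupport {h : CotBundle n M → ℝ}
    (hh : ContMDiff (cotModel n) 𝓘(ℝ, ℝ) ∞ h) (hc : HasCompactSupport h) :
    FibreDecayFamily (P := ℝ) univ fun _ ↦ h := by
  intro x
  have h0 : FibreDecayOn (univ ×ˢ (chartAt (ModelE n) x).target)
      (fun _ : (ℝ × ModelE n) × ModelD n ↦ (0 : ℝ)) :=
    ⟨contDiffOn_const, fun w _ k N ↦ ⟨0, Filter.Eventually.of_forall fun w η ↦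
      (mul_norm_iteratedFDeriv_zero _ _ _).le⟩⟩
  refine h0.of_eq_off_compact (isOpen_univ.prod (chartAt (ModelE n) x).open_target) ?_ ?_
  · exact (contMDiff_cotBundle_iff.1 hh x).comp
      (f := fun v : (ℝ × ModelE n) × ModelD n ↦ (v.1.2, v.2)) (by fun_prop)
      fun v hv ↦ mem_cotChart_target.2 hv.1.2
  · rintro ⟨p, y⟩ ⟨-, hy⟩
    obtain ⟨R, hR⟩ := exists_fibre_radius hc.isCompact x hy
    refine ⟨R, ?_⟩
    filter_upwards [continuous_snd.continuousAt.eventually hR] with w hw η hη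
    exact image_eq_zero_of_notMem_tsupport (hw η hη)

/-- Compactly supported points of the path space, obtained by fibre integration. -/
def fibreTest (k h : CotBundle n M → ℝ) (σ : ℝ → ℝ) : PathDual n M where
  mom q := ∫ p, k (mkCot q p) • p ∂(covectorVolume n)
  dens ξ q := (∫ p, h (mkCot q p) ∂(covectorVolume n)) * σ ξ

lemma isSmooth_fibreTest {k h : CotBundle n M → ℝ} {σ : ℝ → ℝ}
    (hk : ContMDiff (cotModel n) 𝓘(ℝ, ℝ) ∞ k) (hkc : HasCompactSupport k)
    (hh : ContMDiff (cotModel n) 𝓘(ℝ, ℝ) ∞ h) (hhc : HasCompactSupport h)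
    (hσ : ContDiff ℝ ∞ σ) (I : Set ℝ) : (fibreTest k h σ).IsSmooth I := by
  refine ⟨(fibreDecayFamily_of_hasCompactSupport hk hkc).smoothCovDensityOn isOpen_univ, fun x ↦ ?_⟩
  have h1 := (fibreDecayFamily_of_hasCompactSupport hh hhc).smoothDensityOn isOpen_univ x
  have h2 : ContDiffOn ℝ ∞ (fun w : ℝ × ModelE n ↦ σ w.1) (I ×ˢ (chartAt (ModelE n) x).target) :=
    (hσ.comp contDiff_fst).contDiffOn
  exact ((h1.mono (prod_mono (subset_univ I) Subset.rfl)).mul h2).congr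
    fun _ _ ↦ (mul_assoc _ _ _).symm

variable [SigmaCompactSpace M]

lemma densityIntegral_fibre_mul {h : CotBundle n M → ℝ} (hh : Continuous h)
    (hhc : HasCompactSupport h) {g : M → ℝ} (hg : Continuous g) :
    densityIntegral n (fun q ↦ (∫ p, h (mkCot q p) ∂(covectorVolume n)) * g q) =
      ∫ z, h z * g z.proj ∂(liouville n M) := by
  have hi : Integrable (fun z ↦ h z * g z.proj) (liouville n M) :=
    (hh.mul (hg.comp continuous_cotProj)).integrable_of_hasCompactSupport hhc.mul_right
  rw [← densityIntegral_fibreIntegral hi (hhc.isCompact.image continuous_cotProj) fun z hz ↦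
    mul_eq_zero_of_left (image_eq_zero_of_notMem_tsupport fun hm ↦ hz ⟨z, hm, rfl⟩) _]
  congr 1; ext q
  exact (integral_mul_const _ _).symm

lemma densityIntegral_fibre_momentum {k : CotBundle n M → ℝ}
    (hk : ContMDiff (cotModel n) 𝓘(ℝ, ℝ) ∞ k) (hkc : HasCompactSupport k)
    {u : (q : M) → TangentSpace 𝓘(ℝ, ModelE n) q} (hu : SmoothVectorField u) :
    densityIntegral n (fun q ↦ (∫ p, k (mkCot q p) • p ∂(covectorVolume n)) (u q)) =
      ∫ z, k z * momentumFn u z ∂(liouville n M) := by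
  have hi : Integrable (fun z ↦ k z * momentumFn u z) (liouville n M) :=
    (hk.continuous.mul hu.contMDiff_momentumFn.continuous).integrable_of_hasCompactSupport
      hkc.mul_right
  rw [← densityIntegral_fibreIntegral hi (hkc.isCompact.image continuous_cotProj) fun z hz ↦
    mul_eq_zero_of_left (image_eq_zero_of_notMem_tsupport fun hm ↦ hz ⟨z, hm, rfl⟩) _]
  congr 1; ext q
  exact ContinuousLinearMap.integral_apply ((fibreDecayFamily_of_hasCompactSupport hk
    hkc).integrable_smul isOpen_univ (mem_univ (0 : ℝ)) q) _

/-- The variables of the test direction are separated: k probes the vector field, h the dependence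
on q, and σ the dependence on ξ together with the jets at 0. -/
lemma pathPairing_fibreTest {k h : CotBundle n M → ℝ} {σ : ℝ → ℝ}
    (hk : ContMDiff (cotModel n) 𝓘(ℝ, ℝ) ∞ k) (hkc : HasCompactSupport k)
    (hh : Continuous h) (hhc : HasCompactSupport h) {I : Set ℝ} (hIm : MeasurableSet I)
    {X : PathAlg n M} (hX : X.IsRegular I) :
    pathPairing I (fibreTest k h σ) X = (∫ z, k z * momentumFn X.vec z ∂(liouville n M)) +
      (∫ ξ in I, σ ξ * ∫ z, h z * X.fam ξ z.proj ∂(liouville n M)) +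
      ∑ᶠ a, iteratedDerivWithin a σ I 0 * ∫ z, h z * X.jet a z.proj ∂(liouville n M) := by
  have e : ∀ {g : M → ℝ}, Continuous g → ∀ s : ℝ, densityIntegral n
      (fun q ↦ (∫ p, h (mkCot q p) ∂(covectorVolume n)) * s * g q) =
      s * ∫ z, h z * g z.proj ∂(liouville n M) := by
    intro g hg s
    have h1 := densityIntegral_fibre_mul hh hhc (g := fun q ↦ s * g q) (continuous_const.mul hg)
    simp only [mul_assoc]
    rw [h1, ← integral_const_mul]
    congr 1; ext z; ring
  rw [pathPairing]
  refine congrArg₂ (· + ·) (congrArg₂ (· + ·) (densityIntegral_fibre_momentum hk hkc hX.1) ?_) ?_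
  · exact setIntegral_congr_fun hIm fun ξ hξ ↦ e (hX.continuous_fam hξ) (σ ξ)
  · refine finsum_congr fun a ↦ ?_
    rw [← e (hX.2.2.2.1 a).continuous]
    congr 1; ext q
    exact congrArg (· * X.jet a q) (iteratedDerivWithin_const_mul_field _ _)

lemma eq_of_integral_proj_eq {g g' : M → ℝ} (hg : ContMDiff 𝓘(ℝ, ModelE n) 𝓘(ℝ, ℝ) ∞ g)
    (hg' : ContMDiff 𝓘(ℝ, ModelE n) 𝓘(ℝ, ℝ) ∞ g')
    (h : ∀ χ : CotBundle n M → ℝ, ContMDiff (cotModel n) 𝓘(ℝ, ℝ) ∞ χ → HasCompactSupport χ →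
      ∫ z, χ z * g z.proj ∂(liouville n M) = ∫ z, χ z * g' z.proj ∂(liouville n M)) : g = g' := by
  have := eq_of_integral_eq_of_compactSupport (contMDiff_base_proj hg) (contMDiff_base_proj hg') h
  ext q
  exact congrFun this (mkCot q 0)

/-- Covectors separate tangent vectors. -/
lemma eq_of_momentumFn_eq {u v : (q : M) → TangentSpace 𝓘(ℝ, ModelE n) q}
    (h : momentumFn u = momentumFn v) : u = v := by
  ext1 q
  have h1 : ∀ p : ModelD n, p (u q : ModelE n) = p (v q : ModelE n) := fun p ↦ congrFun h (mkCot q p)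
  exact ext_inner_left ℝ (E := ModelE n) fun w : ModelE n ↦ h1 (InnerProductSpace.toDual ℝ (ModelE n) w)

end PathDerivUnique

/-! ### Uniqueness of functional derivatives on the path space -/

section PathDerivUnique

variable {n : ℕ} {M : Type*} [TopologicalSpace M] [ChartedSpace (ModelE n) M]
  [IsManifold 𝓘(ℝ, ModelE n) ∞ M] [T2Space M] [SigmaCompactSpace M]

lemma iteratedDerivWithin_eq_zero_of_notMem_tsupport {I : Set ℝ} {σ : ℝ → ℝ} {ξ : ℝ}
    (h : ξ ∉ tsupport σ) (a : ℕ) : iteratedDerivWithin a σ I ξ = 0 := by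
  have h1 := notMem_tsupport_iff_eventuallyEq.1 h
  rw [(h1.filter_mono nhdsWithin_le_nhds).iteratedDerivWithin_eq h1.self_of_nhds]
  exact (iteratedDerivWithin_const).trans (ite_self 0)

/-- Monomials are dual to jets at 0: testing with ξ^b isolates the coefficient with index b. -/
lemma iteratedDerivWithin_pow_zero {I : Set ℝ} (hI : UniqueDiffOn ℝ I) (hI0 : (0 : ℝ) ∈ I)
    (a b : ℕ) : iteratedDerivWithin a (fun ξ : ℝ ↦ ξ ^ b) I 0 = if a = b then (b.factorial : ℝ) else 0 := by
  rw [iteratedDerivWithin_eq_iteratedDeriv hI (by fun_prop) hI0, iteratedDeriv_fun_pow_zero]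
  push_cast
  rfl

/-- Two continuous functions with the same weak values agree. -/
lemma eqOn_of_integral_mul_eq {U : Set ℝ} (hU : IsOpen U) {f g : ℝ → ℝ} (hf : ContinuousOn f U)
    (hg : ContinuousOn g U) (h : ∀ σ : ℝ → ℝ, ContDiff ℝ ∞ σ → tsupport σ ⊆ U →
      ∫ ξ, σ ξ * f ξ = ∫ ξ, σ ξ * g ξ) : EqOn f g U := by
  have hi : ∀ {f : ℝ → ℝ}, ContinuousOn f U → ∀ σ : ℝ → ℝ, ContDiff ℝ ∞ σ → HasCompactSupport σ →
      tsupport σ ⊆ U → Integrable fun ξ ↦ σ ξ * f ξ := by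
    intro f hf σ hσ hc hs
    refine Continuous.integrable_of_hasCompactSupport ?_ hc.mul_right
    exact (hσ.continuous.continuousOn.mul hf).continuous_of_tsupport_subset hU
      (tsupport_mul_subset_left.trans hs)
  have h1 := hU.ae_eq_zero_of_integral_contDiff_smul_eq_zero (μ := volume) (f := fun ξ ↦ f ξ - g ξ)
    ((hf.sub hg).locallyIntegrableOn hU.measurableSet) fun σ hσ hc hs ↦ by
      simp only [smul_eq_mul, mul_sub]
      rw [integral_sub (hi hf σ hσ hc hs) (hi hg σ hσ hc hs), h σ hσ hs, sub_self]
  refine Measure.eqOn_open_of_ae_eq (μ := volume) ?_ hU hf hg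
  refine (ae_restrict_iff' hU.measurableSet).2 (h1.mono fun ξ h1 hξ ↦ sub_eq_zero.1 (h1 hξ))

/-- Functional derivatives on the path space are unique as far as they matter. -/
theorem HasPathDeriv.eq_on {I : Set ℝ} (hI : UniqueDiffOn ℝ I) (hIm : MeasurableSet I)
    (hIc : I ⊆ closure (interior I)) (hI0 : (0 : ℝ) ∈ I) {F : PathDual n M → ℝ} {z : PathDual n M}
    (hz : z.IsSmooth I) {X Y : PathAlg n M} (hX : HasPathDeriv I F z X)
    (hY : HasPathDeriv I F z Y) :
    X.vec = Y.vec ∧ (∀ ξ ∈ I, X.fam ξ = Y.fam ξ) ∧ ∀ a, X.jet a = Y.jet a := by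
  -- Along the straight line through z in a test direction, both candidates compute the same
  -- derivative of F.
  have key : ∀ {k h : CotBundle n M → ℝ} {σ : ℝ → ℝ}, ContMDiff (cotModel n) 𝓘(ℝ, ℝ) ∞ k →
      HasCompactSupport k → ContMDiff (cotModel n) 𝓘(ℝ, ℝ) ∞ h → HasCompactSupport h →
      ContDiff ℝ ∞ σ →
      (∫ z, k z * momentumFn X.vec z ∂(liouville n M)) +
        (∫ ξ in I, σ ξ * ∫ z, h z * X.fam ξ z.proj ∂(liouville n M)) +
        ∑ᶠ a, iteratedDerivWithin a σ I 0 * ∫ z, h z * X.jet a z.proj ∂(liouville n M) =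
      (∫ z, k z * momentumFn Y.vec z ∂(liouville n M)) +
        (∫ ξ in I, σ ξ * ∫ z, h z * Y.fam ξ z.proj ∂(liouville n M)) +
        ∑ᶠ a, iteratedDerivWithin a σ I 0 * ∫ z, h z * Y.jet a z.proj ∂(liouville n M) := by
    intro k h σ hk hkc hh hhc hσ
    have hz' : ∀ {h : CotBundle n M → ℝ}, ∀ q ∉ TotalSpace.proj '' tsupport h, ∀ p : ModelD n,
        h (mkCot q p) = 0 := fun q hq p ↦
      image_eq_zero_of_notMem_tsupport fun hm ↦ hq ⟨_, hm, rfl⟩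
    obtain ⟨c, hc, hv⟩ := isPathVariation_line hz (isSmooth_fibreTest hk hkc hh hhc hσ I)
      ((hkc.isCompact.image continuous_cotProj).union (hhc.isCompact.image continuous_cotProj))
      fun q hq ↦ ⟨by
        simp only [fibreTest, hz' q fun hm ↦ hq (Or.inl hm), zero_smul, integral_zero],
        fun ξ _ ↦ by
        simp only [fibreTest, hz' q fun hm ↦ hq (Or.inr hm), zero_mul, integral_zero]⟩
    have e := (hX.2 c hc).unique (hY.2 c hc)
    rwa [hv, pathPairing_fibreTest hk hkc hh.continuous hhc hIm hX.1,
      pathPairing_fibreTest hk hkc hh.continuous hhc hIm hY.1] at e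
  have h0 : ContMDiff (cotModel n) 𝓘(ℝ, ℝ) ∞ fun _ : CotBundle n M ↦ (0 : ℝ) := contMDiff_const
  have h0c : HasCompactSupport fun _ : CotBundle n M ↦ (0 : ℝ) := HasCompactSupport.zero
  -- With h = 0 and σ = 0 only the momentum term is left.
  have hvec : X.vec = Y.vec := by
    refine eq_of_momentumFn_eq (eq_of_integral_eq_of_compactSupport hX.1.1.contMDiff_momentumFn
      hY.1.1.contMDiff_momentumFn fun k hk hkc ↦ ?_)
    simpa only [zero_mul, mul_zero, integral_zero, finsum_zero, add_zero] using
      key hk hkc h0 h0c (contDiff_const (c := (0 : ℝ)))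
  have hfam : ∀ ξ ∈ I, X.fam ξ = Y.fam ξ := by
    -- A function σ supported away from 0 does not see the distributional part, so the families can
    -- be compared first, at interior parameters other than 0.
    set U : Set ℝ := interior I ∩ {0}ᶜ with hUd
    have hU : IsOpen U := isOpen_interior.inter isOpen_compl_singleton
    have hUI : U ⊆ I := inter_subset_left.trans interior_subset
    have hc : ∀ {h : CotBundle n M → ℝ}, Continuous h → HasCompactSupport h →
        ∀ {X : PathAlg n M}, X.IsRegular I →
        ContinuousOn (fun ξ ↦ ∫ z, h z * X.fam ξ z.proj ∂(liouville n M)) U := by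
      intro h hh hhc X hX
      refine continuousOn_integral_of_compact_support (f := fun ξ z ↦ h z * X.fam ξ z.proj)
        hhc.isCompact ?_ fun ξ z _ hz ↦
          mul_eq_zero_of_left (image_eq_zero_of_notMem_tsupport hz) _
      exact (hh.comp continuous_snd).continuousOn.mul (hX.continuousOn_fam.comp
        (f := fun w : ℝ × CotBundle n M ↦ (w.1, w.2.proj))
        (continuous_fst.prodMk (continuous_cotProj.comp continuous_snd)).continuousOn
        fun w hw ↦ ⟨hUI hw.1, mem_univ _⟩)
    have hUe : ∀ ξ ∈ U, X.fam ξ = Y.fam ξ := by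
      intro ξ hξ
      refine eq_of_integral_proj_eq (hX.1.contMDiff_fam (hUI hξ)) (hY.1.contMDiff_fam (hUI hξ))
        fun h hh hhc ↦ ?_
      refine eqOn_of_integral_mul_eq hU (hc hh.continuous hhc hX.1) (hc hh.continuous hhc hY.1)
        (fun σ hσ hs ↦ ?_) hξ
      have e := key h0 h0c hh hhc hσ
      have hs0 : (0 : ℝ) ∉ tsupport σ := fun hm ↦ (hs hm).2 rfl
      simp only [zero_mul, integral_zero, zero_add,
        iteratedDerivWithin_eq_zero_of_notMem_tsupport hs0, finsum_zero, add_zero] at e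
      have hσ0 : ∀ ξ ∉ I, σ ξ = 0 := fun ξ hξ ↦
        image_eq_zero_of_notMem_tsupport fun hm ↦ hξ (hUI (hs hm))
      rwa [setIntegral_eq_integral_of_forall_compl_eq_zero fun ξ hξ ↦ mul_eq_zero_of_left
        (hσ0 ξ hξ) _, setIntegral_eq_integral_of_forall_compl_eq_zero fun ξ hξ ↦
        mul_eq_zero_of_left (hσ0 ξ hξ) _] at e
    -- The parameter 0 and the endpoints are recovered by continuity in ξ.
    have hIU : I ⊆ closure U := hIc.trans (closure_minimal
      ((dense_compl_singleton (0 : ℝ)).open_subset_closure_inter isOpen_interior) isClosed_closure)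
    intro ξ hξ
    ext q
    have hq : ∀ {X : PathAlg n M}, X.IsRegular I → ContinuousOn (fun ξ ↦ X.fam ξ q) I := fun hX ↦
      hX.continuousOn_fam.comp (f := fun ξ ↦ (ξ, q)) (by fun_prop) fun ξ hξ ↦ ⟨hξ, mem_univ _⟩
    exact EqOn.of_subset_closure (fun ξ hξ ↦ congrFun (hUe ξ hξ) q) (hq hX.1) (hq hY.1) hUI hIU hξ
  refine ⟨hvec, hfam, fun b ↦ ?_⟩
  refine eq_of_integral_proj_eq (hX.1.2.2.2.1 b) (hY.1.2.2.2.1 b) fun h hh hhc ↦ ?_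
  -- The integrals over I now agree and cancel, and the monomial singles out the b-th jet
  -- coefficient with the factor b!.
  have e := key h0 h0c hh hhc (contDiff_id.pow b)
  have hs : ∀ X : PathAlg n M, (∑ᶠ a, iteratedDerivWithin a (fun ξ : ℝ ↦ ξ ^ b) I 0 *
      ∫ z, h z * X.jet a z.proj ∂(liouville n M)) =
      b.factorial * ∫ z, h z * X.jet b z.proj ∂(liouville n M) := fun X ↦ by
    rw [finsum_eq_single _ b fun a ha ↦ by
      rw [iteratedDerivWithin_pow_zero hI hI0, if_neg ha, zero_mul],
      iteratedDerivWithin_pow_zero hI hI0, if_pos rfl]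
  simp only [zero_mul, integral_zero, zero_add, id] at e
  rw [hs, hs, setIntegral_congr_fun (g := fun ξ ↦ ξ ^ b * ∫ z, h z * Y.fam ξ z.proj ∂(liouville n M))
    hIm fun ξ hξ ↦ by beta_reduce; rw [hfam ξ hξ]] at e
  exact mul_left_cancel₀ (Nat.cast_ne_zero.2 b.factorial_ne_zero) (add_left_cancel e)

end PathDerivUnique

/-! ### The jet truncations are Poisson maps -/

section JetTruncationPoisson

variable {n : ℕ} {M : Type*} [TopologicalSpace M] [ChartedSpace (ModelE n) M]
  [IsManifold 𝓘(ℝ, ModelE n) ∞ M] [T2Space M] [SigmaCompactSpace M]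

/-- Agreement of path algebra elements on the parameter set. -/
def PathAlg.AgreeOn (I : Set ℝ) (X Y : PathAlg n M) : Prop :=
  X.vec = Y.vec ∧ (∀ ξ ∈ I, X.fam ξ = Y.fam ξ) ∧ ∀ a, X.jet a = Y.jet a

/-- Derivatives on the path space are determined only for parameters in I; neither bracket nor
pairing sees the rest. -/
lemma PathAlg.AgreeOn.pathPairing_lie {I : Set ℝ} (hIm : MeasurableSet I) {X X' Y Y' : PathAlg n M}
    (hX : X.AgreeOn I X') (hY : Y.AgreeOn I Y') (z : PathDual n M) :
    pathPairing I z (X.lie Y) = pathPairing I z (X'.lie Y') := by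
  have h1 : (X.lie Y).vec = (X'.lie Y').vec :=
    congrArg₂ (VectorField.mlieBracket 𝓘(ℝ, ModelE n)) hX.1 hY.1
  have h2 : ∀ ξ ∈ I, (X.lie Y).fam ξ = (X'.lie Y').fam ξ := fun ξ hξ ↦ by
    ext q
    change lieDerivFun X.vec (Y.fam ξ) q - lieDerivFun Y.vec (X.fam ξ) q =
      lieDerivFun X'.vec (Y'.fam ξ) q - lieDerivFun Y'.vec (X'.fam ξ) q
    rw [hX.1, hY.1, hX.2.1 ξ hξ, hY.2.1 ξ hξ]
  have h3 : (X.lie Y).jet = (X'.lie Y').jet := by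
    ext a q
    change lieDerivFun X.vec (Y.jet a) q - lieDerivFun Y.vec (X.jet a) q =
      lieDerivFun X'.vec (Y'.jet a) q - lieDerivFun Y'.vec (X'.jet a) q
    rw [hX.1, hY.1, hX.2.2 a, hY.2.2 a]
  rw [pathPairing, pathPairing, h1, h3]
  refine congrArg₂ (· + ·) (congrArg₂ (· + ·) rfl (setIntegral_congr_fun hIm fun ξ hξ ↦ ?_)) rfl
  rw [h2 ξ hξ]

variable {A : ℕ}

lemma FluidAlg.IsRegular.lie {X Y : FluidAlg n M A} (hX : X.IsRegular) (hY : Y.IsRegular) :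
    (X.lie Y).IsRegular := by
  have h := (hX.lift univ).lie uniqueDiffOn_univ (hY.lift univ)
  rw [FluidAlg.lift_lie] at h
  refine ⟨h.1, fun a ↦ ?_⟩
  rw [← FluidAlg.lift_jet]
  exact h.2.2.2.1 a

lemma FluidAlg.vanishesOff_lift {I : Set ℝ} {X : FluidAlg n M A} {K : Set M} :
    X.lift.VanishesOff I K ↔ ∀ q ∉ K, X.vec q = 0 ∧ ∀ a, X.fn a q = 0 := by
  refine forall₂_congr fun q _ ↦ and_congr Iff.rfl ⟨fun h a ↦ ?_, fun h ↦ ⟨fun _ _ ↦ rfl, fun a ↦ ?_⟩⟩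
  · rw [← X.lift_jet]
    exact h.2 a
  · by_cases ha : a < A + 1
    · rw [show X.lift.jet a = X.fn ⟨a, ha⟩ from X.lift_jet ⟨a, ha⟩]
      exact h _
    · rw [X.lift_jet_of_lt (by omega)]

/-- The jet truncations are Poisson maps. -/
theorem isPoissonMap_jetTruncation {I : Set ℝ} (hI : UniqueDiffOn ℝ I) (hIm : MeasurableSet I)
    (hIc : I ⊆ closure (interior I)) (hI0 : (0 : ℝ) ∈ I) (A : ℕ) :
    IsPoissonMap (pathSpace n M I) (fluidSpace n M A) (jetTruncation I A) := by
  intro (z : PathDual n M) (hz : z.IsSmooth I)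
  have hs := hz.jetTruncation hI hI0 A
  refine ⟨hs, fun (F : FluidDual n M A → ℝ) (G : FluidDual n M A → ℝ) ⟨hF, hG, hc⟩ ↦ ?_⟩
  have : Nonempty (FluidAlg n M A) := ⟨⟨fun _ ↦ 0, fun _ _ ↦ 0⟩⟩
  have : Nonempty (PathAlg n M) := ⟨⟨fun _ ↦ 0, fun _ _ ↦ 0, fun _ _ ↦ 0⟩⟩
  have hX : HasFluidDeriv F (jetTruncation I A z) (fluidDeriv F (jetTruncation I A z)) :=
    Classical.epsilon_spec hF
  have hY : HasFluidDeriv G (jetTruncation I A z) (fluidDeriv G (jetTruncation I A z)) :=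
    Classical.epsilon_spec hG
  have pX := hX.hasPathDeriv hI hIc hI0
  have pY := hY.hasPathDeriv hI hIc hI0
  -- The chosen derivative may differ from the lifted one outside I, so only agreement on I can be
  -- asserted.
  have aX : (pathDeriv I (F ∘ jetTruncation I A) z).AgreeOn I _ :=
    HasPathDeriv.eq_on hI hIm hIc hI0 hz (Classical.epsilon_spec ⟨_, pX⟩) pX
  have aY : (pathDeriv I (G ∘ jetTruncation I A) z).AgreeOn I _ :=
    HasPathDeriv.eq_on hI hIm hIc hI0 hz (Classical.epsilon_spec ⟨_, pY⟩) pY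
  have hcs : ∀ {P : PathAlg n M} {X : FluidAlg n M A}, P.AgreeOn I X.lift → X.CompactlySupported →
      P.CompactlySupported I := by
    rintro P X h ⟨K, hK, hX⟩
    refine ⟨K, hK, fun q hq ↦ ?_⟩
    have h1 := FluidAlg.vanishesOff_lift (I := I).2 hX q hq
    exact ⟨(congrFun h.1 q).trans h1.1, fun ξ hξ ↦ (congrFun (h.2.1 ξ hξ) q).trans (h1.2.1 ξ hξ),
      fun a ↦ (congrFun (h.2.2 a) q).trans (h1.2.2 a)⟩
  refine ⟨⟨⟨_, pX⟩, ⟨_, pY⟩, hc.imp (hcs aX) (hcs aY)⟩, ?_⟩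
  obtain ⟨K, hK, hv⟩ : ∃ K, IsCompact K ∧
      ((fluidDeriv F (jetTruncation I A z)).lift.VanishesOff I K ∨
        (fluidDeriv G (jetTruncation I A z)).lift.VanishesOff I K) := by
    rcases hc with ⟨K, hK, h⟩ | ⟨K, hK, h⟩
    · exact ⟨K, hK, Or.inl (FluidAlg.vanishesOff_lift.2 h)⟩
    · exact ⟨K, hK, Or.inr (FluidAlg.vanishesOff_lift.2 h)⟩
  -- The point z has no compact support here, so the support needed to compare the two pairings is
  -- that of the Lie bracket.
  have hvl := PathAlg.VanishesOff.lie_of_isClosed hK.isClosed hv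
  rw [FluidAlg.lift_lie, FluidAlg.vanishesOff_lift] at hvl
  have hm : ∀ x, ContinuousOn (covDensityRep x z.mom) (chartAt (ModelE n) x).target := fun x ↦
    (hz.1 x).continuousOn.comp (f := fun y ↦ ((0 : ℝ), y)) (by fun_prop) fun y hy ↦ ⟨mem_univ _, hy⟩
  have hd : ∀ a, ContinuousDensity n ((jetTruncation I A z).dens a) := fun a x ↦
    (hs.2 a x).continuousOn.comp (f := fun y ↦ ((0 : ℝ), y)) (by fun_prop)
      fun y hy ↦ ⟨mem_univ _, hy⟩
  change -pathPairing I z ((pathDeriv I (F ∘ jetTruncation I A) z).lie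
    (pathDeriv I (G ∘ jetTruncation I A) z)) = -fluidPairing (jetTruncation I A z) _
  rw [aX.pathPairing_lie hIm aY, FluidAlg.lift_lie,
    pathPairing_lift hm hd (hX.1.lie hY.1) hK (Or.inr hvl)]

end JetTruncationPoisson

end

theorem proposition3 (n : ℕ) {M : Type*} [TopologicalSpace M] [T2Space M] [SigmaCompactSpace M]
    [ChartedSpace (ModelE n) M] [IsManifold 𝓘(ℝ, ModelE n) ∞ M]
    (I : Set ℝ) (hI : I.OrdConnected) (hI0 : (0 : ℝ) ∈ I) (hIint : (interior I).Nonempty)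
    (hIlow : I ⊆ Set.Ioi (-1 / 2 : ℝ)) :
    -- the fibre integrals that define `J` converge
    (∀ f ∈ PosDistributions n M, ∀ q : M,
      Integrable (fun p : ModelD n ↦ f ⟨q, p⟩ • p) (covectorVolume n) ∧
      ∀ ξ ∈ I, Integrable (fun p : ModelD n ↦ f ⟨q, p⟩ ^ (1 + ξ)) (covectorVolume n)) ∧
    -- `J` is given by the dual pairing with vector fields and families of functions
    (∀ f ∈ PosDistributions n M, ∀ X : PathAlg n M, X.IsRegular I → X.CompactlySupported I →
      (∀ a q, X.jet a q = 0) →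
      Integrable (fun z : CotBundle n M ↦ covectorApply z.snd (X.vec z.proj) * f z +
        ∫ ξ in I, f z ^ (1 + ξ) * X.fam ξ z.proj) (liouville n M) ∧
      pathPairing I (combinedJ f) X =
        ∫ z : CotBundle n M, (covectorApply z.snd (X.vec z.proj) * f z +
          ∫ ξ in I, f z ^ (1 + ξ) * X.fam ξ z.proj) ∂(liouville n M)) ∧
    -- `J` is a Poisson map
    IsPoissonMap (kineticSpace n M) (pathSpace n M I) combinedJ ∧
    -- the jet truncations are Poisson maps, and their composition with `J` is `J_A`
    ∀ A : ℕ,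
      IsPoissonMap (pathSpace n M I) (fluidSpace n M A) (jetTruncation I A) ∧
      ∀ f ∈ PosDistributions n M, jetTruncation I A (combinedJ f) = fluidJ A f := by
  have hU := hI.uniqueDiffOn hIint
  have hIm := hI.measurableSet
  -- Endpoints of I are limits of interior points. This serves the exchange of derivatives at the
  -- boundary and the continuity argument for uniqueness.
  have hIc : I ⊆ closure (interior I) := by
    rw [(hI.convex (𝕜 := ℝ)).closure_interior_eq_closure_of_nonempty_interior hIint]
    exact subset_closure
  refine ⟨fun f hf q ↦ ⟨integrable_momentumDensity hf q, fun ξ hξ ↦ integrable_powerDensity hf ?_ q⟩,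
    fun f hf X hX hc hj ↦ combinedJ_pairing hU hIm hI0 hIlow hf hX hc hj,
    isPoissonMap_combinedJ hU hIm hI0 hIlow, fun A ↦
      ⟨isPoissonMap_jetTruncation hU hIm hIc hI0 A,
        fun f hf ↦ jetTruncation_combinedJ hU hI0 hIlow hf A⟩⟩
  have : -1 / 2 < ξ := hIlow hξ
  linarith
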